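/- Let $G$ be a connected real semisimple Lie group with finite center, with Lie algebra $\mathfrak g$ and $\mathfrak g_c=\mathfrak g\otimes_{\mathbb R}\mathbb C$, and let $H$ be a closed subgroup of $G$ with at most finitely many connected components, with Lie algebra $\mathfrak h$ and $\mathfrak h_c=\mathfrak h\otimes_{\mathbb R}\mathbb C$. Fix a maximal compact subgroup $K$ of $G$ with Cartan decomposition $\mathfrak g=\mathfrak k+\mathfrak s$, a Cartan subalgebra $\mathfrak j$ of $\mathfrak g$ such that $\mathfrak a:=\mathfrak j\cap\mathfrak s$ is a maximal abelian subspace of $\mathfrak s$, and compatible positive systems $\Sigma(\mathfrak j)^+$ and $\Sigma(\mathfrak a)^+$ of the root systems of $(\mathfrak g_c,\mathfrak j_c)$ and $(\mathfrak g,\mathfrak a)$ (a root in $\Sigma(\mathfrak j)$ with nonzero restriction to $\mathfrak a$ is positive if and only if its restriction is). Let $M$ be the centralizer of $\mathfrak a$ in $K$, $A=\exp\mathfrak a$, $L=MA$, $\mathfrak n=\sum_{\beta\in\Sigma(\mathfrak a)^+}\mathfrak g_\beta$, $N=\exp\mathfrak n$, and let $P=LN$ be the corresponding minimal parabolic subgroup.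 Let $J$ be the Cartan subgroup of $G$ with Lie algebra $\mathfrak j$, i.e. the centralizer of $\mathfrak j$ in $G$. Let $G_c$ be a complex Lie group with Lie algebra $\mathfrak g_c$, let $H_c$ be a (second countable) complex Lie subgroup of $G_c$ with Lie algebra $\mathfrak h_c$, and let $B$ be the Borel subgroup of $G_c$, i.e. the connected subgroup with Lie algebra $\mathfrak b=\mathfrak j_c+\sum_{\alpha\in\Sigma(\mathfrak j)^+}(\mathfrak g_c)_\alpha$. All representations are complex, finite-dimensional and continuous. For an irreducible representation $(\tau,V_\tau)$ of $H$, let $V_{\tau,P}=V_\tau\otimes\mathbb C_{\rho_{\mathfrak n}}$ be the representation of $H\cap P$ obtained by restricting $\tau$ and tensoring with the character $p\mapsto|\det(\mathrm{Ad}(p):\mathfrak n\to\mathfrak n)|^{1/2}$. An irreducible representation $(\zeta,V_\zeta)$ of $L$ is regarded as a representation of $P$ with trivial action of $N$. Assume that $H_cB$ is open in $G_c$ and that $HP$ is open in $G$. Then the dimensions of the irreducible representations of $J$ have a maximum $D$, and for every irreducible representation $(\tau,V_\tau)$ of $H$ and every irreducible representation $(\zeta,V_\zeta)$ of $L$, $$\dim\operatorname{Hom}_{H\cap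 P}(V_\zeta,V_{\tau,P})\le D\cdot\dim\tau .$$ -/

import Mathlib

open scoped Manifold ContDiff TensorProduct Pointwise

/-- Over `ℝ` and `ℂ`, a smooth Lie group is regular enough to have a Lie algebra. -/
instance instLEInftyMinSmoothness {𝕜 : Type*} [RCLike 𝕜] :
    ENat.LEInfty (minSmoothness 𝕜 3) :=
  ⟨by
    rw [minSmoothness_of_isRCLikeNormedField]
    exact ENat.LEInfty.out⟩

namespace KobayashiOshima

noncomputable section

/-! ### Generalities on (real or complex) Lie groups -/

section LieGroups

variable {𝕜 : Type*} [RCLike 𝕜] {E : Type*} [NormedAddCommGroup E] [NormedSpace 𝕜 E]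
  {G : Type*} [Group G] [TopologicalSpace G] [ChartedSpace E G]

/-- `γ` is the one-parameter subgroup `t ↦ exp (t X)` of `G`: a homomorphism from the additive
group of `𝕜` whose derivative at `0` is `X`. (Over `ℂ` these are the holomorphic one-parameter
subgroups.) -/
structure IsOneParam (γ : 𝕜 → G) (X : GroupLieAlgebra 𝓘(𝕜, E) G) : Prop where
  map_add : ∀ s t : 𝕜, γ (s + t) = γ s * γ t
  hasMFDerivAt : HasMFDerivAt 𝓘(𝕜, 𝕜) 𝓘(𝕜, E) γ 0
    (ContinuousLinearMap.toSpanSingleton 𝕜 (X : E))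

/-- The Lie algebra `{X | exp (t X) ∈ S for all t}` of a closed subgroup `S` of `G`, as a set. -/
def lieOf (S : Subgroup G) : Set (GroupLieAlgebra 𝓘(𝕜, E) G) :=
  {X | ∃ γ : 𝕜 → G, IsOneParam γ X ∧ ∀ t, γ t ∈ S}

/-- The subgroup of `G` generated by `exp X`, `X ∈ V`. When `V` is a Lie subalgebra, this is the
connected Lie subgroup with Lie algebra `V`. -/
def analyticSubgroup (V : Set (GroupLieAlgebra 𝓘(𝕜, E) G)) : Subgroup G :=
  Subgroup.closure {g | ∃ X ∈ V, ∃ γ : 𝕜 → G, IsOneParam γ X ∧ γ 1 = g}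

variable (𝕜 E) in
/-- The adjoint representation: `Ad g` is the derivative at `1` of `x ↦ g x g⁻¹`. -/
def Ad (g : G) : GroupLieAlgebra 𝓘(𝕜, E) G →L[𝕜] GroupLieAlgebra 𝓘(𝕜, E) G :=
  (mfderiv 𝓘(𝕜, E) 𝓘(𝕜, E) (fun x : G => g * x * g⁻¹) 1 : E →L[𝕜] E)

lemma Ad_one : Ad 𝕜 E (1 : G) = ContinuousLinearMap.id 𝕜 _ := by
  have h : (fun x : G => 1 * x * (1 : G)⁻¹) = id := by ext x; simp
  unfold Ad
  rw [h]
  exact mfderiv_id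

lemma Ad_mul [LieGroup 𝓘(𝕜, E) ∞ G] (g h : G) : Ad 𝕜 E (g * h) = (Ad 𝕜 E g).comp (Ad 𝕜 E h) := by
  have hd : ∀ (g : G) (y : G),
      MDifferentiableAt 𝓘(𝕜, E) 𝓘(𝕜, E) (fun x : G => g * x * g⁻¹) y := by
    intro g y
    have h : ContMDiff 𝓘(𝕜, E) 𝓘(𝕜, E) ∞ (fun x : G => g * x * g⁻¹) :=
      (contMDiff_mul_right (I := 𝓘(𝕜, E)) (n := ∞) (a := g⁻¹)).comp
        (contMDiff_mul_left (I := 𝓘(𝕜, E)) (n := ∞) (a := g))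
    exact (h y).mdifferentiableAt (by simp)
  have hc : (fun x : G => (g * h) * x * (g * h)⁻¹)
      = (fun x : G => g * x * g⁻¹) ∘ (fun x : G => h * x * h⁻¹) := by
    ext x; simp [mul_assoc]
  have h1 : ∀ y : G, y = 1 →
      (mfderiv 𝓘(𝕜, E) 𝓘(𝕜, E) (fun x : G => g * x * g⁻¹) y : E →L[𝕜] E) =
        (mfderiv 𝓘(𝕜, E) 𝓘(𝕜, E) (fun x : G => g * x * g⁻¹) 1 : E →L[𝕜] E) := by
    rintro _ rfl; rfl
  unfold Ad
  rw [hc]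
  refine (mfderiv_comp (1 : G) (hd g _) (hd h 1)).trans ?_
  exact congrArg (fun T : E →L[𝕜] E => T.comp
    (mfderiv 𝓘(𝕜, E) 𝓘(𝕜, E) (fun x : G => h * x * h⁻¹) 1 : E →L[𝕜] E)) (h1 _ (by simp))

variable (𝕜 E) in
/-- The centralizer in `G` of a subset `V` of the Lie algebra of `G`. -/
def lieCentralizer [LieGroup 𝓘(𝕜, E) ∞ G] (V : Set (GroupLieAlgebra 𝓘(𝕜, E) G)) : Subgroup G where
  carrier := {g | ∀ X ∈ V, Ad 𝕜 E g X = X}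
  one_mem' := fun X _ => by rw [Ad_one]; rfl
  mul_mem' := fun {a b} ha hb X hX => by
    rw [Ad_mul, ContinuousLinearMap.comp_apply, hb X hX, ha X hX]
  inv_mem' := fun {a} ha X hX => by
    have h : Ad 𝕜 E a⁻¹ (Ad 𝕜 E a X) = X := by
      rw [← ContinuousLinearMap.comp_apply, ← Ad_mul, inv_mul_cancel, Ad_one]; rfl
    rwa [ha X hX] at h

end LieGroups

/-! ### Finite-dimensional representations of topological groups -/

section Representations

variable {S : Type*} [Group S] [TopologicalSpace S] {V : Type*} [AddCommGroup V] [Module ℂ V]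

/-- A (finite-dimensional, complex) representation is continuous if its matrix coefficients are. -/
def IsContinuousRep (σ : Representation ℂ S V) : Prop :=
  ∀ (v : V) (l : Module.Dual ℂ V), Continuous fun g : S => l (σ g v)

variable (S) in
/-- The dimensions of the finite-dimensional irreducible continuous representations of `S`. -/
def irrepDims : Set ℕ :=
  {d | ∃ σ : Representation ℂ S (Fin d → ℂ), σ.IsIrreducible ∧ IsContinuousRep σ}

variable (S) in
/-- The maximal dimension of the irreducible representations of `S`. It is a genuine maximum only
if `IsGreatest (irrepDims S) (maxIrrepDim S)`, which has to be asserted separately. -/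
def maxIrrepDim : ℕ := sSup (irrepDims S)

end Representations

/-! ### Real Lie algebras: Cartan decompositions, roots, positive systems -/

section LieAlgebras

variable {g : Type*} [LieRing g] [LieAlgebra ℝ g]

/-- `θ` is a Cartan involution of the semisimple real Lie algebra `g`. -/
structure IsCartanInvolution (θ : g ≃ₗ⁅ℝ⁆ g) : Prop where
  involutive : ∀ X, θ (θ X) = X
  killing_neg : ∀ X, X ≠ 0 → killingForm ℝ g X (θ X) < 0

/-- The summand `𝔰 = {X | θ X = -X}` of the Cartan decomposition `g = 𝔨 + 𝔰` given by `θ`. -/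
def cartanS (θ : g ≃ₗ⁅ℝ⁆ g) : Submodule ℝ g where
  carrier := {X | θ X = -X}
  zero_mem' := by simp
  add_mem' := fun {X Y} (hX : θ X = -X) (hY : θ Y = -Y) => by
    change θ (X + Y) = -(X + Y)
    rw [map_add, hX, hY, neg_add]
  smul_mem' := fun r X (hX : θ X = -X) => by
    change θ (r • X) = -(r • X)
    rw [map_smul, hX, smul_neg]

/-- `a` is a maximal abelian subspace of `s`. -/
def IsMaximalAbelianIn (a s : Submodule ℝ g) : Prop :=
  Maximal (fun a' : Submodule ℝ g => a' ≤ s ∧ ∀ X ∈ a', ∀ Y ∈ a', ⁅X, Y⁆ = 0) a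

/-- The root space of `α` in `g_c` with respect to `𝔧_c`. Complex linear forms on `𝔧_c` are
identified with real linear maps `𝔧 → ℂ`. -/
def rootSpaceJ (j : LieSubalgebra ℝ g) (α : j →ₗ[ℝ] ℂ) : Submodule ℂ (ℂ ⊗[ℝ] g) where
  carrier := {Z | ∀ X : j, LieAlgebra.ad ℂ (ℂ ⊗[ℝ] g) ((1 : ℂ) ⊗ₜ[ℝ] (X : g)) Z = α X • Z}
  zero_mem' := fun X => by rw [map_zero, smul_zero]
  add_mem' := fun {Z W} hZ hW X => by rw [map_add, hZ X, hW X, smul_add]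
  smul_mem' := fun r Z hZ X => by rw [map_smul, hZ X, smul_comm]

/-- The set `Σ(𝔧)` of roots of `(g_c, 𝔧_c)`. -/
def rootsJ (j : LieSubalgebra ℝ g) : Set (j →ₗ[ℝ] ℂ) :=
  {α | α ≠ 0 ∧ rootSpaceJ j α ≠ ⊥}

/-- The (restricted) root space of `β` in `g` with respect to `𝔞`. -/
def rootSpaceA (a : Submodule ℝ g) (β : a →ₗ[ℝ] ℝ) : Submodule ℝ g where
  carrier := {Z | ∀ X : a, ⁅(X : g), Z⁆ = β X • Z}
  zero_mem' := fun X => by simp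
  add_mem' := fun {Z W} hZ hW X => by rw [lie_add, hZ X, hW X, smul_add]
  smul_mem' := fun r Z hZ X => by rw [lie_smul, hZ X, smul_comm]

/-- The set `Σ(𝔞)` of (restricted) roots of `(g, 𝔞)`. -/
def rootsA (a : Submodule ℝ g) : Set (a →ₗ[ℝ] ℝ) :=
  {β | β ≠ 0 ∧ rootSpaceA a β ≠ ⊥}

/-- `R'` is a positive system of the root system `R`. -/
structure IsPositiveSystem {M : Type*} [AddCommGroup M] (R R' : Set M) : Prop where
  subset : R' ⊆ R
  pos_or_neg : ∀ α ∈ R, α ∈ R' ∨ -α ∈ R'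
  not_both : ∀ α ∈ R', -α ∉ R'
  add_mem : ∀ α ∈ R', ∀ β ∈ R', α + β ∈ R → α + β ∈ R'

/-- The Borel subalgebra `𝔟 = 𝔧_c + ∑_{α > 0} g_α` of `g_c`. -/
def borel (j : LieSubalgebra ℝ g) (R' : Set (j →ₗ[ℝ] ℂ)) : Submodule ℂ (ℂ ⊗[ℝ] g) :=
  j.toSubmodule.baseChange ℂ ⊔ ⨆ α ∈ R', rootSpaceJ j α

end LieAlgebras

/-! ### Structure theory of a real semisimple Lie group -/

section Structure

variable (E : Type*) [NormedAddCommGroup E] [NormedSpace ℝ E] [CompleteSpace E]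
  (G : Type*) [Group G] [TopologicalSpace G] [ChartedSpace E G] [LieGroup 𝓘(ℝ, E) ∞ G]

/-- The Lie algebra `𝔤` of the real Lie group `G`. -/
abbrev LieAlg : Type _ := GroupLieAlgebra 𝓘(ℝ, E) G

/-- The complexification `𝔤_c` of `𝔤`. -/
abbrev LieAlgC : Type _ := ℂ ⊗[ℝ] LieAlg E G

variable {E G}

/-- The complexification `𝔥_c ⊆ 𝔤_c` of the Lie algebra `𝔥` of a closed subgroup `H` of `G`. -/
def lieC (H : Subgroup G) : Submodule ℂ (LieAlgC E G) :=
  Submodule.span ℂ {Z | ∃ X ∈ lieOf (𝕜 := ℝ) (E := E) H, Z = (1 : ℂ) ⊗ₜ[ℝ] X}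

variable (E G) in
/-- The choices that determine a minimal parabolic subgroup `P = MAN` of `G` and a Borel
subalgebra `𝔟 ⊆ 𝔭_c`: a maximal compact subgroup with its Cartan decomposition `𝔤 = 𝔨 + 𝔰`, a
Cartan subalgebra `𝔧` such that `𝔞 = 𝔧 ∩ 𝔰` is maximal abelian in `𝔰`, and compatible positive
systems of `Σ(𝔧)` and `Σ(𝔞)`. -/
structure Choices where
  /-- the maximal compact subgroup -/
  K : Subgroup G
  K_maximal : Maximal (fun C : Subgroup G => IsCompact (C : Set G)) K
  /-- the Cartan involution -/
  θ : LieAlg E G ≃ₗ⁅ℝ⁆ LieAlg E G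
  θ_cartan : IsCartanInvolution θ
  lie_K : ∀ X : LieAlg E G, X ∈ lieOf (𝕜 := ℝ) (E := E) K ↔ θ X = X
  /-- the Cartan subalgebra -/
  j : LieSubalgebra ℝ (LieAlg E G)
  j_cartan : j.IsCartanSubalgebra
  a_maximal : IsMaximalAbelianIn (j.toSubmodule ⊓ cartanS θ) (cartanS θ)
  /-- the positive system of `Σ(𝔧)` -/
  posJ : Set (j →ₗ[ℝ] ℂ)
  posJ_positive : IsPositiveSystem (rootsJ j) posJ
  /-- the positive system of `Σ(𝔞)` -/
  posA : Set ((j.toSubmodule ⊓ cartanS θ : Submodule ℝ (LieAlg E G)) →ₗ[ℝ] ℝ)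
  posA_positive : IsPositiveSystem (rootsA (j.toSubmodule ⊓ cartanS θ)) posA
  /-- compatibility: if `α ∈ Σ(𝔧)` restricts to `β ∈ Σ(𝔞)`, then `α` and `β` have the same sign -/
  compatible : ∀ α ∈ rootsJ j, ∀ β ∈ rootsA (j.toSubmodule ⊓ cartanS θ),
    (∀ (X : LieAlg E G) (hX : X ∈ j.toSubmodule ⊓ cartanS θ), α ⟨X, hX.1⟩ = (β ⟨X, hX⟩ : ℂ)) →
      (α ∈ posJ ↔ β ∈ posA)

namespace Choices

variable (c : Choices E G)

/-- `𝔞 = 𝔧 ∩ 𝔰` -/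
def a : Submodule ℝ (LieAlg E G) := c.j.toSubmodule ⊓ cartanS c.θ

/-- `𝔫`, the sum of the root spaces of the positive roots in `Σ(𝔞)` -/
def n : Submodule ℝ (LieAlg E G) := ⨆ β ∈ c.posA, rootSpaceA c.a β

/-- `M`, the centralizer of `𝔞` in `K` -/
def M : Subgroup G := c.K ⊓ lieCentralizer ℝ E (c.a : Set (LieAlg E G))

/-- `A = exp 𝔞` -/
def A : Subgroup G := analyticSubgroup (𝕜 := ℝ) (c.a : Set (LieAlg E G))

/-- `N = exp 𝔫` -/
def N : Subgroup G := analyticSubgroup (𝕜 := ℝ) (c.n : Set (LieAlg E G))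

/-- `L = MA`, the subgroup generated by the commuting subgroups `M` and `A` -/
def L : Subgroup G := c.M ⊔ c.A

/-- The minimal parabolic subgroup `P = LN = MAN`, generated by `L` and `N` (`L` normalizes `N`) -/
def P : Subgroup G := c.L ⊔ c.N

lemma L_le_P : c.L ≤ c.P := le_sup_left

lemma N_le_P : c.N ≤ c.P := le_sup_right

/-- The Cartan subgroup `J` with Lie algebra `𝔧`, that is, the centralizer of `𝔧` in `G` -/
def J : Subgroup G := lieCentralizer ℝ E (c.j : Set (LieAlg E G))

/-- The Borel subalgebra `𝔟` of `𝔤_c` given by the positive system of `Σ(𝔧)` -/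
def b : Submodule ℂ (LieAlgC E G) := borel c.j c.posJ

open Classical in
/-- The character `g ↦ |det (Ad g : 𝔫 → 𝔫)| ^ (1 / 2)` of `P`. Every `g ∈ P` normalizes `𝔫`; the
value at other `g` is irrelevant. -/
def rhoN (g : G) : ℝ :=
  if h : ∀ X ∈ c.n, (Ad ℝ E g : LieAlg E G →ₗ[ℝ] LieAlg E G) X ∈ c.n then
    Real.sqrt |LinearMap.det ((Ad ℝ E g : LieAlg E G →ₗ[ℝ] LieAlg E G).restrict h)|
  else 1

/-- `ζP` is the extension to `P` of the representation `ζ` of `L`, with trivial action of `N`. -/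
structure IsExtension {V : Type*} [AddCommGroup V] [Module ℂ V]
    (ζ : Representation ℂ c.L V) (ζP : Representation ℂ c.P V) : Prop where
  continuous : IsContinuousRep ζP
  on_L : ∀ l : c.L, ζP ⟨l, c.L_le_P l.2⟩ = ζ l
  on_N : ∀ u : c.N, ζP ⟨u, c.N_le_P u.2⟩ = 1

/-- `Hom_{H ∩ P}(V_ζ, V_{τ,P})`, where `V_{τ,P}` is the representation `τ|_{H ∩ P} ⊗ ℂ_{ρ_𝔫}` of
`H ∩ P` on the space `V_τ` (`ℂ_{ρ_𝔫}` is given by `rhoN`). -/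
def homHP (H : Subgroup G) {V W : Type*} [AddCommGroup V] [Module ℂ V] [AddCommGroup W]
    [Module ℂ W] (ζP : Representation ℂ c.P V) (τ : Representation ℂ H W) :
    Submodule ℂ (V →ₗ[ℂ] W) where
  carrier := {f | ∀ (g : G) (hH : g ∈ H) (hP : g ∈ c.P) (v : V),
    f (ζP ⟨g, hP⟩ v) = (c.rhoN g : ℂ) • τ ⟨g, hH⟩ (f v)}
  zero_mem' := fun g hH hP v => by simp
  add_mem' := fun {f f'} hf hf' g hH hP v => by
    simp only [LinearMap.add_apply, map_add, smul_add, hf g hH hP v, hf' g hH hP v]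
  smul_mem' := fun r f hf g hH hP v => by
    simp only [LinearMap.smul_apply, map_smul, hf g hH hP v]
    rw [smul_comm]

end Choices

end Structure

end

end KobayashiOshima

/-!
Write `𝔭_c` and `𝔥_c` for the complexified Lie algebras of `P` and `H`.

**Reduction to highest weight vectors.** Let `ζ` be an irreducible representation of `L` on `V`,
extended trivially to `P`. The vectors of `V` that are killed by the positive root spaces of `𝔧`
form a nonzero space (`highestWeightSpace_ne_bot`), which `J` preserves. Let `U` be a minimal nonzero
`J`-invariant subspace of it, so that `dim U ≤ D`. An element of `Hom_{H ∩ P}(V, V_{τ,P})` is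
determined by its restriction to `U`, and so the dimension of this space is at most
`dim U * dim τ` (`finrank_homHP_le`). The point is that the kernel of a homomorphism vanishing on `U`
is stable under `𝔥_c ∩ 𝔭_c`, while `U` generates `V` over `𝔥_c ∩ 𝔭_c` (`eq_top_of_stable`). For this,
`𝔥_c + 𝔟 = 𝔤_c` implies `𝔭_c = (𝔥_c ∩ 𝔭_c) + 𝔟` by the modular law, and `𝔟` preserves `U`; hence the
span of `U` over `𝔥_c ∩ 𝔭_c` is stable under `𝔭_c`. A nonzero `J`-invariant subspace generates `V` over `𝔩`
(`stableSpan_l_eq_top`) because every `m ∈ M` is moved into `J` by any closed subgroup of `M` that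
contains the exponentials of the Lie algebra of `M` (`exists_mul_mem_J`). The proof of that fact
maximizes a linear functional over an orbit, as in the conjugacy of maximal tori, and then uses that
an element of `K` fixing a regular vector of `𝔧` lies in `J` (`mem_J_of_fix_reg`). The latter holds
because the generalized eigenspace of `Ad g` for the eigenvalue `1` has dimension at least `dim 𝔧` for
all `g ∈ G` (`finrank_le_nilspace_Ad`), by analyticity.

**Openness.** That `H_c B` is open gives `𝔥_c + 𝔟 = 𝔤_c` (`lieC_sup_b_eq_top`). Consider the translates
`Ad h Y`, where `h ∈ H_c` and `Y ∈ 𝔟` is regular. As `B` preserves the regular elements of `𝔟`, the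
translates by `H_c` are the same as those by `H_c B`, and they contain an open set. On the other hand the
rank of `(h, Y) ↦ Ad h Y` is `dim (𝔥_c + 𝔟)`, and `H_c` is second countable, so the Hausdorff dimension
of this set is at most the real dimension of `𝔥_c + 𝔟` (`range_diffOne_sup_eq_top`).

**Existence of `D`.** `J` is finite modulo its center: elements of `J` are products of elements of
the compact group `J ∩ K` and of `exp 𝔞`, and `exp 𝔧` is central and contains a neighbourhood of `1` in
`J` (`exists_finset_J`). By Schur's lemma the dimension of an irreducible representation is at most
the index of the center (`finrank_le_card_of_center`).

**Groundwork.** The Lie algebra has nondegenerate Killing form, so `ad` is injective and `Ad` is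
injective near `1`. The exponential map of `G` and its local inverse `logG` are thus handled through
`Ad`, which is smooth with derivative `ad` (`mfderiv_AdE_one`): a small logarithm of an automorphism
is a derivation, hence inner. The root theory of `(𝔤_c, 𝔧_c)` is that of Mathlib, after identification
of the root spaces (`rootSpace_eq_rootSpaceJ`). A positive system is governed by a regular vector
`T₀ + A₀` of `𝔧`, with `A₀ ∈ 𝔞` and `T₀` in the compact part (`reg_pos`). Finally `K` is the full
fixed point group of the Cartan involution (`K_eq`), and `J` is contained in `L`
(`exists_mul_expG_mem_M`).
-/

namespace KobayashiOshima

open scoped Manifold ContDiff TensorProduct Pointwise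
open Filter Topology
open NormedSpace (exp)

set_option maxSynthPendingDepth 3
set_option linter.unusedSectionVars false

/-! ### Second derivative of a group law in a chart -/

section MultiplicationCalculus

variable {𝕜 : Type*} [RCLike 𝕜] {E : Type*} [NormedAddCommGroup E] [NormedSpace 𝕜 E]

/-- If `m` is a group law and `c (u, v) = u v u⁻¹` the conjugation, read in a chart centred at the
identity `u₀`, then the derivative of `u ↦ ∂₂ c (u, u₀)` at `u₀` is the antisymmetrization of the
mixed second derivative of `m`. It comes from differentiating `m (c (u, v), u) = m (u, v)`. -/
lemma fderiv_conj_of_mul_chart {m c : E × E → E} {u₀ : E}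
    (hm : ContDiffAt 𝕜 ∞ m (u₀, u₀)) (hc : ContDiffAt 𝕜 ∞ c (u₀, u₀))
    (hm1 : ∀ᶠ u in 𝓝 u₀, m (u, u₀) = u)
    (hc1 : ∀ᶠ v in 𝓝 u₀, c (u₀, v) = v) (hc2 : ∀ᶠ u in 𝓝 u₀, c (u, u₀) = u₀)
    (hmc : ∀ᶠ p : E × E in 𝓝 (u₀, u₀), m (c p, p.1) = m p) (X Y : E) :
    fderiv 𝕜 (fun u => fderiv 𝕜 (fun v => c (u, v)) u₀) u₀ X Y =
      fderiv 𝕜 (fun u => fderiv 𝕜 (fun v => m (u, v)) u₀ Y) u₀ X -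
      fderiv 𝕜 (fun u => fderiv 𝕜 (fun v => m (u, v)) u₀ X) u₀ Y := by
  set F := fderiv 𝕜 m with hF
  have hFd : ContDiffAt 𝕜 1 F (u₀, u₀) := hm.fderiv_right (by norm_cast)
  set F2 := fderiv 𝕜 F (u₀, u₀) with hF2
  have hFd' : HasFDerivAt F F2 (u₀, u₀) := (hFd.differentiableAt (by norm_num)).hasFDerivAt
  have hsymm : IsSymmSndFDerivAt 𝕜 m (u₀, u₀) :=
    hm.isSymmSndFDerivAt (by rw [minSmoothness_of_isRCLikeNormedField]; norm_cast)
  have hmev : ∀ᶠ p in 𝓝 (u₀, u₀), DifferentiableAt 𝕜 m p := by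
    filter_upwards [(hm.of_le (m := 1) (by norm_cast)).eventually (by simp)] with p hp
    exact hp.differentiableAt (by norm_num)
  have hcev : ∀ᶠ p in 𝓝 (u₀, u₀), DifferentiableAt 𝕜 c p := by
    filter_upwards [(hc.of_le (m := 1) (by norm_cast)).eventually (by simp)] with p hp
    exact hp.differentiableAt (by norm_num)
  have htl : Tendsto (fun u : E => (u, u₀)) (𝓝 u₀) (𝓝 (u₀, u₀)) :=
    (by fun_prop : Continuous fun u : E => (u, u₀)).tendsto u₀
  have htr : Tendsto (fun u : E => (u₀, u)) (𝓝 u₀) (𝓝 (u₀, u₀)) :=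
    (by fun_prop : Continuous fun u : E => (u₀, u)).tendsto u₀
  -- the derivative of left translations
  have hL : ∀ Z : E, (fun u => fderiv 𝕜 (fun v => m (u, v)) u₀ Z) =ᶠ[𝓝 u₀]
      fun u => F (u, u₀) (0, Z) := by
    intro Z
    filter_upwards [htl.eventually hmev] with u hu
    have h1 : HasFDerivAt (fun v : E => (u, v)) (ContinuousLinearMap.inr 𝕜 E E) u₀ :=
      (hasFDerivAt_prodMk_right u u₀)
    have := (hu.hasFDerivAt.comp u₀ h1).fderiv
    change fderiv 𝕜 (m ∘ fun v => (u, v)) u₀ Z = _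
    rw [this]; simp [hF]
  have hLd : ∀ Z W : E, fderiv 𝕜 (fun u => fderiv 𝕜 (fun v => m (u, v)) u₀ Z) u₀ W =
      F2 (W, 0) (0, Z) := by
    intro Z W
    rw [(hL Z).fderiv_eq]
    have h1 : HasFDerivAt (fun u : E => (u, u₀)) (ContinuousLinearMap.inl 𝕜 E E) u₀ :=
      hasFDerivAt_prodMk_left u₀ u₀
    have h2 := (HasFDerivAt.comp (f := fun u : E => (u, u₀)) u₀ hFd' h1).clm_apply
      (hasFDerivAt_const ((0 : E), Z) u₀)
    have h3 : fderiv 𝕜 (fun u => F (u, u₀) (0, Z)) u₀ = _ := h2.fderiv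
    rw [h3]; simp
  -- the adjoint action in the chart
  set A : E → E →L[𝕜] E := fun u => fderiv 𝕜 (fun v => c (u, v)) u₀ with hA
  have hAd : ContDiffAt 𝕜 1 A u₀ := by
    have : ContDiffAt 𝕜 1 (fun u => fderiv 𝕜 ((fun u v => c (u, v)) u) ((fun _ => u₀) u)) u₀ :=
      ContDiffAt.fderiv (n := ∞) (f := fun u v => c (u, v)) (g := fun _ => u₀) hc
        contDiffAt_const (by norm_cast)
    exact this
  have hAd' : HasFDerivAt A (fderiv 𝕜 A u₀) u₀ := (hAd.differentiableAt (by norm_num)).hasFDerivAt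
  have hA0 : A u₀ = ContinuousLinearMap.id 𝕜 E := by
    have : (fun v => c (u₀, v)) =ᶠ[𝓝 u₀] id := hc1
    simp only [hA]; rw [this.fderiv_eq]; exact fderiv_id
  -- the identity `u v = (u v u⁻¹) u`, differentiated in `v` at `u₀`
  have hkey : (fun u => F (u₀, u) (A u Y, 0)) =ᶠ[𝓝 u₀] fun u => F (u, u₀) (0, Y) := by
    have hmc' : ∀ᶠ p in 𝓝 (u₀, u₀), ∀ᶠ q in 𝓝 p, m (c q, q.1) = m q := hmc.eventually_nhds
    filter_upwards [htl.eventually hmev, htr.eventually hmev, htl.eventually hcev, hc2,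
      htl.eventually hmc'] with u h1 h2 h3 h4 h5
    have hi : HasFDerivAt (fun v : E => (u, v)) (ContinuousLinearMap.inr 𝕜 E E) u₀ :=
      (hasFDerivAt_prodMk_right u u₀)
    have hcu : HasFDerivAt (fun v => c (u, v)) (A u) u₀ :=
      (DifferentiableAt.comp (f := fun v : E => (u, v)) u₀ h3 hi.differentiableAt).hasFDerivAt
    have hcu' : HasFDerivAt (fun v => (c (u, v), u)) ((A u).prod 0) u₀ :=
      hcu.prodMk (hasFDerivAt_const u u₀)
    have e1 : HasFDerivAt (fun v => m (c (u, v), u)) ((F (u₀, u)).comp ((A u).prod 0)) u₀ := by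
      refine HasFDerivAt.comp (f := fun v => (c (u, v), u)) (g := m) u₀ ?_ hcu'
      simp only [h4]; exact h2.hasFDerivAt
    have e2 : HasFDerivAt (fun v => m (u, v)) ((F (u, u₀)).comp (ContinuousLinearMap.inr 𝕜 E E)) u₀ :=
      h1.hasFDerivAt.comp u₀ hi
    have e3 : (fun v => m (c (u, v), u)) =ᶠ[𝓝 u₀] fun v => m (u, v) := by
      have : Tendsto (fun v : E => (u, v)) (𝓝 u₀) (𝓝 (u, u₀)) :=
        (by fun_prop : Continuous fun v : E => (u, v)).tendsto u₀
      exact this.eventually h5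
    have e4 := e1.unique (e2.congr_of_eventuallyEq e3)
    simpa using congrArg (fun T : E →L[𝕜] E => T Y) e4
  -- both sides of `hkey` are now differentiated in `u`
  have hd1 : HasFDerivAt (fun u => F (u₀, u) (A u Y, 0))
      ((F (u₀, u₀)).comp (((fderiv 𝕜 A u₀).flip Y).prod 0) +
        (F2.comp (ContinuousLinearMap.inr 𝕜 E E)).flip (Y, 0)) u₀ := by
    have h1 : HasFDerivAt (fun u : E => (u₀, u)) (ContinuousLinearMap.inr 𝕜 E E) u₀ :=
      hasFDerivAt_prodMk_right u₀ u₀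
    have h2 : HasFDerivAt (fun u => (A u Y, (0 : E))) (((fderiv 𝕜 A u₀).flip Y).prod 0) u₀ := by
      refine HasFDerivAt.prodMk ?_ (hasFDerivAt_const _ _)
      have := hAd'.clm_apply (hasFDerivAt_const Y u₀)
      convert this using 1
      ext; simp
    have h3 := (hFd'.comp u₀ h1).clm_apply h2
    rw [hA0] at h3
    exact h3
  have hd2 : HasFDerivAt (fun u => F (u, u₀) (0, Y))
      ((F2.comp (ContinuousLinearMap.inl 𝕜 E E)).flip (0, Y)) u₀ := by
    have h1 : HasFDerivAt (fun u : E => (u, u₀)) (ContinuousLinearMap.inl 𝕜 E E) u₀ :=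
      hasFDerivAt_prodMk_left u₀ u₀
    have h2 := (HasFDerivAt.comp (f := fun u : E => (u, u₀)) u₀ hFd' h1).clm_apply
      (hasFDerivAt_const ((0 : E), Y) u₀)
    rw [ContinuousLinearMap.comp_zero, zero_add] at h2
    exact h2
  -- the first partial derivative of `m` at the identity is the identity
  have hF0 : ∀ w : E, F (u₀, u₀) (w, 0) = w := by
    intro w
    have h1 : HasFDerivAt (fun u : E => (u, u₀)) (ContinuousLinearMap.inl 𝕜 E E) u₀ :=
      hasFDerivAt_prodMk_left u₀ u₀
    have h2 := HasFDerivAt.comp (f := fun u : E => (u, u₀)) u₀ hmev.self_of_nhds.hasFDerivAt h1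
    have h3 : (m ∘ fun u => (u, u₀)) =ᶠ[𝓝 u₀] id := hm1
    have h4 := h2.unique ((hasFDerivAt_id u₀).congr_of_eventuallyEq h3)
    simpa using congrArg (fun T : E →L[𝕜] E => T w) h4
  have h5 := congrArg (fun T : E →L[𝕜] E => T X) (hd1.unique (hd2.congr_of_eventuallyEq hkey))
  simp [hF0] at h5
  rw [hLd, hLd]
  have h6 := hsymm (0, X) (Y, 0)
  rw [← hF, ← hF2] at h6
  rw [← h6, ← h5]; simp

end MultiplicationCalculus

/-! ### Norm on the Lie algebra and smoothness of the adjoint representation -/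

variable {𝕜 : Type*} [NontriviallyNormedField 𝕜] {E : Type*} [NormedAddCommGroup E] [NormedSpace 𝕜 E]
  {G : Type*} [Group G] [TopologicalSpace G] [ChartedSpace E G]

/-- The norm of the model space. Its topology is the one that the Lie algebra already carries. -/
instance : Norm (GroupLieAlgebra 𝓘(𝕜, E) G) := ⟨fun x => ‖(show E from x)‖⟩

lemma normedSpaceCore_groupLieAlgebra :
    NormedSpace.Core 𝕜 (GroupLieAlgebra 𝓘(𝕜, E) G) where
  norm_nonneg x := norm_nonneg (show E from x)
  norm_smul c x := norm_smul c (show E from x)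
  norm_triangle x y := norm_add_le (show E from x) (show E from y)
  norm_eq_zero_iff x := norm_eq_zero (a := (show E from x))

noncomputable instance : NormedAddCommGroup (GroupLieAlgebra 𝓘(𝕜, E) G) :=
  NormedAddCommGroup.ofCoreReplaceTopology
    (normedSpaceCore_groupLieAlgebra (𝕜 := 𝕜) (E := E) (G := G)) (by
      change (inferInstance : PseudoEMetricSpace E).toUniformSpace.toTopologicalSpace = _
      -- the topology of the Lie algebra is by definition that of the model space
      congr 2
      apply PseudoEMetricSpace.ext
      ext x y
      exact edist_eq_enorm_neg_add x y)

noncomputable instance : NormedSpace 𝕜 (GroupLieAlgebra 𝓘(𝕜, E) G) :=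
  NormedSpace.ofCore (normedSpaceCore_groupLieAlgebra (𝕜 := 𝕜) (E := E) (G := G))

instance [h : FiniteDimensional 𝕜 E] : FiniteDimensional 𝕜 (GroupLieAlgebra 𝓘(𝕜, E) G) :=
  inferInstanceAs (FiniteDimensional 𝕜 E)

variable (𝕜 E G) in
/-- The identity, as an isometric isomorphism from the Lie algebra of `G` to the model space. -/
noncomputable def toModel : GroupLieAlgebra 𝓘(𝕜, E) G ≃ₗᵢ[𝕜] E where
  toFun x := x
  invFun x := x
  map_add' _ _ := rfl
  map_smul' _ _ := rfl
  left_inv _ := rfl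
  right_inv _ := rfl
  norm_map' _ := rfl

instance [CompleteSpace E] : CompleteSpace (GroupLieAlgebra 𝓘(𝕜, E) G) :=
  (toModel 𝕜 E G).isometry.isUniformInducing.completeSpace_congr
    (toModel 𝕜 E G).surjective |>.2 inferInstance

section AdjointSmooth

variable {𝕜 : Type*} [RCLike 𝕜] {E : Type*} [NormedAddCommGroup E] [NormedSpace 𝕜 E]
  {G : Type*} [Group G] [TopologicalSpace G] [ChartedSpace E G] [LieGroup 𝓘(𝕜, E) ∞ G]

lemma contMDiff_conj (g : G) : ContMDiff 𝓘(𝕜, E) 𝓘(𝕜, E) ∞ (fun x : G => g * x * g⁻¹) :=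
  (contMDiff_mul_right (I := 𝓘(𝕜, E)) (n := ∞) (a := g⁻¹)).comp
    (contMDiff_mul_left (I := 𝓘(𝕜, E)) (n := ∞) (a := g))

variable (𝕜 E) in
/-- The adjoint representation, with values in the endomorphisms of the model space. -/
noncomputable def AdE (g : G) : E →L[𝕜] E := Ad 𝕜 E g

lemma AdE_mul (g h : G) : AdE 𝕜 E (g * h) = (AdE 𝕜 E g).comp (AdE 𝕜 E h) := Ad_mul g h

lemma AdE_one : AdE 𝕜 E (1 : G) = ContinuousLinearMap.id 𝕜 E := Ad_one

lemma mfderiv_one_eq_fderiv {f : G → E} (h : MDifferentiableAt 𝓘(𝕜, E) 𝓘(𝕜, E) f 1) :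
    (mfderiv 𝓘(𝕜, E) 𝓘(𝕜, E) f 1 : E →L[𝕜] E) =
      fderiv 𝕜 (fun v => f ((extChartAt 𝓘(𝕜, E) (1 : G)).symm v))
        (extChartAt 𝓘(𝕜, E) (1 : G) 1) := by
  refine h.mfderiv.trans ?_
  simp only [modelWithCornersSelf_coe, Set.range_id, fderivWithin_univ]
  rfl

lemma AdE_eq_fderiv (g : G) :
    AdE 𝕜 E g = fderiv 𝕜 (fun v => extChartAt 𝓘(𝕜, E) (1 : G)
      (g * (extChartAt 𝓘(𝕜, E) (1 : G)).symm v * g⁻¹)) (extChartAt 𝓘(𝕜, E) (1 : G) 1) := by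
  have h := ((contMDiff_conj (𝕜 := 𝕜) (E := E) g) 1).mdifferentiableAt (by simp)
  refine h.mfderiv.trans ?_
  simp only [modelWithCornersSelf_coe, Set.range_id, fderivWithin_univ]
  congr 1
  ext v
  simp [writtenInExtChartAt]

lemma contMDiffAt_chart_symm :
    ContMDiffAt 𝓘(𝕜, E) 𝓘(𝕜, E) ∞ (extChartAt 𝓘(𝕜, E) (1 : G)).symm
      (extChartAt 𝓘(𝕜, E) (1 : G) 1) :=
  (contMDiffOn_extChartAt_symm (1 : G)).contMDiffAt (extChartAt_target_mem_nhds 1)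

lemma contDiffAt_chart_of_contMDiffAt {p : E × E → G} {q : E × E}
    (hp : ContMDiffAt 𝓘(𝕜, E × E) 𝓘(𝕜, E) ∞ p q) (h1 : p q = 1) :
    ContDiffAt 𝕜 ∞ (fun x => extChartAt 𝓘(𝕜, E) (1 : G) (p x)) q := by
  rw [← contMDiffAt_iff_contDiffAt]
  refine ContMDiffAt.comp q ?_ hp
  rw [h1]
  exact contMDiffAt_extChartAt

variable (𝕜 E G) in
/-- The multiplication of `G` in the chart at `1`. -/
noncomputable def chartMul (p : E × E) : E :=
  extChartAt 𝓘(𝕜, E) (1 : G) ((extChartAt 𝓘(𝕜, E) (1 : G)).symm p.1 *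
    (extChartAt 𝓘(𝕜, E) (1 : G)).symm p.2)

variable (𝕜 E G) in
/-- The conjugation of `G` in the chart at `1`. -/
noncomputable def chartConj (p : E × E) : E :=
  extChartAt 𝓘(𝕜, E) (1 : G) ((extChartAt 𝓘(𝕜, E) (1 : G)).symm p.1 *
    (extChartAt 𝓘(𝕜, E) (1 : G)).symm p.2 * ((extChartAt 𝓘(𝕜, E) (1 : G)).symm p.1)⁻¹)

lemma contMDiffAt_chart_symm_fst (u v : E) (hu : u = extChartAt 𝓘(𝕜, E) (1 : G) 1) :
    ContMDiffAt 𝓘(𝕜, E × E) 𝓘(𝕜, E) ∞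
      (fun p : E × E => (extChartAt 𝓘(𝕜, E) (1 : G)).symm p.1) (u, v) := by
  subst hu
  exact ContMDiffAt.comp (I' := 𝓘(𝕜, E)) _ contMDiffAt_chart_symm
    (contMDiffAt_iff_contDiffAt.2 contDiffAt_fst)

lemma contMDiffAt_chart_symm_snd (u v : E) (hv : v = extChartAt 𝓘(𝕜, E) (1 : G) 1) :
    ContMDiffAt 𝓘(𝕜, E × E) 𝓘(𝕜, E) ∞
      (fun p : E × E => (extChartAt 𝓘(𝕜, E) (1 : G)).symm p.2) (u, v) := by
  subst hv
  exact ContMDiffAt.comp (I' := 𝓘(𝕜, E)) _ contMDiffAt_chart_symm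
    (contMDiffAt_iff_contDiffAt.2 contDiffAt_snd)

lemma contDiffAt_chartMul : ContDiffAt 𝕜 ∞ (chartMul 𝕜 E G)
    (extChartAt 𝓘(𝕜, E) (1 : G) 1, extChartAt 𝓘(𝕜, E) (1 : G) 1) := by
  refine contDiffAt_chart_of_contMDiffAt ?_ (by simp)
  exact (contMDiffAt_chart_symm_fst _ _ rfl).mul (contMDiffAt_chart_symm_snd _ _ rfl)

lemma contDiffAt_chartConj : ContDiffAt 𝕜 ∞ (chartConj 𝕜 E G)
    (extChartAt 𝓘(𝕜, E) (1 : G) 1, extChartAt 𝓘(𝕜, E) (1 : G) 1) := by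
  refine contDiffAt_chart_of_contMDiffAt ?_ (by simp)
  exact ((contMDiffAt_chart_symm_fst _ _ rfl).mul (contMDiffAt_chart_symm_snd _ _ rfl)).mul
    (contMDiffAt_chart_symm_fst _ _ rfl).inv

lemma eventually_chart_right_inv : ∀ᶠ u in 𝓝 (extChartAt 𝓘(𝕜, E) (1 : G) 1),
    extChartAt 𝓘(𝕜, E) (1 : G) ((extChartAt 𝓘(𝕜, E) (1 : G)).symm u) = u := by
  filter_upwards [extChartAt_target_mem_nhds (I := 𝓘(𝕜, E)) (1 : G)] with u hu
  exact (extChartAt 𝓘(𝕜, E) (1 : G)).right_inv hu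

lemma chartMul_conj : ∀ᶠ p : E × E in
    𝓝 (extChartAt 𝓘(𝕜, E) (1 : G) 1, extChartAt 𝓘(𝕜, E) (1 : G) 1),
    chartMul 𝕜 E G (chartConj 𝕜 E G p, p.1) = chartMul 𝕜 E G p := by
  have hc : ContinuousAt (fun p : E × E => (extChartAt 𝓘(𝕜, E) (1 : G)).symm p.1 *
      (extChartAt 𝓘(𝕜, E) (1 : G)).symm p.2 * ((extChartAt 𝓘(𝕜, E) (1 : G)).symm p.1)⁻¹)
      (extChartAt 𝓘(𝕜, E) (1 : G) 1, extChartAt 𝓘(𝕜, E) (1 : G) 1) :=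
    (((contMDiffAt_chart_symm_fst (𝕜 := 𝕜) _ _ rfl).mul (contMDiffAt_chart_symm_snd _ _ rfl)).mul
      (contMDiffAt_chart_symm_fst _ _ rfl).inv).continuousAt
  have hs : (extChartAt 𝓘(𝕜, E) (1 : G)).source ∈ 𝓝 ((fun p : E × E =>
      (extChartAt 𝓘(𝕜, E) (1 : G)).symm p.1 *
      (extChartAt 𝓘(𝕜, E) (1 : G)).symm p.2 * ((extChartAt 𝓘(𝕜, E) (1 : G)).symm p.1)⁻¹)
      (extChartAt 𝓘(𝕜, E) (1 : G) 1, extChartAt 𝓘(𝕜, E) (1 : G) 1)) := by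
    simpa using extChartAt_source_mem_nhds (I := 𝓘(𝕜, E)) (1 : G)
  filter_upwards [hc.eventually hs] with p hp
  have := (extChartAt 𝓘(𝕜, E) (1 : G)).left_inv hp
  simp only [chartMul, chartConj]
  rw [this]
  simp [mul_assoc]

lemma AdE_chart_symm (u : E) : AdE 𝕜 E ((extChartAt 𝓘(𝕜, E) (1 : G)).symm u) =
    fderiv 𝕜 (fun v => chartConj 𝕜 E G (u, v)) (extChartAt 𝓘(𝕜, E) (1 : G) 1) :=
  AdE_eq_fderiv _

lemma contDiffAt_AdE_chart :
    ContDiffAt 𝕜 ∞ (fun u => AdE 𝕜 E ((extChartAt 𝓘(𝕜, E) (1 : G)).symm u))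
      (extChartAt 𝓘(𝕜, E) (1 : G) 1) := by
  simp only [AdE_chart_symm]
  exact ContDiffAt.fderiv (n := ∞) (f := fun u v => chartConj 𝕜 E G (u, v))
    (g := fun _ => extChartAt 𝓘(𝕜, E) (1 : G) 1) contDiffAt_chartConj
        contDiffAt_const (by norm_cast)

lemma contMDiff_AdE : ContMDiff 𝓘(𝕜, E) 𝓘(𝕜, E →L[𝕜] E) ∞ (AdE 𝕜 E : G → E →L[𝕜] E) := by
  have h1 : ContMDiffAt 𝓘(𝕜, E) 𝓘(𝕜, E →L[𝕜] E) ∞ (AdE 𝕜 E : G → E →L[𝕜] E) 1 := by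
    have h := ContMDiffAt.comp (I' := 𝓘(𝕜, E)) (1 : G)
      (contMDiffAt_iff_contDiffAt.2 (contDiffAt_AdE_chart (𝕜 := 𝕜) (E := E) (G := G)))
      (contMDiffAt_extChartAt (I := 𝓘(𝕜, E)) (x := (1 : G)))
    refine h.congr_of_eventuallyEq ?_
    filter_upwards [extChartAt_source_mem_nhds (I := 𝓘(𝕜, E)) (1 : G)] with x hx
    simp only [Function.comp]
    rw [(extChartAt 𝓘(𝕜, E) (1 : G)).left_inv hx]
  -- smoothness at `1` spreads to all of `G` by translation
  intro g
  have h2 : (AdE 𝕜 E : G → E →L[𝕜] E) =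
      (fun T : E →L[𝕜] E => (AdE 𝕜 E g).comp T) ∘ (AdE 𝕜 E ∘ fun x => g⁻¹ * x) := by
    ext1 x
    simp only [Function.comp]
    rw [← AdE_mul, mul_inv_cancel_left]
  rw [h2]
  refine ContMDiffAt.comp (I' := 𝓘(𝕜, E →L[𝕜] E)) g (ContDiff.contMDiff ?_).contMDiffAt ?_
  · exact contDiff_const.clm_comp contDiff_id
  · refine ContMDiffAt.comp (I' := 𝓘(𝕜, E)) g ?_ contMDiff_mul_left.contMDiffAt
    rw [inv_mul_cancel]
    exact h1

/-- In the chart at `1`, the left-invariant field of `X` at `u` is the derivative at the identity of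
the left translation by `u`, applied to `X`. -/
lemma mpullback_chart_symm (X : GroupLieAlgebra 𝓘(𝕜, E) G) {u : E}
    (hu : u ∈ (extChartAt 𝓘(𝕜, E) (1 : G)).target) :
    (VectorField.mpullbackWithin 𝓘(𝕜, E) 𝓘(𝕜, E) (extChartAt 𝓘(𝕜, E) (1 : G)).symm
      (mulInvariantVectorField X) (Set.range 𝓘(𝕜, E)) u : E) =
    fderiv 𝕜 (fun v => chartMul 𝕜 E G (u, v)) (extChartAt 𝓘(𝕜, E) (1 : G) 1) X := by
  have hM : IsManifold 𝓘(𝕜, E) 1 G := IsManifold.of_le (n := ∞) (by simp)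
  set e := extChartAt 𝓘(𝕜, E) (1 : G) with he
  have hs : e.symm u ∈ (chartAt E (1 : G)).source := by
    rw [← extChartAt_source 𝓘(𝕜, E)]; exact e.map_target hu
  have hinv : (mfderivWithin 𝓘(𝕜, E) 𝓘(𝕜, E) e.symm (Set.range 𝓘(𝕜, E)) u).inverse =
      mfderiv 𝓘(𝕜, E) 𝓘(𝕜, E) e (e.symm u) :=
    ContinuousLinearMap.inverse_eq (mfderivWithin_extChartAt_symm_comp_mfderiv_extChartAt hu)
      (mfderiv_extChartAt_comp_mfderivWithin_extChartAt_symm hu)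
  rw [VectorField.mpullbackWithin_apply, hinv]
  have hmul : MDifferentiableAt 𝓘(𝕜, E) 𝓘(𝕜, E) (fun x : G => e.symm u * x) 1 :=
    (contMDiff_mul_left (I := 𝓘(𝕜, E)) (n := ∞)).contMDiffAt.mdifferentiableAt (by simp)
  have hE : MDifferentiableAt 𝓘(𝕜, E) 𝓘(𝕜, E) e ((fun x : G => e.symm u * x) 1) := by
    rw [show (fun x : G => e.symm u * x) 1 = e.symm u from mul_one _]
    exact mdifferentiableAt_extChartAt hs
  have h1 := mfderiv_comp (I' := 𝓘(𝕜, E)) (1 : G) hE hmul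
  have h2 := mfderiv_one_eq_fderiv (hE.comp (1 : G) hmul)
  have h3 : ∀ y : G, y = e.symm u → (mfderiv 𝓘(𝕜, E) 𝓘(𝕜, E) e y : E →L[𝕜] E) =
      (mfderiv 𝓘(𝕜, E) 𝓘(𝕜, E) e (e.symm u) : E →L[𝕜] E) := by
    rintro _ rfl; rfl
  have h4 := congrArg (fun T : E →L[𝕜] E => T X) (h1.symm.trans h2)
  refine Eq.trans ?_ h4
  exact (congrArg (fun T : E →L[𝕜] E => T (mfderiv 𝓘(𝕜, E) 𝓘(𝕜, E)
    (fun x : G => e.symm u * x) 1 X : E)) (h3 _ (mul_one _))).symm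

lemma lieBracketWithin_univ_congr {V W V' W' : E → E} {u : E} (hV : V =ᶠ[𝓝 u] V')
    (hW : W =ᶠ[𝓝 u] W') {x y : E} (hx : V' u = x) (hy : W' u = y) :
    VectorField.lieBracketWithin 𝕜 V W Set.univ u = fderiv 𝕜 W' u x - fderiv 𝕜 V' u y := by
  rw [VectorField.lieBracketWithin_univ, VectorField.lieBracket, hV.fderiv_eq, hW.fderiv_eq,
    hV.self_of_nhds, hW.self_of_nhds, hx, hy]

/-- The Lie bracket of a Lie group, in the chart at `1`: the antisymmetrization of the mixed second
derivative of the multiplication. -/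
lemma lie_eq_fderiv_chartMul (X Y : GroupLieAlgebra 𝓘(𝕜, E) G) :
    (⁅X, Y⁆ : GroupLieAlgebra 𝓘(𝕜, E) G) =
      (fderiv 𝕜 (fun u => fderiv 𝕜 (fun v => chartMul 𝕜 E G (u, v))
          (extChartAt 𝓘(𝕜, E) (1 : G) 1) Y) (extChartAt 𝓘(𝕜, E) (1 : G) 1) X -
        fderiv 𝕜 (fun u => fderiv 𝕜 (fun v => chartMul 𝕜 E G (u, v))
          (extChartAt 𝓘(𝕜, E) (1 : G) 1) X) (extChartAt 𝓘(𝕜, E) (1 : G) 1) Y : E) := by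
  have hM : IsManifold 𝓘(𝕜, E) 1 G := IsManifold.of_le (n := ∞) (by simp)
  rw [GroupLieAlgebra.bracket_def, ← VectorField.mlieBracketWithin_univ,
    VectorField.mlieBracketWithin_apply]
  have hid : (mfderiv 𝓘(𝕜, E) 𝓘(𝕜, E) (extChartAt 𝓘(𝕜, E) (1 : G)) 1 : E →L[𝕜] E).inverse =
      ContinuousLinearMap.id 𝕜 E :=
    (congrArg ContinuousLinearMap.inverse
      (show (mfderiv 𝓘(𝕜, E) 𝓘(𝕜, E) (extChartAt 𝓘(𝕜, E) (1 : G)) 1 : E →L[𝕜] E) =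
        ContinuousLinearMap.id 𝕜 E from mfderiv_extChartAt_self)).trans
      ContinuousLinearMap.inverse_id
  refine (congrArg (fun T : E →L[𝕜] E => T _) hid).trans ?_
  simp only [Set.preimage_univ, Set.univ_inter, modelWithCornersSelf_coe, Set.range_id]
  have hev : ∀ Z : GroupLieAlgebra 𝓘(𝕜, E) G,
      (VectorField.mpullbackWithin 𝓘(𝕜, E) 𝓘(𝕜, E) (extChartAt 𝓘(𝕜, E) (1 : G)).symm
      (mulInvariantVectorField Z) Set.univ : E → E) =ᶠ[𝓝 (extChartAt 𝓘(𝕜, E) (1 : G) 1)]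
      fun u => fderiv 𝕜 (fun v => chartMul 𝕜 E G (u, v)) (extChartAt 𝓘(𝕜, E) (1 : G) 1) Z := by
    intro Z
    filter_upwards [extChartAt_target_mem_nhds (I := 𝓘(𝕜, E)) (1 : G)] with u hu
    have := mpullback_chart_symm Z hu
    rwa [modelWithCornersSelf_coe, Set.range_id] at this
  have hone : ∀ Z : E, fderiv 𝕜 (fun v => chartMul 𝕜 E G (extChartAt 𝓘(𝕜, E) (1 : G) 1, v))
      (extChartAt 𝓘(𝕜, E) (1 : G) 1) Z = Z := by
    intro Z
    have : (fun v => chartMul 𝕜 E G (extChartAt 𝓘(𝕜, E) (1 : G) 1, v)) =ᶠ[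
        𝓝 (extChartAt 𝓘(𝕜, E) (1 : G) 1)] id := by
      filter_upwards [eventually_chart_right_inv (𝕜 := 𝕜) (E := E) (G := G)] with u hu
      simpa [chartMul] using hu
    rw [this.fderiv_eq, fderiv_id]; rfl
  exact lieBracketWithin_univ_congr (hev X) (hev Y) (hone X) (hone Y)

/-- The derivative of `Ad` at `1` is `ad`, in the chart at `1`. -/
lemma fderiv_AdE_chart (X Y : GroupLieAlgebra 𝓘(𝕜, E) G) :
    fderiv 𝕜 (fun u => AdE 𝕜 E ((extChartAt 𝓘(𝕜, E) (1 : G)).symm u))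
      (extChartAt 𝓘(𝕜, E) (1 : G) 1) X Y = (⁅X, Y⁆ : GroupLieAlgebra 𝓘(𝕜, E) G) := by
  rw [lie_eq_fderiv_chartMul]
  simp only [AdE_chart_symm]
  refine fderiv_conj_of_mul_chart (E := E) contDiffAt_chartMul contDiffAt_chartConj ?_ ?_ ?_
    chartMul_conj X Y
  · filter_upwards [eventually_chart_right_inv (𝕜 := 𝕜) (E := E) (G := G)] with u hu
    simpa [chartMul] using hu
  · filter_upwards [eventually_chart_right_inv (𝕜 := 𝕜) (E := E) (G := G)] with u hu
    simpa [chartConj] using hu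
  · exact Eventually.of_forall fun u => by simp [chartConj]

/-- The derivative of `Ad` at `1` is `ad`. -/
lemma mfderiv_AdE_one (X Y : GroupLieAlgebra 𝓘(𝕜, E) G) :
    (show E →L[𝕜] E from
      mfderiv 𝓘(𝕜, E) 𝓘(𝕜, E →L[𝕜] E) (AdE 𝕜 E : G → E →L[𝕜] E) 1 X) Y =
      (⁅X, Y⁆ : GroupLieAlgebra 𝓘(𝕜, E) G) := by
  rw [← fderiv_AdE_chart]
  have h := (contMDiff_AdE (𝕜 := 𝕜) (E := E) (G := G) 1).mdifferentiableAt (by simp)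
  have h1 := h.mfderiv
  simp only [modelWithCornersSelf_coe, Set.range_id, fderivWithin_univ] at h1
  exact congrArg (fun T : E →L[𝕜] E →L[𝕜] E => T X Y) h1

end AdjointSmooth

/-! ### One-parameter groups and logarithms in Banach algebras -/

section Exponential

variable {𝕜 : Type*} [RCLike 𝕜] {𝔸 : Type*} [NormedRing 𝔸] [NormedAlgebra 𝕜 𝔸]
  [CompleteSpace 𝔸]

lemma hasDerivAt_exp_smul (T : 𝔸) (t : 𝕜) :
    HasDerivAt (fun t : 𝕜 => exp (t • T)) (exp (t • T) * T) t :=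
  hasDerivAt_exp_smul_const T t

lemma hasDerivAt_exp_smul' (T : 𝔸) (t : 𝕜) :
    HasDerivAt (fun t : 𝕜 => exp (t • T)) (T * exp (t • T)) t :=
  hasDerivAt_exp_smul_const' T t

lemma exp_smul_mul_exp_neg_smul (T : 𝔸) (t : 𝕜) : exp (t • T) * exp (-(t • T)) = 1 := by
  rw [← NormedSpace.exp_add_of_commute_of_mem_ball (𝕂 := 𝕜) (Commute.neg_right (Commute.refl _))]
  · simp
  all_goals rw [NormedSpace.expSeries_radius_eq_top]; simp

/-- A differentiable one-parameter group in a Banach algebra is an exponential. -/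
lemma eq_exp_smul_of_hasDerivAt {γ : 𝕜 → 𝔸} {T : 𝔸} (h0 : γ 0 = 1)
    (h : ∀ t, HasDerivAt γ (γ t * T) t) (t : 𝕜) : γ t = exp (t • T) := by
  have hd : ∀ t, HasDerivAt (fun t => γ t * exp (-(t • T))) 0 t := by
    intro t
    have h1 : HasDerivAt (fun t : 𝕜 => exp (-(t • T))) (-T * exp (-(t • T))) t := by
      have := hasDerivAt_exp_smul' (-T) t
      simpa using this
    have h2 := (h t).mul h1
    have h3 : (0 : 𝔸) = γ t * T * exp (-(t • T)) + γ t * (-T * exp (-(t • T))) := by noncomm_ring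
    rw [h3]
    exact h2
  have hc := is_const_of_deriv_eq_zero (fun t => (hd t).differentiableAt)
    (fun t => (hd t).deriv) t 0
  simp only [h0, zero_smul, neg_zero, NormedSpace.exp_zero, mul_one] at hc
  have h3 : exp (-(t • T)) * exp (t • T) = 1 := by
    simpa using exp_smul_mul_exp_neg_smul (-T) t
  calc γ t = γ t * (exp (-(t • T)) * exp (t • T)) := by rw [h3, mul_one]
    _ = exp (t • T) := by rw [← mul_assoc, hc, one_mul]

end Exponential

section BanachAlgebra

variable {𝔸 : Type*} [NormedRing 𝔸] [NormedAlgebra ℝ 𝔸] [CompleteSpace 𝔸]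

/-- Near `0`, `exp` differs from `A ↦ 1 + A` by a contraction of ratio `1 / 2`. -/
lemma exists_exp_approx (𝔸 : Type*) [NormedRing 𝔸] [NormedAlgebra ℝ 𝔸] [CompleteSpace 𝔸] :
    ∃ ρ > 0, ∀ A B : 𝔸, ‖A‖ ≤ ρ → ‖B‖ ≤ ρ → ‖exp A - exp B - (A - B)‖ ≤ 1 / 2 * ‖A - B‖ := by
  have h := (hasStrictFDerivAt_exp_zero (𝕂 := ℝ) (𝔸 := 𝔸)).isLittleO.def (c := 1 / 2) (by norm_num)
  rw [nhds_prod_eq, eventually_prod_self_iff'] at h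
  obtain ⟨t, ht, h⟩ := h
  obtain ⟨r, hr, hrt⟩ := Metric.mem_nhds_iff.1 ht
  refine ⟨r / 2, by positivity, fun A B hA hB => ?_⟩
  have := h A (hrt (mem_ball_zero_iff.2 (by linarith))) B (hrt (mem_ball_zero_iff.2 (by linarith)))
  simpa using this

/-- A closed non-unital subalgebra contains `exp A - 1` along with `A`. -/
lemma exp_sub_one_mem {S : Submodule ℝ 𝔸} (hS : IsClosed (S : Set 𝔸))
    (hmul : ∀ A ∈ S, ∀ B ∈ S, A * B ∈ S) {A : 𝔸} (hA : A ∈ S) : exp A - 1 ∈ S := by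
  have h := (NormedSpace.exp_series_hasSum_exp' (𝕂 := ℝ) A)
  rw [← hasSum_nat_add_iff' 1] at h
  simp only [Finset.range_one, Finset.sum_singleton, Nat.factorial_zero, Nat.cast_one, inv_one,
    pow_zero, one_smul] at h
  have hpow : ∀ n : ℕ, A ^ (n + 1) ∈ S := by
    intro n
    induction n with
    | zero => simpa using hA
    | succ n ih => rw [pow_succ]; exact hmul _ ih _ hA
  exact hS.mem_of_tendsto h (Eventually.of_forall fun s =>
    S.sum_mem fun n _ => S.smul_mem _ (hpow n))

/-- If `exp D - 1` lies in a closed non-unital subalgebra and `D` is small, then `D` lies in it. -/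
lemma exists_mem_of_exp_sub_one_mem (𝔸 : Type*) [NormedRing 𝔸] [NormedAlgebra ℝ 𝔸]
    [CompleteSpace 𝔸] : ∃ ρ > 0, ∀ S : Submodule ℝ 𝔸, IsClosed (S : Set 𝔸) →
      (∀ A ∈ S, ∀ B ∈ S, A * B ∈ S) → ∀ D : 𝔸, ‖D‖ ≤ ρ → exp D - 1 ∈ S → D ∈ S := by
  obtain ⟨ρ, hρ, h⟩ := exists_exp_approx 𝔸
  refine ⟨ρ / 2, by positivity, fun S hS hmul D hD hDS => ?_⟩
  -- `D` is the fixed point of `A ↦ (exp D - 1) - ((exp A - 1) - A)`, a contraction of ratio `1 / 2`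
  -- which preserves `S`, so that iterating from `0` gives elements of `S` converging to `D`
  have key : ∀ n : ℕ, ∃ A ∈ S, ‖D - A‖ ≤ (1 / 2) ^ n * ‖D‖ := by
    intro n
    induction n with
    | zero => exact ⟨0, S.zero_mem, by simp⟩
    | succ n ih =>
      obtain ⟨A, hA, hDA⟩ := ih
      have hDA' : ‖D - A‖ ≤ ‖D‖ := hDA.trans (mul_le_of_le_one_left (norm_nonneg _)
        (pow_le_one₀ (by norm_num) (by norm_num)))
      have hAn : ‖A‖ ≤ ρ := by
        have : A = D - (D - A) := by abel
        rw [this]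
        refine (norm_sub_le _ _).trans ?_
        linarith
      refine ⟨(exp D - 1) - ((exp A - 1) - A), S.sub_mem hDS (S.sub_mem
        (exp_sub_one_mem hS hmul hA) hA), ?_⟩
      have h1 := h D A (by linarith) hAn
      have h2 : D - ((exp D - 1) - ((exp A - 1) - A)) = -(exp D - exp A - (D - A)) := by abel
      rw [h2, norm_neg, pow_succ']
      refine h1.trans ?_
      rw [mul_assoc]
      exact mul_le_mul_of_nonneg_left hDA (by norm_num)
  choose A hA hDA using key
  have hlim : Tendsto A atTop (𝓝 D) := by
    rw [tendsto_iff_norm_sub_tendsto_zero]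
    refine squeeze_zero (g := fun n => (1 / 2 : ℝ) ^ n * ‖D‖) (fun _ => norm_nonneg _)
      (fun n => by rw [norm_sub_rev]; exact hDA n) ?_
    simpa using (tendsto_pow_atTop_nhds_zero_of_lt_one (by norm_num : (0 : ℝ) ≤ 1 / 2)
      (by norm_num)).mul_const ‖D‖
  exact hS.mem_of_tendsto hlim (Eventually.of_forall hA)

/-- A bound on `T` from a bound on `exp (s T)` for all `s ∈ [0, 1]`. -/
lemma exists_norm_le_of_exp (𝔸 : Type*) [NormedRing 𝔸] [NormedAlgebra ℝ 𝔸]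
    [CompleteSpace 𝔸] : ∃ ε > 0, ∃ ρ : ℝ, ∀ T : 𝔸,
      (∀ s ∈ Set.Icc (0 : ℝ) 1, ‖exp (s • T) - 1‖ ≤ ε) → ‖T‖ ≤ ρ := by
  obtain ⟨ρ, hρ, h⟩ := exists_exp_approx 𝔸
  refine ⟨ρ / 4, by positivity, ρ, fun T hT => ?_⟩
  by_contra! hlt
  have hT0 : 0 < ‖T‖ := hρ.trans hlt
  -- the multiple of `T` of norm `ρ` has `exp` at distance at least `ρ / 2` from `1`
  have h1 := hT (ρ / ‖T‖) ⟨by positivity, (div_le_one hT0).2 hlt.le⟩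
  have hn : ‖(ρ / ‖T‖) • T‖ = ρ := by
    rw [norm_smul, Real.norm_of_nonneg (by positivity)]; field_simp
  have h2 := h ((ρ / ‖T‖) • T) 0 hn.le (by simpa using hρ.le)
  rw [NormedSpace.exp_zero, sub_zero, hn] at h2
  have h3 : ‖(ρ / ‖T‖) • T‖ ≤ ‖exp ((ρ / ‖T‖) • T) - 1‖ +
      ‖exp ((ρ / ‖T‖) • T) - 1 - (ρ / ‖T‖) • T‖ := by
    have : (ρ / ‖T‖) • T = (exp ((ρ / ‖T‖) • T) - 1) -
      (exp ((ρ / ‖T‖) • T) - 1 - (ρ / ‖T‖) • T) := by abel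
    conv_lhs => rw [this]
    exact norm_sub_le _ _
  rw [hn] at h3
  linarith

/-- A continuous one-parameter group in a Banach algebra is an exponential. -/
lemma exists_eq_exp_smul {γ : ℝ → 𝔸} (h0 : γ 0 = 1) (hadd : ∀ s t, γ (s + t) = γ s * γ t)
    (hc : Continuous γ) : ∃ T, ∀ t, γ t = exp (t • T) := by
  -- the primitive `F` of `γ` satisfies `γ t * F a = F (t + a) - F t`, and `F a` is invertible for small
  -- `a ≠ 0`, whence `γ` is differentiable
  let F : ℝ → 𝔸 := fun t => ∫ s in (0 : ℝ)..t, γ s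
  have hF : ∀ t, HasDerivAt F (γ t) t := fun t =>
    intervalIntegral.integral_hasDerivAt_right (hc.intervalIntegrable _ _)
      (hc.stronglyMeasurableAtFilter _ _) hc.continuousAt
  have hu : ∃ a : ℝ, IsUnit (F a) := by
    have h1 : Tendsto (fun t : ℝ => t⁻¹ • (F (0 + t) - F 0)) (𝓝[≠] 0) (𝓝 (γ 0)) :=
      (hF 0).tendsto_slope_zero
    rw [h0] at h1
    have h2 : ∀ᶠ x : 𝔸 in 𝓝 1, IsUnit x := by
      have := Units.isOpen.mem_nhds (isUnit_one (M := 𝔸))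
      exact this
    obtain ⟨t, ht, ht0⟩ := ((h1.eventually h2).and self_mem_nhdsWithin).exists
    refine ⟨t, ?_⟩
    have ht0 : t ≠ 0 := ht0
    have hF0 : F 0 = 0 := by simp [F]
    rw [zero_add, hF0, sub_zero] at ht
    have : F t = t • t⁻¹ • F t := by rw [smul_smul, mul_inv_cancel₀ ht0, one_smul]
    rw [this]
    exact (Units.mk0 t ht0 • ht.unit).isUnit
  obtain ⟨a, ⟨u, hu⟩⟩ := hu
  have hγ : ∀ t, γ t = (F (t + a) - F t) * ↑u⁻¹ := by
    intro t
    have : γ t * F a = F (t + a) - F t := by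
      simp only [F]
      rw [intervalIntegral.integral_interval_sub_left (hc.intervalIntegrable _ _)
        (hc.intervalIntegrable _ _)]
      have h1 := intervalIntegral.integral_comp_add_left (a := 0) (b := a) γ t
      simp only [hadd, add_zero] at h1
      rw [← h1]
      exact (((ContinuousLinearMap.mul ℝ 𝔸 (γ t))).intervalIntegral_comp_comm
        (hc.intervalIntegrable _ _)).symm
    rw [← this, ← hu, mul_assoc, Units.mul_inv, mul_one]
  have hd : ∃ T, HasDerivAt γ T 0 := by
    have h1 : HasDerivAt (fun t => (F (t + a) - F t) * ↑u⁻¹) _ 0 :=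
      ((((hF (0 + a)).comp_add_const 0 a)).sub (hF 0)).mul_const (↑u⁻¹ : 𝔸)
    exact ⟨_, h1.congr_of_eventuallyEq (Eventually.of_forall hγ)⟩
  obtain ⟨T, hT⟩ := hd
  refine ⟨T, eq_exp_smul_of_hasDerivAt h0 fun t => ?_⟩
  have h1 : HasDerivAt (fun s => γ t * γ (s + -t)) (γ t * T) t := by
    refine HasDerivAt.const_mul _ (HasDerivAt.comp_add_const t (-t) ?_)
    simpa using hT
  refine h1.congr_of_eventuallyEq (Eventually.of_forall fun s => ?_)
  change γ s = γ t * γ (s + -t)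
  rw [← hadd]; congr 1; ring

/-- The local inverse at `1` of the exponential of a Banach algebra. -/
noncomputable def logA : 𝔸 → 𝔸 :=
  HasStrictFDerivAt.localInverse (𝕜 := ℝ) (exp : 𝔸 → 𝔸) (ContinuousLinearEquiv.refl ℝ 𝔸) 0
    (hasStrictFDerivAt_exp_zero (𝕂 := ℝ))

lemma hasStrictFDerivAt_logA : HasStrictFDerivAt (logA : 𝔸 → 𝔸) (ContinuousLinearMap.id ℝ 𝔸) 1 := by
  have h := HasStrictFDerivAt.to_localInverse (𝕜 := ℝ) (f := (exp : 𝔸 → 𝔸)) (a := 0)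
    (f' := ContinuousLinearEquiv.refl ℝ 𝔸) (hasStrictFDerivAt_exp_zero (𝕂 := ℝ))
  rw [NormedSpace.exp_zero] at h
  exact h

lemma eventually_exp_logA : ∀ᶠ x in 𝓝 (1 : 𝔸), exp (logA x) = x := by
  have h := HasStrictFDerivAt.eventually_right_inverse (𝕜 := ℝ) (f := (exp : 𝔸 → 𝔸)) (a := 0)
    (f' := ContinuousLinearEquiv.refl ℝ 𝔸) (hasStrictFDerivAt_exp_zero (𝕂 := ℝ))
  rw [NormedSpace.exp_zero] at h
  exact h

lemma eventually_logA_exp : ∀ᶠ x in 𝓝 (0 : 𝔸), logA (exp x) = x :=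
  HasStrictFDerivAt.eventually_left_inverse (𝕜 := ℝ) (f := (exp : 𝔸 → 𝔸)) (a := 0)
    (f' := ContinuousLinearEquiv.refl ℝ 𝔸) (hasStrictFDerivAt_exp_zero (𝕂 := ℝ))

lemma logA_one : logA (1 : 𝔸) = 0 := by
  have h := (eventually_logA_exp (𝔸 := 𝔸)).self_of_nhds
  rwa [NormedSpace.exp_zero] at h

lemma tendsto_logA : Tendsto (logA : 𝔸 → 𝔸) (𝓝 1) (𝓝 0) := by
  have h := (hasStrictFDerivAt_logA (𝔸 := 𝔸)).continuousAt.tendsto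
  rwa [logA_one] at h

end BanachAlgebra

/-! ### Small logarithms of automorphisms are derivations -/

section DerivationLog

variable {V : Type*} [NormedAddCommGroup V] [NormedSpace ℝ V] [CompleteSpace V]

/-- The action of an endomorphism `D` of `V` on bilinear maps. -/
noncomputable def bilinAction (D : V →L[ℝ] V) : (V →L[ℝ] V →L[ℝ] V) →L[ℝ] (V →L[ℝ] V →L[ℝ] V) :=
  LinearMap.mkContinuous
    { toFun := fun β => (ContinuousLinearMap.compL ℝ V V V D).comp β - β.comp D -
        (β.flip.comp D).flip
      map_add' := fun β β' => by ext x y; simp; abel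
      map_smul' := fun r β => by ext x y; simp [smul_sub] } (3 * ‖D‖) (by
    intro β
    refine ContinuousLinearMap.opNorm_le_bound₂ _ (by positivity) fun x y => ?_
    simp only [LinearMap.coe_mk, AddHom.coe_mk, sub_apply,
      ContinuousLinearMap.comp_apply, ContinuousLinearMap.compL_apply,
      ContinuousLinearMap.flip_apply]
    have h1 : ‖D (β x y)‖ ≤ ‖D‖ * ‖β‖ * ‖x‖ * ‖y‖ := by
      refine (D.le_opNorm _).trans ?_
      have := mul_le_mul_of_nonneg_left (β.le_opNorm₂ x y) (norm_nonneg D)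
      linarith
    have h2 : ‖β (D x) y‖ ≤ ‖D‖ * ‖β‖ * ‖x‖ * ‖y‖ := by
      refine (β.le_opNorm₂ _ _).trans ?_
      have := mul_le_mul_of_nonneg_left (D.le_opNorm x) (mul_nonneg (norm_nonneg β) (norm_nonneg y))
      linarith
    have h3 : ‖β x (D y)‖ ≤ ‖D‖ * ‖β‖ * ‖x‖ * ‖y‖ := by
      refine (β.le_opNorm₂ _ _).trans ?_
      have := mul_le_mul_of_nonneg_left (D.le_opNorm y) (mul_nonneg (norm_nonneg β) (norm_nonneg x))
      linarith
    refine (norm_sub_le _ _).trans ?_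
    have := norm_sub_le (D (β x y)) (β (D x) y)
    linarith)

lemma bilinAction_apply (D : V →L[ℝ] V) (β : V →L[ℝ] V →L[ℝ] V) (x y : V) :
    bilinAction D β x y = D (β x y) - β (D x) y - β x (D y) := by
  simp [bilinAction]

lemma norm_bilinAction_le (D : V →L[ℝ] V) : ‖bilinAction D‖ ≤ 3 * ‖D‖ :=
  LinearMap.mkContinuous_norm_le _ (by positivity) _

/-- The action of `exp D` on bilinear maps by transport of structure is the exponential of
`bilinAction D`. -/
lemma exp_bilinAction_apply (D : V →L[ℝ] V) (β : V →L[ℝ] V →L[ℝ] V) (x y : V) :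
    exp (-D) ((exp (bilinAction D) β) (exp D x) (exp D y)) = β x y := by
  let f : ℝ → V := fun t =>
    exp (t • (-D)) ((exp (t • bilinAction D) β) (exp (t • D) x) (exp (t • D) y))
  have hf : ∀ t, HasDerivAt f 0 t := by
    intro t
    have h1 := hasDerivAt_exp_smul (-D) t
    have h2 := (hasDerivAt_exp_smul' (bilinAction D) t).clm_apply (hasDerivAt_const t β)
    have h3 := (hasDerivAt_exp_smul' D t).clm_apply (hasDerivAt_const t x)
    have h4 := (hasDerivAt_exp_smul' D t).clm_apply (hasDerivAt_const t y)
    have h5 := h1.clm_apply ((h2.clm_apply h3).clm_apply h4)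
    have h6 : ∀ a b : V →L[ℝ] V, (a * b : V →L[ℝ] V) = a.comp b := fun _ _ => rfl
    convert h5 using 1
    simp only [mul_apply_eq_comp, map_zero, add_zero, add_apply,
      neg_apply, bilinAction_apply, map_neg]
    rw [← map_neg, ← map_add]
    refine (map_zero (exp (t • -D))).symm.trans (congrArg _ ?_)
    abel
  have hc := is_const_of_deriv_eq_zero (fun t => (hf t).differentiableAt)
    (fun t => (hf t).deriv) 1 0
  simpa [f] using hc

/-- The logarithm of an automorphism of a bilinear structure is a derivation, if it is small. -/
lemma exists_derivation_of_exp (V : Type*) [NormedAddCommGroup V] [NormedSpace ℝ V]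
    [CompleteSpace V] : ∃ ρ > 0, ∀ (D : V →L[ℝ] V) (β : V →L[ℝ] V →L[ℝ] V), ‖D‖ ≤ ρ →
      (∀ x y, exp D (β x y) = β (exp D x) (exp D y)) →
      ∀ x y, D (β x y) = β (D x) y + β x (D y) := by
  obtain ⟨ρ, hρ, h⟩ := exists_mem_of_exp_sub_one_mem
    ((V →L[ℝ] V →L[ℝ] V) →L[ℝ] (V →L[ℝ] V →L[ℝ] V))
  refine ⟨ρ / 3, by positivity, fun D β hD hβ x y => ?_⟩
  -- the subalgebra of the operators on bilinear maps which kill `β`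
  let S : Submodule ℝ ((V →L[ℝ] V →L[ℝ] V) →L[ℝ] (V →L[ℝ] V →L[ℝ] V)) :=
    LinearMap.ker (ContinuousLinearMap.apply ℝ (V →L[ℝ] V →L[ℝ] V) β).toLinearMap
  have hmem : ∀ A, A ∈ S ↔ A β = 0 := fun A => Iff.rfl
  have hSc : IsClosed (S : Set ((V →L[ℝ] V →L[ℝ] V) →L[ℝ] (V →L[ℝ] V →L[ℝ] V))) :=
    (ContinuousLinearMap.apply ℝ (V →L[ℝ] V →L[ℝ] V) β).isClosed_ker
  have hexp : exp (bilinAction D) β = β := by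
    have hinv : ∀ z, exp D (exp (-D) z) = z := by
      intro z
      have := exp_smul_mul_exp_neg_smul D (1 : ℝ)
      simp only [one_smul] at this
      exact congrArg (fun T : V →L[ℝ] V => T z) this
    ext x y
    have h1 := exp_bilinAction_apply D β (exp (-D) x) (exp (-D) y)
    rw [hinv, hinv] at h1
    have h2 := congrArg (fun v => exp D v) h1
    rw [hinv, hβ, hinv, hinv] at h2
    exact h2
  have := h S hSc (fun A hA B hB => by
    rw [hmem] at *; rw [mul_apply_eq_comp, hB, map_zero]) (bilinAction D)
    ((norm_bilinAction_le D).trans (by linarith)) (by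
      rw [hmem, sub_apply, hexp]; simp)
  rw [hmem] at this
  have h2 := congrArg (fun T : V →L[ℝ] V →L[ℝ] V => T x y) this
  simp only [bilinAction_apply, zero_apply] at h2
  rw [sub_sub, sub_eq_zero] at h2
  exact h2

end DerivationLog

/-! ### The adjoint representation along one-parameter subgroups -/

section OneParam

variable {𝕜 : Type*} [RCLike 𝕜] {E : Type*} [NormedAddCommGroup E] [NormedSpace 𝕜 E]
  [FiniteDimensional 𝕜 E] [CompleteSpace E]
  {G : Type*} [Group G] [TopologicalSpace G] [ChartedSpace E G] [LieGroup 𝓘(𝕜, E) ∞ G]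

variable (𝕜 E G) in
/-- The adjoint representation of the Lie algebra of `G`, as a continuous linear map. -/
noncomputable def adL : GroupLieAlgebra 𝓘(𝕜, E) G →L[𝕜]
    GroupLieAlgebra 𝓘(𝕜, E) G →L[𝕜] GroupLieAlgebra 𝓘(𝕜, E) G :=
  LinearMap.toContinuousLinearMap
    ((LinearMap.toContinuousLinearMap (𝕜 := 𝕜) (E := GroupLieAlgebra 𝓘(𝕜, E) G)
      (F' := GroupLieAlgebra 𝓘(𝕜, E) G)).toLinearMap ∘ₗ
      LinearMap.mk₂ 𝕜 (fun X Y : GroupLieAlgebra 𝓘(𝕜, E) G => ⁅X, Y⁆) add_lie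
        (fun r X Y => smul_lie r X Y) lie_add (fun r X Y => lie_smul r X Y))

@[simp] lemma adL_apply (X Y : GroupLieAlgebra 𝓘(𝕜, E) G) : adL 𝕜 E G X Y = ⁅X, Y⁆ := rfl

lemma IsOneParam.map_zero {γ : 𝕜 → G} {X : GroupLieAlgebra 𝓘(𝕜, E) G} (h : IsOneParam γ X) :
    γ 0 = 1 := by
  have := h.map_add 0 0
  simpa using this

lemma IsOneParam.hasDerivAt_Ad_zero {γ : 𝕜 → G} {X : GroupLieAlgebra 𝓘(𝕜, E) G}
    (h : IsOneParam γ X) : HasDerivAt (fun t => Ad 𝕜 E (γ t)) (adL 𝕜 E G X) 0 := by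
  have h1 : ∀ y : G, y = 1 → HasMFDerivAt 𝓘(𝕜, E) 𝓘(𝕜, E →L[𝕜] E) (AdE 𝕜 E : G → E →L[𝕜] E) y
      (show E →L[𝕜] (E →L[𝕜] E) from
        mfderiv 𝓘(𝕜, E) 𝓘(𝕜, E →L[𝕜] E) (AdE 𝕜 E : G → E →L[𝕜] E) 1) := by
    rintro _ rfl
    exact ((contMDiff_AdE (𝕜 := 𝕜) (E := E) (G := G) 1).mdifferentiableAt (by simp)).hasMFDerivAt
  have h2 := HasMFDerivAt.comp (I' := 𝓘(𝕜, E)) (0 : 𝕜) (h1 _ h.map_zero) h.hasMFDerivAt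
  have h3 : HasFDerivAt (AdE 𝕜 E ∘ γ) ((show E →L[𝕜] (E →L[𝕜] E) from
      mfderiv 𝓘(𝕜, E) 𝓘(𝕜, E →L[𝕜] E) (AdE 𝕜 E : G → E →L[𝕜] E) 1).comp
        (ContinuousLinearMap.toSpanSingleton 𝕜 (X : E))) 0 := hasMFDerivAt_iff_hasFDerivAt.1 h2
  have h4 : HasDerivAt (AdE 𝕜 E ∘ γ) (adL 𝕜 E G X : E →L[𝕜] E) 0 := by
    have h6 := h3.hasDerivAt
    have h7 : ((show E →L[𝕜] (E →L[𝕜] E) from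
      mfderiv 𝓘(𝕜, E) 𝓘(𝕜, E →L[𝕜] E) (AdE 𝕜 E : G → E →L[𝕜] E) 1).comp
        (ContinuousLinearMap.toSpanSingleton 𝕜 (X : E))) 1 = (adL 𝕜 E G X : E →L[𝕜] E) := by
      refine ContinuousLinearMap.ext fun Y => ?_
      have h5 := mfderiv_AdE_one (𝕜 := 𝕜) (E := E) (G := G) X Y
      refine Eq.trans ?_ h5
      refine congrArg (fun Z : E => (show E →L[𝕜] E from
        mfderiv 𝓘(𝕜, E) 𝓘(𝕜, E →L[𝕜] E) (AdE 𝕜 E : G → E →L[𝕜] E) 1 Z) Y) ?_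
      exact one_smul 𝕜 (X : E)
    rw [h7] at h6
    exact h6
  exact h4

lemma IsOneParam.hasDerivAt_Ad {γ : 𝕜 → G} {X : GroupLieAlgebra 𝓘(𝕜, E) G}
    (h : IsOneParam γ X) (t : 𝕜) :
    HasDerivAt (fun t => Ad 𝕜 E (γ t)) (Ad 𝕜 E (γ t) * adL 𝕜 E G X) t := by
  have h1 : HasDerivAt (fun s => Ad 𝕜 E (γ t) * Ad 𝕜 E (γ (s + -t)))
      (Ad 𝕜 E (γ t) * adL 𝕜 E G X) t := by
    refine HasDerivAt.const_mul (Ad 𝕜 E (γ t))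
      (HasDerivAt.comp_add_const (f := fun s => Ad 𝕜 E (γ s)) t (-t) ?_)
    simpa using h.hasDerivAt_Ad_zero
  refine h1.congr_of_eventuallyEq (Eventually.of_forall fun s => ?_)
  change _ = (Ad 𝕜 E (γ t)).comp (Ad 𝕜 E (γ (s + -t)))
  rw [← Ad_mul, ← h.map_add]; congr 2; ring

/-- `Ad (exp (t X)) = exp (t ad X)`. -/
lemma IsOneParam.Ad_eq_exp {γ : 𝕜 → G} {X : GroupLieAlgebra 𝓘(𝕜, E) G}
    (h : IsOneParam γ X) (t : 𝕜) : Ad 𝕜 E (γ t) = exp (t • adL 𝕜 E G X) := by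
  refine eq_exp_smul_of_hasDerivAt (γ := fun t => Ad 𝕜 E (γ t)) ?_ h.hasDerivAt_Ad t
  simp only [h.map_zero, Ad_one]
  rfl

lemma Ad_injective_of_inv (g : G) (X : GroupLieAlgebra 𝓘(𝕜, E) G) :
    Ad 𝕜 E g⁻¹ (Ad 𝕜 E g X) = X := by
  rw [← ContinuousLinearMap.comp_apply, ← Ad_mul, inv_mul_cancel, Ad_one]; rfl

lemma Ad_apply_inv (g : G) (X : GroupLieAlgebra 𝓘(𝕜, E) G) :
    Ad 𝕜 E g (Ad 𝕜 E g⁻¹ X) = X := by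
  rw [← ContinuousLinearMap.comp_apply, ← Ad_mul, mul_inv_cancel, Ad_one]; rfl

lemma IsOneParam.conj {γ : 𝕜 → G} {X : GroupLieAlgebra 𝓘(𝕜, E) G}
    (h : IsOneParam γ X) (g : G) : IsOneParam (fun t => g * γ t * g⁻¹) (Ad 𝕜 E g X) where
  map_add s t := by simp [h.map_add, mul_assoc]
  hasMFDerivAt := by
    have h1 : ∀ y : G, y = 1 → HasMFDerivAt 𝓘(𝕜, E) 𝓘(𝕜, E) (fun x : G => g * x * g⁻¹) y
        (show E →L[𝕜] E from Ad 𝕜 E g) := by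
      rintro _ rfl
      exact ((contMDiff_conj (𝕜 := 𝕜) (E := E) g 1).mdifferentiableAt (by simp)).hasMFDerivAt
    have h2 := HasMFDerivAt.comp (I' := 𝓘(𝕜, E)) (0 : 𝕜) (h1 _ h.map_zero) h.hasMFDerivAt
    refine h2.congr_mfderiv ?_
    refine ContinuousLinearMap.ext fun (r : 𝕜) => ?_
    exact map_smul (show E →L[𝕜] E from Ad 𝕜 E g) r (X : E)

lemma IsOneParam.comp_mul {γ : 𝕜 → G} {X : GroupLieAlgebra 𝓘(𝕜, E) G}
    (h : IsOneParam γ X) (r : 𝕜) : IsOneParam (fun t => γ (t * r)) (r • X) where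
  map_add s t := by rw [add_mul, h.map_add]
  hasMFDerivAt := by
    have h0 : HasMFDerivAt 𝓘(𝕜, 𝕜) 𝓘(𝕜, 𝕜) (fun t : 𝕜 => t * r) 0
        (ContinuousLinearMap.toSpanSingleton 𝕜 r) :=
      by
      have h1 : HasDerivAt (fun t : 𝕜 => t * r) r 0 := by
        simpa using (hasDerivAt_id (0 : 𝕜)).mul_const r
      exact hasMFDerivAt_iff_hasFDerivAt.2 h1.hasFDerivAt
    have h1 : ∀ y : 𝕜, y = 0 → HasMFDerivAt 𝓘(𝕜, 𝕜) 𝓘(𝕜, E) γ y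
        (ContinuousLinearMap.toSpanSingleton 𝕜 (X : E)) := by
      rintro _ rfl
      exact h.hasMFDerivAt
    have h2 := HasMFDerivAt.comp (I' := 𝓘(𝕜, 𝕜)) (0 : 𝕜) (h1 _ (zero_mul r)) h0
    refine h2.congr_mfderiv ?_
    refine ContinuousLinearMap.ext fun (t : 𝕜) => ?_
    exact mul_smul t r (X : E)

variable (𝕜 E G) in
/-- The adjoint representation of the Lie algebra, on the model space. -/
noncomputable def adE : E →L[𝕜] E →L[𝕜] E := adL 𝕜 E G

lemma hasMFDerivAt_AdE {y : G} (hy : y = 1) :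
    HasMFDerivAt 𝓘(𝕜, E) 𝓘(𝕜, E →L[𝕜] E) (AdE 𝕜 E : G → E →L[𝕜] E) y (adE 𝕜 E G) := by
  subst hy
  have h := ((contMDiff_AdE (𝕜 := 𝕜) (E := E) (G := G) 1).mdifferentiableAt (by simp)).hasMFDerivAt
  have h1 : (show E →L[𝕜] (E →L[𝕜] E) from
      mfderiv 𝓘(𝕜, E) 𝓘(𝕜, E →L[𝕜] E) (AdE 𝕜 E : G → E →L[𝕜] E) 1) = adE 𝕜 E G :=
    ContinuousLinearMap.ext fun X => ContinuousLinearMap.ext fun Y => mfderiv_AdE_one X Y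
  exact h.congr_mfderiv h1

/-- `Ad g` is an automorphism of the Lie algebra: differentiate `Ad (g x g⁻¹) = Ad g Ad x Ad g⁻¹` at
`x = 1`. -/
lemma Ad_lie (g : G) (X Y : GroupLieAlgebra 𝓘(𝕜, E) G) :
    Ad 𝕜 E g ⁅X, Y⁆ = ⁅Ad 𝕜 E g X, Ad 𝕜 E g Y⁆ := by
  have hc : HasMFDerivAt 𝓘(𝕜, E) 𝓘(𝕜, E) (fun x : G => g * x * g⁻¹) 1
      (show E →L[𝕜] E from Ad 𝕜 E g) :=
    ((contMDiff_conj (𝕜 := 𝕜) (E := E) g 1).mdifferentiableAt (by simp)).hasMFDerivAt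
  have h1 := HasMFDerivAt.comp (I' := 𝓘(𝕜, E)) (1 : G)
    (hasMFDerivAt_AdE (𝕜 := 𝕜) (E := E) (y := g * 1 * g⁻¹) (by simp)) hc
  let Λ : (E →L[𝕜] E) →L[𝕜] (E →L[𝕜] E) :=
    (ContinuousLinearMap.compL 𝕜 E E E (AdE 𝕜 E g)).comp
      ((ContinuousLinearMap.compL 𝕜 E E E).flip (AdE 𝕜 E g⁻¹))
  have h2 := HasMFDerivAt.comp (I' := 𝓘(𝕜, E →L[𝕜] E)) (1 : G)
    (hasMFDerivAt_iff_hasFDerivAt.2 (Λ.hasFDerivAt (x := AdE 𝕜 E (1 : G))))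
    (hasMFDerivAt_AdE (𝕜 := 𝕜) (E := E) (G := G) rfl)
  have h3 : (AdE 𝕜 E : G → E →L[𝕜] E) ∘ (fun x : G => g * x * g⁻¹) =
      Λ ∘ (AdE 𝕜 E : G → E →L[𝕜] E) := by
    funext x
    change AdE 𝕜 E (g * x * g⁻¹) = (AdE 𝕜 E g).comp ((AdE 𝕜 E x).comp (AdE 𝕜 E g⁻¹))
    rw [mul_assoc, AdE_mul, AdE_mul]
  rw [h3] at h1
  have h4 := congrArg (fun T : E →L[𝕜] (E →L[𝕜] E) => T X (Ad 𝕜 E g Y))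
    (hasMFDerivAt_unique h1 h2)
  have h5 : (⁅Ad 𝕜 E g X, Ad 𝕜 E g Y⁆ : GroupLieAlgebra 𝓘(𝕜, E) G) =
    Ad 𝕜 E g ⁅X, Ad 𝕜 E g⁻¹ (Ad 𝕜 E g Y)⁆ := h4
  rw [h5, Ad_injective_of_inv]

end OneParam

/-! ### Existence of one-parameter subgroups -/

section RealExp

variable {E : Type*} [NormedAddCommGroup E] [NormedSpace ℝ E] [FiniteDimensional ℝ E]
  [CompleteSpace E]
  {G : Type*} [Group G] [TopologicalSpace G] [ChartedSpace E G] [LieGroup 𝓘(ℝ, E) ∞ G]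

lemma isTopologicalGroup_of_chartedSpace (E : Type*) [NormedAddCommGroup E] [NormedSpace ℝ E]
    (G : Type*) [Group G] [TopologicalSpace G] [ChartedSpace E G] [LieGroup 𝓘(ℝ, E) ∞ G] :
    IsTopologicalGroup G :=
  topologicalGroup_of_lieGroup 𝓘(ℝ, E) ∞

lemma t2Space_of_chartedSpace (E : Type*) [NormedAddCommGroup E] [NormedSpace ℝ E]
    (G : Type*) [Group G] [TopologicalSpace G] [ChartedSpace E G] [LieGroup 𝓘(ℝ, E) ∞ G] :
    T2Space G := by
  have := isTopologicalGroup_of_chartedSpace E G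
  have := ChartedSpace.t1Space E G
  infer_instance

lemma contMDiff_one_mulInvariantVectorField (X : LieAlg E G) :
    ContMDiff 𝓘(ℝ, E) 𝓘(ℝ, E).tangent 1
      (fun g : G => (⟨g, mulInvariantVectorField X g⟩ : TangentBundle 𝓘(ℝ, E) G)) :=
  (contMDiff_mulInvariantVectorField X).of_le (by
    rw [minSmoothness_of_isRCLikeNormedField]; norm_num)

lemma hasMFDerivAt_mul_left (g x : G) : HasMFDerivAt 𝓘(ℝ, E) 𝓘(ℝ, E) (fun y : G => g * y) x
    (mfderiv 𝓘(ℝ, E) 𝓘(ℝ, E) (fun y : G => g * y) x) :=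
  ((contMDiff_mul_left (I := 𝓘(ℝ, E)) (n := ∞)).contMDiffAt.mdifferentiableAt
    (by simp)).hasMFDerivAt

lemma mfderiv_mul_left_mulInvariantVectorField (X : LieAlg E G) (g x : G) :
    (mfderiv 𝓘(ℝ, E) 𝓘(ℝ, E) (fun y : G => g * y) x (mulInvariantVectorField X x) : E) =
      (mulInvariantVectorField X (g * x) : E) := by
  have h1 : ∀ y : G, y = x → HasMFDerivAt 𝓘(ℝ, E) 𝓘(ℝ, E) (fun z : G => g * z) y
      (show E →L[ℝ] E from mfderiv 𝓘(ℝ, E) 𝓘(ℝ, E) (fun z : G => g * z) x) := by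
    rintro _ rfl; exact hasMFDerivAt_mul_left g _
  have h2 := HasMFDerivAt.comp (I' := 𝓘(ℝ, E)) (1 : G) (h1 _ (mul_one x)) (hasMFDerivAt_mul_left x 1)
  have h3 : (fun z : G => g * z) ∘ (fun z : G => x * z) = fun z => (g * x) * z := by
    ext z; simp [mul_assoc]
  rw [h3] at h2
  have h4 := h2.mfderiv
  exact (congrArg (fun T : E →L[ℝ] E => T X) h4).symm

lemma IsMIntegralCurveOn.mul_left {γ : ℝ → G} {X : LieAlg E G} {s : Set ℝ}
    (h : IsMIntegralCurveOn γ (mulInvariantVectorField X) s) (g : G) :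
    IsMIntegralCurveOn (fun t => g * γ t) (mulInvariantVectorField X) s := by
  intro t ht
  have h2 := HasMFDerivAt.comp_hasMFDerivWithinAt (I' := 𝓘(ℝ, E)) t
    (hasMFDerivAt_mul_left g (γ t)) (h t ht)
  refine h2.congr_mfderiv ?_
  refine ContinuousLinearMap.ext fun (r : ℝ) => ?_
  have h3 := mfderiv_mul_left_mulInvariantVectorField X g (γ t)
  refine (map_smul (show E →L[ℝ] E from mfderiv 𝓘(ℝ, E) 𝓘(ℝ, E) (fun y : G => g * y) (γ t)) r
    (mulInvariantVectorField X (γ t) : E)).trans ?_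
  exact congrArg (fun v : E => r • v) h3

lemma IsOneParam.isMIntegralCurve {γ : ℝ → G} {X : LieAlg E G} (h : IsOneParam γ X) :
    IsMIntegralCurve γ (mulInvariantVectorField X) := by
  intro t
  have h0 : HasMFDerivAt 𝓘(ℝ, ℝ) 𝓘(ℝ, ℝ) (fun s : ℝ => s - t) t (ContinuousLinearMap.id ℝ ℝ) :=
    hasMFDerivAt_iff_hasFDerivAt.2 ((hasFDerivAt_id t).sub_const t)
  have h1 : ∀ y : ℝ, y = 0 → HasMFDerivAt 𝓘(ℝ, ℝ) 𝓘(ℝ, E) γ y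
      (ContinuousLinearMap.toSpanSingleton ℝ (X : E)) := by
    rintro _ rfl
    exact h.hasMFDerivAt
  have h2 := HasMFDerivAt.comp (I' := 𝓘(ℝ, ℝ)) (f := fun s : ℝ => s - t) t (h1 (t - t) (sub_self t)) h0
  have h3 : ∀ y : G, y = 1 → HasMFDerivAt 𝓘(ℝ, E) 𝓘(ℝ, E) (fun z : G => γ t * z) y
      (show E →L[ℝ] E from mfderiv 𝓘(ℝ, E) 𝓘(ℝ, E) (fun z : G => γ t * z) 1) := by
    rintro _ rfl; exact hasMFDerivAt_mul_left _ _
  have h4 := HasMFDerivAt.comp (I' := 𝓘(ℝ, E)) t (h3 (γ (t - t)) (by rw [sub_self, h.map_zero])) h2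
  have h5 : (fun z : G => γ t * z) ∘ γ ∘ (fun s : ℝ => s - t) = γ := by
    ext s; simp only [Function.comp]; rw [← h.map_add]; congr 1; ring
  rw [h5] at h4
  refine h4.congr_mfderiv ?_
  refine ContinuousLinearMap.ext fun (r : ℝ) => ?_
  exact map_smul (show E →L[ℝ] E from mfderiv 𝓘(ℝ, E) 𝓘(ℝ, E) (fun z : G => γ t * z) 1) r (X : E)

lemma isOneParam_of_isMIntegralCurve {γ : ℝ → G} {X : LieAlg E G}
    (h : IsMIntegralCurve γ (mulInvariantVectorField X)) (h0 : γ 0 = 1) : IsOneParam γ X where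
  map_add s t := by
    have := t2Space_of_chartedSpace E G
    have hM : IsManifold 𝓘(ℝ, E) 1 G := IsManifold.of_le (n := ∞) (by simp)
    have h1 : IsMIntegralCurve (γ ∘ (· + s)) (mulInvariantVectorField X) := h.comp_add s
    have h2 : IsMIntegralCurve (fun t => γ s * γ t) (mulInvariantVectorField X) :=
      isMIntegralCurve_iff_isMIntegralCurveOn.2
        (IsMIntegralCurveOn.mul_left (isMIntegralCurve_iff_isMIntegralCurveOn.1 h) (γ s))
    have h3 := isMIntegralCurve_Ioo_eq_of_contMDiff_boundaryless (t₀ := 0)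
      (contMDiff_one_mulInvariantVectorField X) h1 h2 (by simp [h0])
    have h4 := congrFun h3 t
    simpa [add_comm] using h4
  hasMFDerivAt := by
    have h1 := h 0
    refine h1.congr_mfderiv ?_
    have h2 : ∀ y : G, y = 1 → (mulInvariantVectorField X y : E) = (X : E) := by
      rintro _ rfl
      have h3 : (fun y : G => (1 : G) * y) = id := by ext y; simp
      have h4 : (mfderiv 𝓘(ℝ, E) 𝓘(ℝ, E) (fun y : G => (1 : G) * y) 1 : E →L[ℝ] E) =
          ContinuousLinearMap.id ℝ E := by
        rw [h3]; exact mfderiv_id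
      exact congrArg (fun T : E →L[ℝ] E => T X) h4
    refine ContinuousLinearMap.ext fun (r : ℝ) => ?_
    exact congrArg (fun v : E => r • v) (h2 _ h0)

/-- Integral curves of left-invariant fields are complete, since translates of a local integral curve
at `1` are integral curves. -/
lemma exists_isOneParam (X : LieAlg E G) : ∃ γ : ℝ → G, IsOneParam γ X := by
  have := t2Space_of_chartedSpace E G
  have hM : IsManifold 𝓘(ℝ, E) 1 G := IsManifold.of_le (n := ∞) (by simp)
  obtain ⟨γ, hγ0, hγ⟩ := exists_isMIntegralCurveAt_of_contMDiffAt_boundaryless (t₀ := 0)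
    (contMDiff_one_mulInvariantVectorField X).contMDiffAt (x₀ := (1 : G))
  obtain ⟨ε, hε, hγε⟩ := isMIntegralCurveAt_iff'.1 hγ
  rw [Real.ball_eq_Ioo, zero_sub, zero_add] at hγε
  obtain ⟨δ, hδ0, hδ⟩ := exists_isMIntegralCurve_of_isMIntegralCurveOn
    (contMDiff_one_mulInvariantVectorField X) hε
    (fun x => ⟨fun t => x * γ t, by simp [hγ0], IsMIntegralCurveOn.mul_left hγε x⟩) (1 : G)
  exact ⟨δ, isOneParam_of_isMIntegralCurve hδ hδ0⟩

lemma IsOneParam.unique {γ γ' : ℝ → G} {X : LieAlg E G} (h : IsOneParam γ X)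
    (h' : IsOneParam γ' X) : γ = γ' := by
  have := t2Space_of_chartedSpace E G
  have hM : IsManifold 𝓘(ℝ, E) 1 G := IsManifold.of_le (n := ∞) (by simp)
  exact isMIntegralCurve_Ioo_eq_of_contMDiff_boundaryless (t₀ := 0)
    (contMDiff_one_mulInvariantVectorField X) h.isMIntegralCurve h'.isMIntegralCurve
    (by rw [h.map_zero, h'.map_zero])

/-- The exponential map of `G`: the value at `1` of the one-parameter subgroup generated by `X`. -/
noncomputable def expG (X : LieAlg E G) : G := Classical.choose (exists_isOneParam X) 1

end RealExp

/-! ### Exponential map and logarithm through the adjoint representation -/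

section ExpProperties

variable {E : Type*} [NormedAddCommGroup E] [NormedSpace ℝ E] [FiniteDimensional ℝ E]
  [CompleteSpace E]
  {G : Type*} [Group G] [TopologicalSpace G] [ChartedSpace E G] [LieGroup 𝓘(ℝ, E) ∞ G]

lemma IsOneParam.eq_expG {γ : ℝ → G} {X : LieAlg E G} (h : IsOneParam γ X) (t : ℝ) :
    γ t = expG (E := E) (t • X) := by
  have h1 := h.comp_mul t
  have h2 := h1.unique (Classical.choose_spec (exists_isOneParam (t • X)))
  have h3 := congrFun h2 1
  simpa [expG] using h3

lemma isOneParam_expG (X : LieAlg E G) : IsOneParam (fun t : ℝ => expG (t • X)) X := by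
  obtain ⟨γ, hγ⟩ := exists_isOneParam X
  have : γ = fun t : ℝ => expG (t • X) := funext hγ.eq_expG
  rwa [← this]

lemma expG_zero : expG (0 : LieAlg E G) = 1 := by
  simpa using (isOneParam_expG (0 : LieAlg E G)).map_zero

lemma expG_add_smul (s t : ℝ) (X : LieAlg E G) :
    expG ((s + t) • X) = expG (s • X) * expG (t • X) := (isOneParam_expG X).map_add s t

lemma expG_neg (X : LieAlg E G) : expG (-X) = (expG X)⁻¹ := by
  have h := expG_add_smul 1 (-1) X
  simp only [add_neg_cancel, zero_smul, expG_zero, one_smul, neg_smul] at h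
  exact (inv_eq_of_mul_eq_one_right h.symm).symm

lemma expG_nsmul (n : ℕ) (X : LieAlg E G) : expG ((n : ℝ) • X) = expG X ^ n := by
  induction n with
  | zero => simp [expG_zero]
  | succ n ih => rw [Nat.cast_succ, expG_add_smul, ih, one_smul, pow_succ]

lemma Ad_expG (X : LieAlg E G) : Ad ℝ E (expG X) = exp (adL ℝ E G X) := by
  simpa using (isOneParam_expG X).Ad_eq_exp 1

lemma Ad_expG_smul (t : ℝ) (X : LieAlg E G) :
    Ad ℝ E (expG (t • X)) = exp (t • adL ℝ E G X) := (isOneParam_expG X).Ad_eq_exp t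

lemma conj_expG (g : G) (X : LieAlg E G) : g * expG X * g⁻¹ = expG (Ad ℝ E g X) := by
  simpa using ((isOneParam_expG X).conj g).eq_expG 1

lemma continuous_expG_smul (X : LieAlg E G) : Continuous fun t : ℝ => expG (t • X) :=
  (isOneParam_expG X).isMIntegralCurve.continuous

/-- The Lie algebra of a subgroup, in terms of the exponential map. -/
lemma mem_lieOf_iff {S : Subgroup G} {X : LieAlg E G} :
    X ∈ lieOf (𝕜 := ℝ) (E := E) S ↔ ∀ t : ℝ, expG (t • X) ∈ S := by
  constructor
  · rintro ⟨γ, hγ, hS⟩ t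
    rw [← hγ.eq_expG]; exact hS t
  · exact fun h => ⟨_, isOneParam_expG X, h⟩

lemma analyticSubgroup_eq (V : Set (LieAlg E G)) :
    analyticSubgroup (𝕜 := ℝ) V = Subgroup.closure (expG '' V) := by
  unfold analyticSubgroup
  congr 1
  ext g
  constructor
  · rintro ⟨X, hX, γ, hγ, rfl⟩
    exact ⟨X, hX, by simpa using (hγ.eq_expG 1).symm⟩
  · rintro ⟨X, hX, rfl⟩
    exact ⟨X, hX, _, isOneParam_expG X, by simp⟩

lemma expG_mem_analyticSubgroup {V : Set (LieAlg E G)} {X : LieAlg E G} (hX : X ∈ V) :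
    expG X ∈ analyticSubgroup (𝕜 := ℝ) V := by
  rw [analyticSubgroup_eq]
  exact Subgroup.subset_closure ⟨X, hX, rfl⟩

lemma continuous_Ad : Continuous (Ad ℝ E : G → LieAlg E G →L[ℝ] LieAlg E G) :=
  (contMDiff_AdE (𝕜 := ℝ) (E := E) (G := G)).continuous

lemma Ad_mul' (g h : G) : Ad ℝ E (g * h) = Ad ℝ E g * Ad ℝ E h := Ad_mul g h

lemma Ad_one' : Ad ℝ E (1 : G) = 1 := Ad_one

section Killing

variable [LieAlgebra.IsKilling ℝ (LieAlg E G)]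

/-- A Lie algebra with nondegenerate Killing form has trivial center. -/
lemma adL_injective : Function.Injective (adL ℝ E G) := by
  rw [injective_iff_map_eq_zero]
  intro X hX
  have : X ∈ LieAlgebra.center ℝ (LieAlg E G) := by
    rw [LieModule.mem_maxTrivSubmodule]
    intro Y
    have h := congrArg (fun T : LieAlg E G →L[ℝ] LieAlg E G => T Y) hX
    simp only [adL_apply] at h
    rw [← lie_skew, h]
    simp
  rw [LieAlgebra.center_eq_bot] at this
  simpa using this

variable (E G) in
/-- The adjoint representation has a left inverse, being injective. -/
lemma exists_adInv : ∃ L : (LieAlg E G →L[ℝ] LieAlg E G) →L[ℝ] LieAlg E G,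
    ∀ X, L (adL ℝ E G X) = X := by
  obtain ⟨L, hL⟩ := LinearMap.exists_leftInverse_of_injective
    (adL ℝ E G : LieAlg E G →ₗ[ℝ] (LieAlg E G →L[ℝ] LieAlg E G))
    (LinearMap.ker_eq_bot.2 adL_injective)
  exact ⟨LinearMap.toContinuousLinearMap L, fun X => congrArg (fun T => T X) hL⟩

variable (E G) in
/-- A left inverse of the adjoint representation of the Lie algebra. -/
noncomputable def adInv : (LieAlg E G →L[ℝ] LieAlg E G) →L[ℝ] LieAlg E G :=
  Classical.choose (exists_adInv E G)

@[simp] lemma adInv_adL (X : LieAlg E G) : adInv E G (adL ℝ E G X) = X :=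
  Classical.choose_spec (exists_adInv E G) X

variable (E) in
/-- The logarithm of `G` near `1`. -/
noncomputable def logG (g : G) : LieAlg E G := adInv E G (logA (Ad ℝ E g))

lemma logG_one : logG E (1 : G) = 0 := by
  rw [logG, Ad_one', logA_one, map_zero]

lemma tendsto_Ad_one : Tendsto (Ad ℝ E : G → LieAlg E G →L[ℝ] LieAlg E G) (𝓝 1) (𝓝 1) := by
  have := (continuous_Ad (E := E) (G := G)).tendsto 1
  rwa [Ad_one'] at this

lemma tendsto_logG : Tendsto (logG E : G → LieAlg E G) (𝓝 1) (𝓝 0) := by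
  have h := ((adInv E G).continuous.tendsto 0).comp (tendsto_logA.comp (tendsto_Ad_one (E := E)))
  rwa [map_zero] at h

/-- A derivation of a Lie algebra with nondegenerate Killing form is inner. -/
lemma exists_eq_adL {D : LieAlg E G →L[ℝ] LieAlg E G}
    (hD : ∀ X Y, D ⁅X, Y⁆ = ⁅D X, Y⁆ + ⁅X, D Y⁆) : ∃ Z, D = adL ℝ E G Z := by
  let D' : LieDerivation ℝ (LieAlg E G) (LieAlg E G) :=
    { toLinearMap := D
      leibniz' := fun X Y => by
        have := hD X Y
        simp only [ContinuousLinearMap.coe_coe]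
        rw [this, add_comm, ← lie_skew Y (D X), sub_eq_add_neg, neg_neg] }
  obtain ⟨Z, hZ⟩ := LieDerivation.IsKilling.exists_eq_ad D'
  refine ⟨Z, ContinuousLinearMap.ext fun X => ?_⟩
  rw [adL_apply, ← LieDerivation.ad_apply_apply (R := ℝ)]
  exact (congrArg (fun T : LieDerivation ℝ (LieAlg E G) (LieAlg E G) => T X) hZ).symm

/-- A small logarithm of an automorphism of the Lie algebra is inner. -/
lemma exists_adL_of_exp : ∃ ρ > 0, ∀ D : LieAlg E G →L[ℝ] LieAlg E G, ‖D‖ ≤ ρ →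
    (∀ X Y, exp D ⁅X, Y⁆ = ⁅exp D X, exp D Y⁆) → adL ℝ E G (adInv E G D) = D := by
  obtain ⟨ρ, hρ, h⟩ := exists_derivation_of_exp (LieAlg E G)
  refine ⟨ρ, hρ, fun D hD hD' => ?_⟩
  obtain ⟨Z, hZ⟩ := exists_eq_adL (h D (adL ℝ E G) hD hD')
  rw [hZ, adInv_adL]

lemma eventually_adL_logG : ∀ᶠ g in 𝓝 (1 : G), adL ℝ E G (logG E g) = logA (Ad ℝ E g) ∧
    exp (adL ℝ E G (logG E g)) = Ad ℝ E g := by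
  obtain ⟨ρ, hρ, h⟩ := exists_adL_of_exp (E := E) (G := G)
  have h1 := tendsto_logA.comp (tendsto_Ad_one (E := E) (G := G))
  filter_upwards [h1.eventually (Metric.closedBall_mem_nhds 0 hρ),
    (tendsto_Ad_one (E := E) (G := G)).eventually eventually_exp_logA] with g hg hg'
  have h2 : adL ℝ E G (logG E g) = logA (Ad ℝ E g) := by
    refine h _ (by simpa using hg) fun X Y => ?_
    rw [hg']
    exact Ad_lie g X Y
  exact ⟨h2, by rw [h2, hg']⟩

/-- The derivative at `1` of the logarithm along a curve whose image under `Ad` is differentiable. The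
curve itself need not be known to be differentiable. -/
lemma hasDerivAt_logG {c : ℝ → G} {W : LieAlg E G} (h0 : c 0 = 1)
    (h : HasDerivAt (fun t => Ad ℝ E (c t)) (adL ℝ E G W) 0) :
    HasDerivAt (fun t => logG E (c t)) W 0 := by
  have h1 : HasFDerivAt (logA : (LieAlg E G →L[ℝ] LieAlg E G) → _)
      (ContinuousLinearMap.id ℝ (LieAlg E G →L[ℝ] LieAlg E G)) (Ad ℝ E (c 0)) := by
    rw [h0, Ad_one']; exact hasStrictFDerivAt_logA.hasFDerivAt
  have h2 := (adInv E G).hasFDerivAt.comp_hasDerivAt 0 (h1.comp_hasDerivAt 0 h)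
  have h3 : adInv E G ((ContinuousLinearMap.id ℝ _) (adL ℝ E G W)) = W := adInv_adL W
  rw [h3] at h2
  exact h2

variable (E G) in
/-- Near `1`, `adInv ∘ Ad` is a local coordinate system of `G`. -/
lemma exists_Ad_chart : ∃ Ψ : OpenPartialHomeomorph G (LieAlg E G), (1 : G) ∈ Ψ.source ∧
    ∀ g, Ψ g = adInv E G (Ad ℝ E g) := by
  let e := extChartAt 𝓘(ℝ, E) (1 : G)
  let ai : (E →L[ℝ] E) →L[ℝ] E := adInv E G
  let f : E → E := fun u => ai (AdE ℝ E (e.symm u))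
  -- the derivative of `adInv ∘ Ad` at `1` is `adInv ∘ ad = id`
  have hf : HasStrictFDerivAt f ((ContinuousLinearEquiv.refl ℝ E : E ≃L[ℝ] E) : E →L[ℝ] E)
      (e 1) := by
    have h1 := (contDiffAt_AdE_chart (𝕜 := ℝ) (E := E) (G := G)).hasStrictFDerivAt (by simp)
    have h2 := ai.hasStrictFDerivAt.comp (e 1) h1
    convert h2 using 1
    refine ContinuousLinearMap.ext fun X => ?_
    have h3 : fderiv ℝ (fun u => AdE ℝ E ((extChartAt 𝓘(ℝ, E) (1 : G)).symm u))
      (extChartAt 𝓘(ℝ, E) (1 : G) 1) X = (adL ℝ E G X : E →L[ℝ] E) :=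
      ContinuousLinearMap.ext fun Y => fderiv_AdE_chart (𝕜 := ℝ) (E := E) (G := G) X Y
    have h4 := adInv_adL (E := E) (G := G) X
    exact (h4.symm.trans (congrArg ai h3.symm))
  let Φ := hf.toOpenPartialHomeomorph f
  have hΦ : (Φ : E → E) = f := hf.toOpenPartialHomeomorph_coe
  let Ψ₀ : OpenPartialHomeomorph G E := (chartAt E (1 : G)).trans Φ
  have hs : (1 : G) ∈ Ψ₀.source := by
    rw [OpenPartialHomeomorph.trans_source]
    exact ⟨mem_chart_source E 1, hf.mem_toOpenPartialHomeomorph_source⟩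
  -- `Ψ₀` with the function replaced by `adInv ∘ Ad`, with which it agrees on its source
  let Ψ₁ : OpenPartialHomeomorph G E :=
    { toPartialEquiv :=
        { toFun := fun g => ai (AdE ℝ E g)
          invFun := Ψ₀.symm
          source := Ψ₀.source
          target := Ψ₀.target
          map_source' := ?_
          map_target' := fun x hx => Ψ₀.map_target hx
          left_inv' := ?_
          right_inv' := ?_ }
      open_source := Ψ₀.open_source
      open_target := Ψ₀.open_target
      continuousOn_toFun := ?_
      continuousOn_invFun := Ψ₀.continuousOn_invFun }
  · exact ⟨Ψ₁, hs, fun g => rfl⟩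
  all_goals
    have hE : ∀ g ∈ Ψ₀.source, ai (AdE ℝ E g) = Ψ₀ g := by
      intro g hg
      rw [OpenPartialHomeomorph.trans_source] at hg
      change _ = Φ (chartAt E (1 : G) g)
      rw [hΦ]
      change _ = ai (AdE ℝ E ((chartAt E (1 : G)).symm (chartAt E (1 : G) g)))
      rw [(chartAt E (1 : G)).left_inv hg.1]
  · intro g hg; rw [hE g hg]; exact Ψ₀.map_source hg
  · intro g hg; rw [hE g hg]; exact Ψ₀.left_inv hg
  · intro x hx; rw [hE _ (Ψ₀.map_target hx)]; exact Ψ₀.right_inv hx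
  · exact Ψ₀.continuousOn.congr hE

/-- A path starting at `1` along which `Ad` stays close to `1` stays close to `1`. -/
lemma exists_path_mem {V : Set G} (hV : V ∈ 𝓝 (1 : G)) : ∃ δ > 0, ∀ c : ℝ → G, Continuous c →
    c 0 = 1 → (∀ t ∈ Set.Icc (0 : ℝ) 1, ‖Ad ℝ E (c t) - 1‖ < δ) → c 1 ∈ V := by
  have := t2Space_of_chartedSpace E G
  obtain ⟨Ψ, h1, hΨ⟩ := exists_Ad_chart E G
  have hT : Ψ.target ∩ Ψ.symm ⁻¹' V ∈ 𝓝 (Ψ 1) := by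
    refine inter_mem (Ψ.open_target.mem_nhds (Ψ.map_source h1)) ?_
    refine (Ψ.continuousAt_symm (Ψ.map_source h1)).preimage_mem_nhds ?_
    rwa [Ψ.left_inv h1]
  obtain ⟨r, hr, hrT⟩ := Metric.nhds_basis_closedBall.mem_iff.1 hT
  have hC : IsCompact (Ψ.symm '' Metric.closedBall (Ψ 1) r) :=
    (isCompact_closedBall _ _).image_of_continuousOn
      (Ψ.continuousOn_symm.mono fun x hx => (hrT hx).1)
  have hcont : ContinuousAt (fun A : LieAlg E G →L[ℝ] LieAlg E G => adInv E G A) 1 :=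
    (adInv E G).continuous.continuousAt
  obtain ⟨δ, hδ, hδ'⟩ := Metric.continuousAt_iff.1 hcont r hr
  refine ⟨δ, hδ, fun c hc hc0 hcδ => ?_⟩
  let c' : Set.Icc (0 : ℝ) 1 → G := fun t => c t
  have hc' : Continuous c' := hc.comp continuous_subtype_val
  -- as `Ad (c t)` is close to `1`, `c t` is in the source of the chart only if it is in a fixed compact
  -- subset of it, so that the set of these `t` is open and closed in `[0, 1]`
  have hiff : ∀ t, c' t ∈ Ψ.symm '' Metric.closedBall (Ψ 1) r ↔ c' t ∈ Ψ.source := by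
    intro t
    constructor
    · rintro ⟨x, hx, hxt⟩
      rw [← hxt]; exact Ψ.map_target (hrT hx).1
    · intro ht
      refine ⟨Ψ (c' t), ?_, Ψ.left_inv ht⟩
      have h2 := hδ' (x := Ad ℝ E (c' t)) (by rw [dist_eq_norm]; exact hcδ t t.2)
      rw [hΨ, hΨ, Ad_one']
      exact h2.le
  have hclopen : IsClopen {t | c' t ∈ Ψ.source} :=
    ⟨by simp only [← hiff]; exact hC.isClosed.preimage hc', Ψ.open_source.preimage hc'⟩
  have huniv := hclopen.eq_univ ⟨⟨0, by simp⟩, by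
    change c 0 ∈ Ψ.source; rw [hc0]; exact h1⟩
  have h3 : (⟨1, by simp⟩ : Set.Icc (0 : ℝ) 1) ∈ {t | c' t ∈ Ψ.source} := by
    rw [huniv]; trivial
  obtain ⟨x, hx, hxt⟩ := (hiff _).2 h3
  have : c 1 = Ψ.symm x := hxt.symm
  rw [this]
  exact (hrT hx).2

/-- Continuity of the exponential map, deduced from that of `Ad ∘ exp` through `exists_path_mem`. -/
lemma continuous_expG : Continuous (expG : LieAlg E G → G) := by
  have := isTopologicalGroup_of_chartedSpace E G
  rw [continuous_iff_continuousAt]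
  intro W
  have key : Tendsto (fun W' => (expG W)⁻¹ * expG W') (𝓝 W) (𝓝 (1 : G)) := by
    intro V hV
    obtain ⟨δ, hδ, h⟩ := exists_path_mem (E := E) hV
    -- `Ad (exp (-t W) exp (t W')) = exp (-t ad W) exp (t ad W')` is uniformly close to `1`
    have hcomp : ∀ᶠ W' in 𝓝 W, ∀ t ∈ Set.Icc (0 : ℝ) 1,
        ‖exp (-(t • adL ℝ E G W)) * exp (t • adL ℝ E G W') - 1‖ < δ := by
      refine isCompact_Icc.eventually_forall_of_forall_eventually fun t _ => ?_
      have hc : Continuous fun p : LieAlg E G × ℝ =>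
          ‖exp (-(p.2 • adL ℝ E G W)) * exp (p.2 • adL ℝ E G p.1) - 1‖ := by
        let _ : NormedAlgebra ℚ (LieAlg E G →L[ℝ] LieAlg E G) :=
          NormedAlgebra.restrictScalars ℚ ℝ _
        have := NormedSpace.exp_continuous (𝔸 := LieAlg E G →L[ℝ] LieAlg E G)
        fun_prop
      refine hc.continuousAt.eventually (gt_mem_nhds ?_)
      have h2 := exp_smul_mul_exp_neg_smul (-(adL ℝ E G W)) t
      simp only [smul_neg, neg_neg] at h2
      simp only [h2, sub_self, norm_zero]
      exact hδ
    rw [mem_map]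
    filter_upwards [hcomp] with W' hW'
    have h3 := h (fun t => (expG (t • W))⁻¹ * expG (t • W'))
      ((continuous_expG_smul W).inv.mul (continuous_expG_smul W')) (by simp [expG_zero])
      (fun t ht => by
        rw [← expG_neg, Ad_mul', Ad_expG, Ad_expG, map_neg, map_smul, map_smul]
        exact hW' t ht)
    simpa using h3
  have h4 := (tendsto_const_nhds (x := expG W)).mul key
  simpa [ContinuousAt] using h4

lemma tendsto_expG : Tendsto (expG : LieAlg E G → G) (𝓝 0) (𝓝 1) := by
  have := (continuous_expG (E := E) (G := G)).tendsto 0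
  rwa [expG_zero] at this

/-- The logarithm is a local inverse of the exponential map: both sides have the same image under `Ad`,
which is injective near `1`. -/
lemma eventually_expG_logG : ∀ᶠ g in 𝓝 (1 : G), expG (logG E g) = g := by
  obtain ⟨Ψ, h1, hΨ⟩ := exists_Ad_chart E G
  have h2 := Ψ.open_source.mem_nhds h1
  filter_upwards [h2, (tendsto_expG.comp (tendsto_logG (E := E) (G := G))).eventually h2,
    eventually_adL_logG (E := E) (G := G)] with g hg hg' hg''
  refine Ψ.injOn hg' hg ?_
  rw [hΨ, hΨ, Function.comp, Ad_expG, hg''.2]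

/-- In a connected group, the kernel of `Ad` is the center. -/
lemma Ad_eq_one_iff [ConnectedSpace G] (g : G) : Ad ℝ E g = 1 ↔ g ∈ Subgroup.center G := by
  have := isTopologicalGroup_of_chartedSpace E G
  constructor
  · intro hg
    have hX : ∀ X : LieAlg E G, expG X ∈ Subgroup.centralizer {g} := by
      intro X
      rw [Subgroup.mem_centralizer_singleton_iff]
      have h := conj_expG g X
      rw [hg] at h
      have h2 : g * expG X * g⁻¹ = expG X := h
      rw [mul_inv_eq_iff_eq_mul] at h2
      exact h2.symm
    have hopen : IsOpen (Subgroup.centralizer {g} : Set G) := by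
      refine Subgroup.isOpen_of_mem_nhds _ (g := 1) ?_
      filter_upwards [eventually_expG_logG (E := E) (G := G)] with x hx
      rw [← hx]; exact hX _
    have htop : (Subgroup.centralizer {g} : Set G) = Set.univ :=
      IsClopen.eq_univ ⟨Subgroup.isClosed_of_isOpen _ hopen, hopen⟩ ⟨1, one_mem _⟩
    rw [Subgroup.mem_center_iff]
    intro x
    have : x ∈ (Subgroup.centralizer {g} : Set G) := by rw [htop]; trivial
    exact Subgroup.mem_centralizer_singleton_iff.1 this
  · intro hg
    rw [Subgroup.mem_center_iff] at hg
    have h1 : (fun x : G => g * x * g⁻¹) = fun x => 1 * x * (1 : G)⁻¹ := by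
      ext x; rw [← hg x]; simp
    have : Ad ℝ E g = Ad ℝ E (1 : G) := by
      unfold Ad
      rw [h1]
    rw [this, Ad_one']

/-- The Lie algebra of a closed subgroup is stable under addition. -/
lemma add_mem_lieOf {S : Subgroup G} (hS : IsClosed (S : Set G)) {X Y : LieAlg E G}
    (hX : X ∈ lieOf (𝕜 := ℝ) (E := E) S) (hY : Y ∈ lieOf (𝕜 := ℝ) (E := E) S) :
    X + Y ∈ lieOf (𝕜 := ℝ) (E := E) S := by
  have := isTopologicalGroup_of_chartedSpace E G
  rw [mem_lieOf_iff] at *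
  intro s
  let c : ℝ → G := fun t => expG (t • (s • X)) * expG (t • (s • Y))
  have hc0 : c 0 = 1 := by simp [c, expG_zero]
  have hcS : ∀ t, c t ∈ S := fun t => by
    simp only [c, smul_smul]; exact S.mul_mem (hX _) (hY _)
  have hcc : Continuous c := (continuous_expG_smul _).mul (continuous_expG_smul _)
  have hd : HasDerivAt (fun t => Ad ℝ E (c t)) (adL ℝ E G (s • X + s • Y)) 0 := by
    have h1 := (isOneParam_expG (s • X)).hasDerivAt_Ad_zero.mul
      (isOneParam_expG (s • Y)).hasDerivAt_Ad_zero
    simp only [zero_smul, expG_zero, Ad_one', mul_one, one_mul] at h1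
    rw [map_add]
    refine h1.congr_of_eventuallyEq (Eventually.of_forall fun t => ?_)
    exact Ad_mul' _ _
  have hZ := hasDerivAt_logG hc0 hd
  have h2 : Tendsto (fun n : ℕ => ((n : ℝ)⁻¹)) atTop (𝓝[≠] 0) := by
    refine tendsto_nhdsWithin_iff.2 ⟨tendsto_inv_atTop_zero.comp tendsto_natCast_atTop_atTop, ?_⟩
    filter_upwards [eventually_gt_atTop 0] with n hn
    have : (n : ℝ) ≠ 0 := by positivity
    simpa using this
  -- `exp (s (X + Y))` is the limit of `(exp (s X / n) exp (s Y / n)) ^ n`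
  have h3 : Tendsto (fun n : ℕ => (n : ℝ) • logG E (c (n : ℝ)⁻¹)) atTop
      (𝓝 (s • X + s • Y)) := by
    have h4 := hZ.tendsto_slope_zero.comp h2
    refine h4.congr fun n => ?_
    simp [hc0, logG_one]
  have h5 := ((continuous_expG (E := E) (G := G)).tendsto _).comp h3
  rw [smul_add]
  refine hS.mem_of_tendsto h5 ?_
  have h6 : Tendsto (fun n : ℕ => c (n : ℝ)⁻¹) atTop (𝓝 1) := by
    have h7 := (hcc.tendsto 0).comp (h2.mono_right nhdsWithin_le_nhds)
    rwa [hc0] at h7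
  filter_upwards [h6.eventually (eventually_expG_logG (E := E) (G := G))] with n hn
  simp only [Function.comp]
  rw [expG_nsmul, hn]
  exact S.pow_mem (hcS _) n

variable (E) in
/-- The Lie algebra of a closed subgroup, as a subspace. -/
noncomputable def lieSubmodule (S : Subgroup G) (hS : IsClosed (S : Set G)) :
    Submodule ℝ (LieAlg E G) where
  carrier := lieOf (𝕜 := ℝ) (E := E) S
  zero_mem' := mem_lieOf_iff.2 fun t => by rw [smul_zero, expG_zero]; exact S.one_mem
  add_mem' := add_mem_lieOf hS
  smul_mem' := fun r X hX => by
    rw [mem_lieOf_iff] at *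
    intro t
    rw [smul_smul]; exact hX _

end Killing
end ExpProperties

/-! ### Real and imaginary parts in a complexification -/

section Complexification

variable {g : Type*} [AddCommGroup g] [Module ℝ g]

/-- The real part of an element of `ℂ ⊗ g`. -/
noncomputable def reC : ℂ ⊗[ℝ] g →ₗ[ℝ] g :=
  (TensorProduct.lid ℝ g).toLinearMap ∘ₗ LinearMap.rTensor g Complex.reLm

/-- The imaginary part of an element of `ℂ ⊗ g`. -/
noncomputable def imC : ℂ ⊗[ℝ] g →ₗ[ℝ] g :=
  (TensorProduct.lid ℝ g).toLinearMap ∘ₗ LinearMap.rTensor g Complex.imLm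

@[simp] lemma reC_tmul (z : ℂ) (X : g) : reC (z ⊗ₜ[ℝ] X) = z.re • X := by simp [reC]

@[simp] lemma imC_tmul (z : ℂ) (X : g) : imC (z ⊗ₜ[ℝ] X) = z.im • X := by simp [imC]

lemma eq_re_add_im (Z : ℂ ⊗[ℝ] g) :
    Z = (1 : ℂ) ⊗ₜ[ℝ] reC Z + Complex.I • ((1 : ℂ) ⊗ₜ[ℝ] imC Z) := by
  induction Z using TensorProduct.induction_on with
  | zero => simp
  | tmul z X =>
    rw [reC_tmul, imC_tmul, TensorProduct.tmul_smul, TensorProduct.tmul_smul,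
      TensorProduct.smul_tmul', TensorProduct.smul_tmul', TensorProduct.smul_tmul',
      ← TensorProduct.add_tmul]
    congr 1
    apply Complex.ext <;> simp
  | add Z W hZ hW =>
    rw [map_add, map_add, TensorProduct.tmul_add, TensorProduct.tmul_add, smul_add]
    nth_rewrite 1 [hZ, hW]
    abel

lemma reC_smul (z : ℂ) (Z : ℂ ⊗[ℝ] g) : reC (z • Z) = z.re • reC Z - z.im • imC Z := by
  induction Z using TensorProduct.induction_on with
  | zero => simp
  | tmul w X => simp [TensorProduct.smul_tmul', sub_smul, mul_smul]
  | add Z W hZ hW => rw [smul_add, map_add, hZ, hW, map_add, map_add, smul_add, smul_add]; abel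

lemma imC_smul (z : ℂ) (Z : ℂ ⊗[ℝ] g) : imC (z • Z) = z.re • imC Z + z.im • reC Z := by
  induction Z using TensorProduct.induction_on with
  | zero => simp
  | tmul w X => simp [TensorProduct.smul_tmul', add_smul, mul_smul]
  | add Z W hZ hW => rw [smul_add, map_add, hZ, hW, map_add, map_add, smul_add, smul_add]; abel

lemma ext_re_im {Z W : ℂ ⊗[ℝ] g} (h1 : reC Z = reC W) (h2 : imC Z = imC W) : Z = W := by
  rw [eq_re_add_im Z, eq_re_add_im W, h1, h2]

lemma mem_baseChange_iff_re_im (S : Submodule ℝ g) (Z : ℂ ⊗[ℝ] g) :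
    Z ∈ S.baseChange ℂ ↔ reC Z ∈ S ∧ imC Z ∈ S := by
  constructor
  · intro hZ
    rw [Submodule.baseChange_eq_span] at hZ
    induction hZ using Submodule.span_induction with
    | mem x hx =>
      obtain ⟨X, hX, rfl⟩ := hx
      simpa using hX
    | zero => simp
    | add x y _ _ hx hy => simp only [map_add]; exact ⟨S.add_mem hx.1 hy.1, S.add_mem hx.2 hy.2⟩
    | smul r x _ hx =>
      rw [reC_smul, imC_smul]
      exact ⟨S.sub_mem (S.smul_mem _ hx.1) (S.smul_mem _ hx.2),
        S.add_mem (S.smul_mem _ hx.2) (S.smul_mem _ hx.1)⟩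
  · rintro ⟨h1, h2⟩
    rw [eq_re_add_im Z]
    exact Submodule.add_mem _ (Submodule.tmul_mem_baseChange_of_mem _ h1)
      (Submodule.smul_mem _ _ (Submodule.tmul_mem_baseChange_of_mem _ h2))

end Complexification

/-! ### Roots with respect to a real Cartan subalgebra -/

section RootsInterface

variable {g : Type*} [LieRing g] [LieAlgebra ℝ g]

lemma lie_one_tmul (X : g) (Z : ℂ ⊗[ℝ] g) : ⁅(1 : ℂ) ⊗ₜ[ℝ] X, Z⁆ =
    (1 : ℂ) ⊗ₜ[ℝ] ⁅X, reC Z⁆ + Complex.I • ((1 : ℂ) ⊗ₜ[ℝ] ⁅X, imC Z⁆) := by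
  conv_lhs => rw [eq_re_add_im Z]
  rw [lie_add, lie_smul]
  simp

lemma reC_lie (X : g) (Z : ℂ ⊗[ℝ] g) : reC ⁅(1 : ℂ) ⊗ₜ[ℝ] X, Z⁆ = ⁅X, reC Z⁆ := by
  rw [lie_one_tmul]; simp [reC_smul]

lemma imC_lie (X : g) (Z : ℂ ⊗[ℝ] g) : imC ⁅(1 : ℂ) ⊗ₜ[ℝ] X, Z⁆ = ⁅X, imC Z⁆ := by
  rw [lie_one_tmul]; simp [imC_smul]

lemma mem_rootSpaceJ {j : LieSubalgebra ℝ g} {α : j →ₗ[ℝ] ℂ} {Z : ℂ ⊗[ℝ] g} :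
    Z ∈ rootSpaceJ j α ↔ ∀ X : j, ⁅(1 : ℂ) ⊗ₜ[ℝ] (X : g), Z⁆ = α X • Z := Iff.rfl

/-- The complexification of a Lie subalgebra. -/
noncomputable def subalgC (j : LieSubalgebra ℝ g) : LieSubalgebra ℂ (ℂ ⊗[ℝ] g) where
  toSubmodule := j.toSubmodule.baseChange ℂ
  lie_mem' := by
    intro Z W hZ hW
    have hZ : Z ∈ j.toSubmodule.baseChange ℂ := hZ
    have hW : W ∈ j.toSubmodule.baseChange ℂ := hW
    change ⁅Z, W⁆ ∈ j.toSubmodule.baseChange ℂ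
    have key : ∀ X ∈ j, ⁅(1 : ℂ) ⊗ₜ[ℝ] X, W⁆ ∈ j.toSubmodule.baseChange ℂ := by
      intro X hX
      rw [mem_baseChange_iff_re_im] at hW ⊢
      rw [reC_lie, imC_lie]
      exact ⟨j.lie_mem hX hW.1, j.lie_mem hX hW.2⟩
    rw [mem_baseChange_iff_re_im] at hZ
    rw [eq_re_add_im Z, add_lie, smul_lie]
    exact Submodule.add_mem _ (key _ hZ.1) (Submodule.smul_mem _ _ (key _ hZ.2))

lemma mem_subalgC {j : LieSubalgebra ℝ g} {Z : ℂ ⊗[ℝ] g} :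
    Z ∈ subalgC j ↔ reC Z ∈ j ∧ imC Z ∈ j := mem_baseChange_iff_re_im j.toSubmodule Z

/-- The complex linear extension to `𝔧_c` of a real linear form on `𝔧`. -/
noncomputable def extC (j : LieSubalgebra ℝ g) (α : j →ₗ[ℝ] ℂ) : subalgC j →ₗ[ℂ] ℂ where
  toFun h := α ⟨reC (h : ℂ ⊗[ℝ] g), (mem_subalgC.1 h.2).1⟩ +
    Complex.I * α ⟨imC (h : ℂ ⊗[ℝ] g), (mem_subalgC.1 h.2).2⟩
  map_add' h h' := by
    have h1 : (⟨reC ((h + h' : subalgC j) : ℂ ⊗[ℝ] g), (mem_subalgC.1 (h + h').2).1⟩ : j) =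
      ⟨reC (h : ℂ ⊗[ℝ] g), (mem_subalgC.1 h.2).1⟩ +
      ⟨reC (h' : ℂ ⊗[ℝ] g), (mem_subalgC.1 h'.2).1⟩ := by ext; simp
    have h2 : (⟨imC ((h + h' : subalgC j) : ℂ ⊗[ℝ] g), (mem_subalgC.1 (h + h').2).2⟩ : j) =
      ⟨imC (h : ℂ ⊗[ℝ] g), (mem_subalgC.1 h.2).2⟩ +
      ⟨imC (h' : ℂ ⊗[ℝ] g), (mem_subalgC.1 h'.2).2⟩ := by ext; simp
    rw [h1, h2, map_add, map_add]; ring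
  map_smul' z h := by
    have h1 : (⟨reC ((z • h : subalgC j) : ℂ ⊗[ℝ] g), (mem_subalgC.1 (z • h).2).1⟩ : j) =
      z.re • ⟨reC (h : ℂ ⊗[ℝ] g), (mem_subalgC.1 h.2).1⟩ -
      z.im • ⟨imC (h : ℂ ⊗[ℝ] g), (mem_subalgC.1 h.2).2⟩ := by
        ext; simp [reC_smul]
    have h2 : (⟨imC ((z • h : subalgC j) : ℂ ⊗[ℝ] g), (mem_subalgC.1 (z • h).2).2⟩ : j) =
      z.re • ⟨imC (h : ℂ ⊗[ℝ] g), (mem_subalgC.1 h.2).2⟩ +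
      z.im • ⟨reC (h : ℂ ⊗[ℝ] g), (mem_subalgC.1 h.2).1⟩ := by
        ext; simp [imC_smul]
    rw [h1, h2, map_sub, map_add, map_smul, map_smul, map_smul, map_smul]
    simp only [Complex.real_smul, RingHom.id_apply, smul_eq_mul]
    conv_rhs => rw [← Complex.re_add_im z]
    linear_combination -(z.im : ℂ) * α ⟨imC (h : ℂ ⊗[ℝ] g), (mem_subalgC.1 h.2).2⟩ * Complex.I_mul_I

lemma one_tmul_mem_subalgC {j : LieSubalgebra ℝ g} (X : j) :
    (1 : ℂ) ⊗ₜ[ℝ] (X : g) ∈ subalgC j := mem_subalgC.2 (by simp)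

@[simp] lemma extC_one_tmul (j : LieSubalgebra ℝ g) (α : j →ₗ[ℝ] ℂ) (X : j) :
    extC j α ⟨(1 : ℂ) ⊗ₜ[ℝ] (X : g), one_tmul_mem_subalgC X⟩ = α X := by
  have h1 : (⟨reC ((1 : ℂ) ⊗ₜ[ℝ] (X : g)), (mem_subalgC.1 (one_tmul_mem_subalgC X)).1⟩ : j) = X := by
    ext; simp
  have h2 : (⟨imC ((1 : ℂ) ⊗ₜ[ℝ] (X : g)), (mem_subalgC.1 (one_tmul_mem_subalgC X)).2⟩ : j) = 0 := by
    ext; simp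
  simp only [extC, LinearMap.coe_mk, AddHom.coe_mk]
  rw [h1, h2]; simp

/-- The restriction to `𝔧` of a complex linear form on `𝔧_c`. -/
noncomputable def resC (j : LieSubalgebra ℝ g) (w : subalgC j →ₗ[ℂ] ℂ) : j →ₗ[ℝ] ℂ where
  toFun X := w ⟨(1 : ℂ) ⊗ₜ[ℝ] (X : g), one_tmul_mem_subalgC X⟩
  map_add' X Y := by
    rw [← map_add]; congr 1; ext; simp [TensorProduct.tmul_add]
  map_smul' r X := by
    have : (⟨(1 : ℂ) ⊗ₜ[ℝ] ((r • X : j) : g), one_tmul_mem_subalgC _⟩ : subalgC j) =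
        (r : ℂ) • ⟨(1 : ℂ) ⊗ₜ[ℝ] (X : g), one_tmul_mem_subalgC X⟩ := by
      ext
      simp [TensorProduct.tmul_smul, TensorProduct.smul_tmul']
    rw [this, map_smul]; simp

lemma subalgC_eq (j : LieSubalgebra ℝ g) (h : subalgC j) :
    h = (⟨(1 : ℂ) ⊗ₜ[ℝ] reC (h : ℂ ⊗[ℝ] g), one_tmul_mem_subalgC ⟨_, (mem_subalgC.1 h.2).1⟩⟩ :
        subalgC j) +
      Complex.I • ⟨(1 : ℂ) ⊗ₜ[ℝ] imC (h : ℂ ⊗[ℝ] g),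
        one_tmul_mem_subalgC ⟨_, (mem_subalgC.1 h.2).2⟩⟩ :=
  Subtype.ext (eq_re_add_im (h : ℂ ⊗[ℝ] g))

lemma extC_resC (j : LieSubalgebra ℝ g) (w : subalgC j →ₗ[ℂ] ℂ) : extC j (resC j w) = w := by
  ext h
  conv_rhs => rw [subalgC_eq j h]
  rw [map_add, map_smul]
  rfl

lemma resC_extC (j : LieSubalgebra ℝ g) (α : j →ₗ[ℝ] ℂ) : resC j (extC j α) = α := by
  ext X
  exact extC_one_tmul j α X

lemma extC_injective (j : LieSubalgebra ℝ g) : Function.Injective (extC j) := fun α β h => by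
  rw [← resC_extC j α, h, resC_extC]

lemma extC_add (j : LieSubalgebra ℝ g) (α β : j →ₗ[ℝ] ℂ) :
    extC j (α + β) = extC j α + extC j β := by
  ext h; simp [extC]; ring

lemma extC_zero (j : LieSubalgebra ℝ g) : extC j 0 = 0 := by
  ext h; simp [extC]

lemma extC_neg (j : LieSubalgebra ℝ g) (α : j →ₗ[ℝ] ℂ) : extC j (-α) = -extC j α := by
  ext h; simp [extC]; ring

lemma extC_nsmul (j : LieSubalgebra ℝ g) (n : ℕ) (α : j →ₗ[ℝ] ℂ) :
    extC j (n • α) = n • extC j α := by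
  ext h; simp [extC]; ring

lemma lie_of_mem_rootSpaceJ {j : LieSubalgebra ℝ g} {α : j →ₗ[ℝ] ℂ} {Z : ℂ ⊗[ℝ] g}
    (hZ : Z ∈ rootSpaceJ j α) (h : subalgC j) : ⁅(h : ℂ ⊗[ℝ] g), Z⁆ = extC j α h • Z := by
  rw [mem_rootSpaceJ] at hZ
  conv_lhs => rw [eq_re_add_im (h : ℂ ⊗[ℝ] g)]
  rw [add_lie, smul_lie, hZ ⟨_, (mem_subalgC.1 h.2).1⟩, hZ ⟨_, (mem_subalgC.1 h.2).2⟩, smul_smul,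
    ← add_smul]
  rfl

variable [FiniteDimensional ℝ g] [LieAlgebra.IsKilling ℝ g]

lemma killingForm_tmul (X Y : g) :
    killingForm ℂ (ℂ ⊗[ℝ] g) ((1 : ℂ) ⊗ₜ[ℝ] X) ((1 : ℂ) ⊗ₜ[ℝ] Y) = (killingForm ℝ g X Y : ℂ) := by
  have := LieModule.traceForm_baseChange (R := ℝ) (L := g) (M := g) (A := ℂ)
  unfold killingForm
  rw [this]
  simp

/-- The complexification of a Lie algebra with nondegenerate Killing form has the same property. -/
instance isKilling_tensor : LieAlgebra.IsKilling ℂ (ℂ ⊗[ℝ] g) where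
  killingCompl_top_eq_bot := by
    rw [eq_bot_iff]
    intro Z hZ
    rw [LieIdeal.mem_killingCompl] at hZ
    have h1 : ∀ Y : g, killingForm ℝ g Y (reC Z) = 0 ∧ killingForm ℝ g Y (imC Z) = 0 := by
      intro Y
      have h := hZ ((1 : ℂ) ⊗ₜ[ℝ] Y) trivial
      rw [eq_re_add_im Z, map_add, map_smul, killingForm_tmul, killingForm_tmul] at h
      have h2 := congrArg Complex.re h
      have h3 := congrArg Complex.im h
      simp at h2 h3
      exact ⟨h2, h3⟩
    have h0 : ∀ X : g, (∀ Y, killingForm ℝ g Y X = 0) → X = 0 := by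
      intro X hX
      have : X ∈ LieIdeal.killingCompl ℝ g ⊤ := by
        rw [LieIdeal.mem_killingCompl]; exact fun Y _ => hX Y
      rwa [LieAlgebra.IsKilling.killingCompl_top_eq_bot, LieSubmodule.mem_bot] at this
    have : Z = 0 := ext_re_im (by simpa using h0 _ fun Y => (h1 Y).1)
      (by simpa using h0 _ fun Y => (h1 Y).2)
    rw [this]; exact LieSubmodule.zero_mem _

variable (j : LieSubalgebra ℝ g) [hj : j.IsCartanSubalgebra]

lemma lie_eq_zero_of_mem_cartan {X Y : g} (hX : X ∈ j) (hY : Y ∈ j) : ⁅X, Y⁆ = 0 := by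
  have h := LieModule.IsTrivial.trivial (L := j) (M := j) ⟨X, hX⟩ ⟨Y, hY⟩
  simpa using congrArg (Subtype.val) h

/-- The complexification of a Cartan subalgebra is a Cartan subalgebra. -/
instance isCartan_subalgC : (subalgC j).IsCartanSubalgebra where
  nilpotent := by
    have : IsLieAbelian (subalgC j) := by
      refine ⟨fun h h' => Subtype.ext ?_⟩
      have key : ∀ X ∈ j, ⁅(1 : ℂ) ⊗ₜ[ℝ] X, (h' : ℂ ⊗[ℝ] g)⁆ = 0 := by
        intro X hX
        have := mem_subalgC.1 h'.2
        rw [lie_one_tmul, lie_eq_zero_of_mem_cartan j hX this.1,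
          lie_eq_zero_of_mem_cartan j hX this.2]
        simp
      have hm := mem_subalgC.1 h.2
      rw [LieSubalgebra.coe_bracket, eq_re_add_im (h : ℂ ⊗[ℝ] g), add_lie, smul_lie,
        key _ hm.1, key _ hm.2]
      simp
    infer_instance
  self_normalizing := by
    refine le_antisymm (fun Z hZ => ?_) (LieSubalgebra.le_normalizer _)
    rw [LieSubalgebra.mem_normalizer_iff] at hZ
    rw [mem_subalgC]
    have h1 : ∀ X : j, ⁅reC Z, (X : g)⁆ ∈ j ∧ ⁅imC Z, (X : g)⁆ ∈ j := by
      intro X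
      have h := hZ _ (one_tmul_mem_subalgC X)
      rw [mem_subalgC, ← lie_skew, map_neg, map_neg, reC_lie, imC_lie, neg_mem_iff, neg_mem_iff] at h
      rw [← lie_skew, ← lie_skew (imC Z), neg_mem_iff, neg_mem_iff]
      exact h
    have h2 : ∀ X : g, (∀ Y : j, ⁅X, (Y : g)⁆ ∈ j) → X ∈ j := by
      intro X hX
      have : X ∈ j.normalizer := by
        rw [LieSubalgebra.mem_normalizer_iff]; exact fun Y hY => hX ⟨Y, hY⟩
      rwa [hj.self_normalizing] at this
    exact ⟨h2 _ fun X => (h1 X).1, h2 _ fun X => (h1 X).2⟩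

/-- The root spaces of `𝔤_c` in the sense of Mathlib, which are generalized eigenspaces, are the given
ones: `𝔧_c` acts semisimply because the Killing form is nondegenerate. -/
lemma rootSpace_eq_rootSpaceJ (α : j →ₗ[ℝ] ℂ) :
    (LieAlgebra.rootSpace (subalgC j) (extC j α)).toSubmodule = rootSpaceJ j α := by
  ext Z
  constructor
  · intro hZ X
    have := LieAlgebra.IsKilling.lie_eq_smul_of_mem_rootSpace hZ
      ⟨(1 : ℂ) ⊗ₜ[ℝ] (X : g), one_tmul_mem_subalgC X⟩
    rw [extC_one_tmul] at this
    exact this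
  · intro hZ
    refine LieModule.weightSpace_le_genWeightSpace _ _ ?_
    rw [LieModule.mem_weightSpace]
    exact fun h => lie_of_mem_rootSpaceJ hZ h

lemma rootSpaceJ_zero : rootSpaceJ j 0 = j.toSubmodule.baseChange ℂ := by
  rw [← rootSpace_eq_rootSpaceJ, extC_zero]
  change (LieAlgebra.rootSpace (subalgC j) (0 : subalgC j → ℂ)).toSubmodule = _
  rw [LieAlgebra.rootSpace_zero_eq]
  rfl

/-- The weight of Mathlib's theory given by a linear form on `𝔧` with nonzero root space. -/
noncomputable def toWeight (α : j →ₗ[ℝ] ℂ) (hα : rootSpaceJ j α ≠ ⊥) :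
    LieModule.Weight ℂ (subalgC j) (ℂ ⊗[ℝ] g) where
  toFun := extC j α
  genWeightSpace_ne_bot' := by
    intro h
    apply hα
    rw [← rootSpace_eq_rootSpaceJ]
    exact (LieSubmodule.toSubmodule_eq_bot _).2 h

lemma toWeight_isNonZero {α : j →ₗ[ℝ] ℂ} (hα : α ∈ rootsJ j) : (toWeight j α hα.2).IsNonZero := by
  intro h
  apply hα.1
  apply extC_injective j
  rw [extC_zero]
  ext x
  exact congrFun h x

lemma exists_eq_toWeight (w : LieModule.Weight ℂ (subalgC j) (ℂ ⊗[ℝ] g)) :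
    ∃ (α : j →ₗ[ℝ] ℂ) (hα : rootSpaceJ j α ≠ ⊥), w = toWeight j α hα := by
  have h1 : (extC j (resC j w.toLinear) : subalgC j → ℂ) = w := by
    rw [extC_resC]; rfl
  refine ⟨resC j w.toLinear, ?_, ?_⟩
  · rw [← rootSpace_eq_rootSpaceJ, h1]
    exact fun h => w.genWeightSpace_ne_bot' ((LieSubmodule.toSubmodule_eq_bot _).1 h)
  · ext x
    exact (congrFun h1 x).symm

lemma finite_rootsJ : (rootsJ j).Finite := by
  have : Finite (LieModule.Weight ℂ (subalgC j) (ℂ ⊗[ℝ] g)) := inferInstance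
  refine Set.Finite.subset (Set.finite_range fun w : LieModule.Weight ℂ (subalgC j) (ℂ ⊗[ℝ] g) =>
    resC j w.toLinear) ?_
  intro α hα
  refine ⟨toWeight j α hα.2, ?_⟩
  refine (congrArg (resC j) ?_).trans (resC_extC j α)
  ext x; rfl

/-- The root space decomposition of `𝔤_c`. -/
lemma cartan_sup_rootSpaceJ :
    j.toSubmodule.baseChange ℂ ⊔ ⨆ α ∈ rootsJ j, rootSpaceJ j α = ⊤ := by
  have h := LieModule.iSup_genWeightSpace_eq_top' ℂ (subalgC j) (ℂ ⊗[ℝ] g)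
  have h2 := congrArg LieSubmodule.toSubmodule h
  rw [LieSubmodule.iSup_toSubmodule, LieSubmodule.top_toSubmodule] at h2
  rw [eq_top_iff, ← h2]
  refine iSup_le fun w => ?_
  obtain ⟨α, hα, rfl⟩ := exists_eq_toWeight j w
  have h3 : (LieModule.genWeightSpace (ℂ ⊗[ℝ] g) (toWeight j α hα)).toSubmodule =
    rootSpaceJ j α := rootSpace_eq_rootSpaceJ j α
  rw [h3]
  by_cases h0 : α = 0
  · subst h0
    rw [rootSpaceJ_zero]
    exact le_sup_left
  · exact le_sup_of_le_right (le_iSup₂_of_le α ⟨h0, hα⟩ le_rfl)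

/-- The coroot of a root, with its integrality and string properties. -/
lemma exists_corootJ {α : j →ₗ[ℝ] ℂ} (hα : α ∈ rootsJ j) :
    ∃ (h : subalgC j) (z : ℂ), extC j α h = 2 ∧
      (∀ X : j, killingForm ℂ (ℂ ⊗[ℝ] g) h ((1 : ℂ) ⊗ₜ[ℝ] (X : g)) = z * α X) ∧
      ∀ β ∈ rootsJ j, ∃ n : ℤ, extC j β h = n ∧
        ∀ m : ℕ, (m : ℤ) ≤ -n → rootSpaceJ j (m • α + β) ≠ ⊥ := by
  set w := toWeight j α hα.2 with hw
  refine ⟨LieAlgebra.IsKilling.coroot w,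
    2 • (w ((LieAlgebra.IsKilling.cartanEquivDual (subalgC j)).symm w))⁻¹, ?_, ?_, ?_⟩
  · exact LieAlgebra.IsKilling.root_apply_coroot (toWeight_isNonZero j hα)
  · intro X
    have h := LieAlgebra.IsKilling.traceForm_coroot w
      ⟨(1 : ℂ) ⊗ₜ[ℝ] (X : g), one_tmul_mem_subalgC X⟩
    have h2 : w ⟨(1 : ℂ) ⊗ₜ[ℝ] (X : g), one_tmul_mem_subalgC X⟩ = α X := extC_one_tmul j α X
    rw [h2] at h
    refine Eq.trans ?_ (h.trans ?_)
    · rfl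
    · simp [mul_assoc]
  · intro β hβ
    set v := toWeight j β hβ.2 with hv
    refine ⟨_, LieAlgebra.IsKilling.apply_coroot_eq_cast w v, fun m hm => ?_⟩
    have h := (LieAlgebra.IsKilling.rootSpace_zsmul_add_ne_bot_iff w v (toWeight_isNonZero j hα)
      m).2 (by omega)
    intro h0
    rw [← rootSpace_eq_rootSpaceJ] at h0
    apply h
    have h1 : ((extC j (m • α + β) : subalgC j →ₗ[ℂ] ℂ) : subalgC j → ℂ) = (m : ℤ) • w + v := by
      rw [extC_add, extC_nsmul]
      ext x
      simp [hw, hv]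
      rfl
    rw [← h1]
    exact (LieSubmodule.toSubmodule_eq_bot _).1 h0

/-- The root system is reduced. -/
lemma eq_or_eq_neg_of_smul {α β : j →ₗ[ℝ] ℂ} (hα : α ∈ rootsJ j) (hβ : β ∈ rootsJ j) {z : ℂ}
    (h : ∀ X, β X = z * α X) : β = -α ∨ β = α := by
  have h1 := LieAlgebra.IsKilling.eq_neg_or_eq_of_eq_smul (toWeight j α hα.2) (toWeight j β hβ.2)
    (toWeight_isNonZero j hβ) z (by
      ext x
      change extC j β x = z * extC j α x
      simp only [extC, LinearMap.coe_mk, AddHom.coe_mk, h]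
      ring)
  rcases h1 with h1 | h1
  · left
    apply extC_injective
    rw [extC_neg]
    ext x
    exact congrArg (fun w : LieModule.Weight ℂ (subalgC j) (ℂ ⊗[ℝ] g) => w x) h1
  · right
    apply extC_injective
    ext x
    exact congrArg (fun w : LieModule.Weight ℂ (subalgC j) (ℂ ⊗[ℝ] g) => w x) h1

end RootsInterface

/-! ### The Cartan involution and the Cartan subalgebra -/

section CartanInvolution

variable {g : Type*} [LieRing g] [LieAlgebra ℝ g]

/-- The bilinear form `B_θ (X, Y) = -κ (X, θ Y)`, positive definite if `θ` is a Cartan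
involution. -/
noncomputable def Bθ (θ : g ≃ₗ⁅ℝ⁆ g) : LinearMap.BilinForm ℝ g :=
  -(killingForm ℝ g).compl₂ (θ : g →ₗ[ℝ] g)

lemma Bθ_apply (θ : g ≃ₗ⁅ℝ⁆ g) (X Y : g) : Bθ θ X Y = -killingForm ℝ g X (θ Y) := rfl

lemma mem_cartanS {θ : g ≃ₗ⁅ℝ⁆ g} {X : g} : X ∈ cartanS θ ↔ θ X = -X := Iff.rfl

lemma killingForm_lie (X Y Z : g) : killingForm ℝ g ⁅X, Y⁆ Z = killingForm ℝ g X ⁅Y, Z⁆ :=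
  LieModule.traceForm_apply_lie_apply ℝ g g X Y Z

namespace IsCartanInvolution

variable {θ : g ≃ₗ⁅ℝ⁆ g} (hθ : IsCartanInvolution θ)
include hθ

lemma Bθ_pos {X : g} (hX : X ≠ 0) : 0 < Bθ θ X X := by
  rw [Bθ_apply]; linarith [hθ.killing_neg X hX]

lemma Bθ_nonneg (X : g) : 0 ≤ Bθ θ X X := by
  by_cases hX : X = 0
  · simp [hX]
  · exact (hθ.Bθ_pos hX).le

lemma eq_zero_of_Bθ {X : g} (hX : Bθ θ X X = 0) : X = 0 := by
  by_contra h
  exact (hθ.Bθ_pos h).ne' hX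

variable [FiniteDimensional ℝ g]

lemma Bθ_comm (X Y : g) : Bθ θ X Y = Bθ θ Y X := by
  rw [Bθ_apply, Bθ_apply, ← LieAlgebra.killingForm_of_equiv_apply θ X (θ Y), hθ.involutive,
    LieModule.traceForm_comm]

/-- The adjoint of `ad Z` for `B_θ` is `-ad (θ Z)`. -/
lemma Bθ_lie (Z X Y : g) : Bθ θ ⁅Z, X⁆ Y = -Bθ θ X ⁅θ Z, Y⁆ := by
  rw [Bθ_apply, Bθ_apply, LieEquiv.map_lie, hθ.involutive, ← killingForm_lie, ← lie_skew, map_neg,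
    LinearMap.neg_apply]

lemma Bθ_lie_of_fixed {Z : g} (hZ : θ Z = Z) (X Y : g) : Bθ θ ⁅Z, X⁆ Y = -Bθ θ X ⁅Z, Y⁆ := by
  rw [hθ.Bθ_lie, hZ]

lemma Bθ_lie_of_mem_cartanS {Z : g} (hZ : Z ∈ cartanS θ) (X Y : g) :
    Bθ θ ⁅Z, X⁆ Y = Bθ θ X ⁅Z, Y⁆ := by
  rw [hθ.Bθ_lie, mem_cartanS.1 hZ, neg_lie, map_neg, neg_neg]

lemma Bθ_orthogonal {T A : g} (hT : θ T = T) (hA : A ∈ cartanS θ) : Bθ θ T A = 0 := by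
  have h1 : Bθ θ (θ T) (θ A) = Bθ θ T A := by
    rw [Bθ_apply, Bθ_apply, LieAlgebra.killingForm_of_equiv_apply]
  rw [hT, mem_cartanS.1 hA, map_neg] at h1
  linarith

omit [FiniteDimensional ℝ g] in
lemma half_add_fixed (X : g) : θ ((2⁻¹ : ℝ) • (X + θ X)) = (2⁻¹ : ℝ) • (X + θ X) := by
  rw [map_smul, map_add, hθ.involutive, add_comm]

omit [FiniteDimensional ℝ g] in
lemma half_sub_mem (X : g) : (2⁻¹ : ℝ) • (X - θ X) ∈ cartanS θ := by
  rw [mem_cartanS, map_smul, map_sub, hθ.involutive, ← smul_neg, neg_sub]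

omit hθ [FiniteDimensional ℝ g] in
lemma eq_half_add_half (X : g) : X = (2⁻¹ : ℝ) • (X + θ X) + (2⁻¹ : ℝ) • (X - θ X) := by
  module

variable {j : LieSubalgebra ℝ g} [LieAlgebra.IsKilling ℝ g] [hj : j.IsCartanSubalgebra]
  (ha : IsMaximalAbelianIn (j.toSubmodule ⊓ cartanS θ) (cartanS θ))
include ha

omit hθ [FiniteDimensional ℝ g] [LieAlgebra.IsKilling ℝ g] hj in
/-- A maximal abelian subspace of `𝔰` is its own centralizer in `𝔰`. -/
lemma mem_a_of_commute {X : g} (hX : X ∈ cartanS θ)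
    (h : ∀ A ∈ j.toSubmodule ⊓ cartanS θ, ⁅A, X⁆ = 0) : X ∈ j.toSubmodule ⊓ cartanS θ := by
  set a := j.toSubmodule ⊓ cartanS θ
  have h1 : a ⊔ Submodule.span ℝ {X} ≤ a := by
    refine ha.2 ⟨sup_le ha.1.1 ?_, ?_⟩ le_sup_left
    · rw [Submodule.span_singleton_le_iff_mem]; exact hX
    · intro Y hY Z hZ
      obtain ⟨A, hA, _, hs, rfl⟩ := Submodule.mem_sup.1 hY
      obtain ⟨r, rfl⟩ := Submodule.mem_span_singleton.1 hs
      obtain ⟨A', hA', _, hs', rfl⟩ := Submodule.mem_sup.1 hZ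
      obtain ⟨r', rfl⟩ := Submodule.mem_span_singleton.1 hs'
      have h2 : ⁅X, A'⁆ = 0 := by rw [← lie_skew, h A' hA', neg_zero]
      simp [ha.1.2 A hA A' hA', h A hA, h2]
  exact h1 (Submodule.mem_sup_right (Submodule.mem_span_singleton_self X))

/-- The `𝔰`-component of an element of the centralizer of `𝔞` lies in `𝔞`. -/
lemma half_sub_mem_a {X : g} (h : ∀ A ∈ j.toSubmodule ⊓ cartanS θ, ⁅A, X⁆ = 0) :
    (2⁻¹ : ℝ) • (X - θ X) ∈ j.toSubmodule ⊓ cartanS θ := by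
  refine mem_a_of_commute ha (hθ.half_sub_mem X) fun A hA => ?_
  have h1 : ⁅A, θ X⁆ = 0 := by
    have h2 := congrArg θ (h A hA)
    rw [LieEquiv.map_lie, mem_cartanS.1 hA.2, map_zero, neg_lie, neg_eq_zero] at h2
    exact h2
  rw [lie_smul, lie_sub, h A hA, h1, sub_zero, smul_zero]

lemma half_sub_mem_of_mem {X : g} (hX : X ∈ j) :
    (2⁻¹ : ℝ) • (X - θ X) ∈ j.toSubmodule ⊓ cartanS θ :=
  hθ.half_sub_mem_a ha fun _ hA => lie_eq_zero_of_mem_cartan j hA.1 hX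

lemma half_add_mem {X : g} (hX : X ∈ j) : (2⁻¹ : ℝ) • (X + θ X) ∈ j := by
  have h := (hθ.half_sub_mem_of_mem ha hX).1
  have h2 : (2⁻¹ : ℝ) • (X + θ X) = X - (2⁻¹ : ℝ) • (X - θ X) := by module
  rw [h2]
  exact sub_mem hX h

/-- The Cartan subalgebra is stable under `θ`, since its elements have their `𝔰`-components in `𝔞`. -/
lemma theta_mem {X : g} (hX : X ∈ j) : θ X ∈ j := by
  have h := (hθ.half_sub_mem_of_mem ha hX).1
  have h2 : θ X = X - (2 : ℝ) • ((2⁻¹ : ℝ) • (X - θ X)) := by module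
  rw [h2]
  exact sub_mem hX (j.toSubmodule.smul_mem _ h)

end IsCartanInvolution

/-! ### Real and imaginary parts of root vectors -/

section RootVectors

variable {j : LieSubalgebra ℝ g} {α : j →ₗ[ℝ] ℂ} {Z : ℂ ⊗[ℝ] g}

lemma lie_reC (hZ : Z ∈ rootSpaceJ j α) (X : j) :
    ⁅(X : g), reC Z⁆ = (α X).re • reC Z - (α X).im • imC Z := by
  rw [← reC_lie, mem_rootSpaceJ.1 hZ X, reC_smul]

lemma lie_imC (hZ : Z ∈ rootSpaceJ j α) (X : j) :
    ⁅(X : g), imC Z⁆ = (α X).re • imC Z + (α X).im • reC Z := by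
  rw [← imC_lie, mem_rootSpaceJ.1 hZ X, imC_smul]

lemma exists_mem_rootSpaceJ (hα : α ∈ rootsJ j) : ∃ Z ∈ rootSpaceJ j α, Z ≠ 0 :=
  (Submodule.ne_bot_iff _).1 hα.2

/-- The complex conjugate of a linear form. -/
noncomputable def conjRoot (α : j →ₗ[ℝ] ℂ) : j →ₗ[ℝ] ℂ := Complex.conjAe.toLinearMap ∘ₗ α

lemma conjRoot_apply (α : j →ₗ[ℝ] ℂ) (X : j) : conjRoot α X = (starRingEnd ℂ) (α X) := rfl

/-- Complex conjugation of `g_c` with respect to `g`. -/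
noncomputable def conjC : (ℂ ⊗[ℝ] g) →ₗ[ℝ] (ℂ ⊗[ℝ] g) :=
  LinearMap.rTensor g Complex.conjAe.toLinearMap

lemma reC_conjC (Z : ℂ ⊗[ℝ] g) : reC (conjC Z) = reC Z := by
  induction Z using TensorProduct.induction_on with
  | zero => simp
  | tmul z X => simp [conjC]
  | add Z W hZ hW => simp [hZ, hW]

lemma imC_conjC (Z : ℂ ⊗[ℝ] g) : imC (conjC Z) = -imC Z := by
  induction Z using TensorProduct.induction_on with
  | zero => simp
  | tmul z X => simp [conjC]
  | add Z W hZ hW => simp [hZ, hW]; abel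

lemma conjC_conjC (Z : ℂ ⊗[ℝ] g) : conjC (conjC Z) = Z :=
  ext_re_im (by simp [reC_conjC]) (by simp [imC_conjC])

lemma conjC_mem (hZ : Z ∈ rootSpaceJ j α) : conjC Z ∈ rootSpaceJ j (conjRoot α) := by
  rw [mem_rootSpaceJ]
  intro X
  apply ext_re_im
  · rw [reC_lie, reC_conjC, lie_reC hZ, reC_smul, reC_conjC, imC_conjC, conjRoot_apply]
    simp
  · rw [imC_lie, imC_conjC, lie_neg, lie_imC hZ, imC_smul, reC_conjC, imC_conjC, conjRoot_apply]
    simp only [Complex.conj_re, Complex.conj_im]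
    module

lemma conjRoot_mem (hα : α ∈ rootsJ j) : conjRoot α ∈ rootsJ j := by
  obtain ⟨Z, hZ, h0⟩ := exists_mem_rootSpaceJ hα
  refine ⟨fun h => hα.1 ?_, (Submodule.ne_bot_iff _).2 ⟨_, conjC_mem hZ, fun h => h0 ?_⟩⟩
  · ext X
    have := LinearMap.congr_fun h X
    rw [conjRoot_apply, LinearMap.zero_apply, map_eq_zero] at this
    simpa using this
  · rw [← conjC_conjC Z, h, map_zero]

variable {θ : g ≃ₗ⁅ℝ⁆ g} (hθ : IsCartanInvolution θ) [FiniteDimensional ℝ g]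
include hθ

lemma norm_root_vector_pos (h0 : Z ≠ 0) :
    0 < Bθ θ (reC Z) (reC Z) + Bθ θ (imC Z) (imC Z) := by
  have h1 := hθ.Bθ_nonneg (reC Z)
  have h2 := hθ.Bθ_nonneg (imC Z)
  refine lt_of_le_of_ne (by linarith) fun h => h0 ?_
  exact ext_re_im (by simpa using hθ.eq_zero_of_Bθ (by linarith))
    (by simpa using hθ.eq_zero_of_Bθ (by linarith))

/-- Roots are real on `𝔞`. -/
lemma im_root_eq_zero (hα : α ∈ rootsJ j) (X : j) (hX : (X : g) ∈ cartanS θ) : (α X).im = 0 := by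
  obtain ⟨Z, hZ, h0⟩ := exists_mem_rootSpaceJ hα
  have h1 := hθ.Bθ_lie_of_mem_cartanS hX (reC Z) (imC Z)
  rw [lie_reC hZ, lie_imC hZ] at h1
  simp only [map_sub, map_add, map_smul, LinearMap.sub_apply, LinearMap.smul_apply,
    smul_eq_mul] at h1
  have h2 := norm_root_vector_pos hθ h0
  have h3 : (α X).im * (Bθ θ (reC Z) (reC Z) + Bθ θ (imC Z) (imC Z)) = 0 := by linarith
  exact (mul_eq_zero.1 h3).resolve_right h2.ne'

/-- Roots are imaginary on `𝔱 = 𝔧 ∩ 𝔨`. -/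
lemma re_root_eq_zero (hα : α ∈ rootsJ j) (X : j) (hX : θ (X : g) = X) : (α X).re = 0 := by
  obtain ⟨Z, hZ, h0⟩ := exists_mem_rootSpaceJ hα
  have h1 := hθ.Bθ_lie_of_fixed hX (reC Z) (reC Z)
  have h1' := hθ.Bθ_lie_of_fixed hX (imC Z) (imC Z)
  rw [lie_reC hZ] at h1
  rw [lie_imC hZ] at h1'
  simp only [map_sub, map_add, map_smul, LinearMap.sub_apply, LinearMap.smul_apply,
    LinearMap.add_apply, smul_eq_mul] at h1 h1'
  have h2 := norm_root_vector_pos hθ h0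
  have h4 := hθ.Bθ_comm (reC Z) (imC Z)
  rw [h4] at h1 h1'
  have h3 : (α X).re * (Bθ θ (reC Z) (reC Z) + Bθ θ (imC Z) (imC Z)) = 0 := by linarith
  exact (mul_eq_zero.1 h3).resolve_right h2.ne'

end RootVectors
end CartanInvolution

/-! ### A regular vector for a positive system -/

section Regular

variable {g : Type*} [LieRing g] [LieAlgebra ℝ g] [FiniteDimensional ℝ g] [LieAlgebra.IsKilling ℝ g]
  {θ : g ≃ₗ⁅ℝ⁆ g} (hθ : IsCartanInvolution θ)
  {j : LieSubalgebra ℝ g} [hj : j.IsCartanSubalgebra]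
  (ha : IsMaximalAbelianIn (j.toSubmodule ⊓ cartanS θ) (cartanS θ))
include hθ

omit [LieAlgebra.IsKilling ℝ g] hj in
/-- Riesz representation on `𝔧` for the form `B_θ`. -/
lemma exists_riesz (f : j →ₗ[ℝ] ℝ) : ∃ w : j, ∀ X : j, Bθ θ (w : g) (X : g) = f X := by
  let Φ : j →ₗ[ℝ] Module.Dual ℝ j :=
    { toFun := fun w => (Bθ θ (w : g)) ∘ₗ j.toSubmodule.subtype
      map_add' := fun w w' => by ext X; simp
      map_smul' := fun r w => by ext X; simp }
  have hinj : Function.Injective Φ := by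
    rw [← LinearMap.ker_eq_bot, LinearMap.ker_eq_bot']
    intro w hw
    have h1 : Bθ θ (w : g) (w : g) = 0 := LinearMap.congr_fun hw w
    ext
    simpa using hθ.eq_zero_of_Bθ h1
  have hsurj : Function.Surjective Φ :=
    (LinearMap.injective_iff_surjective_of_finrank_eq_finrank
      (Subspace.dual_finrank_eq (K := ℝ) (V := j)).symm).1 hinj
  obtain ⟨w, hw⟩ := hsurj f
  exact ⟨w, fun X => LinearMap.congr_fun hw X⟩

omit hθ [FiniteDimensional ℝ g] [LieAlgebra.IsKilling ℝ g] hj in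
/-- The real linear form `Re α + Im α` on `𝔧`. It determines `α`, because `α` is real on `𝔞` and
imaginary on `𝔱`. -/
noncomputable def realForm (α : j →ₗ[ℝ] ℂ) : j →ₗ[ℝ] ℝ :=
  Complex.reLm ∘ₗ α + Complex.imLm ∘ₗ α

omit hθ [FiniteDimensional ℝ g] [LieAlgebra.IsKilling ℝ g] hj in
lemma realForm_apply (α : j →ₗ[ℝ] ℂ) (X : j) : realForm α X = (α X).re + (α X).im := rfl

include ha

/-- The pairing of two roots, computed with `B_θ`: if `w` and `w'` are the Riesz vectors of `α` and
`β`, then `β (α^∨) = 2 B_θ (w', w) / B_θ (w, w)`. -/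
lemma exists_pairing {α : j →ₗ[ℝ] ℂ} (hα : α ∈ rootsJ j) {w : j}
    (hw : ∀ X : j, Bθ θ (w : g) (X : g) = realForm α X) :
    0 < Bθ θ (w : g) (w : g) ∧ ∀ β ∈ rootsJ j, ∃ n : ℤ,
      2 * realForm β w = n * Bθ θ (w : g) (w : g) ∧
        ∀ m : ℕ, (m : ℤ) ≤ -n → rootSpaceJ j (m • α + β) ≠ ⊥ := by
  obtain ⟨h, z, h2, hz, hβ⟩ := exists_corootJ j hα
  set T : g := (2⁻¹ : ℝ) • ((w : g) + θ w) with hT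
  set A : g := (2⁻¹ : ℝ) • ((w : g) - θ w) with hA
  have hTj : T ∈ j := hθ.half_add_mem ha w.2
  have hAa : A ∈ j.toSubmodule ⊓ cartanS θ := hθ.half_sub_mem_of_mem ha w.2
  have hθT : θ T = T := hθ.half_add_fixed _
  have hwTA : (w : g) = T + A := IsCartanInvolution.eq_half_add_half (θ := θ) _
  have hwTA' : w = (⟨T, hTj⟩ : j) + ⟨A, hAa.1⟩ := Subtype.ext hwTA
  -- `u = A - i T` represents `α` with respect to the Killing form, and roots take on it the values
  -- which their real forms take on `w`
  set u : subalgC j := ⟨(1 : ℂ) ⊗ₜ[ℝ] A, one_tmul_mem_subalgC ⟨A, hAa.1⟩⟩ -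
    Complex.I • ⟨(1 : ℂ) ⊗ₜ[ℝ] T, one_tmul_mem_subalgC ⟨T, hTj⟩⟩ with hu
  have hext : ∀ β ∈ rootsJ j, extC j β u = realForm β w := by
    intro β hβ
    have e1 : extC j β u = β ⟨A, hAa.1⟩ - Complex.I * β ⟨T, hTj⟩ := by
      have h1 := extC_one_tmul j β ⟨A, hAa.1⟩
      have h2 := extC_one_tmul j β ⟨T, hTj⟩
      rw [hu, map_sub, map_smul, smul_eq_mul]
      rw [h1, h2]
    have e2 := im_root_eq_zero hθ hβ ⟨A, hAa.1⟩ hAa.2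
    have e3 := re_root_eq_zero hθ hβ ⟨T, hTj⟩ hθT
    rw [e1, hwTA', map_add, realForm_apply, realForm_apply, e2, e3]
    apply Complex.ext <;> simp [e2, e3, add_comm]
  -- Killing orthogonality relations
  have hκ : ∀ X : j, killingForm ℝ g A X = (α X).re ∧ -killingForm ℝ g T X = (α X).im := by
    intro X
    set XT : g := (2⁻¹ : ℝ) • ((X : g) + θ X) with hXT
    set XA : g := (2⁻¹ : ℝ) • ((X : g) - θ X) with hXA
    have hXTj : XT ∈ j := hθ.half_add_mem ha X.2
    have hXAa : XA ∈ j.toSubmodule ⊓ cartanS θ := hθ.half_sub_mem_of_mem ha X.2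
    have hθX : θ XT = XT := hθ.half_add_fixed _
    have hX : X = (⟨XT, hXTj⟩ : j) + ⟨XA, hXAa.1⟩ :=
      Subtype.ext (IsCartanInvolution.eq_half_add_half (θ := θ) _)
    have e2 := im_root_eq_zero hθ hα ⟨XA, hXAa.1⟩ hXAa.2
    have e3 := re_root_eq_zero hθ hα ⟨XT, hXTj⟩ hθX
    have f1 := hw ⟨XA, hXAa.1⟩
    have f2 := hw ⟨XT, hXTj⟩
    rw [realForm_apply, hwTA, map_add, LinearMap.add_apply] at f1 f2
    have o1 : Bθ θ T XA = 0 := hθ.Bθ_orthogonal hθT hXAa.2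
    have o2 : Bθ θ A XT = 0 := by rw [hθ.Bθ_comm]; exact hθ.Bθ_orthogonal hθX hAa.2
    have g1 : Bθ θ A XA = killingForm ℝ g A XA := by
      rw [Bθ_apply, mem_cartanS.1 hXAa.2, map_neg, neg_neg]
    have g2 : Bθ θ T XT = -killingForm ℝ g T XT := by rw [Bθ_apply, hθX]
    have g3 : Bθ θ T XA = killingForm ℝ g T XA := by
      rw [Bθ_apply, mem_cartanS.1 hXAa.2, map_neg, neg_neg]
    have g4 : Bθ θ A XT = -killingForm ℝ g A XT := by rw [Bθ_apply, hθX]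
    have hXc : (X : g) = XT + XA := congrArg Subtype.val hX
    rw [hXc, map_add, map_add, hX, map_add, Complex.add_re, Complex.add_im]
    simp only at f1 f2
    constructor <;> linarith
  -- the coroot is proportional to `u`
  have hzu : h = z • u := by
    have key : ∀ X : j, killingForm ℂ (ℂ ⊗[ℝ] g) (h - z • u : subalgC j)
        ((1 : ℂ) ⊗ₜ[ℝ] (X : g)) = 0 := by
      intro X
      have e : killingForm ℂ (ℂ ⊗[ℝ] g) (u : ℂ ⊗[ℝ] g) ((1 : ℂ) ⊗ₜ[ℝ] (X : g)) = α X := by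
        change killingForm ℂ (ℂ ⊗[ℝ] g) ((1 : ℂ) ⊗ₜ[ℝ] A - Complex.I • ((1 : ℂ) ⊗ₜ[ℝ] T)) _ = _
        rw [map_sub, map_smul, LinearMap.sub_apply, LinearMap.smul_apply, killingForm_tmul,
          killingForm_tmul]
        have h3 := hκ X
        apply Complex.ext
        · simpa using h3.1
        · simpa using h3.2
      change killingForm ℂ (ℂ ⊗[ℝ] g) ((h : ℂ ⊗[ℝ] g) - z • (u : ℂ ⊗[ℝ] g)) _ = _
      rw [map_sub, map_smul, LinearMap.sub_apply, LinearMap.smul_apply, hz, e, smul_eq_mul, sub_self]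
    rw [← sub_eq_zero]
    generalize (h - z • u : subalgC j) = v at key
    have hm := mem_subalgC.1 v.2
    have key2 : ∀ X : j, killingForm ℝ g (reC (v : ℂ ⊗[ℝ] g)) X = 0 ∧
        killingForm ℝ g (imC (v : ℂ ⊗[ℝ] g)) X = 0 := by
      intro X
      have h3 := key X
      rw [eq_re_add_im (v : ℂ ⊗[ℝ] g), map_add, map_smul,
        LinearMap.add_apply, LinearMap.smul_apply, killingForm_tmul, killingForm_tmul] at h3
      have h4 := congrArg Complex.re h3
      have h5 := congrArg Complex.im h3
      simp at h4 h5
      exact ⟨h4, h5⟩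
    have key3 : ∀ Y ∈ j, (∀ X : j, killingForm ℝ g Y X = 0) → Y = 0 := by
      intro Y hY hX
      apply hθ.eq_zero_of_Bθ
      rw [Bθ_apply, hX ⟨θ Y, hθ.theta_mem ha hY⟩, neg_zero]
    have h4 : (v : ℂ ⊗[ℝ] g) = 0 :=
      ext_re_im (by simpa using key3 _ hm.1 fun X => (key2 X).1)
        (by simpa using key3 _ hm.2 fun X => (key2 X).2)
    exact Subtype.ext h4
  have hww : extC j α u = Bθ θ (w : g) (w : g) := by rw [hext α hα, hw]
  have hzw : z * (Bθ θ (w : g) (w : g) : ℂ) = 2 := by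
    rw [← hww, ← h2, hzu, map_smul, smul_eq_mul]
  have hpos : 0 < Bθ θ (w : g) (w : g) := by
    refine lt_of_le_of_ne (hθ.Bθ_nonneg _) fun h0 => ?_
    rw [← h0] at hzw
    simp at hzw
  refine ⟨hpos, fun β hβ' => ?_⟩
  obtain ⟨n, hn, hs⟩ := hβ β hβ'
  refine ⟨n, ?_, hs⟩
  rw [hzu, map_smul, smul_eq_mul, hext β hβ'] at hn
  have : (2 * realForm β w : ℂ) = n * (Bθ θ (w : g) (w : g) : ℂ) := by
    rw [← hzw, ← hn]; ring
  exact_mod_cast this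

/-- For a positive root `α`, the sum of the positive roots has positive pairing with `α`: the
reflection `s_α` maps the positive roots with negative pairing injectively to positive roots with
opposite pairing, different from `α`. -/
lemma sum_pairing_pos {R' : Set (j →ₗ[ℝ] ℂ)} (hR : IsPositiveSystem (rootsJ j) R')
    (F : Finset (j →ₗ[ℝ] ℂ)) (hF : ∀ α, α ∈ F ↔ α ∈ R') {α : j →ₗ[ℝ] ℂ} (hα : α ∈ R') {w : j}
    (hw : ∀ X : j, Bθ θ (w : g) (X : g) = realForm α X) :
    0 < ∑ β ∈ F, realForm β w := by
  classical
  have hαr := hR.subset hα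
  obtain ⟨hpos, hpair⟩ := exists_pairing hθ ha hαr hw
  set b := Bθ θ (w : g) (w : g) with hb
  have hn : ∀ β : j →ₗ[ℝ] ℂ, ∃ n : ℤ, β ∈ rootsJ j → 2 * realForm β w = n * b ∧
        ∀ m : ℕ, (m : ℤ) ≤ -n → rootSpaceJ j (m • α + β) ≠ ⊥ := by
    intro β
    by_cases hβ : β ∈ rootsJ j
    · obtain ⟨n, hn⟩ := hpair β hβ; exact ⟨n, fun _ => hn⟩
    · exact ⟨0, fun h => absurd h hβ⟩
  choose n hn using hn
  have hFr : ∀ β ∈ F, β ∈ rootsJ j := fun β hβ => hR.subset ((hF β).1 hβ)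
  have hαα : realForm α w = b := (hw w).symm
  -- `n β` is the pairing of `β` with the coroot of `α`
  have hnα : n α = 2 := by
    have h1 := (hn α hαr).1
    rw [hαα] at h1
    have h2 := mul_right_cancel₀ hpos.ne' h1
    exact_mod_cast h2.symm
  -- multiples of `α` among the positive roots
  have hmul : ∀ β ∈ F, ∀ z : ℂ, (∀ X, β X = z * α X) → β = α := by
    intro β hβ z hz
    rcases eq_or_eq_neg_of_smul j hαr (hFr β hβ) hz with h | h
    · exact absurd ((hF β).1 hβ) (h ▸ hR.not_both α hα)
    · exact h
  -- the root string from `β` to its reflection consists of positive roots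
  have hrefl : ∀ β ∈ F, ∀ m : ℕ, (m : ℤ) ≤ -n β → m • α + β ∈ F := by
    intro β hβ m
    induction m with
    | zero => intro _; simpa using hβ
    | succ m ih =>
      intro hm
      have h1 := ih (by push_cast at hm; omega)
      have h2 : (m + 1) • α + β = (m • α + β) + α := by rw [add_smul, one_smul]; abel
      rw [hF, h2]
      refine hR.add_mem _ ((hF _).1 h1) _ hα ⟨fun h0 => ?_, ?_⟩
      · refine hR.not_both α hα ?_
        rw [← eq_neg_of_add_eq_zero_left h0]
        exact (hF _).1 h1
      · rw [← h2]
        exact (hn β (hFr β hβ)).2 (m + 1) hm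
  set s : (j →ₗ[ℝ] ℂ) → (j →ₗ[ℝ] ℂ) := fun β => (-n β).toNat • α + β with hs
  set N := F.filter fun β => n β < 0 with hN
  have hsF : ∀ β ∈ N, s β ∈ F := by
    intro β hβ
    rw [hN, Finset.mem_filter] at hβ
    exact hrefl β hβ.1 _ (by omega)
  have hns : ∀ β ∈ N, n (s β) = -n β := by
    intro β hβ
    have h1 := (hn (s β) (hFr _ (hsF β hβ))).1
    rw [hN, Finset.mem_filter] at hβ
    have h2 := (hn β (hFr β hβ.1)).1
    have h3 : realForm (s β) w = (-n β).toNat * b + realForm β w := by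
      rw [← hαα]
      simp [realForm_apply, hs]; ring
    rw [h3] at h1
    have h5 : ((n (s β) : ℝ)) * b = ((-n β : ℤ) : ℝ) * b := by
      rw [← h1]
      have h4' : ((-n β).toNat : ℝ) = -(n β : ℝ) := by
        rw [← Int.cast_natCast, Int.toNat_of_nonneg (by omega), Int.cast_neg]
      rw [h4']
      push_cast
      linear_combination h2
    exact_mod_cast mul_right_cancel₀ hpos.ne' h5
  have hsα : ∀ β ∈ N, s β ≠ α := by
    intro β hβ h
    have h1 := hns β hβ
    rw [hN, Finset.mem_filter] at hβ
    have h2 : β = α := by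
      refine hmul β hβ.1 (1 - ((-n β).toNat : ℂ)) fun X => ?_
      have h3 := LinearMap.congr_fun h X
      simp [hs] at h3
      rw [sub_mul, one_mul]
      linear_combination h3
    rw [h2, hnα] at hβ
    omega
  have hinj : Set.InjOn s N := by
    intro β hβ β' hβ' h
    have h1 := hns β hβ
    have h2 := hns β' hβ'
    rw [h] at h1
    have h3 : n β = n β' := by omega
    simp only [hs, h3] at h
    exact add_left_cancel h
  -- the positive terms contain `2` for `α` and the opposites of the negative terms
  have hsum : 2 ≤ ∑ β ∈ F, n β := by
    have e1 := Finset.sum_filter_add_sum_filter_not F (fun β => n β < 0) n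
    have hαi : α ∉ N.image s := by
      rw [Finset.mem_image]
      rintro ⟨β, hβ, h⟩
      exact hsα β hβ h
    have e2 : ∑ β ∈ insert α (N.image s), n β ≤ ∑ β ∈ F.filter (fun β => ¬ n β < 0), n β := by
      refine Finset.sum_le_sum_of_subset_of_nonneg ?_ ?_
      · intro β hβ
        rw [Finset.mem_insert, Finset.mem_image] at hβ
        rw [Finset.mem_filter]
        rcases hβ with rfl | ⟨γ, hγ, rfl⟩
        · exact ⟨(hF _).2 hα, by omega⟩
        · refine ⟨hsF γ hγ, ?_⟩
          have h1 := hns γ hγ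
          rw [hN, Finset.mem_filter] at hγ
          omega
      · intro β hβ _
        rw [Finset.mem_filter] at hβ
        omega
    rw [Finset.sum_insert hαi, Finset.sum_image hinj, hnα, Finset.sum_congr rfl hns,
      Finset.sum_neg_distrib] at e2
    rw [← hN] at e1
    omega
  have h2 : 2 * ∑ β ∈ F, realForm β w = (∑ β ∈ F, n β : ℤ) * b := by
    rw [Finset.mul_sum, Int.cast_sum, Finset.sum_mul]
    exact Finset.sum_congr rfl fun β hβ => (hn β (hFr β hβ)).1
  have h3 : (0 : ℝ) < (∑ β ∈ F, n β : ℤ) := by exact_mod_cast (by omega : 0 < ∑ β ∈ F, n β)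
  have h4 := mul_pos h3 hpos
  linarith

/-- The vector of `𝔧` representing the sum of the positive roots: it is regular, and positive
systems are recovered from it. -/
lemma exists_regular {R' : Set (j →ₗ[ℝ] ℂ)} (hR : IsPositiveSystem (rootsJ j) R') :
    ∃ X : j, (∀ α ∈ R', 0 < realForm α X) ∧
      ∀ Y : j, Bθ θ (X : g) (Y : g) = ∑ᶠ α ∈ R', realForm α Y := by
  classical
  have hfin : R'.Finite := (finite_rootsJ j).subset hR.subset
  obtain ⟨X, hX⟩ := exists_riesz hθ (∑ α ∈ hfin.toFinset, realForm α)
  refine ⟨X, fun α hα => ?_, fun Y => ?_⟩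
  · obtain ⟨w, hw⟩ := exists_riesz hθ (realForm α)
    have h := sum_pairing_pos hθ ha hR hfin.toFinset (fun α => by simp) hα hw
    rw [← hw, hθ.Bθ_comm, hX, LinearMap.sum_apply]
    exact h
  · rw [hX, LinearMap.sum_apply, finsum_mem_eq_finite_toFinset_sum _ hfin]

end Regular

/-! ### Restricted roots and the minimal parabolic subalgebra -/

section RestrictedRoots

/-- A nonzero subspace of `g_c` stable under `𝔧_c` contains a root vector or an element of
`𝔧_c`. -/
lemma exists_rootSpaceJ_inf {g : Type*} [LieRing g] [LieAlgebra ℝ g] [FiniteDimensional ℝ g]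
    [LieAlgebra.IsKilling ℝ g] (j : LieSubalgebra ℝ g) [hj : j.IsCartanSubalgebra]
    (V : Submodule ℂ (ℂ ⊗[ℝ] g)) (hV : V ≠ ⊥)
    (h : ∀ X : j, ∀ Z ∈ V, ⁅(1 : ℂ) ⊗ₜ[ℝ] (X : g), Z⁆ ∈ V) :
    ∃ α : j →ₗ[ℝ] ℂ, ∃ Z ∈ V, Z ≠ 0 ∧ Z ∈ rootSpaceJ j α := by
  let V' : LieSubmodule ℂ (subalgC j) (ℂ ⊗[ℝ] g) :=
    { V with
      lie_mem := by
        intro x Z hZ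
        change ⁅(x : ℂ ⊗[ℝ] g), Z⁆ ∈ V
        rw [eq_re_add_im (x : ℂ ⊗[ℝ] g), add_lie, smul_lie]
        have hm := mem_subalgC.1 x.2
        exact V.add_mem (h ⟨_, hm.1⟩ Z hZ) (V.smul_mem _ (h ⟨_, hm.2⟩ Z hZ)) }
  have hne : Nonempty (LieModule.Weight ℂ (subalgC j) V') := by
    by_contra hcon
    rw [not_nonempty_iff] at hcon
    have h1 := LieModule.iSup_genWeightSpace_eq_top' ℂ (subalgC j) V'
    rw [iSup_of_empty] at h1
    apply hV
    rw [eq_bot_iff]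
    intro Z hZ
    have h2 : (⟨Z, hZ⟩ : V') ∈ (⊥ : LieSubmodule ℂ (subalgC j) V') := by rw [h1]; trivial
    rw [LieSubmodule.mem_bot] at h2
    exact congrArg Subtype.val h2
  obtain ⟨χ⟩ := hne
  obtain ⟨Z, h0, hZ⟩ := LieModule.exists_forall_lie_eq_smul ℂ (subalgC j) V' χ
  refine ⟨resC j χ.toLinear, Z, Z.2, fun hh => h0 (Subtype.ext hh), fun X => ?_⟩
  exact congrArg Subtype.val (hZ ⟨(1 : ℂ) ⊗ₜ[ℝ] (X : g), one_tmul_mem_subalgC X⟩)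

variable {E : Type*} [NormedAddCommGroup E] [NormedSpace ℝ E] [FiniteDimensional ℝ E]
  [CompleteSpace E]
  {G : Type*} [Group G] [TopologicalSpace G] [ChartedSpace E G] [LieGroup 𝓘(ℝ, E) ∞ G]
  [LieAlgebra.IsKilling ℝ (LieAlg E G)]

namespace Choices

variable (c : Choices E G)

instance instIsCartan : c.j.IsCartanSubalgebra := c.j_cartan

lemma mem_a {X : LieAlg E G} : X ∈ c.a ↔ X ∈ c.j ∧ c.θ X = -X := Iff.rfl

/-- A regular vector of `𝔧` on which the positive roots are positive, in the sense of
`Choices.reg_pos`. -/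
noncomputable def reg : c.j :=
  Classical.choose (exists_regular c.θ_cartan c.a_maximal c.posJ_positive)

lemma reg_spec (Y : c.j) : Bθ c.θ (c.reg : LieAlg E G) Y = ∑ᶠ α ∈ c.posJ, realForm α Y :=
  (Classical.choose_spec (exists_regular c.θ_cartan c.a_maximal c.posJ_positive)).2 Y

/-- The component of the regular vector in `𝔞`. -/
noncomputable def A₀ : c.j :=
  ⟨(2⁻¹ : ℝ) • ((c.reg : LieAlg E G) - c.θ c.reg),
    (c.θ_cartan.half_sub_mem_of_mem c.a_maximal c.reg.2).1⟩

/-- The component of the regular vector in `𝔱 = 𝔧 ∩ 𝔨`. -/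
noncomputable def T₀ : c.j :=
  ⟨(2⁻¹ : ℝ) • ((c.reg : LieAlg E G) + c.θ c.reg), c.θ_cartan.half_add_mem c.a_maximal c.reg.2⟩

lemma reg_eq : c.reg = c.T₀ + c.A₀ :=
  Subtype.ext (IsCartanInvolution.eq_half_add_half (θ := c.θ) _)

lemma A₀_mem : (c.A₀ : LieAlg E G) ∈ c.a :=
  c.θ_cartan.half_sub_mem_of_mem c.a_maximal c.reg.2

lemma theta_T₀ : c.θ (c.T₀ : LieAlg E G) = c.T₀ := c.θ_cartan.half_add_fixed _

lemma im_eq_zero {α : c.j →ₗ[ℝ] ℂ} (hα : α ∈ rootsJ c.j) {X : LieAlg E G} (hX : X ∈ c.a) :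
    (α ⟨X, hX.1⟩).im = 0 := im_root_eq_zero c.θ_cartan hα ⟨X, hX.1⟩ hX.2

lemma re_eq_zero {α : c.j →ₗ[ℝ] ℂ} (hα : α ∈ rootsJ c.j) {X : c.j}
    (hX : c.θ (X : LieAlg E G) = X) : (α X).re = 0 := re_root_eq_zero c.θ_cartan hα X hX

/-- Positivity of the positive roots on the regular vector. -/
lemma reg_pos {α : c.j →ₗ[ℝ] ℂ} (hα : α ∈ c.posJ) : 0 < (α c.A₀).re + (α c.T₀).im := by
  have h1 : 0 < realForm α c.reg :=
    (Classical.choose_spec (exists_regular c.θ_cartan c.a_maximal c.posJ_positive)).1 α hα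
  have hα' := c.posJ_positive.subset hα
  have h2 := c.im_eq_zero hα' c.A₀_mem
  have h3 := c.re_eq_zero hα' c.theta_T₀
  rw [c.reg_eq, map_add, realForm_apply, realForm_apply, h3] at h1
  have h4 : (α c.A₀).im = 0 := h2
  rw [h4] at h1
  linarith

/-- The restriction to `𝔞` of a root. -/
noncomputable def restrict (α : c.j →ₗ[ℝ] ℂ) : c.a →ₗ[ℝ] ℝ where
  toFun X := (α ⟨X, X.2.1⟩).re
  map_add' X Y := by
    rw [← Complex.add_re, ← map_add]; rfl
  map_smul' r X := by
    have : (⟨((r • X : c.a) : LieAlg E G), (r • X).2.1⟩ : c.j) = r • ⟨X, X.2.1⟩ := rfl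
    rw [this, map_smul]; simp

lemma restrict_apply (α : c.j →ₗ[ℝ] ℂ) (X : c.a) : c.restrict α X = (α ⟨X, X.2.1⟩).re := rfl

lemma coe_restrict {α : c.j →ₗ[ℝ] ℂ} (hα : α ∈ rootsJ c.j) (X : c.a) :
    (c.restrict α X : ℂ) = α ⟨X, X.2.1⟩ := by
  apply Complex.ext
  · simp [restrict_apply]
  · rw [c.im_eq_zero hα X.2]; simp

/-- Real and imaginary parts of root vectors are restricted root vectors, as roots are real on `𝔞`. -/
lemma reC_mem_rootSpaceA {α : c.j →ₗ[ℝ] ℂ} (hα : α ∈ rootsJ c.j) {Z : LieAlgC E G}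
    (hZ : Z ∈ rootSpaceJ c.j α) :
    reC Z ∈ rootSpaceA c.a (c.restrict α) ∧ imC Z ∈ rootSpaceA c.a (c.restrict α) := by
  constructor
  · intro X
    have h := lie_reC hZ ⟨X, X.2.1⟩
    rw [c.im_eq_zero hα X.2, zero_smul, sub_zero] at h
    exact h
  · intro X
    have h := lie_imC hZ ⟨X, X.2.1⟩
    rw [c.im_eq_zero hα X.2, zero_smul, add_zero] at h
    exact h

lemma restrict_mem {α : c.j →ₗ[ℝ] ℂ} (hα : α ∈ rootsJ c.j) (h0 : c.restrict α ≠ 0) :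
    c.restrict α ∈ rootsA c.a := by
  refine ⟨h0, fun hbot => ?_⟩
  obtain ⟨Z, hZ, hZ0⟩ := exists_mem_rootSpaceJ hα
  have h := c.reC_mem_rootSpaceA hα hZ
  rw [hbot, Submodule.mem_bot, Submodule.mem_bot] at h
  exact hZ0 (ext_re_im (by simpa using h.1) (by simpa using h.2))

lemma restrict_mem_posA_iff {α : c.j →ₗ[ℝ] ℂ} (hα : α ∈ rootsJ c.j) (h0 : c.restrict α ≠ 0) :
    α ∈ c.posJ ↔ c.restrict α ∈ c.posA :=
  c.compatible α hα (c.restrict α) (c.restrict_mem hα h0)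
    fun X hX => (c.coe_restrict hα ⟨X, hX⟩).symm

/-- Every restricted root is the restriction of a root. -/
lemma exists_restrict_eq {β : c.a →ₗ[ℝ] ℝ} (hβ : β ∈ rootsA c.a) :
    ∃ α ∈ rootsJ c.j, c.restrict α = β := by
  obtain ⟨Y, hY, hY0⟩ := (Submodule.ne_bot_iff _).1 hβ.2
  let V : Submodule ℂ (LieAlgC E G) := (rootSpaceA c.a β).baseChange ℂ
  have hV : V ≠ ⊥ := by
    refine (Submodule.ne_bot_iff _).2 ⟨(1 : ℂ) ⊗ₜ[ℝ] Y, ?_, fun h => hY0 ?_⟩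
    · exact Submodule.tmul_mem_baseChange_of_mem _ hY
    · simpa using congrArg reC h
  have hst : ∀ X : c.j, ∀ W ∈ rootSpaceA c.a β, ⁅(X : LieAlg E G), W⁆ ∈ rootSpaceA c.a β := by
    intro X W hW A
    rw [leibniz_lie, lie_eq_zero_of_mem_cartan c.j A.2.1 X.2, zero_lie, zero_add, hW A, lie_smul]
  obtain ⟨α, Z, hZV, hZ0, hZ⟩ := exists_rootSpaceJ_inf c.j V hV (by
    intro X Z hZ
    rw [mem_baseChange_iff_re_im] at hZ ⊢
    rw [reC_lie, imC_lie]
    exact ⟨hst X _ hZ.1, hst X _ hZ.2⟩)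
  rw [mem_baseChange_iff_re_im] at hZV
  have hval : ∀ X : c.a, α ⟨X, X.2.1⟩ = (β X : ℂ) := by
    intro X
    have h1 := mem_rootSpaceJ.1 hZ ⟨X, X.2.1⟩
    have h2 : ⁅(1 : ℂ) ⊗ₜ[ℝ] (X : LieAlg E G), Z⁆ = (β X : ℂ) • Z := by
      apply ext_re_im
      · rw [reC_lie, reC_smul, hZV.1 X]; simp
      · rw [imC_lie, imC_smul, hZV.2 X]; simp
    have h3 : (α ⟨X, X.2.1⟩ - (β X : ℂ)) • Z = 0 := by
      rw [sub_smul, ← h1, ← h2, sub_self]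
    exact sub_eq_zero.1 ((smul_eq_zero.1 h3).resolve_right hZ0)
  have hres : c.restrict α = β := by
    ext X
    rw [restrict_apply, hval X, Complex.ofReal_re]
  refine ⟨α, ⟨fun h => hβ.1 ?_, (Submodule.ne_bot_iff _).2 ⟨Z, hZ, hZ0⟩⟩, hres⟩
  rw [← hres, h]
  ext X; rfl

lemma restrict_conjRoot (α : c.j →ₗ[ℝ] ℂ) : c.restrict (conjRoot α) = c.restrict α := by
  ext X; simp [restrict_apply, conjRoot_apply]

/-- The positive restricted roots are positive on `A₀`. -/
lemma A₀_pos {β : c.a →ₗ[ℝ] ℝ} (hβ : β ∈ c.posA) : 0 < β ⟨c.A₀, c.A₀_mem⟩ := by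
  have hβ' : β ∈ rootsA c.a := c.posA_positive.subset hβ
  obtain ⟨α, hα, rfl⟩ := c.exists_restrict_eq hβ'
  have h1 := c.reg_pos ((c.restrict_mem_posA_iff hα hβ'.1).2 hβ)
  -- `α` and its conjugate are both positive and have the same real part and opposite imaginary parts
  have h2 := c.reg_pos ((c.restrict_mem_posA_iff (conjRoot_mem hα)
    (by rw [restrict_conjRoot]; exact hβ'.1)).2 (by rw [restrict_conjRoot]; exact hβ))
  rw [conjRoot_apply, conjRoot_apply, Complex.conj_re, Complex.conj_im] at h2
  rw [restrict_apply]
  change 0 < (α c.A₀).re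
  linarith

/-- The centralizer `𝔩` of `𝔞` in `g`. -/
noncomputable def l : Submodule ℝ (LieAlg E G) := rootSpaceA c.a 0

lemma mem_l {X : LieAlg E G} : X ∈ c.l ↔ ∀ A ∈ c.a, ⁅A, X⁆ = 0 := by
  constructor
  · intro h A hA
    simpa using h ⟨A, hA⟩
  · intro h A
    simpa using h A A.2

lemma j_le_l : c.j.toSubmodule ≤ c.l := fun _ hX =>
  c.mem_l.2 fun _ hA => lie_eq_zero_of_mem_cartan c.j hA.1 hX

/-- The sum of the root spaces of the negative restricted roots. -/
noncomputable def nMinus : Submodule ℝ (LieAlg E G) :=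
  ⨆ (β : c.a →ₗ[ℝ] ℝ) (_ : β ∈ c.posA), rootSpaceA c.a (-β)

/-- The restricted root space decomposition `𝔤 = 𝔩 + 𝔫 + 𝔫⁻`. -/
lemma l_sup_n_sup_nMinus : c.l ⊔ c.n ⊔ c.nMinus = ⊤ := by
  rw [eq_top_iff]
  have hc : (⊤ : Submodule ℂ (LieAlgC E G)) ≤ (c.l ⊔ c.n ⊔ c.nMinus).baseChange ℂ := by
    rw [← cartan_sup_rootSpaceJ c.j]
    refine sup_le (fun Z hZ => ?_) (iSup₂_le fun α hα Z hZ => ?_)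
    · rw [mem_baseChange_iff_re_im] at hZ ⊢
      exact ⟨Submodule.mem_sup_left (Submodule.mem_sup_left (c.j_le_l hZ.1)),
        Submodule.mem_sup_left (Submodule.mem_sup_left (c.j_le_l hZ.2))⟩
    · have key : rootSpaceA c.a (c.restrict α) ≤ c.l ⊔ c.n ⊔ c.nMinus := by
        by_cases h0 : c.restrict α = 0
        · rw [h0]; exact le_sup_of_le_left le_sup_left
        · rcases c.posA_positive.pos_or_neg _ (c.restrict_mem hα h0) with h | h
          · exact le_sup_of_le_left (le_sup_of_le_right
              (le_iSup₂_of_le (c.restrict α) h le_rfl))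
          · refine le_sup_of_le_right (le_iSup₂_of_le (-c.restrict α) h ?_)
            exact (congrArg (rootSpaceA c.a) (neg_neg (c.restrict α)).symm).le
      rw [mem_baseChange_iff_re_im]
      have h := c.reC_mem_rootSpaceA hα hZ
      exact ⟨key h.1, key h.2⟩
  intro X _
  have h : (1 : ℂ) ⊗ₜ[ℝ] X ∈ (c.l ⊔ c.n ⊔ c.nMinus).baseChange ℂ := hc trivial
  rw [mem_baseChange_iff_re_im] at h
  simpa using h.1

/-- The eigenspaces of `ad A₀`. -/
noncomputable def eig (ν : ℝ) : Submodule ℝ (LieAlg E G) :=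
  Module.End.eigenspace (LieAlgebra.ad ℝ (LieAlg E G) (c.A₀ : LieAlg E G)) ν

lemma mem_eig {ν : ℝ} {X : LieAlg E G} : X ∈ c.eig ν ↔ ⁅(c.A₀ : LieAlg E G), X⁆ = ν • X :=
  Module.End.mem_eigenspace_iff

lemma rootSpaceA_le_eig (β : c.a →ₗ[ℝ] ℝ) : rootSpaceA c.a β ≤ c.eig (β ⟨c.A₀, c.A₀_mem⟩) :=
  fun _ hX => c.mem_eig.2 (hX ⟨c.A₀, c.A₀_mem⟩)

lemma disjoint_eig {s t : Set ℝ} (h : Disjoint s t) :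
    Disjoint (⨆ ν ∈ s, c.eig ν) (⨆ ν ∈ t, c.eig ν) :=
  (Module.End.eigenspaces_iSupIndep _).disjoint_biSup_biSup h

lemma l_le_eig : c.l ≤ c.eig 0 := fun X hX => c.mem_eig.2 (by
  rw [c.mem_l.1 hX _ c.A₀_mem, zero_smul])

lemma n_le_eig : c.n ≤ ⨆ ν ∈ Set.Ioi (0 : ℝ), c.eig ν :=
  iSup₂_le fun β hβ => (c.rootSpaceA_le_eig β).trans
    (le_iSup₂_of_le (β ⟨c.A₀, c.A₀_mem⟩) (c.A₀_pos hβ) le_rfl)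

lemma nMinus_le_eig : c.nMinus ≤ ⨆ ν ∈ Set.Iio (0 : ℝ), c.eig ν :=
  iSup₂_le fun β hβ => (c.rootSpaceA_le_eig (-β)).trans
    (le_iSup₂_of_le (-(β ⟨c.A₀, c.A₀_mem⟩)) (neg_lt_zero.2 (c.A₀_pos hβ)) le_rfl)

lemma exists_decomp (X : LieAlg E G) :
    ∃ Y ∈ c.l, ∃ U ∈ c.n, ∃ U' ∈ c.nMinus, X = Y + U + U' := by
  have h : X ∈ c.l ⊔ c.n ⊔ c.nMinus := by rw [l_sup_n_sup_nMinus]; trivial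
  obtain ⟨Z, hZ, U', hU', rfl⟩ := Submodule.mem_sup.1 h
  obtain ⟨Y, hY, U, hU, rfl⟩ := Submodule.mem_sup.1 hZ
  exact ⟨Y, hY, U, hU, U', hU', rfl⟩

lemma eig_le_biSup {s : Set ℝ} {ν : ℝ} (h : ν ∈ s) : c.eig ν ≤ ⨆ ν ∈ s, c.eig ν :=
  le_iSup₂_of_le ν h le_rfl

lemma biSup_eig_mono {s t : Set ℝ} (h : s ⊆ t) : (⨆ ν ∈ s, c.eig ν) ≤ ⨆ ν ∈ t, c.eig ν :=
  iSup₂_le fun _ hν => c.eig_le_biSup (h hν)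

lemma eq_zero_of_disjoint {s t : Set ℝ} (h : Disjoint s t) {X : LieAlg E G}
    (h1 : X ∈ ⨆ ν ∈ s, c.eig ν) (h2 : X ∈ ⨆ ν ∈ t, c.eig ν) : X = 0 :=
  Submodule.disjoint_def.1 (c.disjoint_eig h) X h1 h2

/-- `A₀` is regular in `𝔞`: its centralizer is that of `𝔞`. -/
lemma eig_zero : c.eig 0 = c.l := by
  refine le_antisymm (fun X hX => ?_) c.l_le_eig
  obtain ⟨Y, hY, U, hU, U', hU', rfl⟩ := c.exists_decomp X
  have h0 : U + U' = 0 := by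
    refine c.eq_zero_of_disjoint (s := {0}) (t := Set.Ioi 0 ∪ Set.Iio 0) (by simp) ?_ ?_
    · refine c.eig_le_biSup (Set.mem_singleton 0) ?_
      have : U + U' = (Y + U + U') - Y := by abel
      rw [this]
      exact sub_mem hX (c.l_le_eig hY)
    · exact add_mem (c.biSup_eig_mono Set.subset_union_left (c.n_le_eig hU))
        (c.biSup_eig_mono Set.subset_union_right (c.nMinus_le_eig hU'))
  rwa [add_assoc, h0, add_zero]

/-- `𝔫` is the sum of the eigenspaces of `ad A₀` with positive eigenvalue. -/
lemma n_eq : c.n = ⨆ ν ∈ Set.Ioi (0 : ℝ), c.eig ν := by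
  refine le_antisymm c.n_le_eig fun X hX => ?_
  obtain ⟨Y, hY, U, hU, U', hU', rfl⟩ := c.exists_decomp X
  have h0 : Y + U' = 0 := by
    refine c.eq_zero_of_disjoint (s := Set.Ioi 0) (t := Set.Iic 0)
      (Set.disjoint_left.2 fun x h1 h2 => absurd (Set.mem_Iic.1 h2) (not_le.2 h1)) ?_ ?_
    · have : Y + U' = (Y + U + U') - U := by abel
      rw [this]
      exact sub_mem hX (c.n_le_eig hU)
    · exact add_mem (c.eig_le_biSup Set.self_mem_Iic (c.l_le_eig hY))
        (c.biSup_eig_mono Set.Iio_subset_Iic_self (c.nMinus_le_eig hU'))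
  have : Y + U + U' = U + (Y + U') := by abel
  rwa [this, h0, add_zero]

lemma iSup_eig : ⨆ ν, c.eig ν = ⊤ := by
  rw [eq_top_iff, ← l_sup_n_sup_nMinus]
  have h : ∀ s : Set ℝ, (⨆ ν ∈ s, c.eig ν) ≤ ⨆ ν, c.eig ν := fun s =>
    iSup₂_le fun ν _ => le_iSup c.eig ν
  exact sup_le (sup_le (c.l_le_eig.trans (le_iSup c.eig 0)) (c.n_le_eig.trans (h _)))
    (c.nMinus_le_eig.trans (h _))

lemma lie_mem_eig {ν μ : ℝ} {X Y : LieAlg E G} (hX : X ∈ c.eig ν) (hY : Y ∈ c.eig μ) :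
    ⁅X, Y⁆ ∈ c.eig (ν + μ) := by
  rw [mem_eig] at hX hY ⊢
  rw [leibniz_lie, hX, hY, smul_lie, lie_smul, add_smul]

/-- The minimal parabolic subalgebra `𝔭 = 𝔩 + 𝔫`. -/
noncomputable def p : Submodule ℝ (LieAlg E G) := c.l ⊔ c.n

lemma p_eq : c.p = ⨆ ν ∈ Set.Ici (0 : ℝ), c.eig ν := by
  rw [p, ← eig_zero, n_eq]
  refine le_antisymm (sup_le (c.eig_le_biSup Set.self_mem_Ici)
    (c.biSup_eig_mono Set.Ioi_subset_Ici_self)) (iSup₂_le fun ν hν => ?_)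
  rcases (Set.mem_Ici.1 hν).eq_or_lt with h | h
  · rw [← h]; exact le_sup_left
  · exact le_sup_of_le_right (c.eig_le_biSup h)

lemma rootSpaceA_le_p {α : c.j →ₗ[ℝ] ℂ} (hα : α ∈ c.posJ) :
    rootSpaceA c.a (c.restrict α) ≤ c.p := by
  by_cases h0 : c.restrict α = 0
  · rw [h0]; exact le_sup_left
  · exact le_sup_of_le_right (le_iSup₂_of_le (c.restrict α)
      ((c.restrict_mem_posA_iff (c.posJ_positive.subset hα) h0).1 hα) le_rfl)

/-- The Borel subalgebra is contained in `𝔭_c`. -/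
lemma b_le : c.b ≤ c.p.baseChange ℂ := by
  refine sup_le (fun Z hZ => ?_) (iSup₂_le fun α hα Z hZ => ?_)
  · rw [mem_baseChange_iff_re_im] at hZ ⊢
    exact ⟨le_sup_left (a := c.l) (c.j_le_l hZ.1), le_sup_left (a := c.l) (c.j_le_l hZ.2)⟩
  · rw [mem_baseChange_iff_re_im]
    have h := c.reC_mem_rootSpaceA (c.posJ_positive.subset hα) hZ
    exact ⟨c.rootSpaceA_le_p hα h.1, c.rootSpaceA_le_p hα h.2⟩

end Choices

end RestrictedRoots

/-! ### Linear algebra of definite forms -/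

section LinearTools

lemma exp_apply_of_apply_eq_smul {𝕜 : Type*} [RCLike 𝕜] {V : Type*} [NormedAddCommGroup V]
    [NormedSpace 𝕜 V] [CompleteSpace V] {D : V →L[𝕜] V} {ν : 𝕜} {v : V} (h : D v = ν • v) :
    exp D v = (exp ν : 𝕜) • v := by
  have h1 := (NormedSpace.exp_series_hasSum_exp' (𝕂 := 𝕜) D).mapL
    (ContinuousLinearMap.apply 𝕜 V v)
  have h2 := (NormedSpace.exp_series_hasSum_exp' (𝕂 := 𝕜) ν).smul_const v
  have hpow : ∀ n : ℕ, (D ^ n) v = ν ^ n • v := by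
    intro n
    induction n with
    | zero => simp
    | succ n ih => rw [pow_succ, mul_apply_eq_comp, h, map_smul, ih, smul_smul,
        pow_succ']
  refine HasSum.unique h1 ?_
  convert h2 using 2 with n
  simp [hpow, smul_smul]

lemma exp_apply_mem {𝕜 : Type*} [RCLike 𝕜] {V : Type*} [NormedAddCommGroup V]
    [NormedSpace 𝕜 V] [FiniteDimensional 𝕜 V] [CompleteSpace V] {D : V →L[𝕜] V}
    {S : Submodule 𝕜 V} (h : ∀ v ∈ S, D v ∈ S) {v : V} (hv : v ∈ S) : exp D v ∈ S := by
  have h1 := (NormedSpace.exp_series_hasSum_exp' (𝕂 := 𝕜) D).mapL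
    (ContinuousLinearMap.apply 𝕜 V v)
  have hpow : ∀ n : ℕ, (D ^ n) v ∈ S := by
    intro n
    induction n with
    | zero => simpa
    | succ n ih => rw [pow_succ', mul_apply_eq_comp]; exact h _ ih
  refine (Submodule.closed_of_finiteDimensional S).mem_of_tendsto h1
    (Filter.Eventually.of_forall fun s => Submodule.sum_mem _ fun n _ => ?_)
  simpa using S.smul_mem _ (hpow n)

/-- The spectral theorem for an operator that is symmetric for a positive definite form. -/
lemma iSup_eigenspace_eq_top_of_symmetric {V : Type*} [AddCommGroup V] [Module ℝ V]
    [FiniteDimensional ℝ V] (B : LinearMap.BilinForm ℝ V) (hsymm : ∀ x y, B x y = B y x)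
    (hpos : ∀ x, x ≠ 0 → 0 < B x x) (T : V →ₗ[ℝ] V) (hT : ∀ x y, B (T x) y = B x (T y)) :
    ⨆ μ, Module.End.eigenspace T μ = ⊤ := by
  let core : InnerProductSpace.Core ℝ V :=
    { inner := fun x y => B x y
      conj_inner_symm := fun x y => by simp [hsymm x y]
      re_inner_nonneg := fun x => by
        by_cases hx : x = 0
        · simp [hx]
        · exact (hpos x hx).le
      add_left := fun x y z => by simp
      smul_left := fun x y r => by simp
      definite := fun x hx => by
        by_contra h
        exact (hpos x h).ne' hx }
  let _ : NormedAddCommGroup V := core.toNormedAddCommGroup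
  let _ : InnerProductSpace ℝ V := InnerProductSpace.ofCore core.toCore
  have h : T.IsSymmetric := fun x y => hT x y
  have h1 := h.orthogonalComplement_iSup_eigenspaces_eq_bot
  exact (Submodule.orthogonal_eq_bot_iff).1 h1

/-- The operator norm is bounded on the isometries of a positive definite form. -/
lemma exists_le_of_pos {V : Type*} [NormedAddCommGroup V] [NormedSpace ℝ V]
    [FiniteDimensional ℝ V] (B : LinearMap.BilinForm ℝ V) (hpos : ∀ x, x ≠ 0 → 0 < B x x) :
    ∃ R > 0, ∀ D : V →L[ℝ] V, (∀ x, B (D x) (D x) = B x x) → ‖D‖ ≤ R := by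
  have : ProperSpace V := FiniteDimensional.proper ℝ V
  let B' : V →ₗ[ℝ] (V →L[ℝ] ℝ) := (LinearMap.toContinuousLinearMap : (V →ₗ[ℝ] ℝ) ≃ₗ[ℝ] _) ∘ₗ B
  let C : V →L[ℝ] V →L[ℝ] ℝ := LinearMap.toContinuousLinearMap B'
  have hC : ∀ x y, C x y = B x y := fun x y => rfl
  have hcont : Continuous fun x : V => B x x := by
    have : Continuous fun x : V => C x x := by fun_prop
    simpa [hC] using this
  obtain ⟨m, hm, hle⟩ := (isCompact_sphere (0 : V) 1).exists_forall_le' hcont.continuousOn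
    (a := 0) (fun x hx => hpos x (by rintro rfl; simp at hx))
  have h1 : ∀ x, m * ‖x‖ ^ 2 ≤ B x x := by
    intro x
    by_cases hx : x = 0
    · simp [hx]
    have hn : 0 < ‖x‖ := norm_pos_iff.2 hx
    have := hle (‖x‖⁻¹ • x) (by simp [norm_smul, hn.ne'])
    simp only [map_smul, LinearMap.smul_apply, smul_eq_mul] at this
    calc m * ‖x‖ ^ 2 ≤ (‖x‖⁻¹ * (‖x‖⁻¹ * B x x)) * ‖x‖ ^ 2 := by gcongr
      _ = B x x := by field_simp
  have h2 : ∀ x, B x x ≤ ‖C‖ * ‖x‖ ^ 2 := by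
    intro x
    rw [← hC]
    calc C x x ≤ ‖C x x‖ := le_abs_self _
      _ ≤ ‖C‖ * ‖x‖ * ‖x‖ := C.le_opNorm₂ x x
      _ = _ := by ring
  refine ⟨Real.sqrt (‖C‖ / m + 1), by positivity, fun D hD => ?_⟩
  refine ContinuousLinearMap.opNorm_le_bound _ (Real.sqrt_nonneg _) fun x => ?_
  have h3 : m * ‖D x‖ ^ 2 ≤ ‖C‖ * ‖x‖ ^ 2 := (h1 (D x)).trans ((hD x).trans_le (h2 x))
  rw [← abs_of_nonneg (norm_nonneg (D x)), ← Real.sqrt_sq_eq_abs,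
    ← Real.sqrt_sq (norm_nonneg x), ← Real.sqrt_mul (by positivity)]
  refine Real.sqrt_le_sqrt ?_
  rw [add_mul, div_mul_eq_mul_div, one_mul]
  have h4 : ‖D x‖ ^ 2 ≤ ‖C‖ * ‖x‖ ^ 2 / m := by
    rw [le_div_iff₀ hm]; linarith
  nlinarith [sq_nonneg ‖x‖]

end LinearTools

/-! ### Paths determined by their image under the adjoint representation -/

section GroupTools

variable {E : Type*} [NormedAddCommGroup E] [NormedSpace ℝ E] [FiniteDimensional ℝ E]
  [CompleteSpace E]
  {G : Type*} [Group G] [TopologicalSpace G] [ChartedSpace E G] [LieGroup 𝓘(ℝ, E) ∞ G]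

variable (E) in
/-- `Ad g` as an automorphism of the Lie algebra. -/
noncomputable def AdEquiv (g : G) : LieAlg E G ≃ₗ⁅ℝ⁆ LieAlg E G where
  toFun := Ad ℝ E g
  map_add' := map_add _
  map_smul' := map_smul _
  map_lie' := Ad_lie g _ _
  invFun := Ad ℝ E g⁻¹
  left_inv X := Ad_injective_of_inv g X
  right_inv X := Ad_apply_inv g X

lemma killingForm_Ad (g : G) (X Y : LieAlg E G) :
    killingForm ℝ (LieAlg E G) (Ad ℝ E g X) (Ad ℝ E g Y) = killingForm ℝ (LieAlg E G) X Y :=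
  LieAlgebra.killingForm_of_equiv_apply (AdEquiv E g) X Y

lemma eq_zero_of_killingForm [LieAlgebra.IsKilling ℝ (LieAlg E G)] {X : LieAlg E G}
    (h : ∀ Y, killingForm ℝ (LieAlg E G) Y X = 0) : X = 0 := by
  have : X ∈ LieIdeal.killingCompl ℝ (LieAlg E G) ⊤ := by
    rw [LieIdeal.mem_killingCompl]; exact fun Y _ => h Y
  rwa [LieAlgebra.IsKilling.killingCompl_top_eq_bot, LieSubmodule.mem_bot] at this

variable [LieAlgebra.IsKilling ℝ (LieAlg E G)] [ConnectedSpace G] [Finite (Subgroup.center G)]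

/-- Two paths in `G` with the same starting point and the same image in `Ad G` coincide. -/
lemma eq_of_Ad_eq {c c' : ℝ → G} (hc : Continuous c) (hc' : Continuous c') (h0 : c 0 = c' 0)
    (h : ∀ t, Ad ℝ E (c t) = Ad ℝ E (c' t)) (t : ℝ) : c t = c' t := by
  have := isTopologicalGroup_of_chartedSpace E G
  have := t2Space_of_chartedSpace E G
  let u : ℝ → Subgroup.center G := fun t => ⟨(c t)⁻¹ * c' t, by
    rw [← Ad_eq_one_iff (E := E), Ad_mul', ← h t, ← Ad_mul', inv_mul_cancel, Ad_one']⟩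
  have hu : Continuous u := Continuous.subtype_mk (hc.inv.mul hc') _
  have h1 := (isPreconnected_range hu).subsingleton (Set.mem_range_self t) (Set.mem_range_self 0)
  have h2 := congrArg Subtype.val h1
  simp only [u, h0, inv_mul_cancel] at h2
  exact inv_mul_eq_one.1 h2

/-- Exponentials of commuting elements multiply: both sides are paths with the same image under `Ad`,
whose kernel, the center, is finite. -/
lemma expG_add_of_lie_eq_zero {X Y : LieAlg E G} (h : ⁅X, Y⁆ = 0) :
    expG (X + Y) = expG X * expG Y := by
  have := isTopologicalGroup_of_chartedSpace E G
  have hcomm : Commute (adL ℝ E G X) (adL ℝ E G Y) := by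
    ext Z
    have := leibniz_lie X Y Z
    rw [h, zero_lie, zero_add] at this
    simpa [mul_apply_eq_comp] using this
  have key := eq_of_Ad_eq (E := E) (c := fun t : ℝ => expG (t • (X + Y)))
    (c' := fun t : ℝ => expG (t • X) * expG (t • Y)) (continuous_expG_smul _)
    ((continuous_expG_smul _).mul (continuous_expG_smul _)) (by simp [expG_zero]) (fun t => by
      let _ : NormedAlgebra ℚ (LieAlg E G →L[ℝ] LieAlg E G) := NormedAlgebra.restrictScalars ℚ ℝ _
      rw [Ad_mul', Ad_expG_smul, Ad_expG_smul, Ad_expG_smul, ← NormedSpace.exp_add_of_commute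
        ((hcomm.smul_left t).smul_right t), map_add, smul_add]) 1
  simpa using key

end GroupTools

/-! ### The maximal compact subgroup -/

section MaximalCompact

variable {E : Type*} [NormedAddCommGroup E] [NormedSpace ℝ E] [FiniteDimensional ℝ E]
  [CompleteSpace E]
  {G : Type*} [Group G] [TopologicalSpace G] [ChartedSpace E G] [LieGroup 𝓘(ℝ, E) ∞ G]
  [LieAlgebra.IsKilling ℝ (LieAlg E G)]

variable (E) in
/-- The subgroup of the `g` for which `Ad g` commutes with `θ`. -/
noncomputable def fixSubgroup (θ : LieAlg E G ≃ₗ⁅ℝ⁆ LieAlg E G) : Subgroup G where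
  carrier := {g | ∀ X, Ad ℝ E g (θ X) = θ (Ad ℝ E g X)}
  one_mem' := fun X => by simp [Ad_one']
  mul_mem' := fun {a b} ha hb X => by
    simp only [Ad_mul', mul_apply_eq_comp]
    rw [hb X, ha]
  inv_mem' := fun {a} ha X => by
    have h := ha (Ad ℝ E a⁻¹ X)
    rw [Ad_apply_inv] at h
    rw [← h, Ad_injective_of_inv]

lemma mem_fixSubgroup {θ : LieAlg E G ≃ₗ⁅ℝ⁆ LieAlg E G} {g : G} :
    g ∈ fixSubgroup E θ ↔ ∀ X, Ad ℝ E g (θ X) = θ (Ad ℝ E g X) := Iff.rfl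

lemma mem_fixSubgroup_iff_Bθ {θ : LieAlg E G ≃ₗ⁅ℝ⁆ LieAlg E G} {g : G} :
    g ∈ fixSubgroup E θ ↔ ∀ X Y, Bθ θ (Ad ℝ E g X) (Ad ℝ E g Y) = Bθ θ X Y := by
  constructor
  · intro h X Y
    rw [Bθ_apply, ← h Y, killingForm_Ad, Bθ_apply]
  · intro h X
    rw [← sub_eq_zero]
    refine eq_zero_of_killingForm fun Y => ?_
    have h1 := h (Ad ℝ E g⁻¹ Y) X
    rw [Bθ_apply, Bθ_apply, Ad_apply_inv, neg_inj, ← killingForm_Ad g (Ad ℝ E g⁻¹ Y),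
      Ad_apply_inv] at h1
    rw [map_sub, h1, sub_self]

lemma isClosed_fixSubgroup (θ : LieAlg E G ≃ₗ⁅ℝ⁆ LieAlg E G) :
    IsClosed (fixSubgroup E θ : Set G) := by
  have hθ : Continuous θ := (θ : LieAlg E G →ₗ[ℝ] LieAlg E G).continuous_of_finiteDimensional
  have : (fixSubgroup E θ : Set G) = ⋂ X, {g : G | Ad ℝ E g (θ X) = θ (Ad ℝ E g X)} := by
    ext g; simp [mem_fixSubgroup]
  rw [this]
  refine isClosed_iInter fun X => isClosed_eq ?_ ?_
  · exact continuous_Ad.clm_apply continuous_const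
  · exact hθ.comp (continuous_Ad.clm_apply continuous_const)

variable [ConnectedSpace G] [Finite (Subgroup.center G)]

/-- `Ad` maps this subgroup into the orthogonal group of `B_θ`, and `Ad` is proper because `Ad G`
is open in the automorphism group and the center of `G` is finite. -/
lemma isCompact_fixSubgroup {θ : LieAlg E G ≃ₗ⁅ℝ⁆ LieAlg E G} (hθ : IsCartanInvolution θ) :
    IsCompact (fixSubgroup E θ : Set G) := by
  have := isTopologicalGroup_of_chartedSpace E G
  have := t2Space_of_chartedSpace E G
  have : ProperSpace (LieAlg E G →L[ℝ] LieAlg E G) := FiniteDimensional.proper ℝ _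
  have : ProperSpace (LieAlg E G) := FiniteDimensional.proper ℝ _
  obtain ⟨R, hR, hbd⟩ := exists_le_of_pos (Bθ θ) fun X hX => hθ.Bθ_pos hX
  have hbound : ∀ g ∈ fixSubgroup E θ, ‖Ad ℝ E g‖ ≤ R := fun g hg =>
    hbd _ fun X => mem_fixSubgroup_iff_Bθ.1 hg X X
  obtain ⟨ρ, hρ, hex⟩ := exists_adL_of_exp (E := E) (G := G)
  -- a neighbourhood of `1` on which the logarithm is defined and small
  have hev : ∀ᶠ D in 𝓝 (1 : LieAlg E G →L[ℝ] LieAlg E G), exp (logA D) = D ∧ ‖logA D‖ ≤ ρ := by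
    filter_upwards [eventually_exp_logA, tendsto_logA.eventually (Metric.closedBall_mem_nhds 0 hρ)]
      with D h1 h2
    exact ⟨h1, by simpa using h2⟩
  obtain ⟨ε, hε, hball⟩ := Metric.eventually_nhds_iff.1 hev
  rw [isCompact_iff_ultrafilter_le_nhds]
  intro f hf
  have hfK : (fixSubgroup E θ : Set G) ∈ f := hf (mem_principal_self _)
  -- the image under `Ad` converges
  obtain ⟨D, _, hD⟩ := (isCompact_closedBall (0 : LieAlg E G →L[ℝ] LieAlg E G) R).ultrafilter_le_nhds
    (f.map (Ad ℝ E)) (by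
      rw [le_principal_iff, Ultrafilter.mem_coe, Ultrafilter.mem_map]
      filter_upwards [hfK] with g hg
      simpa using hbound g hg)
  have hnear : ∀ᶠ g in (f : Filter G), ‖Ad ℝ E g - D‖ < ε / (2 * R) := by
    have := (show Tendsto (Ad ℝ E) (f : Filter G) (𝓝 D) from hD).eventually
      (Metric.ball_mem_nhds D (show 0 < ε / (2 * R) by positivity))
    filter_upwards [this] with g hg
    rwa [← dist_eq_norm]
  obtain ⟨k₀, hk₀, hk₀K⟩ := (hnear.and hfK).exists
  have hclose : ∀ᶠ k in (f : Filter G), exp (logA (Ad ℝ E (k₀⁻¹ * k))) = Ad ℝ E (k₀⁻¹ * k) ∧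
      ‖logA (Ad ℝ E (k₀⁻¹ * k))‖ ≤ ρ := by
    filter_upwards [hnear] with k hk
    apply hball
    have e1 : Ad ℝ E (k₀⁻¹ * k) - 1 = Ad ℝ E k₀⁻¹ * (Ad ℝ E k - Ad ℝ E k₀) := by
      rw [mul_sub, ← Ad_mul', ← Ad_mul', inv_mul_cancel, Ad_one']
    rw [dist_eq_norm, e1]
    calc ‖Ad ℝ E k₀⁻¹ * (Ad ℝ E k - Ad ℝ E k₀)‖ ≤ ‖Ad ℝ E k₀⁻¹‖ * ‖Ad ℝ E k - Ad ℝ E k₀‖ :=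
          norm_mul_le _ _
      _ ≤ R * ‖(Ad ℝ E k - D) - (Ad ℝ E k₀ - D)‖ := by
          rw [sub_sub_sub_cancel_right]
          gcongr
          exact hbound _ (inv_mem hk₀K)
      _ ≤ R * (‖Ad ℝ E k - D‖ + ‖Ad ℝ E k₀ - D‖) := by gcongr; exact norm_sub_le _ _
      _ < R * (ε / (2 * R) + ε / (2 * R)) := by gcongr
      _ = ε := by field_simp; ring
  set Z : G → LieAlg E G := fun k => logG E (k₀⁻¹ * k) with hZ
  have hcen : ∀ᶠ k in (f : Filter G), (k₀ * expG (Z k))⁻¹ * k ∈ Subgroup.center G := by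
    filter_upwards [hclose] with k hk
    rw [← Ad_eq_one_iff (E := E), mul_inv_rev, mul_assoc, Ad_mul', ← hk.1]
    have e2 : adL ℝ E G (Z k) = logA (Ad ℝ E (k₀⁻¹ * k)) := by
      refine hex _ hk.2 fun X Y => ?_
      rw [hk.1]
      exact Ad_lie _ X Y
    rw [← e2, ← Ad_expG, ← Ad_mul', inv_mul_cancel, Ad_one']
  have hZb : ∀ᶠ k in (f : Filter G), ‖Z k‖ ≤ ‖adInv E G‖ * ρ := by
    filter_upwards [hclose] with k hk
    exact ((adInv E G).le_opNorm _).trans (by gcongr; exact hk.2)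
  -- along the ultrafilter, `k = k₀ exp (Z k) z` with `Z k` bounded and `z` in the finite center
  obtain ⟨Z₁, _, hZ₁⟩ := (isCompact_closedBall (0 : LieAlg E G)
    (‖adInv E G‖ * ρ)).ultrafilter_le_nhds (f.map Z) (by
      rw [le_principal_iff, Ultrafilter.mem_coe, Ultrafilter.mem_map]
      filter_upwards [hZb] with k hk
      simpa using hk)
  obtain ⟨z₁, _, hz₁⟩ := (Set.toFinite (Subgroup.center G : Set G)).isCompact.ultrafilter_le_nhds
    (f.map fun k => (k₀ * expG (Z k))⁻¹ * k) (by rw [le_principal_iff]; exact hcen)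
  have hlim : Tendsto (fun k : G => k) (f : Filter G) (𝓝 (k₀ * expG Z₁ * z₁)) := by
    have t1 : Tendsto Z (f : Filter G) (𝓝 Z₁) := hZ₁
    have t2 : Tendsto (fun k => (k₀ * expG (Z k))⁻¹ * k) (f : Filter G) (𝓝 z₁) := hz₁
    have t3 := ((continuous_expG (E := E) (G := G)).tendsto Z₁).comp t1
    have t4 := (tendsto_const_nhds (x := k₀)).mul t3
    refine (t4.mul t2).congr fun k => ?_
    simp [mul_assoc]
  refine ⟨k₀ * expG Z₁ * z₁, ?_, hlim⟩
  exact (isClosed_fixSubgroup θ).mem_of_tendsto hlim hfK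

namespace Choices

variable (c : Choices E G)

/-- `Ad k` preserves `𝔨`, hence its Killing orthogonal `𝔰`, and therefore commutes with `θ`. -/
lemma K_le : c.K ≤ fixSubgroup E c.θ := by
  intro k hk
  have hθ := c.θ_cartan
  have hfix : ∀ k ∈ c.K, ∀ X : LieAlg E G, c.θ X = X → c.θ (Ad ℝ E k X) = Ad ℝ E k X := by
    intro k hk X hX
    rw [← c.lie_K, mem_lieOf_iff] at hX ⊢
    intro t
    have h1 := c.K.mul_mem (c.K.mul_mem hk (hX t)) (c.K.inv_mem hk)
    rwa [conj_expG, map_smul] at h1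
  have hs : ∀ X : LieAlg E G, c.θ X = -X → c.θ (Ad ℝ E k X) = -Ad ℝ E k X := by
    intro X hX
    set Y := Ad ℝ E k X with hY
    set Yk : LieAlg E G := (2⁻¹ : ℝ) • (Y + c.θ Y) with hYk
    set Ys : LieAlg E G := (2⁻¹ : ℝ) • (Y - c.θ Y) with hYs
    have hk1 : c.θ Yk = Yk := hθ.half_add_fixed Y
    have hs1 : Ys ∈ cartanS c.θ := hθ.half_sub_mem Y
    have hsum : Y = Yk + Ys := IsCartanInvolution.eq_half_add_half (θ := c.θ) Y
    have horth : ∀ T A : LieAlg E G, c.θ T = T → c.θ A = -A →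
        killingForm ℝ (LieAlg E G) T A = 0 := by
      intro T A hT hA
      have := hθ.Bθ_orthogonal hT (mem_cartanS.2 hA)
      rw [Bθ_apply, hA, map_neg, neg_neg] at this
      exact this
    have e1 : killingForm ℝ (LieAlg E G) Yk Y = 0 := by
      rw [← killingForm_Ad k⁻¹, hY, Ad_injective_of_inv]
      exact horth _ _ (hfix _ (c.K.inv_mem hk) _ hk1) hX
    have e2 : Bθ c.θ Yk Yk = 0 := by
      rw [hsum, map_add, horth Yk Ys hk1 hs1, add_zero] at e1
      rw [Bθ_apply, hk1, e1, neg_zero]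
    have e3 := hθ.eq_zero_of_Bθ e2
    rw [e3, zero_add] at hsum
    rw [hsum]
    exact hs1
  intro X
  set Xk : LieAlg E G := (2⁻¹ : ℝ) • (X + c.θ X) with hXk
  set Xs : LieAlg E G := (2⁻¹ : ℝ) • (X - c.θ X) with hXs
  have hsum : X = Xk + Xs := IsCartanInvolution.eq_half_add_half (θ := c.θ) X
  have hk1 : c.θ Xk = Xk := hθ.half_add_fixed X
  have hs1 : c.θ Xs = -Xs := hθ.half_sub_mem X
  rw [hsum, map_add, map_add, map_add, map_add, hk1, hs1, hfix k hk _ hk1, hs _ hs1, map_neg]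

/-- The maximal compact subgroup is the group of all `g` for which `Ad g` commutes with `θ`. -/
lemma K_eq : c.K = fixSubgroup E c.θ :=
  le_antisymm c.K_le (c.K_maximal.2 (isCompact_fixSubgroup c.θ_cartan) c.K_le)

end Choices

end MaximalCompact

/-! ### Polar decomposition of the Cartan subgroup -/

section CartanSubgroup

variable {E : Type*} [NormedAddCommGroup E] [NormedSpace ℝ E] [FiniteDimensional ℝ E]
  [CompleteSpace E]
  {G : Type*} [Group G] [TopologicalSpace G] [ChartedSpace E G] [LieGroup 𝓘(ℝ, E) ∞ G]
  [LieAlgebra.IsKilling ℝ (LieAlg E G)]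

/-- The logarithm of a positive automorphism of the Lie algebra is a derivation. -/
lemma exists_log_of_positive {Q : LieAlg E G →L[ℝ] LieAlg E G}
    (hQ : ∀ X Y, Q ⁅X, Y⁆ = ⁅Q X, Q Y⁆)
    (htop : ⨆ μ, Module.End.eigenspace (Q : LieAlg E G →ₗ[ℝ] LieAlg E G) μ = ⊤)
    (hpos : ∀ (μ : ℝ) X, X ≠ 0 → Q X = μ • X → 0 < μ) :
    ∃ Y : LieAlg E G, ∀ (μ : ℝ) X, Q X = μ • X → ⁅Y, X⁆ = Real.log μ • X := by
  classical
  set q : Module.End ℝ (LieAlg E G) := (Q : LieAlg E G →ₗ[ℝ] LieAlg E G) with hq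
  have hfin := Module.End.finite_hasEigenvalue q
  -- the logarithm is the polynomial in `Q` which interpolates `log` at the eigenvalues of `Q`
  let pol : Polynomial ℝ := Lagrange.interpolate hfin.toFinset id Real.log
  let D : LieAlg E G →L[ℝ] LieAlg E G := LinearMap.toContinuousLinearMap (Polynomial.aeval q pol)
  have hD : ∀ (μ : ℝ) X, Q X = μ • X → D X = Real.log μ • X := by
    intro μ X hX
    by_cases h0 : X = 0
    · simp [h0]
    have hev : q.HasEigenvector μ X := ⟨Module.End.mem_eigenspace_iff.2 hX, h0⟩
    have h1 := Module.End.aeval_apply_of_hasEigenvector (p := pol) hev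
    have h2 : Polynomial.eval μ pol = Real.log μ :=
      Lagrange.eval_interpolate_at_node (i := μ) (s := hfin.toFinset) (v := id) Real.log
        (fun _ _ _ _ h => h) (by
          rw [Set.Finite.mem_toFinset]
          exact Module.End.hasEigenvalue_of_hasEigenvector hev)
    rw [h2] at h1
    exact h1
  have hder : ∀ X Y, D ⁅X, Y⁆ = ⁅D X, Y⁆ + ⁅X, D Y⁆ := by
    intro X Y
    have hX : X ∈ ⨆ μ, q.eigenspace μ := by rw [htop]; trivial
    have hY : Y ∈ ⨆ μ, q.eigenspace μ := by rw [htop]; trivial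
    induction hX using Submodule.iSup_induction' with
    | zero => simp
    | add X X' _ _ h h' => rw [add_lie, map_add, h, h', map_add, add_lie, add_lie]; abel
    | mem μ X hX =>
      induction hY using Submodule.iSup_induction' with
      | zero => simp
      | add Y Y' _ _ h h' => rw [lie_add, map_add, h, h', map_add, lie_add, lie_add]; abel
      | mem ν Y hY =>
        have hX' : Q X = μ • X := Module.End.mem_eigenspace_iff.1 hX
        have hY' : Q Y = ν • Y := Module.End.mem_eigenspace_iff.1 hY
        by_cases h0 : X = 0
        · simp [h0]
        by_cases h1 : Y = 0
        · simp [h1]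
        have h2 : Q ⁅X, Y⁆ = (μ * ν) • ⁅X, Y⁆ := by
          rw [hQ, hX', hY', smul_lie, lie_smul, smul_smul]
        rw [hD _ _ h2, hD _ _ hX', hD _ _ hY', Real.log_mul (hpos _ _ h0 hX').ne'
          (hpos _ _ h1 hY').ne', smul_lie, lie_smul, add_smul]
  obtain ⟨Y, hY⟩ := exists_eq_adL hder
  refine ⟨Y, fun μ X hX => ?_⟩
  rw [← hD μ X hX, hY, adL_apply]

variable [ConnectedSpace G] [Finite (Subgroup.center G)]

namespace Choices

variable (c : Choices E G)

lemma mem_K_iff {g : G} : g ∈ c.K ↔ ∀ X, Ad ℝ E g (c.θ X) = c.θ (Ad ℝ E g X) := by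
  rw [K_eq]; rfl

lemma mem_M_iff {g : G} : g ∈ c.M ↔ g ∈ c.K ∧ ∀ X ∈ c.a, Ad ℝ E g X = X := Iff.rfl

lemma mem_J_iff {g : G} : g ∈ c.J ↔ ∀ X ∈ c.j, Ad ℝ E g X = X := Iff.rfl

lemma expG_mem_A {X : LieAlg E G} (hX : X ∈ c.a) : expG X ∈ c.A :=
  expG_mem_analyticSubgroup hX

lemma expG_mem_J {X : LieAlg E G} (hX : X ∈ c.j) : expG X ∈ c.J := by
  rw [mem_J_iff]
  intro Y hY
  have h : adL ℝ E G X Y = (0 : ℝ) • Y := by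
    rw [adL_apply, lie_eq_zero_of_mem_cartan c.j hX hY, zero_smul]
  rw [Ad_expG, exp_apply_of_apply_eq_smul h, NormedSpace.exp_zero, one_smul]

/-- Polar decomposition of the Cartan subgroup: the positive automorphism `(Ad g)* Ad g` has a
logarithm in `ad 𝔞`. -/
lemma exists_mul_expG_mem_M {g : G} (hg : g ∈ c.J) : ∃ Z ∈ c.a, g * expG Z ∈ c.M := by
  have hθ := c.θ_cartan
  have hgj := c.mem_J_iff.1 hg
  have hgj' := c.mem_J_iff.1 (inv_mem hg)
  set B := Bθ c.θ with hB
  have hBθ : ∀ X Y, B (c.θ X) (c.θ Y) = B X Y := by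
    intro X Y
    rw [hB, Bθ_apply, Bθ_apply, LieAlgebra.killingForm_of_equiv_apply]
  -- `Q` is the composition of `Ad g` with its adjoint
  let θL : LieAlg E G →L[ℝ] LieAlg E G :=
    LinearMap.toContinuousLinearMap (c.θ : LieAlg E G →ₗ[ℝ] LieAlg E G)
  have hθL : ∀ X, θL X = c.θ X := fun X => rfl
  let Q : LieAlg E G →L[ℝ] LieAlg E G := θL * Ad ℝ E g⁻¹ * θL * Ad ℝ E g
  have hQ : ∀ X, Q X = c.θ (Ad ℝ E g⁻¹ (c.θ (Ad ℝ E g X))) := fun X => rfl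
  have hBQ : ∀ X Y, B (Q X) Y = B (Ad ℝ E g X) (Ad ℝ E g Y) := by
    intro X Y
    rw [hQ, ← hBθ, hθ.involutive, hB, Bθ_apply, hθ.involutive, ← killingForm_Ad g, Ad_apply_inv,
      hθ.Bθ_comm, Bθ_apply, LieModule.traceForm_comm]
  have hQlie : ∀ X Y, Q ⁅X, Y⁆ = ⁅Q X, Q Y⁆ := by
    intro X Y
    simp only [hQ, Ad_lie, LieEquiv.map_lie]
  have hpos : ∀ (μ : ℝ) X, X ≠ 0 → Q X = μ • X → 0 < μ := by
    intro μ X h0 hX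
    have h1 := hBQ X X
    rw [hX, map_smul, LinearMap.smul_apply, smul_eq_mul] at h1
    have h2 : 0 < B (Ad ℝ E g X) (Ad ℝ E g X) := hθ.Bθ_pos fun h => h0 (by
      rw [← Ad_injective_of_inv g X, h, map_zero])
    rw [← h1] at h2
    exact (pos_iff_pos_of_mul_pos h2).2 (hθ.Bθ_pos h0)
  have hsymm : ∀ X Y, B (Q X) Y = B X (Q Y) := by
    intro X Y
    rw [hBQ, hB, hθ.Bθ_comm X, ← hB, hBQ, hB, hθ.Bθ_comm]
  have htop : ⨆ μ, Module.End.eigenspace (Q : LieAlg E G →ₗ[ℝ] LieAlg E G) μ = ⊤ :=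
    iSup_eigenspace_eq_top_of_symmetric B hθ.Bθ_comm (fun X hX => hθ.Bθ_pos hX) _ hsymm
  obtain ⟨Y, hY⟩ := exists_log_of_positive hQlie htop hpos
  -- `Y` lies in `𝔞`
  have hQj : ∀ X ∈ c.j, Q X = X := by
    intro X hX
    rw [hQ, hgj X hX, hgj' _ (hθ.theta_mem c.a_maximal hX), hθ.involutive]
  have hYj : ∀ X ∈ c.j, ⁅Y, X⁆ = 0 := by
    intro X hX
    have := hY 1 X (by rw [hQj X hX, one_smul])
    simpa using this
  have hYmem : Y ∈ c.j := by
    have : Y ∈ c.j.normalizer := by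
      rw [LieSubalgebra.mem_normalizer_iff]
      intro X hX
      rw [hYj X hX]
      exact c.j.zero_mem
    rwa [c.j_cartan.self_normalizing] at this
  have hadsymm : ∀ X X', B ⁅Y, X⁆ X' = B X ⁅Y, X'⁆ := by
    intro X X'
    have hX : X ∈ ⨆ μ, Module.End.eigenspace (Q : LieAlg E G →ₗ[ℝ] LieAlg E G) μ := by
      rw [htop]; trivial
    have hX' : X' ∈ ⨆ μ, Module.End.eigenspace (Q : LieAlg E G →ₗ[ℝ] LieAlg E G) μ := by
      rw [htop]; trivial
    induction hX using Submodule.iSup_induction' with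
    | zero => simp
    | add X X' _ _ h h' => rw [lie_add, map_add, map_add, LinearMap.add_apply,
        LinearMap.add_apply, h, h']
    | mem μ X hX =>
      induction hX' using Submodule.iSup_induction' with
      | zero => simp
      | add Y Y' _ _ h h' => rw [lie_add, map_add, map_add, h, h']
      | mem ν X' hX' =>
        have h1 : Q X = μ • X := Module.End.mem_eigenspace_iff.1 hX
        have h2 : Q X' = ν • X' := Module.End.mem_eigenspace_iff.1 hX'
        rw [hY _ _ h1, hY _ _ h2, map_smul, map_smul, LinearMap.smul_apply]
        have h3 := hsymm X X'
        rw [h1, h2, map_smul, map_smul, LinearMap.smul_apply, smul_eq_mul, smul_eq_mul] at h3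
        by_cases h4 : μ = ν
        · rw [h4]
        · have : (μ - ν) * B X X' = 0 := by linarith
          rw [(mul_eq_zero.1 this).resolve_left (sub_ne_zero.2 h4), smul_zero, smul_zero]
  have hYθ : c.θ Y = -Y := by
    apply adL_injective (E := E) (G := G)
    ext X
    rw [adL_apply, map_neg, neg_apply, adL_apply, ← add_eq_zero_iff_eq_neg]
    apply hθ.eq_zero_of_Bθ
    set W := ⁅c.θ Y, X⁆ + ⁅Y, X⁆ with hW
    have h1 := hadsymm W X
    have h2 := hθ.Bθ_lie Y W X
    rw [hB] at h1
    have h3 : Bθ c.θ W W = Bθ c.θ W ⁅c.θ Y, X⁆ + Bθ c.θ W ⁅Y, X⁆ := by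
      conv_lhs => arg 2; rw [hW]
      exact map_add _ _ _
    rw [h3]
    linarith
  -- `Q = exp (ad Y)`, so that `g exp (-Y / 2)` preserves `B_θ`
  set Z : LieAlg E G := (-2⁻¹ : ℝ) • Y with hZ
  have hZa : Z ∈ c.a := c.a.smul_mem _ (c.mem_a.2 ⟨hYmem, hYθ⟩)
  -- the compact part of `g`
  refine ⟨Z, hZa, ?_⟩
  have hJ : g * expG Z ∈ c.J := mul_mem hg (c.expG_mem_J hZa.1)
  refine c.mem_M_iff.2 ⟨?_, fun X hX => c.mem_J_iff.1 hJ X hX.1⟩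
  rw [K_eq, mem_fixSubgroup_iff_Bθ]
  intro X X'
  rw [← hB, Ad_mul', mul_apply_eq_comp, mul_apply_eq_comp, ← hBQ]
  have hX : X ∈ ⨆ μ, Module.End.eigenspace (Q : LieAlg E G →ₗ[ℝ] LieAlg E G) μ := by
    rw [htop]; trivial
  have hX' : X' ∈ ⨆ μ, Module.End.eigenspace (Q : LieAlg E G →ₗ[ℝ] LieAlg E G) μ := by
    rw [htop]; trivial
  induction hX using Submodule.iSup_induction' with
  | zero => simp
  | add X X' _ _ h h' => simp only [map_add, LinearMap.add_apply, h, h']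
  | mem μ X hX =>
    induction hX' using Submodule.iSup_induction' with
    | zero => simp
    | add Y Y' _ _ h h' => simp only [map_add, h, h']
    | mem ν X' hX' =>
      have h1 : Q X = μ • X := Module.End.mem_eigenspace_iff.1 hX
      have h2 : Q X' = ν • X' := Module.End.mem_eigenspace_iff.1 hX'
      have hexp : ∀ (μ : ℝ) X, Q X = μ • X →
          Ad ℝ E (expG Z) X = Real.exp (-2⁻¹ * Real.log μ) • X := by
        intro μ X h
        have h3 : adL ℝ E G Z X = (-2⁻¹ * Real.log μ) • X := by
          rw [adL_apply, hZ, smul_lie, hY μ X h, smul_smul]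
        rw [Ad_expG, exp_apply_of_apply_eq_smul h3, Real.exp_eq_exp_ℝ]
      rw [hexp _ _ h1, hexp _ _ h2]
      simp only [map_smul, LinearMap.smul_apply, smul_eq_mul, h1]
      have h3 := hsymm X X'
      rw [h1, h2, map_smul, map_smul, LinearMap.smul_apply, smul_eq_mul, smul_eq_mul] at h3
      by_cases h4 : μ = ν
      · subst h4
        by_cases h0 : X = 0
        · simp [h0]
        have hp := hpos _ _ h0 h1
        have e : Real.exp (-2⁻¹ * Real.log μ) * Real.exp (-2⁻¹ * Real.log μ) * μ = 1 := by
          rw [← Real.exp_add]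
          nth_rewrite 3 [← Real.exp_log hp]
          rw [← Real.exp_add]
          ring_nf
          exact Real.exp_zero
        linear_combination B X X' * e
      · have : (μ - ν) * B X X' = 0 := by linarith
        rw [(mul_eq_zero.1 this).resolve_left (sub_ne_zero.2 h4)]
        ring

/-- Consequence of the polar decomposition of `J`. -/
lemma J_le_L : c.J ≤ c.L := by
  intro g hg
  obtain ⟨Z, hZa, hM⟩ := c.exists_mul_expG_mem_M hg
  have hg' : g = (g * expG Z) * expG (-Z) := by rw [expG_neg, mul_inv_cancel_right]
  rw [hg']
  exact mul_mem (Subgroup.mem_sup_left hM)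
    (Subgroup.mem_sup_right (c.expG_mem_A (c.a.neg_mem hZa)))

/-- The exponential of the centralizer of `𝔞` lies in `L = MA`. -/
lemma expG_mem_L {X : LieAlg E G} (hX : X ∈ c.l) : expG X ∈ c.L := by
  have hθ := c.θ_cartan
  set Xk : LieAlg E G := (2⁻¹ : ℝ) • (X + c.θ X) with hXk
  set Xs : LieAlg E G := (2⁻¹ : ℝ) • (X - c.θ X) with hXs
  have hsum : X = Xk + Xs := IsCartanInvolution.eq_half_add_half (θ := c.θ) X
  have hXa : Xs ∈ c.a := hθ.half_sub_mem_a c.a_maximal (c.mem_l.1 hX)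
  have hka : ∀ A ∈ c.a, ⁅A, Xk⁆ = 0 := by
    intro A hA
    have h1 := c.mem_l.1 hX A hA
    rw [hsum, lie_add, c.a_maximal.1.2 A hA Xs hXa, add_zero] at h1
    exact h1
  have h0 : ⁅Xk, Xs⁆ = 0 := by rw [← lie_skew, hka _ hXa, neg_zero]
  rw [hsum, expG_add_of_lie_eq_zero h0]
  refine mul_mem (Subgroup.mem_sup_left (c.mem_M_iff.2 ⟨?_, fun A hA => ?_⟩))
    (Subgroup.mem_sup_right (c.expG_mem_A hXa))
  · have h1 := (c.lie_K Xk).2 (hθ.half_add_fixed X)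
    simpa using mem_lieOf_iff.1 h1 1
  · have h : adL ℝ E G Xk A = (0 : ℝ) • A := by
      rw [adL_apply, ← lie_skew, hka A hA, neg_zero, zero_smul]
    rw [Ad_expG, exp_apply_of_apply_eq_smul h, NormedSpace.exp_zero, one_smul]

end Choices

end CartanSubgroup

/-! ### Exponentials in the minimal parabolic subgroup -/

section Parabolic

variable {E : Type*} [NormedAddCommGroup E] [NormedSpace ℝ E] [FiniteDimensional ℝ E]
  [CompleteSpace E]
  {G : Type*} [Group G] [TopologicalSpace G] [ChartedSpace E G] [LieGroup 𝓘(ℝ, E) ∞ G]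
  [LieAlgebra.IsKilling ℝ (LieAlg E G)]

/-- The logarithms near `1` of group elements `g` with `Ad g - 1 ∈ S` lie in `ad⁻¹ S`, for a
multiplicatively closed space `S` of endomorphisms of the Lie algebra. -/
lemma eventually_adL_logG_mem {S : Submodule ℝ (LieAlg E G →L[ℝ] LieAlg E G)}
    (hmul : ∀ A ∈ S, ∀ B ∈ S, A * B ∈ S) :
    ∀ᶠ g in 𝓝 (1 : G), Ad ℝ E g - 1 ∈ S → adL ℝ E G (logG E g) ∈ S := by
  obtain ⟨ρ, hρ, h⟩ := exists_mem_of_exp_sub_one_mem (LieAlg E G →L[ℝ] LieAlg E G)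
  have h1 := ((adL ℝ E G).continuous.tendsto 0).comp (tendsto_logG (E := E) (G := G))
  rw [map_zero] at h1
  filter_upwards [eventually_adL_logG (E := E) (G := G),
    h1.eventually (Metric.closedBall_mem_nhds 0 hρ)] with g hg hg' hgS
  refine h S (Submodule.closed_of_finiteDimensional S) hmul _ (by simpa using hg') ?_
  rwa [hg.2]

/-- If `g` is near `1` and `Ad g` fixes `V` pointwise, then `log g` centralizes `V`. -/
lemma eventually_lie_logG (V : Set (LieAlg E G)) :
    ∀ᶠ g in 𝓝 (1 : G), (∀ X ∈ V, Ad ℝ E g X = X) → ∀ X ∈ V, ⁅logG E g, X⁆ = 0 := by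
  let S : Submodule ℝ (LieAlg E G →L[ℝ] LieAlg E G) :=
    { carrier := {D | ∀ X ∈ V, D X = 0}
      zero_mem' := fun X _ => rfl
      add_mem' := fun {D D'} h h' X hX => by rw [add_apply, h X hX, h' X hX, add_zero]
      smul_mem' := fun r D h X hX => by rw [smul_apply, h X hX, smul_zero] }
  have hmul : ∀ A ∈ S, ∀ B ∈ S, A * B ∈ S := fun A hA B hB X hX => by
    rw [mul_apply_eq_comp, hB X hX, map_zero]
  filter_upwards [eventually_adL_logG_mem hmul] with g hg hL X hX
  have h := hg (fun X hX => by rw [sub_apply, hL X hX]; simp) X hX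
  rwa [adL_apply] at h

/-- If `V` lies in a closed space `S` with `(U + V) S ⊆ S` and `S U ⊆ S`, then `exp (U + V)` and
`exp U` differ by an element of `S`. -/
lemma exp_sub_exp_mem {S : Submodule ℝ (LieAlg E G →L[ℝ] LieAlg E G)}
    {U V W : LieAlg E G →L[ℝ] LieAlg E G}
    (hW : W = U + V) (hV : V ∈ S) (h1 : ∀ D ∈ S, W * D ∈ S) (h2 : ∀ D ∈ S, D * U ∈ S) :
    exp W - exp U ∈ S := by
  have hs := (NormedSpace.exp_series_hasSum_exp' (𝕂 := ℝ) W).sub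
    (NormedSpace.exp_series_hasSum_exp' (𝕂 := ℝ) U)
  have hpow : ∀ n : ℕ, V * U ^ n ∈ S := by
    intro n
    induction n with
    | zero => simpa
    | succ n ih => rw [pow_succ, ← mul_assoc]; exact h2 _ ih
  have hdiff : ∀ n : ℕ, W ^ n - U ^ n ∈ S := by
    intro n
    induction n with
    | zero => simp
    | succ n ih =>
      have : W ^ (n + 1) - U ^ (n + 1) = W * (W ^ n - U ^ n) + V * U ^ n := by
        rw [pow_succ', pow_succ' U, mul_sub, hW, add_mul, add_mul]; abel
      rw [this]
      exact S.add_mem (h1 _ ih) (hpow n)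
  refine (Submodule.closed_of_finiteDimensional S).mem_of_tendsto hs
    (Filter.Eventually.of_forall fun s => Submodule.sum_mem _ fun n _ => ?_)
  rw [← smul_sub]
  exact S.smul_mem _ (hdiff n)

namespace Choices

variable (c : Choices E G)

/-- The endomorphisms of `g` that strictly raise the grading by the eigenvalues of `ad A₀`. -/
noncomputable def raising : Submodule ℝ (LieAlg E G →L[ℝ] LieAlg E G) where
  carrier := {D | ∀ ν, ∀ X ∈ c.eig ν, D X ∈ ⨆ μ ∈ Set.Ioi ν, c.eig μ}
  zero_mem' := fun ν X _ => by simp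
  add_mem' := fun hD hD' ν X hX => add_mem (hD ν X hX) (hD' ν X hX)
  smul_mem' := fun r D hD ν X hX => Submodule.smul_mem _ r (hD ν X hX)

lemma map_biSup_eig_of_raising {D : LieAlg E G →L[ℝ] LieAlg E G}
    (hD : D ∈ c.raising) {ν : ℝ} {X : LieAlg E G} (hX : X ∈ ⨆ μ ∈ Set.Ioi ν, c.eig μ) :
    D X ∈ ⨆ μ ∈ Set.Ioi ν, c.eig μ := by
  have : (⨆ μ ∈ Set.Ioi ν, c.eig μ) ≤
      (⨆ μ ∈ Set.Ioi ν, c.eig μ).comap (D : LieAlg E G →ₗ[ℝ] LieAlg E G) :=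
    iSup₂_le fun μ hμ Y hY => c.biSup_eig_mono (Set.Ioi_subset_Ioi (le_of_lt hμ)) (hD μ Y hY)
  exact this hX

lemma map_biSup_eig_of_preserves {D : LieAlg E G →L[ℝ] LieAlg E G}
    (hD : ∀ ν, ∀ X ∈ c.eig ν, D X ∈ c.eig ν) {s : Set ℝ} {X : LieAlg E G}
    (hX : X ∈ ⨆ μ ∈ s, c.eig μ) : D X ∈ ⨆ μ ∈ s, c.eig μ := by
  have : (⨆ μ ∈ s, c.eig μ) ≤ (⨆ μ ∈ s, c.eig μ).comap (D : LieAlg E G →ₗ[ℝ] LieAlg E G) :=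
    iSup₂_le fun μ hμ Y hY => c.eig_le_biSup hμ (hD μ Y hY)
  exact this hX

lemma mul_mem_raising {D D' : LieAlg E G →L[ℝ] LieAlg E G} (hD : D ∈ c.raising)
    (hD' : D' ∈ c.raising) : D * D' ∈ c.raising := fun ν X hX =>
  c.map_biSup_eig_of_raising hD (hD' ν X hX)

lemma preserves_mul_mem_raising {U D : LieAlg E G →L[ℝ] LieAlg E G}
    (hU : ∀ ν, ∀ X ∈ c.eig ν, U X ∈ c.eig ν) (hD : D ∈ c.raising) : U * D ∈ c.raising :=
  fun ν X hX => c.map_biSup_eig_of_preserves hU (hD ν X hX)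

lemma mul_preserves_mem_raising {U D : LieAlg E G →L[ℝ] LieAlg E G}
    (hU : ∀ ν, ∀ X ∈ c.eig ν, U X ∈ c.eig ν) (hD : D ∈ c.raising) : D * U ∈ c.raising :=
  fun ν X hX => hD ν _ (hU ν X hX)

lemma adL_l_preserves {X : LieAlg E G} (hX : X ∈ c.l) :
    ∀ ν, ∀ Y ∈ c.eig ν, adL ℝ E G X Y ∈ c.eig ν := by
  intro ν Y hY
  rw [adL_apply]
  simpa using c.lie_mem_eig (c.l_le_eig hX) hY

lemma adL_n_mem_raising {X : LieAlg E G} (hX : X ∈ c.n) : adL ℝ E G X ∈ c.raising := by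
  have : c.n ≤ c.raising.comap (adL ℝ E G : LieAlg E G →ₗ[ℝ] _) := by
    rw [n_eq]
    refine iSup₂_le fun μ hμ Y hY ν Z hZ => ?_
    change adL ℝ E G Y Z ∈ _
    rw [adL_apply]
    exact c.eig_le_biSup (by simpa using hμ) (c.lie_mem_eig hY hZ)
  exact this hX

lemma A₀_mem_eig : (c.A₀ : LieAlg E G) ∈ c.eig 0 := c.mem_eig.2 (by simp)

lemma lie_A₀_mem_biSup {s : Set ℝ} {X : LieAlg E G} (hX : X ∈ ⨆ μ ∈ s, c.eig μ) :
    ⁅(c.A₀ : LieAlg E G), X⁆ ∈ ⨆ μ ∈ s, c.eig μ := by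
  have h := c.map_biSup_eig_of_preserves (D := adL ℝ E G c.A₀)
    (c.adL_l_preserves (c.j_le_l c.A₀.2)) hX
  rwa [adL_apply] at h

/-- An element of `g` whose adjoint action strictly raises the grading lies in `𝔫`. -/
lemma mem_n_of_adL_mem_raising {Z : LieAlg E G} (hZ : adL ℝ E G Z ∈ c.raising) : Z ∈ c.n := by
  obtain ⟨Y, hY, U, hU, U', hU', rfl⟩ := c.exists_decomp Z
  have h1 := hZ 0 _ c.A₀_mem_eig
  rw [adL_apply, ← lie_skew, neg_mem_iff, lie_add, lie_add, c.mem_l.1 hY _ c.A₀_mem,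
    zero_add] at h1
  have h2 : ⁅(c.A₀ : LieAlg E G), U'⁆ = 0 := by
    refine c.eq_zero_of_disjoint (s := Set.Ioi 0) (t := Set.Iio 0)
      (Set.disjoint_left.2 fun x h1 h2 => lt_asymm (Set.mem_Ioi.1 h1) (Set.mem_Iio.1 h2)) ?_
      (c.lie_A₀_mem_biSup (c.nMinus_le_eig hU'))
    have h3 := sub_mem h1 (c.lie_A₀_mem_biSup (c.n_le_eig hU))
    rwa [add_sub_cancel_left] at h3
  have h3 : U' = 0 := by
    refine c.eq_zero_of_disjoint (s := {0}) (t := Set.Iio 0) (by simp)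
      (c.eig_le_biSup (Set.mem_singleton 0) (c.mem_eig.2 (by rw [h2, zero_smul])))
      (c.nMinus_le_eig hU')
  rw [h3, add_zero] at hZ ⊢
  have h4 : adL ℝ E G Y ∈ c.raising := by
    have := sub_mem hZ (c.adL_n_mem_raising hU)
    rwa [map_add, add_sub_cancel_right] at this
  have h5 : adL ℝ E G Y = 0 := by
    ext X
    have hX : X ∈ ⨆ ν, c.eig ν := by rw [iSup_eig]; trivial
    have : (⨆ ν, c.eig ν) ≤ LinearMap.ker (adL ℝ E G Y : LieAlg E G →ₗ[ℝ] LieAlg E G) := by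
      refine iSup_le fun ν W hW => ?_
      exact c.eq_zero_of_disjoint (s := {ν}) (t := Set.Ioi ν) (by simp)
        (c.eig_le_biSup (Set.mem_singleton ν) (c.adL_l_preserves hY ν W hW)) (h4 ν W hW)
    exact this hX
  have h6 : Y = 0 := adL_injective (h5.trans (map_zero _).symm)
  rwa [h6, zero_add]

lemma expG_mem_N {X : LieAlg E G} (hX : X ∈ c.n) : expG X ∈ c.N := expG_mem_analyticSubgroup hX

/-- `Ad (exp (-X) exp (X + Y))` is unipotent for the grading by `ad A₀` if `X ∈ 𝔩` and `Y ∈ 𝔫`. -/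
lemma Ad_sub_one_mem_raising {X Y : LieAlg E G} (hX : X ∈ c.l) (hY : Y ∈ c.n) :
    Ad ℝ E (expG (-X) * expG (X + Y)) - 1 ∈ c.raising := by
  set U := adL ℝ E G X with hU
  set W := adL ℝ E G (X + Y) with hW
  have hUp := c.adL_l_preserves hX
  have hVr := c.adL_n_mem_raising hY
  have hWU : W = U + adL ℝ E G Y := map_add _ _ _
  have h1 : exp W - exp U ∈ c.raising := by
    refine exp_sub_exp_mem hWU hVr (fun D hD => ?_) fun D hD => c.mul_preserves_mem_raising hUp hD
    rw [hWU, add_mul]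
    exact add_mem (c.preserves_mul_mem_raising hUp hD) (c.mul_mem_raising hVr hD)
  have h2 : exp (-U) * exp U = 1 := by
    have := exp_smul_mul_exp_neg_smul (𝕜 := ℝ) (-U) 1
    simpa using this
  have h3 : Ad ℝ E (expG (-X) * expG (X + Y)) - 1 = exp (-U) * (exp W - exp U) := by
    rw [mul_sub, h2, Ad_mul', Ad_expG, Ad_expG, map_neg]
  rw [h3]
  refine c.preserves_mul_mem_raising (fun ν Z hZ => exp_apply_mem (fun Z' hZ' => ?_) hZ) h1
  rw [neg_apply]
  exact neg_mem (hUp ν Z' hZ')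

/-- Near `1`, `exp (X + Y) ∈ exp X · N` for `X ∈ 𝔩` and `Y ∈ 𝔫`. -/
lemma eventually_mem_N {X Y : LieAlg E G} (hX : X ∈ c.l) (hY : Y ∈ c.n) :
    ∀ᶠ t in 𝓝 (0 : ℝ), expG (-(t • X)) * expG (t • (X + Y)) ∈ c.N := by
  have := isTopologicalGroup_of_chartedSpace E G
  have hcont : Continuous fun t : ℝ => expG (-(t • X)) * expG (t • (X + Y)) := by
    refine Continuous.mul ?_ (continuous_expG_smul _)
    simpa only [smul_neg] using continuous_expG_smul (-X)
  have hlim : Tendsto (fun t : ℝ => expG (-(t • X)) * expG (t • (X + Y))) (𝓝 0) (𝓝 1) := by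
    have := hcont.tendsto 0
    simpa [expG_zero] using this
  filter_upwards [hlim.eventually (eventually_adL_logG_mem fun A hA B hB => c.mul_mem_raising hA hB),
    hlim.eventually (eventually_expG_logG (E := E))] with t h1 h2
  rw [← h2]
  refine c.expG_mem_N (c.mem_n_of_adL_mem_raising (h1 ?_))
  rw [smul_add]
  exact c.Ad_sub_one_mem_raising (c.l.smul_mem t hX) (c.n.smul_mem t hY)

variable [ConnectedSpace G] [Finite (Subgroup.center G)]

/-- The exponential of the minimal parabolic subalgebra lies in `P`, as a power of an element of
`exp 𝔩 · N` close to `1`. -/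
lemma expG_mem_P {X : LieAlg E G} (hX : X ∈ c.p) : expG X ∈ c.P := by
  obtain ⟨Y, hY, U, hU, rfl⟩ := Submodule.mem_sup.1 hX
  have h1 := c.eventually_mem_N hY hU
  have h2 : Tendsto (fun n : ℕ => ((n : ℝ) + 1)⁻¹) atTop (𝓝 0) := by
    simpa [one_div] using tendsto_one_div_add_atTop_nhds_zero_nat (𝕜 := ℝ)
  obtain ⟨n, hn⟩ := (h2.eventually h1).exists
  set t : ℝ := ((n : ℝ) + 1)⁻¹ with ht
  have h3 : expG (t • (Y + U)) ∈ c.P := by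
    have h4 : expG (t • (Y + U)) = expG (t • Y) * (expG (-(t • Y)) * expG (t • (Y + U))) := by
      rw [expG_neg, mul_inv_cancel_left]
    rw [h4]
    exact mul_mem (c.L_le_P (c.expG_mem_L (c.l.smul_mem t hY))) (c.N_le_P hn)
  have h5 : expG (Y + U) = expG (t • (Y + U)) ^ (n + 1) := by
    rw [← expG_nsmul, smul_smul, ht]
    push_cast
    rw [mul_inv_cancel₀ (by positivity), one_smul]
  rw [h5]
  exact pow_mem h3 _

omit [ConnectedSpace G] [Finite (Subgroup.center G)] in
/-- `L` centralizes `𝔞`. -/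
lemma Ad_a_of_mem_L {g : G} (hg : g ∈ c.L) {X : LieAlg E G} (hX : X ∈ c.a) : Ad ℝ E g X = X := by
  have : c.L ≤ lieCentralizer ℝ E (c.a : Set (LieAlg E G)) := by
    refine sup_le inf_le_right ?_
    rw [A, analyticSubgroup_eq, Subgroup.closure_le]
    rintro _ ⟨Y, hY, rfl⟩ Z hZ
    have h : adL ℝ E G Y Z = (0 : ℝ) • Z := by
      rw [adL_apply, c.a_maximal.1.2 Y hY Z hZ, zero_smul]
    rw [Ad_expG, exp_apply_of_apply_eq_smul h, NormedSpace.exp_zero, one_smul]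
  exact this hg X hX

omit [ConnectedSpace G] [Finite (Subgroup.center G)] in
lemma Ad_mem_l {g : G} (hg : g ∈ c.L) {X : LieAlg E G} (hX : X ∈ c.l) : Ad ℝ E g X ∈ c.l := by
  rw [mem_l] at hX ⊢
  intro A hA
  rw [← c.Ad_a_of_mem_L hg hA, ← Ad_lie, hX A hA, map_zero]

/-- Logarithms of elements of `L` near `1` lie in `𝔩`. -/
lemma eventually_logG_mem_l : ∀ᶠ g in 𝓝 (1 : G), g ∈ c.L → logG E g ∈ c.l := by
  filter_upwards [eventually_lie_logG (E := E) (G := G) (c.a : Set (LieAlg E G))] with g hg hL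
  rw [mem_l]
  intro A hA
  rw [← lie_skew, hg (fun X hX => c.Ad_a_of_mem_L hL hX) A hA, neg_zero]

end Choices

end Parabolic

/-! ### Bounds for dimensions of irreducible representations -/

section IrreducibleRepresentations

lemma eq_top_of_irreducible {S : Type*} [Group S] {V : Type*} [AddCommGroup V] [Module ℂ V]
    {σ : Representation ℂ S V} (hσ : σ.IsIrreducible) {W : Submodule ℂ V} (hW : W ≠ ⊥)
    (hinv : ∀ g, ∀ v ∈ W, σ g v ∈ W) : W = ⊤ := by
  let W' : Subrepresentation σ := ⟨W, fun g v hv => hinv g v hv⟩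
  rcases hσ.eq_bot_or_eq_top W' with h | h
  · exact absurd (congrArg Subrepresentation.toSubmodule h) hW
  · exact congrArg Subrepresentation.toSubmodule h

lemma nontrivial_of_irreducible {S : Type*} [Group S] {V : Type*} [AddCommGroup V] [Module ℂ V]
    {σ : Representation ℂ S V} (hσ : σ.IsIrreducible) : Nontrivial V := by
  by_contra h
  rw [not_nontrivial_iff_subsingleton] at h
  have h1 : (⊥ : Subrepresentation σ) ≠ ⊤ := bot_ne_top
  exact h1 (Subrepresentation.toSubmodule_injective (Subsingleton.elim _ _))

/-- The dimension of an irreducible representation is bounded by the index of the center. -/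
lemma finrank_le_card_of_center {S : Type*} [Group S] {V : Type*} [AddCommGroup V] [Module ℂ V]
    [FiniteDimensional ℂ V] {σ : Representation ℂ S V} (hσ : σ.IsIrreducible) (R : Finset S)
    (hR : ∀ g : S, ∃ r ∈ R, ∃ z ∈ Subgroup.center S, g = r * z) : Module.finrank ℂ V ≤ R.card := by
  classical
  have := nontrivial_of_irreducible hσ
  have hscalar : ∀ z ∈ Subgroup.center S, ∃ μ : ℂ, ∀ v, σ z v = μ • v := by
    intro z hz
    obtain ⟨μ, hμ⟩ := Module.End.exists_eigenvalue (σ z)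
    have h : Module.End.eigenspace (σ z) μ = ⊤ := eq_top_of_irreducible hσ hμ (fun g v hv => by
      rw [Module.End.mem_eigenspace_iff] at hv ⊢
      rw [← Module.End.mul_apply, ← map_mul, ← Subgroup.mem_center_iff.1 hz g, map_mul,
        Module.End.mul_apply, hv, map_smul])
    exact ⟨μ, fun v => Module.End.mem_eigenspace_iff.1 (by rw [h]; trivial)⟩
  -- the orbit of a vector `v` spans, and is contained in the span of the `σ r v`
  obtain ⟨v, hv⟩ := exists_ne (0 : V)
  let W : Submodule ℂ V := Submodule.span ℂ (R.image fun r => σ r v : Finset V)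
  have hmem : ∀ g, σ g v ∈ W := by
    intro g
    obtain ⟨r, hr, z, hz, rfl⟩ := hR g
    obtain ⟨μ, hμ⟩ := hscalar z hz
    rw [map_mul, Module.End.mul_apply, hμ, map_smul]
    exact W.smul_mem _ (Submodule.subset_span (by
      simpa using ⟨r, hr, rfl⟩))
  have hinv : ∀ g, ∀ w ∈ W, σ g w ∈ W := by
    intro g
    have : W ≤ W.comap (σ g) := by
      refine Submodule.span_le.2 fun w hw => ?_
      obtain ⟨r, _, rfl⟩ := Finset.mem_image.1 (Finset.mem_coe.1 hw)
      change σ g (σ r v) ∈ W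
      rw [← Module.End.mul_apply, ← map_mul]
      exact hmem _
    exact this
  have hW : W = ⊤ := by
    refine eq_top_of_irreducible hσ ((Submodule.ne_bot_iff _).2 ⟨v, ?_, hv⟩) hinv
    simpa using hmem 1
  calc Module.finrank ℂ V = Module.finrank ℂ W := by rw [hW, finrank_top]
    _ ≤ (R.image fun r => σ r v).card := finrank_span_finset_le_card _
    _ ≤ R.card := Finset.card_image_le

/-- The trivial representation is irreducible, so that there are irreducible representations. -/
lemma one_mem_irrepDims (S : Type*) [Group S] [TopologicalSpace S] : 1 ∈ irrepDims S := by
  refine ⟨Representation.trivial ℂ S (Fin 1 → ℂ), ?_, fun v l => ?_⟩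
  · have hne : (⊥ : Subrepresentation (Representation.trivial ℂ S (Fin 1 → ℂ))) ≠ ⊤ := by
      intro h
      have h1 : (⊥ : Submodule ℂ (Fin 1 → ℂ)) = ⊤ := congrArg Subrepresentation.toSubmodule h
      exact bot_ne_top h1
    have : Nontrivial (Subrepresentation (Representation.trivial ℂ S (Fin 1 → ℂ))) := ⟨_, _, hne⟩
    refine ⟨fun W => ?_⟩
    have h1 : Module.finrank ℂ (Fin 1 → ℂ) = 1 := by simp
    have h2 := isSimpleModule_iff_finrank_eq_one.2 h1
    rcases h2.eq_bot_or_eq_top W.toSubmodule with h | h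
    · exact Or.inl (Subrepresentation.toSubmodule_injective h)
    · exact Or.inr (Subrepresentation.toSubmodule_injective h)
  · simpa using continuous_const

end IrreducibleRepresentations

/-! ### Irreducible representations of the Cartan subgroup -/

section CartanDims

variable {E : Type*} [NormedAddCommGroup E] [NormedSpace ℝ E] [FiniteDimensional ℝ E]
  [CompleteSpace E]
  {G : Type*} [Group G] [TopologicalSpace G] [ChartedSpace E G] [LieGroup 𝓘(ℝ, E) ∞ G]
  [LieAlgebra.IsKilling ℝ (LieAlg E G)]

omit [LieAlgebra.IsKilling ℝ (LieAlg E G)] in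
lemma isClosed_lieCentralizer (V : Set (LieAlg E G)) :
    IsClosed (lieCentralizer ℝ E V : Set G) := by
  have : (lieCentralizer ℝ E V : Set G) = ⋂ X ∈ V, {g : G | Ad ℝ E g X = X} := by
    ext g; simp [lieCentralizer]
  rw [this]
  exact isClosed_biInter fun X _ => isClosed_eq (continuous_Ad.clm_apply continuous_const)
    continuous_const

namespace Choices

variable (c : Choices E G)

lemma expG_mul_comm_of_mem_J {g : G} (hg : g ∈ c.J) {X : LieAlg E G} (hX : X ∈ c.j) :
    g * expG X = expG X * g := by
  have h : Ad ℝ E g X = X := hg X hX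
  have h1 := conj_expG g X
  rw [h] at h1
  exact mul_inv_eq_iff_eq_mul.1 h1

/-- Logarithms of elements of `J` near `1` lie in `𝔧`, which is its own normalizer. -/
lemma eventually_logG_mem_j : ∀ᶠ g in 𝓝 (1 : G), g ∈ c.J → logG E g ∈ c.j := by
  filter_upwards [eventually_lie_logG (E := E) (G := G) (c.j : Set (LieAlg E G))] with g hg hJ
  have : logG E g ∈ c.j.normalizer := by
    rw [LieSubalgebra.mem_normalizer_iff]
    intro X hX
    rw [hg (fun X hX => hJ X hX) X hX]
    exact c.j.zero_mem
  rwa [c.j_cartan.self_normalizing] at this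

variable [ConnectedSpace G] [Finite (Subgroup.center G)]

lemma expG_mem_center_J {X : LieAlg E G} (hX : X ∈ c.j) :
    (⟨expG X, c.expG_mem_J hX⟩ : c.J) ∈ Subgroup.center c.J :=
  Subgroup.mem_center_iff.2 fun g => Subtype.ext (c.expG_mul_comm_of_mem_J g.2 hX)

/-- The Cartan subgroup is finite modulo its center: its compact part is compact and `exp 𝔧` is an
open central subgroup. -/
lemma exists_finset_J : ∃ R : Finset c.J, ∀ g : c.J, ∃ r ∈ R, ∃ z ∈ Subgroup.center c.J,
    g = r * z := by
  classical
  have := isTopologicalGroup_of_chartedSpace E G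
  have := t2Space_of_chartedSpace E G
  let C : Subgroup G := c.J ⊓ c.K
  have hC : IsCompact (C : Set G) := by
    have h1 : (C : Set G) = (c.J : Set G) ∩ (c.K : Set G) := rfl
    rw [h1]
    exact c.K_maximal.1.inter_left (isClosed_lieCentralizer _)
  have : CompactSpace C := isCompact_iff_compactSpace.1 hC
  let U : Subgroup C := (Subgroup.center c.J).comap (Subgroup.inclusion inf_le_left)
  have hU : IsOpen (U : Set C) := by
    refine Subgroup.isOpen_of_mem_nhds U (g := 1) ?_
    rw [mem_nhds_subtype]
    refine ⟨_, (c.eventually_logG_mem_j.and (eventually_expG_logG (E := E) (G := G))), ?_⟩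
    rintro ⟨g, hg⟩ ⟨h1, h2⟩
    change Subgroup.inclusion _ (⟨g, hg⟩ : C) ∈ Subgroup.center c.J
    have h3 := c.expG_mem_center_J (h1 hg.1)
    have h4 : (⟨expG (logG E g), c.expG_mem_J (h1 hg.1)⟩ : c.J) = ⟨g, hg.1⟩ := Subtype.ext h2
    rw [h4] at h3
    exact h3
  have hfin : Finite (C ⧸ U) := Subgroup.quotient_finite_of_isOpen U hU
  let := Fintype.ofFinite (C ⧸ U)
  refine ⟨Finset.univ.image fun q : C ⧸ U => Subgroup.inclusion inf_le_left q.out, fun g => ?_⟩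
  obtain ⟨Z, hZ, hM⟩ := c.exists_mul_expG_mem_M g.2
  have hCm : (g : G) * expG Z ∈ C := ⟨mul_mem g.2 (c.expG_mem_J hZ.1), hM.1⟩
  let m : C := ⟨(g : G) * expG Z, hCm⟩
  have hu : ((m : C ⧸ U).out)⁻¹ * m ∈ U := QuotientGroup.eq.1 (Quotient.out_eq' (m : C ⧸ U))
  refine ⟨Subgroup.inclusion inf_le_left (m : C ⧸ U).out, by simp, _,
    mul_mem hu (inv_mem (c.expG_mem_center_J hZ.1)), ?_⟩
  ext
  simp only [m, Subgroup.coe_mul, Subgroup.coe_inclusion, InvMemClass.coe_inv]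
  group

/-- The dimensions of the irreducible representations of `J` have a maximum. -/
lemma isGreatest_irrepDims : IsGreatest (irrepDims c.J) (maxIrrepDim c.J) := by
  obtain ⟨R, hR⟩ := c.exists_finset_J
  have hbdd : BddAbove (irrepDims c.J) := by
    refine ⟨R.card, ?_⟩
    rintro d ⟨σ, hσ, _⟩
    simpa using finrank_le_card_of_center hσ R hR
  exact ⟨Nat.sSup_mem ⟨1, one_mem_irrepDims _⟩ hbdd, fun d hd => le_csSup hbdd hd⟩

end Choices
end CartanDims

/-! ### Nullspaces of endomorphisms -/

section Nullity

variable {V : Type*} [NormedAddCommGroup V] [NormedSpace ℝ V] [FiniteDimensional ℝ V]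

/-- The nullspace of an endomorphism `D` is the generalized eigenspace for the eigenvalue `0`. -/
noncomputable def nilspace (D : V →L[ℝ] V) : Submodule ℝ V :=
  Module.End.maxGenEigenspace (D : V →ₗ[ℝ] V) 0

lemma mem_nilspace {D : V →L[ℝ] V} {v : V} : v ∈ nilspace D ↔ ∃ k : ℕ, (D ^ k) v = 0 := by
  rw [nilspace, Module.End.mem_maxGenEigenspace, zero_smul, sub_zero]
  refine exists_congr fun k => ?_
  have : ((D : V →ₗ[ℝ] V) ^ k) v = (D ^ k) v := by
    induction k with
    | zero => rfl
    | succ k ih => rw [pow_succ', pow_succ', Module.End.mul_apply, ih]; rfl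
  rw [this]

/-- The dimension of the nullspace is the order of vanishing at `0` of the characteristic polynomial. -/
lemma le_finrank_nilspace_iff {D : V →L[ℝ] V} {r : ℕ} : r ≤ Module.finrank ℝ (nilspace D) ↔
    ∀ i < r, (LinearMap.charpoly (D : V →ₗ[ℝ] V)).coeff i = 0 := by
  rw [nilspace, LinearMap.finrank_maxGenEigenspace_zero_eq]
  constructor
  · intro h i hi
    exact Polynomial.coeff_eq_zero_of_lt_natTrailingDegree (lt_of_lt_of_le hi h)
  · intro h
    exact Polynomial.le_natTrailingDegree (LinearMap.charpoly_monic _).ne_zero h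

lemma analyticOnNhd_charpoly_coeff (i : ℕ) : AnalyticOnNhd ℝ
    (fun D : V →L[ℝ] V => (LinearMap.charpoly (D : V →ₗ[ℝ] V)).coeff i) Set.univ := by
  classical
  let φ : (V →L[ℝ] V) →ₗ[ℝ] Module.End ℝ V := ContinuousLinearMap.coeLM ℝ
  let b := Module.finBasis ℝ (V →L[ℝ] V)
  have h1 : ∀ D : V →L[ℝ] V, (LinearMap.charpoly (D : V →ₗ[ℝ] V)).coeff i =
      MvPolynomial.eval (b.repr D) ((φ.polyCharpoly b).coeff i) := fun D =>
    (LinearMap.polyCharpoly_coeff_eval φ b D i).symm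
  simp only [h1]
  let L : (V →L[ℝ] V) →L[ℝ] (Fin (Module.finrank ℝ (V →L[ℝ] V)) → ℝ) :=
    LinearMap.toContinuousLinearMap b.equivFun.toLinearMap
  have h2 := (AnalyticOnNhd.eval_mvPolynomial (𝕜 := ℝ) ((φ.polyCharpoly b).coeff i)).comp
    (L.analyticOnNhd Set.univ) (Set.mapsTo_univ _ _)
  exact h2

/-- The dimension of the nullspace is bounded below on the whole of an analytic family if it is so
on an open set. -/
lemma le_finrank_nilspace_of_eventually {W : Type*} [NormedAddCommGroup W] [NormedSpace ℝ W]
    {Φ : W → (V →L[ℝ] V)} (hΦ : AnalyticOnNhd ℝ Φ Set.univ) {r : ℕ} {w₀ : W}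
    (h : ∀ᶠ w in 𝓝 w₀, r ≤ Module.finrank ℝ (nilspace (Φ w))) (w : W) :
    r ≤ Module.finrank ℝ (nilspace (Φ w)) := by
  rw [le_finrank_nilspace_iff]
  intro i hi
  have h1 : AnalyticOnNhd ℝ (fun w => (LinearMap.charpoly (Φ w : V →ₗ[ℝ] V)).coeff i) Set.univ :=
    (analyticOnNhd_charpoly_coeff i).comp hΦ (Set.mapsTo_univ _ _)
  have h2 := h1.eqOn_of_preconnected_of_eventuallyEq (g := fun _ => 0)
    (fun _ _ => analyticAt_const) isPreconnected_univ (Set.mem_univ w₀) (by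
      filter_upwards [h] with w hw
      exact le_finrank_nilspace_iff.1 hw i hi)
  exact h2 (Set.mem_univ w)

/-- The operator `exp D - 1` is in the non-unital algebra of the operators which map the kernel of
`D ^ (k + 1)` to that of `D ^ k` for all `k`. -/
lemma nilspace_le_nilspace_exp_sub_one (D : V →L[ℝ] V) : nilspace D ≤ nilspace (exp D - 1) := by
  have : CompleteSpace V := FiniteDimensional.complete ℝ V
  let S : Submodule ℝ (V →L[ℝ] V) :=
    { carrier := {A | ∀ k : ℕ, ∀ v, (D ^ (k + 1)) v = 0 → (D ^ k) (A v) = 0}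
      zero_mem' := fun k v _ => by simp
      add_mem' := fun {A B} hA hB k v hv => by rw [add_apply, map_add, hA k v hv, hB k v hv, add_zero]
      smul_mem' := fun r A hA k v hv => by rw [smul_apply, map_smul, hA k v hv, smul_zero] }
  have hmul : ∀ A ∈ S, ∀ B ∈ S, A * B ∈ S := by
    intro A hA B hB k v hv
    refine hA k _ ?_
    rw [pow_succ', mul_apply_eq_comp]
    exact (congrArg D (hB k v hv)).trans (map_zero D)
  have hD : D ∈ S := fun k v hv => by rwa [pow_succ, mul_apply_eq_comp] at hv
  have hE := exp_sub_one_mem (Submodule.closed_of_finiteDimensional S) hmul hD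
  intro v hv
  obtain ⟨k, hk⟩ := mem_nilspace.1 hv
  rw [mem_nilspace]
  refine ⟨k, ?_⟩
  have key : ∀ m k : ℕ, ∀ v, (D ^ (k + m)) v = 0 → (D ^ k) (((exp D - 1) ^ m) v) = 0 := by
    intro m
    induction m with
    | zero => intro k v hv; simpa using hv
    | succ m ih =>
      intro k v hv
      rw [pow_succ', mul_apply_eq_comp]
      refine hE k _ (ih (k + 1) v ?_)
      rwa [add_assoc, add_comm 1 m]
  simpa using key k 0 v (by simpa using hk)

/-- For an isometry `f` of a positive definite form, `f - 1` is semisimple. -/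
lemma eq_of_mem_nilspace_of_isometry {B : LinearMap.BilinForm ℝ V}
    (hpos : ∀ x, B x x = 0 → x = 0) {f : V →L[ℝ] V} (hf : ∀ x y, B (f x) (f y) = B x y) {v : V}
    (hv : v ∈ nilspace (f - 1)) : f v = v := by
  obtain ⟨k, hk⟩ := mem_nilspace.1 hv
  have h2 : ∀ x, (f - 1) ((f - 1) x) = 0 → (f - 1) x = 0 := by
    intro x hx
    set u := (f - 1) x with hu
    have e1 : f u = u := by
      rw [sub_apply] at hx
      exact sub_eq_zero.1 hx
    have e2 : f x = x + u := by rw [hu, sub_apply]; simp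
    apply hpos
    have h3 := hf x u
    rw [e1, e2, map_add, LinearMap.add_apply] at h3
    linarith
  have h3 : ∀ k : ℕ, ((f - 1) ^ (k + 1)) v = 0 → (f - 1) v = 0 := by
    intro k
    induction k with
    | zero => intro h; simpa using h
    | succ k ih =>
      intro h
      apply ih
      rw [pow_succ', mul_apply_eq_comp]
      apply h2
      rw [pow_succ', pow_succ', mul_apply_eq_comp, mul_apply_eq_comp] at h
      exact h
  have h4 : (f - 1) v = 0 := h3 k (by rw [pow_succ', mul_apply_eq_comp, hk, map_zero])
  rw [sub_apply] at h4
  exact sub_eq_zero.1 h4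

/-- If `T` commutes with `σ` and is injective on a `T`- and `σ`-stable subspace `R`, then for some
`s` the operator `σ exp (s T)` has no nonzero fixed vector in `R`: for different small values of
`s`, the spaces of fixed vectors are linearly independent. -/
lemma exists_no_fixed_vector {σ T : V →L[ℝ] V} (hcomm : Commute σ T) {R : Submodule ℝ V}
    (hσi : ∀ v, σ v = 0 → v = 0) (hσ : ∀ v ∈ R, σ v ∈ R) (hTR : ∀ v ∈ R, T v ∈ R)
    (hT : ∀ v ∈ R, T v = 0 → v = 0) :
    ∃ s : ℝ, ∀ v ∈ R, σ (exp (s • T) v) = v → v = 0 := by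
  classical
  have : CompleteSpace V := FiniteDimensional.complete ℝ V
  let _ : NormedAlgebra ℚ (V →L[ℝ] V) := NormedAlgebra.restrictScalars ℚ ℝ _
  obtain ⟨ρ, hρ, hlog⟩ := exists_mem_of_exp_sub_one_mem (V →L[ℝ] V)
  by_contra! hcon
  choose v hvR hfix hv0 using hcon
  set δ := ρ / (‖T‖ + 1) with hδ
  have hδ0 : 0 < δ := by positivity
  -- `exp (u T)` has no fixed vector in `R` for small `u ≠ 0`
  have hsmall : ∀ u : ℝ, u ≠ 0 → |u| ≤ δ → ∀ w ∈ R, exp (u • T) w = w → w = 0 := by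
    intro u hu hu' w hw hfix
    let S : Submodule ℝ (V →L[ℝ] V) :=
      { carrier := {A | A w = 0}
        zero_mem' := rfl
        add_mem' := fun {A B} (hA : A w = 0) (hB : B w = 0) => by
          change (A + B) w = 0; rw [add_apply, hA, hB, add_zero]
        smul_mem' := fun r A (hA : A w = 0) => by
          change (r • A) w = 0; rw [smul_apply, hA, smul_zero] }
    have h1 : u • T ∈ S := by
      refine hlog S (Submodule.closed_of_finiteDimensional S) (fun A _ B (hB : B w = 0) => ?_) _ ?_ ?_
      · change (A * B) w = 0
        rw [mul_apply_eq_comp, hB, map_zero]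
      · rw [norm_smul, Real.norm_eq_abs]
        calc |u| * ‖T‖ ≤ δ * (‖T‖ + 1) := by gcongr; linarith
          _ = ρ := by rw [hδ]; field_simp
      · change (exp (u • T) - 1) w = 0
        rw [sub_apply, hfix]; simp
    have h2 : u • T w = 0 := h1
    exact hT w hw ((smul_eq_zero.1 h2).resolve_left hu)
  let φ : ℝ → (V →L[ℝ] V) := fun s => σ * exp (s • T)
  have hφc : ∀ s t, Commute (φ s) (φ t) := by
    intro s t
    have h1 : Commute (exp (s • T)) (exp (t • T)) :=
      (((Commute.refl T).smul_left s).smul_right t).exp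
    have h2 : ∀ s : ℝ, Commute σ (exp (s • T)) := fun s => (hcomm.smul_right s).exp_right
    exact ((Commute.refl σ).mul_right (h2 t)).mul_left ((h2 s).symm.mul_right h1)
  have hφR : ∀ s, ∀ w ∈ R, φ s w ∈ R := fun s w hw =>
    hσ _ (exp_apply_mem (fun w hw => R.smul_mem s (hTR w hw)) hw)
  have hpair : ∀ s t, s ≠ t → |s - t| ≤ δ → ∀ w ∈ R, φ s w = w → φ t w = w → w = 0 := by
    intro s t hst hd w hw h1 h2
    have h3 : φ s = φ t * exp ((s - t) • T) := by
      simp only [φ]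
      rw [mul_assoc, ← NormedSpace.exp_add_of_commute
        (((Commute.refl T).smul_left t).smul_right (s - t)), ← add_smul, add_sub_cancel]
    have h4 : exp ((s - t) • T) w ∈ R := exp_apply_mem (fun w hw => R.smul_mem _ (hTR w hw)) hw
    have h5 : φ t (exp ((s - t) • T) w - w) = 0 := by
      rw [map_sub, h2, ← mul_apply_eq_comp (φ t), ← h3, h1, sub_self]
    have h6 : exp (t • T) (exp ((s - t) • T) w - w) = 0 := hσi _ h5
    have h7 : exp ((s - t) • T) w - w = 0 := by
      have h8 := exp_smul_mul_exp_neg_smul (𝕜 := ℝ) (-T) t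
      rw [smul_neg, neg_neg] at h8
      have h9 := congrArg (fun A : V →L[ℝ] V => A (exp ((s - t) • T) w - w)) h8
      simp only [mul_apply_eq_comp, h6, map_zero] at h9
      exact h9.symm
    exact hsmall (s - t) (sub_ne_zero.2 hst) hd w hw (sub_eq_zero.1 h7)
  -- fixed vectors for different parameters are independent: apply `φ a - 1` to a relation
  have hind : ∀ s : Finset ℝ, (∀ i ∈ s, i ∈ Set.Ioo 0 δ) → ∀ x : ℝ → V,
      (∀ i ∈ s, x i ∈ R ∧ φ i (x i) = x i) → ∑ i ∈ s, x i = 0 → ∀ i ∈ s, x i = 0 := by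
    intro s
    induction s using Finset.induction_on with
    | empty => intro _ x _ _ i hi; simp at hi
    | insert a s ha ih =>
      intro hs x hx hsum
      rw [Finset.sum_insert ha] at hsum
      have hxa := hx a (Finset.mem_insert_self a s)
      have hy : ∀ i ∈ s, φ a (x i) - x i = 0 := by
        refine ih (fun i hi => hs i (Finset.mem_insert_of_mem hi)) (fun i => φ a (x i) - x i)
          (fun i hi => ?_) ?_
        · have hxi := hx i (Finset.mem_insert_of_mem hi)
          refine ⟨R.sub_mem (hφR a _ hxi.1) hxi.1, ?_⟩
          rw [map_sub, ← mul_apply_eq_comp (φ i), (hφc i a).eq, mul_apply_eq_comp, hxi.2]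
        · rw [Finset.sum_sub_distrib, ← map_sum]
          have h1 : ∑ i ∈ s, x i = -x a := eq_neg_of_add_eq_zero_right hsum
          rw [h1, map_neg, hxa.2, sub_self]
      have hxs : ∀ i ∈ s, x i = 0 := by
        intro i hi
        have hxi := hx i (Finset.mem_insert_of_mem hi)
        have m1 := hs i (Finset.mem_insert_of_mem hi)
        have m2 := hs a (Finset.mem_insert_self a s)
        refine hpair i a (fun h => ha (h ▸ hi)) ?_ _ hxi.1 hxi.2 (sub_eq_zero.1 (hy i hi))
        rw [abs_le]
        constructor <;> linarith [m1.1, m1.2, m2.1, m2.2]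
      intro i hi
      rcases Finset.mem_insert.1 hi with rfl | hi
      · rw [Finset.sum_eq_zero hxs, add_zero] at hsum
        exact hsum
      · exact hxs i hi
  have hli : LinearIndependent ℝ fun i : Set.Ioo 0 δ => v i := by
    rw [linearIndependent_iff']
    intro s c hc i hi
    have h1 := hind (s.map (Function.Embedding.subtype _)) (fun i hi => by
      obtain ⟨j, _, rfl⟩ := Finset.mem_map.1 hi; exact j.2)
      (fun t => if ht : t ∈ Set.Ioo 0 δ then c ⟨t, ht⟩ • v t else 0) (fun i hi => by
        obtain ⟨j, _, rfl⟩ := Finset.mem_map.1 hi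
        have hj : (Function.Embedding.subtype _) j ∈ Set.Ioo 0 δ := j.2
        simp only [hj, dif_pos]
        refine ⟨R.smul_mem _ (hvR _), ?_⟩
        rw [map_smul]
        congr 1
        exact hfix _) (by
        rw [Finset.sum_map, ← hc]
        refine Finset.sum_congr rfl fun j _ => ?_
        have hj : (Function.Embedding.subtype _) j ∈ Set.Ioo 0 δ := j.2
        simp only [hj, dif_pos]
        rfl) i (Finset.mem_map_of_mem _ hi)
    have h2 : c i • v i = 0 := by
      have hj : (i : ℝ) ∈ Set.Ioo 0 δ := i.2
      simpa only [hj, dif_pos] using h1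
    exact (smul_eq_zero.1 h2).resolve_right (hv0 _)
  have hfin : Finite (Set.Ioo 0 δ) := hli.finite
  exact Set.Ioo_infinite hδ0 (Set.toFinite _)

end Nullity

/-! ### Rank of the group and elements fixing the regular vector -/

lemma ker_eq_and_inf_range_eq_bot {V : Type*} [AddCommGroup V] [Module ℝ V]
    [FiniteDimensional ℝ V] {T : V →ₗ[ℝ] V} {j : Submodule ℝ V} (h1 : j ≤ LinearMap.ker T)
    (h2 : j ⊔ LinearMap.range T = ⊤) : LinearMap.ker T = j ∧ j ⊓ LinearMap.range T = ⊥ := by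
  have e1 := T.finrank_range_add_finrank_ker
  have e2 := Submodule.finrank_sup_add_finrank_inf_eq j (LinearMap.range T)
  rw [h2, finrank_top] at e2
  have e3 := Submodule.finrank_mono h1
  refine ⟨(Submodule.eq_of_le_of_finrank_le h1 (by omega)).symm, Submodule.finrank_eq_zero.1 ?_⟩
  omega

section Rank

variable {E : Type*} [NormedAddCommGroup E] [NormedSpace ℝ E] [FiniteDimensional ℝ E]
  [CompleteSpace E]
  {G : Type*} [Group G] [TopologicalSpace G] [ChartedSpace E G] [LieGroup 𝓘(ℝ, E) ∞ G]
  [LieAlgebra.IsKilling ℝ (LieAlg E G)]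

omit [LieAlgebra.IsKilling ℝ (LieAlg E G)] in
lemma nilspace_adL_Ad (g : G) (W : LieAlg E G) :
    Module.finrank ℝ (nilspace (adL ℝ E G (Ad ℝ E g W))) =
      Module.finrank ℝ (nilspace (adL ℝ E G W)) := by
  have h : (adL ℝ E G (Ad ℝ E g W) : LieAlg E G →ₗ[ℝ] LieAlg E G) =
      (AdEquiv E g).toLinearEquiv.conj (adL ℝ E G W : LieAlg E G →ₗ[ℝ] LieAlg E G) := by
    ext X
    rw [LinearEquiv.conj_apply_apply]
    change adL ℝ E G (Ad ℝ E g W) X = Ad ℝ E g (adL ℝ E G W (Ad ℝ E g⁻¹ X))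
    rw [adL_apply, adL_apply, Ad_lie, Ad_apply_inv]
  rw [nilspace, nilspace, LinearMap.finrank_maxGenEigenspace_zero_eq,
    LinearMap.finrank_maxGenEigenspace_zero_eq, h, LinearEquiv.charpoly_conj]

namespace Choices

variable (c : Choices E G)

/-- No root vanishes on the regular vector `T₀ + A₀`. For a positive root `α`, the value has real part
`α A₀` and imaginary part `Im (α T₀)`, and the sum of these two is positive. -/
lemma root_reg_ne_zero {α : c.j →ₗ[ℝ] ℂ} (hα : α ∈ rootsJ c.j) : α c.reg ≠ 0 := by
  have key : ∀ α ∈ c.posJ, α c.reg ≠ 0 := by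
    intro α hα h
    have h1 := c.reg_pos hα
    have hα' := c.posJ_positive.subset hα
    have h2 : (α c.A₀).im = 0 := c.im_eq_zero hα' c.A₀_mem
    have h3 := c.re_eq_zero hα' c.theta_T₀
    rw [c.reg_eq, map_add] at h
    have h4 := congrArg Complex.re h
    have h5 := congrArg Complex.im h
    rw [Complex.add_re, Complex.zero_re] at h4
    rw [Complex.add_im, Complex.zero_im] at h5
    linarith
  rcases c.posJ_positive.pos_or_neg α hα with h | h
  · exact key α h
  · have := key _ h
    rwa [LinearMap.neg_apply, neg_ne_zero] at this

/-- The range of `ad` of the regular vector. -/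
noncomputable def regRange : Submodule ℝ (LieAlg E G) :=
  LinearMap.range (adL ℝ E G c.reg : LieAlg E G →ₗ[ℝ] LieAlg E G)

lemma lie_reg_mem (X : LieAlg E G) : ⁅(c.reg : LieAlg E G), X⁆ ∈ c.regRange :=
  ⟨X, by rw [← adL_apply]; rfl⟩

lemma j_sup_regRange : c.j.toSubmodule ⊔ c.regRange = ⊤ := by
  rw [eq_top_iff]
  have hc : (⊤ : Submodule ℂ (LieAlgC E G)) ≤ (c.j.toSubmodule ⊔ c.regRange).baseChange ℂ := by
    rw [← cartan_sup_rootSpaceJ c.j]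
    refine sup_le (fun Z hZ => ?_) (iSup₂_le fun α hα Z hZ => ?_)
    · rw [mem_baseChange_iff_re_im] at hZ ⊢
      exact ⟨Submodule.mem_sup_left hZ.1, Submodule.mem_sup_left hZ.2⟩
    · have h1 : Z = ⁅(1 : ℂ) ⊗ₜ[ℝ] (c.reg : LieAlg E G), (α c.reg)⁻¹ • Z⁆ := by
        rw [lie_smul, mem_rootSpaceJ.1 hZ, smul_smul, inv_mul_cancel₀ (c.root_reg_ne_zero hα),
          one_smul]
      rw [mem_baseChange_iff_re_im, h1, reC_lie, imC_lie]
      exact ⟨Submodule.mem_sup_right (c.lie_reg_mem _), Submodule.mem_sup_right (c.lie_reg_mem _)⟩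
  intro X _
  have h : (1 : ℂ) ⊗ₜ[ℝ] X ∈ (c.j.toSubmodule ⊔ c.regRange).baseChange ℂ := hc trivial
  rw [mem_baseChange_iff_re_im] at h
  simpa using h.1

/-- The centralizer of the regular vector is `𝔧`. -/
lemma ker_adL_reg : LinearMap.ker (adL ℝ E G c.reg : LieAlg E G →ₗ[ℝ] LieAlg E G) =
    c.j.toSubmodule :=
  (ker_eq_and_inf_range_eq_bot (fun X hX => by
    rw [LinearMap.mem_ker]
    change adL ℝ E G c.reg X = 0
    rw [adL_apply, lie_eq_zero_of_mem_cartan c.j c.reg.2 hX]) c.j_sup_regRange).1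

lemma mem_j_iff_lie_reg {X : LieAlg E G} : X ∈ c.j ↔ ⁅(c.reg : LieAlg E G), X⁆ = 0 := by
  rw [← LieSubalgebra.mem_toSubmodule, ← ker_adL_reg, LinearMap.mem_ker, ← adL_apply]
  rfl

lemma eq_zero_of_mem_j_of_mem_regRange {X : LieAlg E G} (h1 : X ∈ c.j) (h2 : X ∈ c.regRange) :
    X = 0 := by
  have h := (ker_eq_and_inf_range_eq_bot (T := (adL ℝ E G c.reg : LieAlg E G →ₗ[ℝ] LieAlg E G))
    c.ker_adL_reg.ge c.j_sup_regRange).2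
  exact (Submodule.mem_bot ℝ).1 (h ▸ Submodule.mem_inf.2 ⟨h1, h2⟩)

/-- The rank of `𝔤` is the dimension of the Cartan subalgebra `𝔧`. Near the regular vector every
element is conjugate to an element of `𝔧`. -/
lemma finrank_le_nilspace_adL (W : LieAlg E G) :
    Module.finrank ℝ c.j ≤ Module.finrank ℝ (nilspace (adL ℝ E G W)) := by
  have hcE : CompleteSpace (LieAlg E G) := FiniteDimensional.complete ℝ _
  have hj : ∀ H : c.j, Module.finrank ℝ c.j ≤ Module.finrank ℝ (nilspace (adL ℝ E G H)) := by
    intro H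
    refine Submodule.finrank_mono (s := c.j.toSubmodule) fun X hX => mem_nilspace.2 ⟨1, ?_⟩
    rw [pow_one, adL_apply, lie_eq_zero_of_mem_cartan c.j H.2 hX]
  -- `Ψ` is a submersion at `0`, because `𝔧` and the range of `ad reg` span `𝔤`
  let Ψ : LieAlg E G × c.j → LieAlg E G := fun p =>
    exp (adL ℝ E G p.1) ((c.reg : LieAlg E G) + p.2)
  let incl : c.j →L[ℝ] LieAlg E G := c.j.toSubmodule.subtypeL
  have hd : HasStrictFDerivAt Ψ ((adL ℝ E G).flip c.reg ∘L ContinuousLinearMap.fst ℝ _ _ +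
      incl ∘L ContinuousLinearMap.snd ℝ _ _) 0 := by
    have h1 : HasStrictFDerivAt (fun p : LieAlg E G × c.j => exp (adL ℝ E G p.1))
        (adL ℝ E G ∘L ContinuousLinearMap.fst ℝ _ _) 0 := by
      have h3 : HasStrictFDerivAt (exp : (LieAlg E G →L[ℝ] LieAlg E G) → _)
          (1 : (LieAlg E G →L[ℝ] LieAlg E G) →L[ℝ] _)
          ((adL ℝ E G ∘L ContinuousLinearMap.fst ℝ (LieAlg E G) c.j) 0) := by
        rw [map_zero]; exact hasStrictFDerivAt_exp_zero
      exact h3.comp 0 (adL ℝ E G ∘L ContinuousLinearMap.fst ℝ (LieAlg E G) c.j).hasStrictFDerivAt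
    have h2 : HasStrictFDerivAt (fun p : LieAlg E G × c.j => (c.reg : LieAlg E G) + p.2)
        (incl ∘L ContinuousLinearMap.snd ℝ _ _) 0 :=
      (incl ∘L ContinuousLinearMap.snd ℝ (LieAlg E G) c.j).hasStrictFDerivAt.const_add _
    have h := h1.clm_apply h2
    refine h.congr_fderiv ?_
    ext p <;> simp
  have hsurj : ((adL ℝ E G).flip c.reg ∘L ContinuousLinearMap.fst ℝ (LieAlg E G) c.j +
      incl ∘L ContinuousLinearMap.snd ℝ _ _).range = ⊤ := by
    rw [eq_top_iff, ← c.j_sup_regRange]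
    refine sup_le (fun X hX => ⟨(0, ⟨X, hX⟩), by simp [incl]; rfl⟩) ?_
    rintro _ ⟨X, rfl⟩
    refine ⟨(-X, 0), ?_⟩
    simp only [add_apply, ContinuousLinearMap.coe_coe, ContinuousLinearMap.comp_apply,
      ContinuousLinearMap.coe_fst', ContinuousLinearMap.coe_snd', ContinuousLinearMap.flip_apply,
      adL_apply, map_zero, add_zero, neg_lie, lie_skew]
  have hnhds := hd.map_nhds_eq_of_surj hsurj
  refine le_finrank_nilspace_of_eventually (w₀ := Ψ 0) ((adL ℝ E G).analyticOnNhd _) ?_ W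
  rw [← hnhds, Filter.eventually_map]
  refine Filter.Eventually.of_forall fun p => ?_
  have h : Ψ p = Ad ℝ E (expG p.1) ((c.reg : LieAlg E G) + p.2) := by
    rw [Ad_expG]
  change _ ≤ Module.finrank ℝ (nilspace (adL ℝ E G (Ψ p)))
  rw [h, nilspace_adL_Ad]
  exact hj (c.reg + p.2)

variable [ConnectedSpace G]

/-- For every `g ∈ G`, the generalized eigenspace of `Ad g` for the eigenvalue `1` has dimension
at least the rank of `𝔤`. Near `1` this is the corresponding statement for the Lie algebra; it
propagates by analyticity. -/
lemma finrank_le_nilspace_Ad (g : G) :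
    Module.finrank ℝ c.j ≤ Module.finrank ℝ (nilspace (Ad ℝ E g - 1)) := by
  have hcE : CompleteSpace (LieAlg E G) := FiniteDimensional.complete ℝ _
  have := isTopologicalGroup_of_chartedSpace E G
  set P : G → Prop := fun g => Module.finrank ℝ c.j ≤ Module.finrank ℝ (nilspace (Ad ℝ E g - 1))
    with hP
  have hone : ∀ᶠ g in 𝓝 (1 : G), P g := by
    filter_upwards [eventually_expG_logG (E := E) (G := G)] with g hg
    rw [hP, ← hg]
    refine (c.finrank_le_nilspace_adL (logG E g)).trans (Submodule.finrank_mono ?_)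
    rw [Ad_expG]
    exact nilspace_le_nilspace_exp_sub_one _
  have hopen : IsOpen {g : G | ∀ᶠ g' in 𝓝 g, P g'} := isOpen_setOfPred_eventually_nhds
  have hlog : ∀ g : G, ∀ᶠ g' in 𝓝 g, expG (logG E (g⁻¹ * g')) = g⁻¹ * g' := by
    intro g
    have h1 : Tendsto (fun g' => g⁻¹ * g') (𝓝 g) (𝓝 1) := by
      have : Tendsto (fun g' => g⁻¹ * g') (𝓝 g) (𝓝 (g⁻¹ * g)) :=
        (continuous_const.mul continuous_id).tendsto g
      rwa [inv_mul_cancel] at this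
    exact h1.eventually eventually_expG_logG
  -- the bound near a point `g'` close to `g` extends by analyticity to `g * expG Z` for all `Z`
  have hclosed : IsClosed {g : G | ∀ᶠ g' in 𝓝 g, P g'} := by
    rw [← closure_subset_iff_isClosed]
    intro g hg
    obtain ⟨g', hg', hg'P⟩ := mem_closure_iff_nhds.1 hg _ (hlog g)
    have hg'e : g * expG (logG E (g⁻¹ * g')) = g' := by
      have h : expG (logG E (g⁻¹ * g')) = g⁻¹ * g' := hg'
      rw [h, mul_inv_cancel_left]
    have hΦ : AnalyticOnNhd ℝ (fun Z : LieAlg E G => Ad ℝ E g * exp (adL ℝ E G Z) - 1)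
        Set.univ := by
      intro Z _
      have h1 : AnalyticAt ℝ (fun Z : LieAlg E G => exp (adL ℝ E G Z)) Z :=
        (NormedSpace.exp_analytic (𝕂 := ℝ) (adL ℝ E G Z)).comp ((adL ℝ E G).analyticAt Z)
      exact (analyticAt_const.mul h1).sub analyticAt_const
    have hall := le_finrank_nilspace_of_eventually (r := Module.finrank ℝ c.j) hΦ
      (w₀ := logG E (g⁻¹ * g')) (by
        have hc : Tendsto (fun Z : LieAlg E G => g * expG Z) (𝓝 (logG E (g⁻¹ * g'))) (𝓝 g') := by
          have := (continuous_const.mul (continuous_expG (E := E) (G := G))).tendsto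
            (f := fun Z => g * expG Z) (logG E (g⁻¹ * g'))
          rwa [hg'e] at this
        filter_upwards [hc.eventually hg'P] with Z hZ
        change _ ≤ Module.finrank ℝ (nilspace (Ad ℝ E (g * expG Z) - 1)) at hZ
        rwa [Ad_mul', Ad_expG] at hZ)
    filter_upwards [hlog g] with g'' hg''
    have h1 := hall (logG E (g⁻¹ * g''))
    rwa [← Ad_expG, ← Ad_mul', hg'', mul_inv_cancel_left] at h1
  have huniv := IsClopen.eq_univ ⟨hclosed, hopen⟩ ⟨1, hone⟩
  have : g ∈ {g : G | ∀ᶠ g' in 𝓝 g, P g'} := by rw [huniv]; trivial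
  exact this.self_of_nhds

/-- An element of `K` fixing the regular vector centralizes `𝔧`. -/
lemma mem_J_of_fix_reg {w : G} (hw : w ∈ fixSubgroup E c.θ)
    (hreg : Ad ℝ E w c.reg = c.reg) : w ∈ c.J := by
  set T := adL ℝ E G c.reg with hT
  set σ := Ad ℝ E w with hσ
  have hcomm : Commute σ T := by
    ext X
    rw [mul_apply_eq_comp, mul_apply_eq_comp, hT, adL_apply, adL_apply, hσ, Ad_lie, hreg]
  have hσR : ∀ v ∈ c.regRange, σ v ∈ c.regRange := by
    rintro _ ⟨X, rfl⟩
    exact ⟨σ X, (congrArg (fun A : LieAlg E G →L[ℝ] LieAlg E G => A X) hcomm.eq).symm⟩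
  -- for a suitable `s`, the element `w * expG (s • reg)` has no fixed vectors in the range of `ad reg`
  obtain ⟨s, hs⟩ := exists_no_fixed_vector hcomm (R := c.regRange)
    (fun v hv => by rw [← Ad_injective_of_inv w v]; exact (congrArg _ hv).trans (map_zero _)) hσR
    (fun v _ => ⟨v, rfl⟩) (fun v hv hv0 => by
      refine c.eq_zero_of_mem_j_of_mem_regRange ?_ hv
      rw [mem_j_iff_lie_reg, ← adL_apply]
      exact hv0)
  set φ := Ad ℝ E (w * expG (s • (c.reg : LieAlg E G))) with hφ
  have hφe : ∀ v, φ v = σ (exp (s • T) v) := by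
    intro v
    rw [hφ, Ad_mul', Ad_expG_smul, mul_apply_eq_comp]
  have hφj : ∀ v ∈ c.j, φ v = σ v := by
    intro v hv
    have h : (s • T) v = (0 : ℝ) • v := by
      rw [smul_apply, hT, adL_apply, lie_eq_zero_of_mem_cartan c.j c.reg.2 hv, smul_zero, zero_smul]
    rw [hφe, exp_apply_of_apply_eq_smul h, NormedSpace.exp_zero, one_smul]
  have hσj : ∀ v ∈ c.j, σ v ∈ c.j := by
    intro v hv
    rw [mem_j_iff_lie_reg] at hv ⊢
    rw [← hreg, hσ, ← Ad_lie, hv, map_zero]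
  have hφR : ∀ v ∈ c.regRange, φ v ∈ c.regRange := by
    intro v hv
    rw [hφe]
    exact hσR _ (exp_apply_mem (fun v _ => c.regRange.smul_mem s ⟨v, rfl⟩) hv)
  -- the generalized eigenspace of `φ` for the eigenvalue `1` is `𝔧`
  have hpowj : ∀ k : ℕ, ∀ v ∈ c.j, ((φ - 1) ^ k) v ∈ c.j ∧ ((φ - 1) ^ k) v = ((σ - 1) ^ k) v := by
    intro k
    induction k with
    | zero => intro v hv; simpa using hv
    | succ k ih =>
      intro v hv
      have h1 := ih v hv
      rw [pow_succ', pow_succ', mul_apply_eq_comp, mul_apply_eq_comp, ← h1.2, sub_apply, sub_apply,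
        hφj _ h1.1]
      exact ⟨sub_mem (hσj _ h1.1) h1.1, rfl⟩
  have hpowR : ∀ k : ℕ, ∀ v ∈ c.regRange, ((φ - 1) ^ k) v ∈ c.regRange ∧
      (((φ - 1) ^ k) v = 0 → v = 0) := by
    intro k
    induction k with
    | zero => intro v hv; simpa using hv
    | succ k ih =>
      intro v hv
      have h0 : (φ - 1) v ∈ c.regRange := by
        rw [sub_apply]; exact sub_mem (hφR v hv) hv
      have h1 := ih _ h0
      rw [pow_succ, mul_apply_eq_comp]
      refine ⟨h1.1, fun h => hs v hv ?_⟩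
      have h2 := h1.2 h
      rw [sub_apply, sub_eq_zero] at h2
      rw [← hφe]
      exact h2
  have hle : nilspace (φ - 1) ≤ c.j.toSubmodule := by
    intro v hv
    obtain ⟨k, hk⟩ := mem_nilspace.1 hv
    have hv' : v ∈ c.j.toSubmodule ⊔ c.regRange := by rw [j_sup_regRange]; trivial
    obtain ⟨x, hx, y, hy, rfl⟩ := Submodule.mem_sup.1 hv'
    rw [map_add] at hk
    have h1 := (hpowj k x hx).1
    have h2 := (hpowR k y hy).1
    have h3 : ((φ - 1) ^ k) y = 0 := by
      refine c.eq_zero_of_mem_j_of_mem_regRange ?_ h2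
      rw [eq_neg_of_add_eq_zero_right hk]
      exact neg_mem h1
    rw [(hpowR k y hy).2 h3, add_zero]
    exact hx
  have heq : nilspace (φ - 1) = c.j.toSubmodule :=
    Submodule.eq_of_le_of_finrank_le hle (c.finrank_le_nilspace_Ad _)
  intro X hX
  refine eq_of_mem_nilspace_of_isometry (B := Bθ c.θ) (fun x => c.θ_cartan.eq_zero_of_Bθ)
    (mem_fixSubgroup_iff_Bθ.1 hw) ?_
  have hX' : X ∈ nilspace (φ - 1) := by rw [heq]; exact hX
  obtain ⟨k, hk⟩ := mem_nilspace.1 hX'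
  exact mem_nilspace.2 ⟨k, by rw [← (hpowj k X hX).2, hk]⟩

end Choices
end Rank

/-! ### Conjugation of the compact part into the Cartan subgroup -/

/-- The first and second order conditions for a linear functional to attain its maximum on an orbit
of a one-parameter group at the starting point. -/
lemma deriv_conditions_of_max {V : Type*} [NormedAddCommGroup V] [NormedSpace ℝ V]
    [CompleteSpace V] {D : V →L[ℝ] V} {f : V →L[ℝ] ℝ} {y : V}
    (h : ∀ t : ℝ, f (exp (t • D) y) ≤ f y) : f (D y) = 0 ∧ f (D (D y)) ≤ 0 := by
  have hd : ∀ (v : V) (t : ℝ), HasDerivAt (fun t : ℝ => f (exp (t • D) v))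
      (f (exp (t • D) (D v))) t := fun v t => by
    have h1 := (hasDerivAt_exp_smul D t).clm_apply (hasDerivAt_const t v)
    have h2 := f.hasFDerivAt.comp_hasDerivAt t h1
    simpa [Function.comp_def] using h2
  have h1 : deriv (fun t : ℝ => f (exp (t • D) y)) = fun t => f (exp (t • D) (D y)) :=
    funext fun t => (hd y t).deriv
  have h2 : ∀ v, f (exp ((0 : ℝ) • D) v) = f v := fun v => by simp
  have hmax : IsLocalMax (fun t : ℝ => f (exp (t • D) y)) 0 :=
    Eventually.of_forall fun t => (h t).trans_eq (h2 y).symm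
  have h0 : f (D y) = 0 := by
    have := hmax.deriv_eq_zero
    rw [h1] at this
    exact (h2 _).symm.trans this
  refine ⟨h0, le_of_not_gt fun hpos => ?_⟩
  have hdd : deriv (deriv fun t : ℝ => f (exp (t • D) y)) 0 = f (D (D y)) := by
    rw [h1, (hd (D y) 0).deriv, h2]
  have hmin : IsLocalMin (fun t : ℝ => f (exp (t • D) y)) 0 :=
    isLocalMin_of_deriv_deriv_pos (by rw [hdd]; exact hpos) (by rw [h1]; exact (h2 _).trans h0)
      (hd y 0).continuousAt
  have hconst : (fun t : ℝ => f (exp (t • D) y)) =ᶠ[𝓝 0] fun _ => f y := by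
    filter_upwards [hmin] with t ht
    rw [h2] at ht
    exact le_antisymm (h t) ht
  rw [hconst.deriv.deriv_eq] at hdd
  simp at hdd
  linarith

section Conjugation

variable {E : Type*} [NormedAddCommGroup E] [NormedSpace ℝ E] [FiniteDimensional ℝ E]
  [CompleteSpace E]
  {G : Type*} [Group G] [TopologicalSpace G] [ChartedSpace E G] [LieGroup 𝓘(ℝ, E) ∞ G]
  [LieAlgebra.IsKilling ℝ (LieAlg E G)]

namespace Choices

variable (c : Choices E G)

lemma lie_mem_l {X Y : LieAlg E G} (hX : X ∈ c.l) (hY : Y ∈ c.l) : ⁅X, Y⁆ ∈ c.l := by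
  rw [← eig_zero] at *
  simpa using c.lie_mem_eig hX hY

/-- The roots that vanish on `𝔞` are compact: their root vectors lie in the complexification of
`𝔨`. -/
lemma theta_reC {α : c.j →ₗ[ℝ] ℂ} (hα : α ∈ rootsJ c.j) (h0 : c.restrict α = 0)
    (hT : (α c.T₀).im ≠ 0) {Z : LieAlgC E G} (hZ : Z ∈ rootSpaceJ c.j α) :
    c.θ (reC Z) = reC Z ∧ c.θ (imC Z) = imC Z := by
  have hθ := c.θ_cartan
  have hl := c.reC_mem_rootSpaceA hα hZ
  rw [h0] at hl
  have hre : (α c.T₀).re = 0 := c.re_eq_zero hα c.theta_T₀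
  have hR := lie_reC hZ c.T₀
  have hI := lie_imC hZ c.T₀
  rw [hre, zero_smul, zero_sub] at hR
  rw [hre, zero_smul, zero_add] at hI
  have key : ∀ X ∈ c.l, c.θ ⁅(c.T₀ : LieAlg E G), X⁆ = ⁅(c.T₀ : LieAlg E G), X⁆ := by
    intro X hX
    have h1 := hθ.half_sub_mem_a c.a_maximal (c.mem_l.1 hX)
    have h2 := lie_eq_zero_of_mem_cartan c.j c.T₀.2 h1.1
    have h3 : ⁅(c.T₀ : LieAlg E G), X⁆ =
        ⁅(c.T₀ : LieAlg E G), (2⁻¹ : ℝ) • (X + c.θ X)⁆ := by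
      conv_lhs => rw [IsCartanInvolution.eq_half_add_half (θ := c.θ) X, lie_add, h2, add_zero]
    rw [h3, LieEquiv.map_lie, hθ.half_add_fixed, c.theta_T₀]
  have k1 := key _ hl.1
  have k2 := key _ hl.2
  rw [hR, map_neg, map_smul, neg_inj] at k1
  rw [hI, map_smul] at k2
  exact ⟨smul_right_injective _ hT k2, smul_right_injective _ hT k1⟩

lemma apply_A₀_eq_zero {α : c.j →ₗ[ℝ] ℂ} (hα : α ∈ rootsJ c.j) (h0 : c.restrict α = 0) :
    α c.A₀ = 0 := by
  have h := c.coe_restrict hα ⟨c.A₀, c.A₀_mem⟩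
  rw [h0] at h
  simpa using h.symm

/-- An element of the Weyl group of the centralizer of `𝔞` that preserves positivity of the roots
fixes the regular vector. -/
lemma Ad_reg_of_posJ {w : G} (hw : w ∈ fixSubgroup E c.θ)
    (hj : ∀ X ∈ c.j, Ad ℝ E w X ∈ c.j)
    (hpos : ∀ α ∈ c.posJ, ∀ σ : c.j →ₗ[ℝ] c.j, (∀ X, (σ X : LieAlg E G) = Ad ℝ E w X) →
      α ∘ₗ σ ∈ c.posJ) : Ad ℝ E w c.reg = c.reg := by
  have hB := mem_fixSubgroup_iff_Bθ.1 hw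
  let σ : c.j →ₗ[ℝ] c.j :=
    (Ad ℝ E w : LieAlg E G →ₗ[ℝ] LieAlg E G).restrict (p := c.j.toSubmodule)
      (q := c.j.toSubmodule) hj
  have hσ : ∀ X, (σ X : LieAlg E G) = Ad ℝ E w X := fun X => rfl
  have hinj : Function.Injective σ := fun X Y h => Subtype.ext (by
    have h' := congrArg (fun Z : c.j => Ad ℝ E w⁻¹ (Z : LieAlg E G)) h
    simpa only [hσ, Ad_injective_of_inv] using h')
  have hsurj : Function.Surjective σ := LinearMap.injective_iff_surjective.1 hinj
  have hfin : c.posJ.Finite := (finite_rootsJ c.j).subset c.posJ_positive.subset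
  have hbij : Set.BijOn (fun α : c.j →ₗ[ℝ] ℂ => α ∘ₗ σ) c.posJ c.posJ := by
    have hm : Set.MapsTo (fun α : c.j →ₗ[ℝ] ℂ => α ∘ₗ σ) c.posJ c.posJ :=
      fun α hα => hpos α hα σ hσ
    have hi : Set.InjOn (fun α : c.j →ₗ[ℝ] ℂ => α ∘ₗ σ) c.posJ := fun α _ β _ h =>
      LinearMap.ext fun X => by
        obtain ⟨Y, rfl⟩ := hsurj X
        exact LinearMap.congr_fun h Y
    exact ⟨hm, hi, (Set.eq_of_subset_of_ncard_le hm.image_subset hi.ncard_image.ge hfin).ge⟩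
  obtain ⟨R, hR⟩ := hsurj c.reg
  have key : ∀ Y : c.j, Bθ c.θ (c.reg : LieAlg E G) Y = Bθ c.θ (R : LieAlg E G) Y := by
    intro Y
    have h1 : Bθ c.θ (c.reg : LieAlg E G) (σ Y) = Bθ c.θ (R : LieAlg E G) Y := by
      rw [← hR, hσ, hσ, hB]
    rw [← h1, c.reg_spec, c.reg_spec]
    symm
    exact finsum_mem_eq_of_bijOn _ hbij fun α _ => rfl
  have h3 : (R : LieAlg E G) = c.reg := by
    rw [← sub_eq_zero]
    refine c.θ_cartan.eq_zero_of_Bθ ?_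
    have := key (R - c.reg)
    push_cast at this ⊢
    rw [LinearMap.map_sub₂, ← this, sub_self]
  rw [← hσ, ← congrArg σ (Subtype.ext h3), hR]

/-- The root `α ∘ Ad w`, for `w` normalizing `𝔧`. -/
lemma comp_Ad_mem_rootsJ {w : G} {α : c.j →ₗ[ℝ] ℂ} (hα : α ∈ rootsJ c.j) {σ : c.j →ₗ[ℝ] c.j}
    (hσ : ∀ X, (σ X : LieAlg E G) = Ad ℝ E w X) : α ∘ₗ σ ∈ rootsJ c.j := by
  have hinj : Function.Injective σ := fun X Y h => Subtype.ext (by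
    have h' := congrArg (fun Z : c.j => Ad ℝ E w⁻¹ (Z : LieAlg E G)) h
    simpa only [hσ, Ad_injective_of_inv] using h')
  have hsurj : Function.Surjective σ := LinearMap.injective_iff_surjective.1 hinj
  obtain ⟨Z, hZ, hZ0⟩ := exists_mem_rootSpaceJ hα
  have hinv : ∀ X, Ad ℝ E w⁻¹ X = 0 → X = 0 := fun X hX => by
    rw [← Ad_apply_inv w X, hX, map_zero]
  refine ⟨fun h => hα.1 ?_, (Submodule.ne_bot_iff _).2
    ⟨(1 : ℂ) ⊗ₜ[ℝ] Ad ℝ E w⁻¹ (reC Z) + Complex.I • ((1 : ℂ) ⊗ₜ[ℝ] Ad ℝ E w⁻¹ (imC Z)), ?_, ?_⟩⟩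
  · ext X
    obtain ⟨Y, rfl⟩ := hsurj X
    exact LinearMap.congr_fun h Y
  · rw [mem_rootSpaceJ]
    have hX : ∀ X : c.j, (X : LieAlg E G) = Ad ℝ E w⁻¹ (σ X) := fun X => by
      rw [hσ, Ad_injective_of_inv]
    intro X
    apply ext_re_im
    · rw [reC_lie, reC_smul]
      simp only [map_add, reC_tmul, imC_tmul, reC_smul, imC_smul, Complex.one_re, Complex.one_im,
        Complex.I_re, Complex.I_im, one_smul, zero_smul, add_zero, zero_add, sub_zero]
      rw [hX, ← Ad_lie, lie_reC hZ, map_sub, map_smul, map_smul]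
      simp
    · rw [imC_lie, imC_smul]
      simp only [map_add, reC_tmul, imC_tmul, reC_smul, imC_smul, Complex.one_re, Complex.one_im,
        Complex.I_re, Complex.I_im, one_smul, zero_smul, add_zero, zero_add, sub_zero]
      rw [hX, ← Ad_lie, lie_imC hZ, map_add, map_smul, map_smul]
      simp
  · intro h
    have h1 := congrArg reC h
    have h2 := congrArg imC h
    simp only [map_add, reC_tmul, imC_tmul, reC_smul, imC_smul, Complex.one_re, Complex.one_im,
        Complex.I_re, Complex.I_im, one_smul, zero_smul, add_zero, zero_add, sub_zero,
        map_zero] at h1 h2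
    exact hZ0 (ext_re_im (by simpa using hinv _ h1) (by simpa using hinv _ h2))

variable [ConnectedSpace G] [Finite (Subgroup.center G)]

/-- Every element of `M` is conjugate into the Cartan subgroup by left multiplication with an
element of any closed subgroup of `M` that contains the exponentials of the Lie algebra of `M`.
The element `k` is chosen so that the pairing of `Ad (k m) T₀` with `T₀` is maximal; then
`Ad (k m)` maps the Weyl chamber of `T₀` to itself. -/
lemma exists_mul_mem_J {S : Subgroup G} (hS : IsClosed (S : Set G)) (hSM : S ≤ c.M)
    (hexp : ∀ X ∈ c.l, c.θ X = X → expG X ∈ S) {m : G} (hm : m ∈ c.M) :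
    ∃ k ∈ S, k * m ∈ c.J := by
  have hθ := c.θ_cartan
  have := isTopologicalGroup_of_chartedSpace E G
  let f : LieAlg E G →L[ℝ] ℝ :=
    LinearMap.toContinuousLinearMap ((Bθ c.θ).flip (c.T₀ : LieAlg E G))
  have hf : ∀ X, f X = Bθ c.θ X c.T₀ := fun X => rfl
  have hcpt : IsCompact (S : Set G) := c.K_maximal.1.of_isClosed_subset hS
    fun x hx => (hSM hx).1
  have hcont : Continuous fun k : G => f (Ad ℝ E (k * m) c.T₀) :=
    f.continuous.comp ((continuous_Ad.comp (continuous_mul_const m)).clm_apply continuous_const)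
  obtain ⟨k, hk, hmax⟩ := hcpt.exists_isMaxOn ⟨1, S.one_mem⟩ hcont.continuousOn
  refine ⟨k, hk, ?_⟩
  set w := k * m with hwdef
  have hwM : w ∈ c.M := c.M.mul_mem (hSM hk) hm
  have hwK := c.mem_K_iff.1 hwM.1
  have hwa := (c.mem_M_iff.1 hwM).2
  have hwF : w ∈ fixSubgroup E c.θ := hwK
  set Y : LieAlg E G := Ad ℝ E w c.T₀ with hY
  have hYθ : c.θ Y = Y := by rw [hY, ← hwK, c.theta_T₀]
  have hYl : Y ∈ c.l := c.mem_l.2 fun A hA => by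
    rw [hY, ← hwa A hA, ← Ad_lie, lie_eq_zero_of_mem_cartan c.j hA.1 c.T₀.2, map_zero]
  have hcond : ∀ Z ∈ c.l, c.θ Z = Z →
      Bθ c.θ ⁅Z, Y⁆ c.T₀ = 0 ∧ Bθ c.θ ⁅Z, ⁅Z, Y⁆⁆ c.T₀ ≤ 0 := by
    intro Z hZ hZθ
    have h := deriv_conditions_of_max (D := adL ℝ E G Z) (f := f) (y := Y) (fun t => by
      have h1 : expG (t • Z) * k ∈ S := S.mul_mem (hexp _ (c.l.smul_mem t hZ)
        (by rw [map_smul, hZθ])) hk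
      have h2 := hmax h1
      change f (Ad ℝ E (expG (t • Z) * k * m) c.T₀) ≤ f (Ad ℝ E (k * m) c.T₀) at h2
      rwa [mul_assoc, Ad_mul', Ad_expG_smul] at h2)
    simpa only [adL_apply, hf] using h
  -- first order: `Y` commutes with `T₀`, hence lies in `𝔧`
  have hYT : ⁅Y, (c.T₀ : LieAlg E G)⁆ = 0 := by
    have hZ : ⁅Y, (c.T₀ : LieAlg E G)⁆ ∈ c.l := c.lie_mem_l hYl (c.j_le_l c.T₀.2)
    have h1 := (hcond _ hZ (by rw [LieEquiv.map_lie, hYθ, c.theta_T₀])).1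
    rw [← lie_skew, map_neg, LinearMap.neg_apply, hθ.Bθ_lie_of_fixed hYθ, neg_neg] at h1
    exact hθ.eq_zero_of_Bθ h1
  have hYj : Y ∈ c.j := by
    rw [mem_j_iff_lie_reg, c.reg_eq]
    change ⁅(c.T₀ : LieAlg E G) + c.A₀, Y⁆ = 0
    rw [add_lie, c.mem_l.1 hYl _ c.A₀_mem, ← lie_skew, hYT, neg_zero, add_zero]
  -- second order: the compact positive roots have the same sign on `Y` as on `T₀`
  have hsign : ∀ α ∈ c.posJ, c.restrict α = 0 → 0 ≤ (α ⟨Y, hYj⟩).im := by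
    intro α hα h0
    have hα' := c.posJ_positive.subset hα
    have hA := c.apply_A₀_eq_zero hα' h0
    have hT := c.reg_pos hα
    rw [hA, Complex.zero_re, zero_add] at hT
    obtain ⟨Z, hZ, hZ0⟩ := exists_mem_rootSpaceJ hα'
    have hl := c.reC_mem_rootSpaceA hα' hZ
    rw [h0] at hl
    obtain ⟨hRθ, hIθ⟩ := c.theta_reC hα' h0 hT.ne' hZ
    have hre : (α c.T₀).re = 0 := c.re_eq_zero hα' c.theta_T₀
    have hreY : (α ⟨Y, hYj⟩).re = 0 := c.re_eq_zero hα' hYθ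
    have r1 := lie_reC hZ c.T₀
    have i1 := lie_imC hZ c.T₀
    have r2 := lie_reC hZ ⟨Y, hYj⟩
    have i2 := lie_imC hZ ⟨Y, hYj⟩
    rw [hre, zero_smul] at r1 i1
    rw [hreY, zero_smul] at r2 i2
    have c1 := (hcond _ hl.1 hRθ).2
    have c2 := (hcond _ hl.2 hIθ).2
    rw [hθ.Bθ_lie_of_fixed hRθ, ← lie_skew (reC Z), ← lie_skew (reC Z), r1, r2] at c1
    rw [hθ.Bθ_lie_of_fixed hIθ, ← lie_skew (imC Z), ← lie_skew (imC Z), i1, i2] at c2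
    simp only [zero_sub, zero_add, neg_neg, map_neg, map_smul, LinearMap.neg_apply,
      LinearMap.smul_apply, smul_eq_mul] at c1 c2
    have hpos := norm_root_vector_pos hθ hZ0
    by_contra hneg
    have h3 := mul_pos (mul_pos hT (neg_pos.2 (not_le.1 hneg))) hpos
    nlinarith
  have hinvj : ∀ X ∈ c.j, Ad ℝ E w⁻¹ X ∈ c.j := by
    intro X hX
    rw [mem_j_iff_lie_reg]
    have h1 : (c.reg : LieAlg E G) = Ad ℝ E w⁻¹ (Y + c.A₀) := by
      have h2 : Ad ℝ E w⁻¹ (c.A₀ : LieAlg E G) = c.A₀ := by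
        conv_lhs => rw [← hwa _ c.A₀_mem, Ad_injective_of_inv]
      rw [map_add, hY, Ad_injective_of_inv, h2, c.reg_eq]
      rfl
    rw [h1, ← Ad_lie, lie_eq_zero_of_mem_cartan c.j (add_mem hYj c.A₀.2) hX, map_zero]
  have hj : ∀ X ∈ c.j, Ad ℝ E w X ∈ c.j := by
    let σ : c.j →ₗ[ℝ] c.j :=
      (Ad ℝ E w⁻¹ : LieAlg E G →ₗ[ℝ] LieAlg E G).restrict (p := c.j.toSubmodule)
        (q := c.j.toSubmodule) hinvj
    have hinj : Function.Injective σ := fun X Y h => Subtype.ext (by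
      have h' := congrArg (fun Z : c.j => Ad ℝ E w (Z : LieAlg E G)) h
      change Ad ℝ E w (Ad ℝ E w⁻¹ X) = Ad ℝ E w (Ad ℝ E w⁻¹ Y) at h'
      simpa only [Ad_apply_inv] using h')
    have hsurj : Function.Surjective σ := LinearMap.injective_iff_surjective.1 hinj
    intro X hX
    obtain ⟨X', hX'⟩ := hsurj ⟨X, hX⟩
    have h1 : Ad ℝ E w⁻¹ X' = X := congrArg Subtype.val hX'
    rw [← h1, Ad_apply_inv]
    exact X'.2
  refine c.mem_J_of_fix_reg hwF (c.Ad_reg_of_posJ hwF hj fun α hα σ hσ => ?_)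
  have hα' := c.posJ_positive.subset hα
  have hασ := c.comp_Ad_mem_rootsJ hα' hσ
  have hres : c.restrict (α ∘ₗ σ) = c.restrict α := by
    ext X
    rw [restrict_apply, restrict_apply, LinearMap.comp_apply]
    congr 2
    exact Subtype.ext ((hσ _).trans (hwa _ X.2))
  by_cases h0 : c.restrict α = 0
  · refine (c.posJ_positive.pos_or_neg _ hασ).resolve_right fun hn => ?_
    have h1 := c.reg_pos hn
    have hA := c.apply_A₀_eq_zero hασ (hres.trans h0)
    have h2 : σ c.T₀ = ⟨Y, hYj⟩ := Subtype.ext (hσ _)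
    have h3 := hsign α hα h0
    rw [LinearMap.neg_apply, LinearMap.neg_apply, hA, LinearMap.comp_apply, h2, neg_zero,
      Complex.zero_re, Complex.neg_im] at h1
    linarith
  · rw [c.restrict_mem_posA_iff hασ (by rw [hres]; exact h0), hres,
      ← c.restrict_mem_posA_iff hα' h0]
    exact hα

end Choices
end Conjugation

/-! ### Images of maps of constant rank -/

section ConstantRank

variable {X Y : Type*} [NormedAddCommGroup X] [NormedSpace ℂ X] [FiniteDimensional ℂ X]
  [NormedAddCommGroup Y] [NormedSpace ℂ Y] [FiniteDimensional ℂ Y]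

/-- Near a point where the rank of the derivative of a `C¹` map is maximal, the image is contained
in a piece of a manifold whose dimension is that rank. -/
lemma exists_dimH_image_le {f : X → Y} {x₀ : X} (hf : ContDiffAt ℂ 1 f x₀)
    (hr : ∀ᶠ x in 𝓝 x₀, Module.finrank ℂ (LinearMap.range (fderiv ℂ f x : X →ₗ[ℂ] Y)) ≤
      Module.finrank ℂ (LinearMap.range (fderiv ℂ f x₀ : X →ₗ[ℂ] Y))) :
    ∃ V ∈ 𝓝 x₀, dimH (f '' V) ≤
      (2 * Module.finrank ℂ (LinearMap.range (fderiv ℂ f x₀ : X →ₗ[ℂ] Y)) : ℕ) := by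
  have : CompleteSpace X := FiniteDimensional.complete ℂ X
  have : CompleteSpace Y := FiniteDimensional.complete ℂ Y
  set L := fderiv ℂ f x₀ with hL
  set R := LinearMap.range (L : X →ₗ[ℂ] Y) with hR
  set K := LinearMap.ker (L : X →ₗ[ℂ] Y) with hK
  obtain ⟨π', hπ'⟩ := LinearMap.exists_leftInverse_of_injective R.subtype R.ker_subtype
  obtain ⟨κ', hκ'⟩ := LinearMap.exists_leftInverse_of_injective K.subtype K.ker_subtype
  let π : Y →L[ℂ] R := LinearMap.toContinuousLinearMap π'
  let κ : X →L[ℂ] K := LinearMap.toContinuousLinearMap κ'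
  have hπ : ∀ y : R, π y = y := fun y => LinearMap.congr_fun hπ' y
  have hκ : ∀ x : K, κ x = x := fun x => LinearMap.congr_fun hκ' x
  -- `(π ∘ f, κ)` is a local diffeomorphism, in whose coordinates `π ∘ f` is the first projection
  let ψ : X → R × K := fun x => (π (f x), κ x)
  have hψ : ContDiffAt ℂ 1 ψ x₀ :=
    (π.contDiff.contDiffAt.comp x₀ hf).prodMk κ.contDiff.contDiffAt
  have hd : HasFDerivAt ψ ((π.comp L).prod κ) x₀ :=
    (π.hasFDerivAt.comp x₀ (hf.differentiableAt one_ne_zero).hasFDerivAt).prodMk κ.hasFDerivAt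
  have hinj : Function.Injective ((π.comp L).prod κ : X →ₗ[ℂ] R × K) := by
    rw [injective_iff_map_eq_zero]
    intro x hx
    have h1 : π (L x) = 0 := congrArg Prod.fst hx
    have h2 : κ x = 0 := congrArg Prod.snd hx
    have h3 := hπ ⟨L x, ⟨x, rfl⟩⟩
    rw [h1] at h3
    have h4 : x ∈ K := (congrArg Subtype.val h3).symm
    have h5 := hκ ⟨x, h4⟩
    rw [h2] at h5
    exact (congrArg Subtype.val h5).symm
  have hdim : Module.finrank ℂ X = Module.finrank ℂ (R × K) := by
    rw [Module.finrank_prod]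
    exact ((L : X →ₗ[ℂ] Y).finrank_range_add_finrank_ker).symm
  let e : X ≃L[ℂ] R × K :=
    (LinearEquiv.ofInjectiveOfFinrankEq _ hinj hdim).toContinuousLinearEquiv
  have hd' : HasFDerivAt ψ (e : X →L[ℂ] R × K) x₀ := by
    have he : (e : X →L[ℂ] R × K) = (π.comp L).prod κ := ContinuousLinearMap.ext fun x => rfl
    rw [he]
    exact hd
  let Ψ := hψ.toOpenPartialHomeomorph ψ hd' one_ne_zero
  have hx₀ : x₀ ∈ Ψ.source := hψ.mem_toOpenPartialHomeomorph_source hd' one_ne_zero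
  have hΨ : ∀ x, Ψ x = ψ x := fun x => rfl
  have hsymm : ContDiffAt ℂ 1 Ψ.symm (ψ x₀) := hψ.to_localInverse hd' one_ne_zero
  have hx₀' : Ψ.symm (ψ x₀) = x₀ := Ψ.left_inv hx₀
  let F : R × K → Y := fun p => f (Ψ.symm p)
  have hF : ContDiffAt ℂ 1 F (ψ x₀) := ContDiffAt.comp _ (by rw [hx₀']; exact hf) hsymm
  have htend : Tendsto Ψ.symm (𝓝 (ψ x₀)) (𝓝 x₀) := by
    have := hsymm.continuousAt.tendsto
    rwa [hx₀'] at this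
  have hev : ∀ᶠ p in 𝓝 (ψ x₀), ContDiffAt ℂ 1 F p ∧ p ∈ Ψ.target ∧
      ContDiffAt ℂ 1 f (Ψ.symm p) ∧ ContDiffAt ℂ 1 Ψ.symm p ∧
      Module.finrank ℂ (LinearMap.range (fderiv ℂ f (Ψ.symm p) : X →ₗ[ℂ] Y)) ≤
        Module.finrank ℂ R := by
    filter_upwards [hF.eventually (by simp), Ψ.open_target.mem_nhds (Ψ.map_source hx₀),
      htend.eventually (hf.eventually (by simp)), hsymm.eventually (by simp),
      htend.eventually hr] with p h1 h2 h3 h4 h5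
    exact ⟨h1, h2, h3, h4, h5⟩
  obtain ⟨δ, hδ, hball⟩ := Metric.eventually_nhds_iff_ball.1 hev
  -- on the ball, `F` is constant in the direction of `K`
  have hker : ∀ p ∈ Metric.ball (ψ x₀) δ, ∀ k : K, fderiv ℂ F p (0, k) = 0 := by
    intro p hp k
    obtain ⟨h1, h2, h3, h4, h5⟩ := hball p hp
    set D := fderiv ℂ F p with hD
    have hfst : ∀ v, π (D v) = v.1 := by
      have e1 : (fun q => π (F q)) =ᶠ[𝓝 p] Prod.fst := by
        filter_upwards [Ψ.open_target.mem_nhds h2] with q hq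
        exact congrArg Prod.fst (Ψ.right_inv hq)
      have e2 := π.hasFDerivAt.comp p (h1.differentiableAt one_ne_zero).hasFDerivAt
      have e3 := (e2.congr_of_eventuallyEq e1.symm).unique hasFDerivAt_fst
      exact fun v => congrArg (fun T : R × K →L[ℂ] R => T v) e3
    have hle : LinearMap.range (D : R × K →ₗ[ℂ] Y) ≤
        LinearMap.range (fderiv ℂ f (Ψ.symm p) : X →ₗ[ℂ] Y) := by
      have e1 := ((h3.differentiableAt one_ne_zero).hasFDerivAt.comp p
        (h4.differentiableAt one_ne_zero).hasFDerivAt).fderiv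
      rintro _ ⟨v, rfl⟩
      exact ⟨fderiv ℂ Ψ.symm p v, (congrArg (fun T : R × K →L[ℂ] Y => T v) e1).symm⟩
    let T : LinearMap.range (D : R × K →ₗ[ℂ] Y) →ₗ[ℂ] R :=
      (π : Y →ₗ[ℂ] R) ∘ₗ Submodule.subtype _
    have hsurj : Function.Surjective T := fun ρ => ⟨⟨D (ρ, 0), ⟨(ρ, 0), rfl⟩⟩, hfst (ρ, 0)⟩
    have hTinj : Function.Injective T := by
      rw [LinearMap.injective_iff_surjective_of_finrank_eq_finrank]
      · exact hsurj
      · exact le_antisymm ((Submodule.finrank_mono hle).trans h5)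
          (LinearMap.finrank_le_finrank_of_surjective hsurj)
    have h0 : T ⟨D (0, k), ⟨(0, k), rfl⟩⟩ = T 0 := by
      rw [map_zero]; exact hfst (0, k)
    exact congrArg Subtype.val (hTinj h0)
  have hconst : ∀ p ∈ Metric.ball (ψ x₀) δ, F p = F (p.1, (ψ x₀).2) := by
    rintro ⟨ρ, k⟩ hp
    have hρ : ∀ k' ∈ Metric.ball (ψ x₀).2 δ, ((ρ, k') : R × K) ∈ Metric.ball (ψ x₀) δ := by
      intro k' hk'
      rw [← ball_prod_same] at hp ⊢
      exact ⟨hp.1, hk'⟩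
    have hk : k ∈ Metric.ball (ψ x₀).2 δ := by
      rw [← ball_prod_same] at hp
      exact hp.2
    have hdk : ∀ k' ∈ Metric.ball (ψ x₀).2 δ, HasFDerivAt (𝕜 := ℂ) (fun k => F (ρ, k)) 0 k' := by
      intro k' hk'
      have e1 := ((hball _ (hρ k' hk')).1.differentiableAt one_ne_zero).hasFDerivAt.comp k'
        (hasFDerivAt_prodMk_right ρ k')
      have e2 : (fderiv ℂ F (ρ, k')).comp (ContinuousLinearMap.inr ℂ R K) = 0 :=
        ContinuousLinearMap.ext fun k'' => hker _ (hρ k' hk') k''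
      rw [e2] at e1
      exact e1
    exact Metric.isOpen_ball.is_const_of_fderiv_eq_zero (𝕜 := ℂ) (f := fun k => F (ρ, k))
      (convex_ball _ _).isPreconnected
      (fun k' hk' => (hdk k' hk').differentiableAt.differentiableWithinAt)
      (fun k' hk' => (hdk k' hk').fderiv) hk (Metric.mem_ball_self hδ)
  refine ⟨Ψ.source ∩ Ψ ⁻¹' Metric.ball (ψ x₀) δ,
    (Ψ.isOpen_inter_preimage Metric.isOpen_ball).mem_nhds ⟨hx₀, Metric.mem_ball_self hδ⟩, ?_⟩
  have hsub : f '' (Ψ.source ∩ Ψ ⁻¹' Metric.ball (ψ x₀) δ) ⊆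
      (fun ρ : R => F (ρ, (ψ x₀).2)) '' Metric.ball (ψ x₀).1 δ := by
    rintro _ ⟨x, ⟨hx, hx'⟩, rfl⟩
    refine ⟨(ψ x).1, ?_, ?_⟩
    · rw [Set.mem_preimage, ← ball_prod_same] at hx'
      exact hx'.1
    · change F ((ψ x).1, (ψ x₀).2) = f x
      exact (hconst _ hx').symm.trans (congrArg f (Ψ.left_inv hx))
  have hC : ContDiffOn ℂ 1 (fun ρ : R => F (ρ, (ψ x₀).2)) (Metric.ball (ψ x₀).1 δ) := by
    intro ρ hρ
    have h1 := (hball (ρ, (ψ x₀).2) (by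
      rw [← ball_prod_same]; exact ⟨hρ, Metric.mem_ball_self hδ⟩)).1
    exact (ContDiffAt.comp (f := fun ρ : R => (ρ, (ψ x₀).2)) ρ h1
      (contDiffAt_id.prodMk contDiffAt_const)).contDiffWithinAt
  -- the Hausdorff dimension is the real dimension of `R`
  refine (dimH_mono hsub).trans (((hC.restrict_scalars ℝ).dimH_image_le (convex_ball _ _)
    subset_rfl).trans ((dimH_mono (Set.subset_univ _)).trans ?_))
  rw [Real.dimH_univ_eq_finrank, finrank_real_of_complex]

end ConstantRank

/-! ### Rank modulo a subspace -/

section QuotientRank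

variable {K V W : Type*} [Field K] [AddCommGroup V] [Module K V] [AddCommGroup W] [Module K W]
  [FiniteDimensional K V]

/-- The dimension of `range A + b` is the rank of `A` modulo `b` plus the dimension of `b`. -/
lemma finrank_range_sup (A : W →ₗ[K] V) (b : Submodule K V) :
    Module.finrank K (LinearMap.range A ⊔ b : Submodule K V) =
      Module.finrank K (LinearMap.range (b.mkQ ∘ₗ A)) + Module.finrank K b := by
  set S := LinearMap.range A ⊔ b with hS
  have h1 := (b.mkQ ∘ₗ S.subtype).finrank_range_add_finrank_ker
  have h2 : LinearMap.range (b.mkQ ∘ₗ S.subtype) = LinearMap.range (b.mkQ ∘ₗ A) := by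
    rw [LinearMap.range_comp, LinearMap.range_comp, Submodule.range_subtype, hS,
      Submodule.map_sup, Submodule.mkQ_map_self, sup_bot_eq]
  have h3 : LinearMap.ker (b.mkQ ∘ₗ S.subtype) = b.comap S.subtype := by
    rw [LinearMap.ker_comp, Submodule.ker_mkQ]
  rw [h2, h3, (Submodule.comapSubtypeEquivOfLe (le_sup_right : b ≤ S)).finrank_eq] at h1
  exact h1.symm

/-- An operator that preserves `b` does not increase the dimension modulo `b`, and preserves it if
it is surjective modulo `b`. -/
lemma finrank_range_comp_sup (A : W →ₗ[K] V) {b : Submodule K V} {T : V →ₗ[K] V}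
    (hT : ∀ x ∈ b, T x ∈ b) :
    Module.finrank K (LinearMap.range (T ∘ₗ A) ⊔ b : Submodule K V) ≤
      Module.finrank K (LinearMap.range A ⊔ b : Submodule K V) ∧
    ((∀ x, ∃ y, ∃ w ∈ b, x = T y + w) →
      Module.finrank K (LinearMap.range (T ∘ₗ A) ⊔ b : Submodule K V) =
      Module.finrank K (LinearMap.range A ⊔ b : Submodule K V)) := by
  have h1 : b.mkQ ∘ₗ T ∘ₗ A = (b.mapQ b T hT) ∘ₗ (b.mkQ ∘ₗ A) := by
    ext x; rfl
  rw [finrank_range_sup, finrank_range_sup, h1, LinearMap.range_comp (b.mkQ ∘ₗ A)]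
  refine ⟨Nat.add_le_add_right (Submodule.finrank_map_le _ _) _, fun h => ?_⟩
  have hs : Function.Surjective (b.mapQ b T hT) := by
    intro x
    obtain ⟨x, rfl⟩ := b.mkQ_surjective x
    obtain ⟨y, w, hw, rfl⟩ := h x
    refine ⟨b.mkQ y, ?_⟩
    rw [map_add, Submodule.mkQ_apply b w, (Submodule.Quotient.mk_eq_zero b).2 hw, add_zero]
    rfl
  rw [← (Submodule.equivMapOfInjective _ (LinearMap.injective_iff_surjective.2 hs) _).finrank_eq]

end QuotientRank

/-! ### Translates of a subalgebra under a complex Lie subgroup -/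

section ComplexOrbits

variable {Ec : Type*} [NormedAddCommGroup Ec] [NormedSpace ℂ Ec] [FiniteDimensional ℂ Ec]
  [CompleteSpace Ec]
  {Gc : Type*} [Group Gc] [TopologicalSpace Gc] [ChartedSpace Ec Gc] [LieGroup 𝓘(ℂ, Ec) ∞ Gc]
  {F : Type*} [NormedAddCommGroup F] [NormedSpace ℂ F]
  {Hc : Type*} [Group Hc] [TopologicalSpace Hc]
  [ChartedSpace F Hc] [LieGroup 𝓘(ℂ, F) ∞ Hc]

/-- The differential at `1` of a map between Lie groups, as a map between the model spaces. -/
noncomputable def diffOne (ι : Hc → Gc) : F →L[ℂ] Ec := mfderiv 𝓘(ℂ, F) 𝓘(ℂ, Ec) ι 1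

/-- The adjoint action on the Lie algebra of `Gc` of the differential of a map to `Gc`. -/
noncomputable def adOne (ι : Hc → Gc) : F →L[ℂ] Ec →L[ℂ] Ec :=
  (adE ℂ Ec Gc).comp (diffOne ι)

variable {ι : Hc →* Gc} (hι : ContMDiff 𝓘(ℂ, F) 𝓘(ℂ, Ec) ∞ ι)
include hι

lemma contDiffAt_Ad_chart {u : F} (hu : u ∈ (extChartAt 𝓘(ℂ, F) (1 : Hc)).target) :
    ContDiffAt ℂ ∞ (fun u => AdE ℂ Ec (ι ((extChartAt 𝓘(ℂ, F) (1 : Hc)).symm u))) u := by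
  rw [← contMDiffAt_iff_contDiffAt]
  have h1 : ContMDiffAt 𝓘(ℂ, F) 𝓘(ℂ, F) ∞ (extChartAt 𝓘(ℂ, F) (1 : Hc)).symm u :=
    (contMDiffOn_extChartAt_symm (1 : Hc)).contMDiffAt
      ((isOpen_extChartAt_target (1 : Hc)).mem_nhds hu)
  exact ContMDiffAt.comp (I' := 𝓘(ℂ, F)) (g := fun h => AdE ℂ Ec (ι h)) u
    ((contMDiff_AdE (𝕜 := ℂ) (E := Ec)).comp hι).contMDiffAt h1

lemma hasMFDerivAt_AdE_comp {h : Hc} (h1 : h = 1) :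
    HasMFDerivAt 𝓘(ℂ, F) 𝓘(ℂ, Ec →L[ℂ] Ec) (fun h => AdE ℂ Ec (ι h)) h
      (adOne (Ec := Ec) (F := F) ι) := by
  subst h1
  exact HasMFDerivAt.comp (I' := 𝓘(ℂ, Ec)) (1 : Hc) (hasMFDerivAt_AdE (map_one ι))
    ((hι 1).mdifferentiableAt (by simp)).hasMFDerivAt

lemma hasFDerivAt_Ad_chart_one :
    HasFDerivAt (fun u => AdE ℂ Ec (ι ((extChartAt 𝓘(ℂ, F) (1 : Hc)).symm u)))
      (adOne ι) (extChartAt 𝓘(ℂ, F) (1 : Hc) 1) := by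
  have h := (hasMFDerivAt_AdE_comp hι rfl).2
  simp only [modelWithCornersSelf_coe, Set.range_id] at h
  exact hasFDerivWithinAt_univ.1 h

/-- The derivative of `h ↦ Ad (ι h)` at any point is the composition of `Ad` with `ad` of elements
of the Lie algebra of `Hc`. -/
lemma exists_hasFDerivAt_Ad_chart {u : F} (hu : u ∈ (extChartAt 𝓘(ℂ, F) (1 : Hc)).target) :
    ∃ D : F →L[ℂ] F,
      HasFDerivAt (fun u => AdE ℂ Ec (ι ((extChartAt 𝓘(ℂ, F) (1 : Hc)).symm u)))
      ((ContinuousLinearMap.compL ℂ Ec Ec Ec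
        (AdE ℂ Ec (ι ((extChartAt 𝓘(ℂ, F) (1 : Hc)).symm u)))).comp
          ((adOne ι).comp D)) u := by
  set y := (extChartAt 𝓘(ℂ, F) (1 : Hc)).symm with hy
  have h1 : ContMDiffAt 𝓘(ℂ, F) 𝓘(ℂ, F) ∞ y u :=
    (contMDiffOn_extChartAt_symm (1 : Hc)).contMDiffAt
      ((isOpen_extChartAt_target (1 : Hc)).mem_nhds hu)
  have h2 : ContMDiffAt 𝓘(ℂ, F) 𝓘(ℂ, F) ∞ (fun w => (y u)⁻¹ * y w) u :=
    ContMDiffAt.comp u (contMDiff_mul_left (I := 𝓘(ℂ, F)) (n := ∞) (a := (y u)⁻¹)).contMDiffAt h1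
  have h3 := (h2.mdifferentiableAt (by simp)).hasMFDerivAt
  refine ⟨mfderiv 𝓘(ℂ, F) 𝓘(ℂ, F) (fun w => (y u)⁻¹ * y w) u, ?_⟩
  have h4 := HasMFDerivAt.comp (I' := 𝓘(ℂ, F)) u
    (hasMFDerivAt_AdE_comp hι (h := (y u)⁻¹ * y u) (by simp)) h3
  have h5 := (ContinuousLinearMap.compL ℂ Ec Ec Ec (AdE ℂ Ec (ι (y u)))).hasFDerivAt.comp u
    (hasMFDerivAt_iff_hasFDerivAt.1 h4)
  refine h5.congr_of_eventuallyEq (Eventually.of_forall fun w => ?_)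
  change AdE ℂ Ec (ι (y w)) = (AdE ℂ Ec (ι (y u))).comp (AdE ℂ Ec (ι ((y u)⁻¹ * y w)))
  rw [← AdE_mul, ← map_mul, mul_inv_cancel_left]

variable [FiniteDimensional ℂ F]

/-- The union of the translates `Ad (ι h) Y`, for `h` near `1` and `Y` in a subalgebra `b` near a
point that is regular modulo `b`, has at most the dimension of the sum of `b` and the Lie algebra of
`Hc`. -/
lemma exists_dimH_orbit_le {b : Submodule ℂ Ec}
    (hb : ∀ X ∈ b, ∀ Y ∈ b, adE ℂ Ec Gc X Y ∈ b) {Y₀ : b}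
    (hY₀ : ∀ X, ∃ Z, ∃ W ∈ b, X = adE ℂ Ec Gc Z Y₀ + W) :
    ∃ V ∈ 𝓝 (1 : Hc), ∃ V' ∈ 𝓝 Y₀,
      dimH {X | ∃ h ∈ V, ∃ Y ∈ V', X = AdE ℂ Ec (ι h) (Y : Ec)} ≤
        (2 * Module.finrank ℂ
          (LinearMap.range (diffOne ι : F →L[ℂ] Ec).toLinearMap ⊔ b : Submodule ℂ Ec) : ℕ) := by
  set e := extChartAt 𝓘(ℂ, F) (1 : Hc) with he
  set a : F → Ec →L[ℂ] Ec := fun u => AdE ℂ Ec (ι (e.symm u)) with ha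
  set S := LinearMap.range (diffOne ι : F →L[ℂ] Ec).toLinearMap ⊔ b with hS
  have ht : e.target ∈ 𝓝 (e 1) := extChartAt_target_mem_nhds (1 : Hc)
  let f : F × b → Ec := fun p => a p.1 p.2
  -- the range of the derivative of `f` at `(u, Y)` is contained in the translate of `N Y` by `a u`
  let N : b → Submodule ℂ Ec := fun Y =>
    LinearMap.range (((adE ℂ Ec Gc).flip (Y : Ec) : Ec →ₗ[ℂ] Ec) ∘ₗ
      (diffOne ι : F →L[ℂ] Ec).toLinearMap) ⊔ b
  have hN : ∀ Y : b, Module.finrank ℂ (N Y) ≤ Module.finrank ℂ S := fun Y =>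
    (finrank_range_comp_sup _ (T := ((adE ℂ Ec Gc).flip (Y : Ec) : Ec →ₗ[ℂ] Ec))
      fun X hX => hb X hX Y Y.2).1
  have hN₀ : Module.finrank ℂ (N Y₀) = Module.finrank ℂ S :=
    (finrank_range_comp_sup _ (T := ((adE ℂ Ec Gc).flip (Y₀ : Ec) : Ec →ₗ[ℂ] Ec))
      fun X hX => hb X hX Y₀ Y₀.2).2 hY₀
  have hfd : ∀ {A' : F →L[ℂ] Ec →L[ℂ] Ec} {p : F × b}, HasFDerivAt a A' p.1 →
      ∀ w, fderiv ℂ f p w = a p.1 w.2 + A' w.1 p.2 := by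
    intro A' p hA w
    have h1 : HasFDerivAt (fun p : F × b => a p.1)
        (A'.comp (ContinuousLinearMap.fst ℂ F b)) p := hA.comp p hasFDerivAt_fst
    have h2 : HasFDerivAt (fun p : F × b => (p.2 : Ec))
        (b.subtypeL.comp (ContinuousLinearMap.snd ℂ F b)) p :=
      b.subtypeL.hasFDerivAt.comp p hasFDerivAt_snd
    have h3 := h1.clm_apply h2
    rw [h3.fderiv]
    rfl
  have hrange : ∀ p : F × b, p.1 ∈ e.target →
      Module.finrank ℂ (LinearMap.range (fderiv ℂ f p : F × b →ₗ[ℂ] Ec)) ≤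
        Module.finrank ℂ S := by
    intro p hp
    obtain ⟨D, hD⟩ := exists_hasFDerivAt_Ad_chart hι hp
    have hle : LinearMap.range (fderiv ℂ f p : F × b →ₗ[ℂ] Ec) ≤
        (N p.2).map (a p.1 : Ec →ₗ[ℂ] Ec) := by
      rintro _ ⟨w, rfl⟩
      refine ⟨(adE ℂ Ec Gc) (diffOne ι (D w.1)) p.2 + w.2, add_mem (Submodule.mem_sup_left
        ⟨D w.1, rfl⟩) (Submodule.mem_sup_right w.2.2), ?_⟩
      have h := hfd hD w
      refine Eq.trans ?_ h.symm
      rw [map_add, add_comm]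
      rfl
    exact (Submodule.finrank_mono hle).trans ((Submodule.finrank_map_le _ _).trans (hN p.2))
  have ha1 : a (e 1) = ContinuousLinearMap.id ℂ Ec := by
    rw [ha]
    change AdE ℂ Ec (ι (e.symm (e 1))) = _
    rw [extChartAt_to_inv, map_one, AdE_one]
  -- at `(e 1, Y₀)` the rank is maximal, because `Y₀` is regular modulo `b`
  have hrange₀ : Module.finrank ℂ S ≤
      Module.finrank ℂ (LinearMap.range (fderiv ℂ f (e 1, Y₀) : F × b →ₗ[ℂ] Ec)) := by
    rw [← hN₀]
    refine Submodule.finrank_mono ?_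
    intro x hx
    obtain ⟨_, ⟨v, rfl⟩, w, hw, rfl⟩ := Submodule.mem_sup.1 hx
    refine ⟨(v, ⟨w, hw⟩), ?_⟩
    refine (hfd (hasFDerivAt_Ad_chart_one hι) (v, ⟨w, hw⟩)).trans ?_
    rw [ha1, add_comm]
    rfl
  have hf : ContDiffAt ℂ 1 f (e 1, Y₀) := by
    have h1 : ContDiffAt ℂ 1 a (e 1) :=
      (contDiffAt_Ad_chart hι (mem_extChartAt_target (1 : Hc))).of_le (by norm_cast)
    have h2 : ContDiffAt ℂ 1 (fun p : F × b => a p.1) (e 1, Y₀) :=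
      ContDiffAt.comp (g := a) (e 1, Y₀) h1 contDiffAt_fst
    exact h2.clm_apply (b.subtypeL.contDiff.contDiffAt.comp (e 1, Y₀) contDiffAt_snd)
  obtain ⟨V, hV, hdim⟩ := exists_dimH_image_le hf (by
    have htend : Tendsto (Prod.fst : F × b → F) (𝓝 (e 1, Y₀)) (𝓝 (e 1)) :=
      continuous_fst.tendsto _
    filter_upwards [htend.eventually ht] with p hp
    exact (hrange p hp).trans hrange₀)
  rw [nhds_prod_eq] at hV
  obtain ⟨V₁, hV₁, V₂, hV₂, hsub⟩ := Filter.mem_prod_iff.1 hV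
  refine ⟨e.source ∩ e ⁻¹' V₁, inter_mem (extChartAt_source_mem_nhds (1 : Hc))
    ((continuousAt_extChartAt (1 : Hc)) hV₁), V₂, hV₂, (dimH_mono ?_).trans (hdim.trans ?_)⟩
  · rintro _ ⟨h, ⟨hh, hh'⟩, Y, hY, rfl⟩
    refine ⟨(e h, Y), hsub ⟨hh', hY⟩, ?_⟩
    change AdE ℂ Ec (ι (e.symm (e h))) (Y : Ec) = _
    rw [e.left_inv hh]
  · exact_mod_cast Nat.mul_le_mul_left 2 (hrange (e 1, Y₀) (mem_extChartAt_target (1 : Hc)))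

end ComplexOrbits

/-! ### Open products and transversality of Lie algebras -/

section OpenOrbits

variable {Ec : Type*} [NormedAddCommGroup Ec] [NormedSpace ℂ Ec] [FiniteDimensional ℂ Ec]
  [CompleteSpace Ec]
  {Gc : Type*} [Group Gc] [TopologicalSpace Gc] [ChartedSpace Ec Gc] [LieGroup 𝓘(ℂ, Ec) ∞ Gc]

/-- The elements of `b` that are regular modulo `b` form an open set. -/
lemma eventually_regular {b : Submodule ℂ Ec} {Y₀ : b}
    (hY₀ : ∀ X, ∃ Z, ∃ W ∈ b, X = adE ℂ Ec Gc Z Y₀ + W) :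
    ∀ᶠ Y : b in 𝓝 Y₀, ∀ X, ∃ Z, ∃ W ∈ b, X = adE ℂ Ec Gc Z Y + W := by
  let M : b → Ec × b →L[ℂ] Ec := fun Y =>
    ((adE ℂ Ec Gc).flip (Y : Ec)).comp (ContinuousLinearMap.fst ℂ Ec b) +
      b.subtypeL.comp (ContinuousLinearMap.snd ℂ Ec b)
  have hM : ∀ Y p, M Y p = adE ℂ Ec Gc p.1 Y + p.2 := fun Y p => rfl
  obtain ⟨R', hR'⟩ := LinearMap.exists_rightInverse_of_surjective (M Y₀ : Ec × b →ₗ[ℂ] Ec)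
    (LinearMap.range_eq_top.2 fun X => by
      obtain ⟨Z, W, hW, rfl⟩ := hY₀ X
      exact ⟨(Z, ⟨W, hW⟩), rfl⟩)
  let R : Ec →L[ℂ] Ec × b := LinearMap.toContinuousLinearMap R'
  have hMc : Continuous fun Y => (M Y).comp R := by
    have h1 : Continuous M := by
      refine Continuous.add ?_ continuous_const
      exact ((adE ℂ Ec Gc).flip.continuous.comp b.subtypeL.continuous).clm_comp continuous_const
    exact h1.clm_comp continuous_const
  have h0 : (M Y₀).comp R = 1 := ContinuousLinearMap.ext fun X => LinearMap.congr_fun hR' X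
  have h1 : ∀ᶠ Y in 𝓝 Y₀, IsUnit ((M Y).comp R) :=
    hMc.continuousAt.eventually (Units.isOpen.mem_nhds (by
      change IsUnit ((M Y₀).comp R)
      rw [h0]; exact isUnit_one))
  filter_upwards [h1] with Y hY X
  obtain ⟨T, hT⟩ := hY
  have h2 : (M Y) (R ((T⁻¹ : (Ec →L[ℂ] Ec)ˣ).val X)) = X := by
    change ((M Y).comp R) ((T⁻¹ : (Ec →L[ℂ] Ec)ˣ).val X) = X
    rw [← hT, ← mul_apply_eq_comp, Units.mul_inv]
    rfl
  exact ⟨_, _, (R ((T⁻¹ : (Ec →L[ℂ] Ec)ˣ).val X)).2.2, h2.symm⟩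

/-- The translates of the regular elements of `b` fill a neighbourhood. -/
lemma orbit_mem_nhds {b : Submodule ℂ Ec} {Y₀ : b}
    (hY₀ : ∀ X, ∃ Z, ∃ W ∈ b, X = adE ℂ Ec Gc Z Y₀ + W) {U : Set Gc} (hU : U ∈ 𝓝 (1 : Gc))
    {r : Set b} (hr : r ∈ 𝓝 Y₀) :
    {X | ∃ g ∈ U, ∃ Y ∈ r, X = AdE ℂ Ec g (Y : Ec)} ∈ 𝓝 (Y₀ : Ec) := by
  set e := extChartAt 𝓘(ℂ, Ec) (1 : Gc) with he
  set a : Ec → Ec →L[ℂ] Ec := fun u => AdE ℂ Ec (e.symm u) with ha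
  let f : Ec × b → Ec := fun p => a p.1 p.2
  have ha' : ContDiffAt ℂ 1 a (e 1) :=
    (contDiffAt_AdE_chart (𝕜 := ℂ) (E := Ec) (G := Gc)).of_le (by norm_cast)
  have h2 : ContDiffAt ℂ 1 (fun p : Ec × b => a p.1) (e 1, Y₀) :=
    ContDiffAt.comp (g := a) (e 1, Y₀) ha' contDiffAt_fst
  have hf : ContDiffAt ℂ 1 f (e 1, Y₀) :=
    h2.clm_apply (b.subtypeL.contDiff.contDiffAt.comp (e 1, Y₀) contDiffAt_snd)
  have ha1 : a (e 1) = ContinuousLinearMap.id ℂ Ec := by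
    change AdE ℂ Ec (e.symm (e 1)) = _
    rw [extChartAt_to_inv, AdE_one]
  have hfd : ∀ w, fderiv ℂ f (e 1, Y₀) w = w.2 + adE ℂ Ec Gc w.1 Y₀ := by
    intro w
    have h1 : HasFDerivAt (fun p : Ec × b => a p.1)
        ((fderiv ℂ a (e 1)).comp (ContinuousLinearMap.fst ℂ Ec b)) (e 1, Y₀) :=
      HasFDerivAt.comp (g := a) (e 1, Y₀)
        (ha'.differentiableAt one_ne_zero).hasFDerivAt hasFDerivAt_fst
    have h2 : HasFDerivAt (fun p : Ec × b => (p.2 : Ec))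
        (b.subtypeL.comp (ContinuousLinearMap.snd ℂ Ec b)) (e 1, Y₀) :=
      b.subtypeL.hasFDerivAt.comp (e 1, Y₀) hasFDerivAt_snd
    have h3 := h1.clm_apply h2
    have h4 : fderiv ℂ a (e 1) w.1 Y₀ = adE ℂ Ec Gc w.1 Y₀ :=
      fderiv_AdE_chart (𝕜 := ℂ) (E := Ec) (G := Gc) w.1 (Y₀ : Ec)
    rw [h3.fderiv, ← h4]
    change a (e 1) w.2 + fderiv ℂ a (e 1) w.1 Y₀ = _
    rw [ha1]
    rfl
  -- regularity of `Y₀` says that `f` is a submersion at `(e 1, Y₀)`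
  have hsurj : LinearMap.range (fderiv ℂ f (e 1, Y₀) : Ec × b →ₗ[ℂ] Ec) = ⊤ := by
    rw [LinearMap.range_eq_top]
    intro X
    obtain ⟨Z, W, hW, rfl⟩ := hY₀ X
    refine ⟨(Z, ⟨W, hW⟩), (hfd _).trans ?_⟩
    rw [add_comm]
  have hmap := (hf.hasStrictFDerivAt one_ne_zero).map_nhds_eq_of_surj hsurj
  have hf0 : f (e 1, Y₀) = Y₀ := by
    change a (e 1) Y₀ = _
    rw [ha1]; rfl
  rw [hf0] at hmap
  rw [← hmap, Filter.mem_map]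
  have hs : ContinuousAt e.symm (e 1) := continuousAt_extChartAt_symm (1 : Gc)
  have hU' : e.symm ⁻¹' U ∈ 𝓝 (e 1) := hs (by rw [extChartAt_to_inv]; exact hU)
  rw [nhds_prod_eq]
  filter_upwards [prod_mem_prod hU' hr] with p hp
  exact ⟨_, hp.1, _, hp.2, rfl⟩

variable {F : Type*} [NormedAddCommGroup F] [NormedSpace ℂ F] [FiniteDimensional ℂ F]
  {Hc : Type*} [Group Hc] [TopologicalSpace Hc] [SecondCountableTopology Hc]
  [ChartedSpace F Hc] [LieGroup 𝓘(ℂ, F) ∞ Hc]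

/-- If `Hc B` is open, then the Lie algebra of `Hc` and the subalgebra `b`, which is normalized by
`B`, span the Lie algebra of `Gc`. The dimension of the set of all translates of the regular
elements of `b` is compared on both sides. -/
lemma range_diffOne_sup_eq_top {ι : Hc →* Gc} (hι : ContMDiff 𝓘(ℂ, F) 𝓘(ℂ, Ec) ∞ ι)
    {b : Submodule ℂ Ec} (hb : ∀ X ∈ b, ∀ Y ∈ b, adE ℂ Ec Gc X Y ∈ b) {Y₀ : b}
    (hY₀ : ∀ X, ∃ Z, ∃ W ∈ b, X = adE ℂ Ec Gc Z Y₀ + W) {B : Subgroup Gc}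
    (hB : ∀ β ∈ B, ∀ X ∈ b, AdE ℂ Ec β X ∈ b) (hopen : IsOpen (Set.range ι * (B : Set Gc))) :
    LinearMap.range (diffOne ι : F →L[ℂ] Ec).toLinearMap ⊔ b = ⊤ := by
  set S := LinearMap.range (diffOne ι : F →L[ℂ] Ec).toLinearMap ⊔ b with hS
  have : IsTopologicalGroup Hc := topologicalGroup_of_lieGroup 𝓘(ℂ, F) ∞
  have : ProperSpace b := FiniteDimensional.proper ℂ b
  let r : Set b := {Y | ∀ X, ∃ Z, ∃ W ∈ b, X = adE ℂ Ec Gc Z Y + W}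
  have hr : r ∈ 𝓝 Y₀ := eventually_regular hY₀
  -- the set of the translates `Ad (ι h) Y` with `(h, Y)` in a given set
  let O : Set (Hc × b) → Set Ec := fun U => {X | ∃ p ∈ U, X = AdE ℂ Ec (ι p.1) (p.2 : Ec)}
  have hloc : ∀ x ∈ (Set.univ ×ˢ r : Set (Hc × b)), ∃ U ∈ 𝓝[Set.univ ×ˢ r] x,
      dimH (O U) ≤ (2 * Module.finrank ℂ S : ℕ) := by
    rintro ⟨h₀, Y⟩ ⟨-, hY⟩
    obtain ⟨V, hV, V', hV', hdim⟩ := exists_dimH_orbit_le hι hb hY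
    refine ⟨{p | h₀⁻¹ * p.1 ∈ V ∧ p.2 ∈ V'}, mem_nhdsWithin_of_mem_nhds ?_, ?_⟩
    · have h1 : Tendsto (fun p : Hc × b => h₀⁻¹ * p.1) (𝓝 (h₀, Y)) (𝓝 1) := by
        have : Continuous fun p : Hc × b => h₀⁻¹ * p.1 := continuous_const.mul continuous_fst
        simpa using this.tendsto (h₀, Y)
      exact inter_mem (h1 hV) (continuous_snd.tendsto (h₀, Y) hV')
    · have hsub : O {p | h₀⁻¹ * p.1 ∈ V ∧ p.2 ∈ V'} ⊆ (AdE ℂ Ec (ι h₀)) ''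
          {X | ∃ h ∈ V, ∃ Y ∈ V', X = AdE ℂ Ec (ι h) (Y : Ec)} := by
        rintro _ ⟨p, hp, rfl⟩
        refine ⟨_, ⟨_, hp.1, _, hp.2, rfl⟩, ?_⟩
        rw [← ContinuousLinearMap.comp_apply, ← AdE_mul, ← map_mul, mul_inv_cancel_left]
      exact (dimH_mono hsub).trans (((AdE ℂ Ec (ι h₀)).lipschitz.dimH_image_le _).trans hdim)
  choose! U hU hUdim using hloc
  obtain ⟨t, htr, htc, hcover⟩ := TopologicalSpace.countable_cover_nhdsWithin hU
  -- upper bound, by second countability of `Hc × b`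
  have hle : dimH (O (Set.univ ×ˢ r)) ≤ (2 * Module.finrank ℂ S : ℕ) := by
    have hsub : O (Set.univ ×ˢ r) ⊆ ⋃ x ∈ t, O (U x) := by
      rintro _ ⟨p, hp, rfl⟩
      obtain ⟨x, hx, hpx⟩ := Set.mem_iUnion₂.1 (hcover hp)
      exact Set.mem_iUnion₂.2 ⟨x, hx, p, hpx, rfl⟩
    refine (dimH_mono hsub).trans ?_
    rw [dimH_bUnion htc]
    exact iSup₂_le fun x hx => hUdim x (htr hx)
  -- lower bound: as `Hc B` is a neighbourhood of `1` and `B` preserves the set `r` of regular elements,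
  -- the translates by `Hc` already fill a neighbourhood
  have hnhds : O (Set.univ ×ˢ r) ∈ 𝓝 (Y₀ : Ec) := by
    have h1 : Set.range ι * (B : Set Gc) ∈ 𝓝 (1 : Gc) :=
      hopen.mem_nhds ⟨1, ⟨1, map_one ι⟩, 1, B.one_mem, one_mul 1⟩
    filter_upwards [orbit_mem_nhds hY₀ h1 hr] with X hX
    obtain ⟨_, ⟨_, ⟨h, rfl⟩, β, hβ, rfl⟩, Y, hY, rfl⟩ := hX
    refine ⟨(h, ⟨AdE ℂ Ec β Y, hB β hβ Y Y.2⟩), ⟨trivial, fun X => ?_⟩, ?_⟩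
    · obtain ⟨Z, W, hW, hX⟩ := hY (AdE ℂ Ec β⁻¹ X)
      refine ⟨AdE ℂ Ec β Z, AdE ℂ Ec β W, hB β hβ W hW, ?_⟩
      have h2 : AdE ℂ Ec β (AdE ℂ Ec β⁻¹ X) = X := Ad_apply_inv (𝕜 := ℂ) (E := Ec) β X
      have h3 : AdE ℂ Ec β (adE ℂ Ec Gc Z Y) = adE ℂ Ec Gc (AdE ℂ Ec β Z) (AdE ℂ Ec β Y) :=
        Ad_lie (𝕜 := ℂ) (E := Ec) β Z (Y : Ec)
      rw [← h2, hX, map_add, h3]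
    · change AdE ℂ Ec (ι h * β) (Y : Ec) = AdE ℂ Ec (ι h) (AdE ℂ Ec β Y)
      rw [AdE_mul]; rfl
  rw [Real.dimH_of_mem_nhds hnhds, finrank_real_of_complex] at hle
  have hle' : Module.finrank ℂ Ec ≤ Module.finrank ℂ S := by
    have : 2 * Module.finrank ℂ Ec ≤ 2 * Module.finrank ℂ S := by exact_mod_cast hle
    omega
  exact Submodule.eq_top_of_finrank_eq (le_antisymm (Submodule.finrank_le _) hle')

/-- The group generated by the exponentials of a subalgebra normalizes it. -/
lemma Ad_mem_of_mem_analyticSubgroup {b : Submodule ℂ Ec}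
    (hb : ∀ X ∈ b, ∀ Y ∈ b, adE ℂ Ec Gc X Y ∈ b) {β : Gc}
    (hβ : β ∈ analyticSubgroup (𝕜 := ℂ) (E := Ec) (b : Set Ec)) {X : Ec} (hX : X ∈ b) :
    AdE ℂ Ec β X ∈ b := by
  have key : ∀ β ∈ analyticSubgroup (𝕜 := ℂ) (E := Ec) (G := Gc) (b : Set Ec),
      ∀ X ∈ b, AdE ℂ Ec β X ∈ b ∧ AdE ℂ Ec β⁻¹ X ∈ b := by
    intro β hβ
    induction hβ using Subgroup.closure_induction with
    | mem x hx =>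
      obtain ⟨Z, hZ, γ, hγ, rfl⟩ := hx
      intro X hX
      have h1 : ∀ t : ℂ, AdE ℂ Ec (γ t) X ∈ b := fun t => by
        have h2 := hγ.Ad_eq_exp t
        have h3 : AdE ℂ Ec (γ t) = exp (t • adE ℂ Ec Gc Z) := h2
        rw [h3]
        exact exp_apply_mem (fun v hv => b.smul_mem t (hb Z hZ v hv)) hX
      refine ⟨h1 1, ?_⟩
      have h4 : (γ 1)⁻¹ = γ (-1) := by
        rw [inv_eq_iff_mul_eq_one, ← hγ.map_add, add_neg_cancel, hγ.map_zero]
      rw [h4]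
      exact h1 _
    | one => intro X hX; rw [inv_one, AdE_one]; exact ⟨hX, hX⟩
    | mul x y _ _ hx hy =>
      intro X hX
      rw [mul_inv_rev, AdE_mul, AdE_mul]
      exact ⟨(hx _ (hy X hX).1).1, (hy _ (hx X hX).2).2⟩
    | inv x _ hx => intro X hX; rw [inv_inv]; exact (hx X hX).symm
  exact (key β hβ X hX).1

end OpenOrbits

/-! ### The Borel subalgebra -/

section BorelSubalgebra

variable {E : Type*} [NormedAddCommGroup E] [NormedSpace ℝ E] [FiniteDimensional ℝ E]
  [CompleteSpace E]
  {G : Type*} [Group G] [TopologicalSpace G] [ChartedSpace E G] [LieGroup 𝓘(ℝ, E) ∞ G]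
  [LieAlgebra.IsKilling ℝ (LieAlg E G)]

omit [FiniteDimensional ℝ E] [LieAlgebra.IsKilling ℝ (LieAlg E G)] in
lemma lie_mem_rootSpaceJ {j : LieSubalgebra ℝ (LieAlg E G)} {α β : j →ₗ[ℝ] ℂ}
    {Z W : LieAlgC E G} (hZ : Z ∈ rootSpaceJ j α) (hW : W ∈ rootSpaceJ j β) :
    ⁅Z, W⁆ ∈ rootSpaceJ j (α + β) := by
  rw [mem_rootSpaceJ] at *
  intro X
  rw [leibniz_lie, hZ, hW, smul_lie, lie_smul, LinearMap.add_apply, add_smul]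

namespace Choices

variable (c : Choices E G)

lemma b_eq : c.b = ⨆ α ∈ insert 0 c.posJ, rootSpaceJ c.j α := by
  rw [iSup_insert, rootSpaceJ_zero]
  rfl

lemma rootSpaceJ_le_b {α : c.j →ₗ[ℝ] ℂ} (hα : α ∈ insert 0 c.posJ) :
    rootSpaceJ c.j α ≤ c.b := by
  rw [b_eq]
  exact le_iSup₂_of_le α hα le_rfl

/-- `𝔟` is a subalgebra. -/
lemma lie_mem_b {X Y : LieAlgC E G} (hX : X ∈ c.b) (hY : Y ∈ c.b) : ⁅X, Y⁆ ∈ c.b := by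
  have key : ∀ α ∈ insert 0 c.posJ, ∀ Z ∈ rootSpaceJ c.j α, ∀ W ∈ c.b, ⁅Z, W⁆ ∈ c.b := by
    intro α hα Z hZ W hW
    have h : c.b ≤ c.b.comap (LieAlgebra.ad ℂ (LieAlgC E G) Z) := by
      conv_lhs => rw [b_eq]
      refine iSup₂_le fun β hβ W hW => ?_
      change ⁅Z, W⁆ ∈ c.b
      have h1 := lie_mem_rootSpaceJ hZ hW
      by_cases h0 : ⁅Z, W⁆ = 0
      · rw [h0]; exact c.b.zero_mem
      refine c.rootSpaceJ_le_b ?_ h1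
      rcases hα with rfl | hα
      · rwa [zero_add]
      rcases hβ with rfl | hβ
      · rw [add_zero]; exact Or.inr hα
      refine Or.inr (c.posJ_positive.add_mem α hα β hβ ⟨fun hs => ?_,
        (Submodule.ne_bot_iff _).2 ⟨_, h1, h0⟩⟩)
      rw [eq_neg_of_add_eq_zero_right hs] at hβ
      exact c.posJ_positive.not_both α hα hβ
    exact h hW
  have h : c.b ≤ c.b.comap (LieAlgebra.ad ℂ (LieAlgC E G) Y) := by
    conv_lhs => rw [b_eq]
    refine iSup₂_le fun α hα Z hZ => ?_
    change ⁅Y, Z⁆ ∈ c.b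
    rw [← lie_skew]
    exact neg_mem (key α hα Z hZ Y hY)
  rw [← lie_skew]
  exact neg_mem (h hX)

lemma one_tmul_mem_b {X : LieAlg E G} (hX : X ∈ c.j) : (1 : ℂ) ⊗ₜ[ℝ] X ∈ c.b :=
  Submodule.mem_sup_left (Submodule.tmul_mem_baseChange_of_mem (1 : ℂ) hX)

/-- The regular vector of `𝔧` acts surjectively on `𝔤_c` modulo `𝔟`. -/
lemma exists_eq_lie_reg_add (X : LieAlgC E G) :
    ∃ Z : LieAlgC E G, ∃ W ∈ c.b, X = ⁅Z, (1 : ℂ) ⊗ₜ[ℝ] (c.reg : LieAlg E G)⁆ + W := by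
  have h : (⊤ : Submodule ℂ (LieAlgC E G)) ≤ LinearMap.range
      (-LieAlgebra.ad ℂ (LieAlgC E G) ((1 : ℂ) ⊗ₜ[ℝ] (c.reg : LieAlg E G))) ⊔ c.b := by
    rw [← cartan_sup_rootSpaceJ c.j]
    refine sup_le (le_sup_of_le_right le_sup_left) (iSup₂_le fun α hα Z hZ => ?_)
    refine Submodule.mem_sup_left ⟨-((α c.reg)⁻¹ • Z), ?_⟩
    rw [LinearMap.neg_apply, map_neg, neg_neg]
    change ⁅(1 : ℂ) ⊗ₜ[ℝ] (c.reg : LieAlg E G), (α c.reg)⁻¹ • Z⁆ = Z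
    rw [lie_smul, mem_rootSpaceJ.1 hZ, smul_smul, inv_mul_cancel₀ (c.root_reg_ne_zero hα),
      one_smul]
  obtain ⟨_, ⟨Z, rfl⟩, W, hW, hX⟩ := Submodule.mem_sup.1 (h (Submodule.mem_top (x := X)))
  refine ⟨Z, W, hW, ?_⟩
  rw [← hX, LinearMap.neg_apply, ← lie_skew]
  rfl

end Choices

lemma lieC_eq_baseChange {H : Subgroup G} (hH : IsClosed (H : Set G)) :
    lieC (E := E) H = (lieSubmodule E H hH).baseChange ℂ := by
  rw [Submodule.baseChange_eq_span]
  refine congrArg (Submodule.span ℂ) ?_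
  ext Z
  constructor
  · rintro ⟨X, hX, rfl⟩
    exact ⟨X, hX, rfl⟩
  · rintro ⟨X, hX, rfl⟩
    exact ⟨X, hX, rfl⟩

/-- Infinitesimal form of the openness of `Hc B` in `Gc`. -/
lemma lieC_sup_b_eq_top (c : Choices E G) (H : Subgroup G)
    {Ec : Type*} [NormedAddCommGroup Ec] [NormedSpace ℂ Ec] [FiniteDimensional ℂ Ec]
    [CompleteSpace Ec]
    {Gc : Type*} [Group Gc] [TopologicalSpace Gc] [ChartedSpace Ec Gc] [LieGroup 𝓘(ℂ, Ec) ∞ Gc]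
    (φ : LieAlgC E G ≃ₗ⁅ℂ⁆ GroupLieAlgebra 𝓘(ℂ, Ec) Gc)
    {F : Type*} [NormedAddCommGroup F] [NormedSpace ℂ F] [FiniteDimensional ℂ F]
    {Hc : Type*} [Group Hc] [TopologicalSpace Hc] [SecondCountableTopology Hc]
    [ChartedSpace F Hc] [LieGroup 𝓘(ℂ, F) ∞ Hc]
    (ι : Hc →* Gc) (hι' : ContMDiff 𝓘(ℂ, F) 𝓘(ℂ, Ec) ∞ ι)
    (hHc : Set.range (mfderiv 𝓘(ℂ, F) 𝓘(ℂ, Ec) ι 1) = φ '' (lieC (E := E) H : Set (LieAlgC E G)))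
    (hHB : IsOpen (Set.range ι *
      (analyticSubgroup (𝕜 := ℂ) (E := Ec) (φ '' (c.b : Set (LieAlgC E G))) : Set Gc))) :
    lieC (E := E) H ⊔ c.b = ⊤ := by
  let b' : Submodule ℂ Ec := show Submodule ℂ (GroupLieAlgebra 𝓘(ℂ, Ec) Gc) from
    c.b.map (φ : LieAlgC E G →ₗ[ℂ] GroupLieAlgebra 𝓘(ℂ, Ec) Gc)
  have hb'c : (b' : Set Ec) = φ '' (c.b : Set (LieAlgC E G)) := rfl
  have hmem : ∀ X ∈ c.b, (φ X : Ec) ∈ b' := fun X hX => ⟨X, hX, rfl⟩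
  have hb' : ∀ X ∈ b', ∀ Y ∈ b', adE ℂ Ec Gc X Y ∈ b' := by
    rintro _ ⟨X, hX, rfl⟩ _ ⟨Y, hY, rfl⟩
    refine ⟨⁅X, Y⁆, c.lie_mem_b hX hY, ?_⟩
    exact φ.map_lie X Y
  have hreg : ∀ X : Ec, ∃ Z, ∃ W ∈ b', X = adE ℂ Ec Gc Z
      ((⟨φ ((1 : ℂ) ⊗ₜ[ℝ] (c.reg : LieAlg E G)), hmem _ (c.one_tmul_mem_b c.reg.2)⟩ : b') : Ec)
        + W := by
    intro X
    obtain ⟨X, rfl⟩ : ∃ X', φ X' = X := φ.surjective X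
    obtain ⟨Z, W, hW, hX⟩ := c.exists_eq_lie_reg_add X
    refine ⟨φ Z, φ W, hmem W hW, ?_⟩
    conv_lhs => rw [hX]
    exact (map_add φ _ _).trans (congrArg (· + φ W) (φ.map_lie _ _))
  have htop := range_diffOne_sup_eq_top hι' hb' hreg
    (fun β hβ X hX => Ad_mem_of_mem_analyticSubgroup hb' hβ hX) hHB
  rw [eq_top_iff]
  intro X _
  have h1 : (φ X : Ec) ∈ LinearMap.range (diffOne ι : F →L[ℂ] Ec).toLinearMap ⊔ b' := by
    rw [htop]; trivial
  obtain ⟨_, ⟨v, rfl⟩, y, hy, hsum⟩ := (Submodule.mem_sup (R := ℂ) (M := Ec)).1 h1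
  obtain ⟨Y, hY, hYy⟩ : ∃ Y ∈ c.b, φ Y = y := hy
  obtain ⟨Z, hZ, hZv⟩ := hHc.le (Set.mem_range_self (v : F))
  have h2 : φ (Z + Y) = φ X := by
    rw [map_add, hZv, hYy]; exact hsum
  rw [← φ.injective h2]
  exact Submodule.add_mem_sup hZ hY

end BorelSubalgebra

/-! ### The derivative of a representation -/

section DerivedRepresentation

variable {E : Type*} [NormedAddCommGroup E] [NormedSpace ℝ E] [FiniteDimensional ℝ E]
  [CompleteSpace E]
  {G : Type*} [Group G] [TopologicalSpace G] [ChartedSpace E G] [LieGroup 𝓘(ℝ, E) ∞ G]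
  {𝔸 : Type*} [NormedRing 𝔸] [NormedAlgebra ℝ 𝔸] [CompleteSpace 𝔸]

lemma eq_of_eventually_exp_smul_eq {T T' : 𝔸}
    (h : ∀ᶠ t in 𝓝 (0 : ℝ), exp (t • T) = exp (t • T')) : T = T' := by
  have h1 := hasDerivAt_exp_smul (𝕜 := ℝ) T 0
  have h2 := (hasDerivAt_exp_smul (𝕜 := ℝ) T' 0).congr_of_eventuallyEq h
  simpa using h1.unique h2

/-- The restriction of `R` to the subgroup `S` is a continuous homomorphism to the units of the
Banach algebra `𝔸`. The values of `R` outside `S` play no role. -/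
structure IsRepOn (S : Subgroup G) (R : G → 𝔸) : Prop where
  map_one : R 1 = 1
  map_mul : ∀ g ∈ S, ∀ h ∈ S, R (g * h) = R g * R h
  continuousOn : ContinuousOn R S

lemma IsRepOn.mono {S S' : Subgroup G} {R : G → 𝔸} (hR : IsRepOn S R) (h : S' ≤ S) :
    IsRepOn S' R :=
  ⟨hR.map_one, fun g hg g' hg' => hR.map_mul g (h hg) g' (h hg'), hR.continuousOn.mono h⟩

lemma IsRepOn.mul_inv {S : Subgroup G} {R : G → 𝔸} (hR : IsRepOn S R) {g : G} (hg : g ∈ S) :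
    R g * R g⁻¹ = 1 := by
  rw [← hR.map_mul g hg _ (inv_mem hg), mul_inv_cancel, hR.map_one]

lemma IsRepOn.inv_mul {S : Subgroup G} {R : G → 𝔸} (hR : IsRepOn S R) {g : G} (hg : g ∈ S) :
    R g⁻¹ * R g = 1 := by
  rw [← hR.map_mul _ (inv_mem hg) g hg, inv_mul_cancel, hR.map_one]

open Classical in
/-- The derivative of `R` in the direction `X`: the `T` with `R (exp (t X)) = exp (t T)` for all
`t`, and `0` if there is none. -/
noncomputable def derivedRep (R : G → 𝔸) (X : LieAlg E G) : 𝔸 :=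
  if h : ∃ T : 𝔸, ∀ t : ℝ, R (expG (t • X)) = exp (t • T) then h.choose else 0

lemma IsRepOn.apply_expG_smul {S : Subgroup G} {R : G → 𝔸} (hR : IsRepOn S R) {X : LieAlg E G}
    (hX : X ∈ lieOf (𝕜 := ℝ) (E := E) S) (t : ℝ) :
    R (expG (t • X)) = exp (t • derivedRep R X) := by
  rw [mem_lieOf_iff] at hX
  have h : ∃ T : 𝔸, ∀ t : ℝ, R (expG (t • X)) = exp (t • T) := by
    refine exists_eq_exp_smul ?_ (fun s t => ?_) ?_
    · rw [zero_smul, expG_zero, hR.map_one]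
    · rw [expG_add_smul, hR.map_mul _ (hX s) _ (hX t)]
    · exact hR.continuousOn.comp_continuous (continuous_expG_smul X) hX
  rw [derivedRep, dif_pos h]
  exact h.choose_spec t

lemma IsRepOn.apply_expG {S : Subgroup G} {R : G → 𝔸} (hR : IsRepOn S R) {X : LieAlg E G}
    (hX : X ∈ lieOf (𝕜 := ℝ) (E := E) S) : R (expG X) = exp (derivedRep R X) := by
  simpa using hR.apply_expG_smul hX 1

lemma derivedRep_eq {R : G → 𝔸} {X : LieAlg E G} {T : 𝔸}
    (h : ∀ t : ℝ, R (expG (t • X)) = exp (t • T)) : derivedRep R X = T := by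
  have h' : ∃ T : 𝔸, ∀ t : ℝ, R (expG (t • X)) = exp (t • T) := ⟨T, h⟩
  rw [derivedRep, dif_pos h']
  refine eq_of_eventually_exp_smul_eq (Eventually.of_forall fun t => ?_)
  rw [← h'.choose_spec t, h t]

lemma IsRepOn.derivedRep_smul {S : Subgroup G} {R : G → 𝔸} (hR : IsRepOn S R) {X : LieAlg E G}
    (hX : X ∈ lieOf (𝕜 := ℝ) (E := E) S) (r : ℝ) :
    derivedRep R (r • X) = r • derivedRep R X :=
  derivedRep_eq fun t => by rw [smul_smul, smul_smul, hR.apply_expG_smul hX]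

/-- `R` intertwines its derivative with the adjoint action. -/
lemma IsRepOn.mul_derivedRep {S : Subgroup G} {R : G → 𝔸} (hR : IsRepOn S R) {g : G} (hg : g ∈ S)
    {X : LieAlg E G} (hX : X ∈ lieOf (𝕜 := ℝ) (E := E) S) :
    R g * derivedRep R X = derivedRep R (Ad ℝ E g X) * R g := by
  have hX' : ∀ t : ℝ, expG (t • X) ∈ S := mem_lieOf_iff.1 hX
  have hconj : ∀ t : ℝ, expG (t • Ad ℝ E g X) = g * expG (t • X) * g⁻¹ := fun t => by
    rw [conj_expG, map_smul]
  have hgX : Ad ℝ E g X ∈ lieOf (𝕜 := ℝ) (E := E) S := mem_lieOf_iff.2 fun t => by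
    rw [hconj]
    exact mul_mem (mul_mem hg (hX' t)) (inv_mem hg)
  have h : ∀ t : ℝ, exp (t • derivedRep R (Ad ℝ E g X)) * R g =
      R g * exp (t • derivedRep R X) := fun t => by
    rw [← hR.apply_expG_smul hgX, ← hR.apply_expG_smul hX,
      ← hR.map_mul _ (mem_lieOf_iff.1 hgX t) _ hg, ← hR.map_mul _ hg _ (hX' t), hconj]
    congr 1
    group
  have h1 := (hasDerivAt_exp_smul (𝕜 := ℝ) (derivedRep R (Ad ℝ E g X)) 0).mul_const (R g)
  have h2 := (hasDerivAt_exp_smul (𝕜 := ℝ) (derivedRep R X) 0).const_mul (R g)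
  have h3 := h2.unique (h1.congr_of_eventuallyEq (Eventually.of_forall fun t => (h t).symm))
  simpa using h3

section Additivity

variable [LieAlgebra.IsKilling ℝ (LieAlg E G)]

/-- Additivity of the derivative on a subspace `V` of the Lie algebra of `S` that contains the
logarithms of the elements of `S` near `1`. -/
lemma IsRepOn.derivedRep_add {S : Subgroup G} {R : G → 𝔸} (hR : IsRepOn S R)
    {V : Submodule ℝ (LieAlg E G)} (hV : ∀ X ∈ V, expG X ∈ S)
    (hlog : ∀ᶠ g in 𝓝 (1 : G), g ∈ S → logG E g ∈ V) {X Y : LieAlg E G} (hX : X ∈ V)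
    (hY : Y ∈ V) : derivedRep R (X + Y) = derivedRep R X + derivedRep R Y := by
  have := isTopologicalGroup_of_chartedSpace E G
  have hlie : ∀ Z ∈ V, Z ∈ lieOf (𝕜 := ℝ) (E := E) S := fun Z hZ =>
    mem_lieOf_iff.2 fun t => hV _ (V.smul_mem t hZ)
  have h0 : derivedRep R (0 : LieAlg E G) = 0 := by
    simpa using hR.derivedRep_smul (hlie _ V.zero_mem) 0
  -- `R` is close to `1` near `1`, so its derivative is bounded on a ball of `V`.
  obtain ⟨C, hC⟩ : ∃ C : ℝ, ∀ Z ∈ V, ‖derivedRep R Z‖ ≤ C * ‖Z‖ := by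
    obtain ⟨ε, hε, ρ, hρ⟩ := exists_norm_le_of_exp 𝔸
    have h1 : ∀ᶠ Z in 𝓝 (0 : LieAlg E G), expG Z ∈ S → ‖R (expG Z) - 1‖ ≤ ε := by
      have h2 : Tendsto R (𝓝[(S : Set G)] 1) (𝓝 1) := by
        have := hR.continuousOn 1 S.one_mem
        rwa [ContinuousWithinAt, hR.map_one] at this
      have h3 : ∀ᶠ g in 𝓝 (1 : G), g ∈ S → ‖R g - 1‖ ≤ ε := by
        have h4 := h2.eventually (Metric.closedBall_mem_nhds (1 : 𝔸) hε)
        rw [eventually_nhdsWithin_iff] at h4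
        filter_upwards [h4] with g hg hgS
        simpa [dist_eq_norm] using hg hgS
      exact tendsto_expG.eventually h3
    obtain ⟨δ, hδ, hball⟩ := Metric.eventually_nhds_iff.1 h1
    have h5 : ∀ Z ∈ V, ‖Z‖ < δ → ‖derivedRep R Z‖ ≤ ρ := by
      intro Z hZ hlt
      refine hρ _ fun s hs => ?_
      rw [← hR.apply_expG_smul (hlie Z hZ)]
      refine hball ?_ (hV _ (V.smul_mem s hZ))
      rw [dist_zero_right, norm_smul, Real.norm_of_nonneg hs.1]
      exact (mul_le_of_le_one_left (norm_nonneg _) hs.2).trans_lt hlt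
    refine ⟨ρ * (2 / δ), fun Z hZ => ?_⟩
    rcases eq_or_ne Z 0 with rfl | hZ0
    · simp [h0]
    have hn : 0 < ‖Z‖ := norm_pos_iff.2 hZ0
    have h6 := h5 ((δ / (2 * ‖Z‖)) • Z) (V.smul_mem _ hZ) (by
      rw [norm_smul, Real.norm_of_nonneg (by positivity)]
      field_simp
      linarith)
    rw [hR.derivedRep_smul (hlie Z hZ), norm_smul, Real.norm_of_nonneg (by positivity)] at h6
    calc ‖derivedRep R Z‖ = (2 * ‖Z‖ / δ) * (δ / (2 * ‖Z‖) * ‖derivedRep R Z‖) := by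
          field_simp
      _ ≤ (2 * ‖Z‖ / δ) * ρ := by gcongr
      _ = ρ * (2 / δ) * ‖Z‖ := by ring
  -- The curve `exp (-t (X + Y)) exp (t X) exp (t Y)` has derivative `0` at `t = 0`.
  let c : ℝ → G := fun t => expG (t • (-(X + Y))) * (expG (t • X) * expG (t • Y))
  have hc0 : c 0 = 1 := by simp [c, expG_zero]
  have hcS : ∀ t, c t ∈ S := fun t => mul_mem (hV _ (V.smul_mem t (neg_mem (add_mem hX hY))))
    (mul_mem (hV _ (V.smul_mem t hX)) (hV _ (V.smul_mem t hY)))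
  have hcc : Continuous c := (continuous_expG_smul _).mul
    ((continuous_expG_smul _).mul (continuous_expG_smul _))
  have hd : HasDerivAt (fun t => Ad ℝ E (c t)) (adL ℝ E G (0 : LieAlg E G)) 0 := by
    have h1 := (isOneParam_expG (-(X + Y))).hasDerivAt_Ad_zero.mul
      ((isOneParam_expG X).hasDerivAt_Ad_zero.mul (isOneParam_expG Y).hasDerivAt_Ad_zero)
    simp only [Pi.mul_apply, zero_smul, expG_zero, Ad_one', mul_one, one_mul] at h1
    rw [← map_add, ← map_add, neg_add_cancel] at h1
    refine h1.congr_of_eventuallyEq (Eventually.of_forall fun t => ?_)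
    simp only [c, Ad_mul', Pi.mul_apply]
  have hZ := hasDerivAt_logG hc0 hd
  have hlim : Tendsto c (𝓝 0) (𝓝 1) := by
    have := hcc.tendsto 0
    rwa [hc0] at this
  have hev : ∀ᶠ t in 𝓝 (0 : ℝ), logG E (c t) ∈ V ∧ expG (logG E (c t)) = c t := by
    filter_upwards [hlim.eventually hlog, hlim.eventually (eventually_expG_logG (E := E))]
      with t h1 h2
    exact ⟨h1 (hcS t), h2⟩
  have hd1 : HasDerivAt (fun t => derivedRep R (logG E (c t))) 0 0 := by
    rw [hasDerivAt_iff_isLittleO] at hZ ⊢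
    simp only [h0, hc0, logG_one, sub_zero, smul_zero] at hZ ⊢
    refine Asymptotics.IsBigO.trans_isLittleO (Asymptotics.IsBigO.of_bound C ?_) hZ
    filter_upwards [hev] with t ht
    exact hC _ ht.1
  have hd2 : HasDerivAt (fun t => R (c t)) 0 0 := by
    have h1 : HasFDerivAt (exp : 𝔸 → 𝔸) (1 : 𝔸 →L[ℝ] 𝔸) (derivedRep R (logG E (c 0))) := by
      rw [hc0, logG_one, h0]
      exact hasFDerivAt_exp_zero
    have h2 := h1.comp_hasDerivAt (0 : ℝ) hd1
    rw [map_zero] at h2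
    refine h2.congr_of_eventuallyEq ?_
    filter_upwards [hev] with t ht
    rw [Function.comp_apply, ← hR.apply_expG (hlie _ ht.1), ht.2]
  have hd3 : HasDerivAt (fun t => R (c t))
      (-derivedRep R (X + Y) + (derivedRep R X + derivedRep R Y)) 0 := by
    have h1 := (hasDerivAt_exp_smul (𝕜 := ℝ) (-derivedRep R (X + Y)) 0).mul
      ((hasDerivAt_exp_smul (𝕜 := ℝ) (derivedRep R X) 0).mul
        (hasDerivAt_exp_smul (𝕜 := ℝ) (derivedRep R Y) 0))
    simp only [Pi.mul_apply, zero_smul, NormedSpace.exp_zero, mul_one, one_mul] at h1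
    refine h1.congr_of_eventuallyEq (Eventually.of_forall fun t => ?_)
    have h2 : derivedRep R (-(X + Y)) = -derivedRep R (X + Y) := by
      rw [← neg_one_smul ℝ (X + Y), hR.derivedRep_smul (hlie _ (add_mem hX hY)), neg_one_smul]
    simp only [c, Pi.mul_apply]
    rw [hR.map_mul _ (hV _ (V.smul_mem t (neg_mem (add_mem hX hY)))) _
      (mul_mem (hV _ (V.smul_mem t hX)) (hV _ (V.smul_mem t hY))),
      hR.map_mul _ (hV _ (V.smul_mem t hX)) _ (hV _ (V.smul_mem t hY)),
      hR.apply_expG_smul (hlie _ hX), hR.apply_expG_smul (hlie _ hY),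
      hR.apply_expG_smul (hlie _ (neg_mem (add_mem hX hY))), h2]
  have h := hd3.unique hd2
  rw [neg_add_eq_zero] at h
  exact h

end Additivity

end DerivedRepresentation

/-! ### The derivative of a representation of the minimal parabolic subgroup -/

section ParabolicRepresentation

variable {E : Type*} [NormedAddCommGroup E] [NormedSpace ℝ E] [FiniteDimensional ℝ E]
  [CompleteSpace E]
  {G : Type*} [Group G] [TopologicalSpace G] [ChartedSpace E G] [LieGroup 𝓘(ℝ, E) ∞ G]
  [LieAlgebra.IsKilling ℝ (LieAlg E G)]
  {𝔸 : Type*} [NormedRing 𝔸] [NormedAlgebra ℝ 𝔸] [CompleteSpace 𝔸]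

namespace Choices

variable (c : Choices E G)

lemma lie_mem_p {X Y : LieAlg E G} (hX : X ∈ c.p) (hY : Y ∈ c.p) : ⁅X, Y⁆ ∈ c.p := by
  rw [p_eq] at hX hY ⊢
  have key : ∀ ν ∈ Set.Ici (0 : ℝ), ∀ Z ∈ c.eig ν, ∀ W ∈ ⨆ ν ∈ Set.Ici (0 : ℝ), c.eig ν,
      ⁅Z, W⁆ ∈ ⨆ ν ∈ Set.Ici (0 : ℝ), c.eig ν := by
    intro ν hν Z hZ W hW
    have h : ⨆ ν ∈ Set.Ici (0 : ℝ), c.eig ν ≤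
        (⨆ ν ∈ Set.Ici (0 : ℝ), c.eig ν).comap (LieAlgebra.ad ℝ (LieAlg E G) Z) :=
      iSup₂_le fun μ hμ W hW => c.eig_le_biSup (add_nonneg hν hμ : (0 : ℝ) ≤ ν + μ)
        (c.lie_mem_eig hZ hW)
    exact h hW
  have h : ⨆ ν ∈ Set.Ici (0 : ℝ), c.eig ν ≤ (⨆ ν ∈ Set.Ici (0 : ℝ), c.eig ν).comap
      (LieAlgebra.ad ℝ (LieAlg E G) Y) := by
    refine iSup₂_le fun μ hμ Z hZ => ?_
    change ⁅Y, Z⁆ ∈ ⨆ ν ∈ Set.Ici (0 : ℝ), c.eig ν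
    rw [← lie_skew]
    exact neg_mem (key μ hμ Z hZ Y hY)
  rw [← lie_skew]
  exact neg_mem (h hX)

variable [ConnectedSpace G] [Finite (Subgroup.center G)]

lemma p_le_lieOf {X : LieAlg E G} (hX : X ∈ c.p) : X ∈ lieOf (𝕜 := ℝ) (E := E) c.P :=
  mem_lieOf_iff.2 fun t => c.expG_mem_P (c.p.smul_mem t hX)

/-- The derivative `T` of a representation of `P` that is trivial on `N`: a linear map, extended
arbitrarily from `𝔭` to `𝔤`, that is compatible with brackets on `𝔭` and intertwines the
adjoint action. -/
lemma exists_derived {R : G → 𝔸} (hR : IsRepOn c.P R) (hN : ∀ g ∈ c.N, R g = 1) :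
    ∃ T : LieAlg E G →ₗ[ℝ] 𝔸, (∀ X ∈ c.p, ∀ t : ℝ, R (expG (t • X)) = exp (t • T X)) ∧
      (∀ X ∈ c.p, ∀ Y ∈ c.p, T ⁅X, Y⁆ = T X * T Y - T Y * T X) ∧
      ∀ g ∈ c.P, ∀ X ∈ c.p, Ad ℝ E g X ∈ c.p → R g * T X = T (Ad ℝ E g X) * R g := by
  have hRL := hR.mono c.L_le_P
  have hl : ∀ X ∈ c.l, ∀ Y ∈ c.l, derivedRep R (X + Y) = derivedRep R X + derivedRep R Y :=
    fun X hX Y hY => hRL.derivedRep_add (fun Z hZ => c.expG_mem_L hZ) c.eventually_logG_mem_l hX hY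
  have hn : ∀ X ∈ c.l, ∀ Y ∈ c.n, derivedRep R (X + Y) = derivedRep R X := by
    intro X hX Y hY
    have hp : X + Y ∈ c.p := Submodule.add_mem_sup hX hY
    have hXp : X ∈ c.p := Submodule.mem_sup_left hX
    refine eq_of_eventually_exp_smul_eq ?_
    filter_upwards [c.eventually_mem_N hX hY] with t ht
    rw [← hR.apply_expG_smul (c.p_le_lieOf hp), ← hR.apply_expG_smul (c.p_le_lieOf hXp)]
    have h : expG (t • (X + Y)) = expG (t • X) * (expG (-(t • X)) * expG (t • (X + Y))) := by
      rw [expG_neg, mul_inv_cancel_left]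
    rw [h, hR.map_mul _ (c.expG_mem_P (c.p.smul_mem t hXp)) _ (c.N_le_P ht), hN _ ht, mul_one]
  have hadd : ∀ X ∈ c.p, ∀ Y ∈ c.p,
      derivedRep R (X + Y) = derivedRep R X + derivedRep R Y := by
    intro X hX Y hY
    obtain ⟨X₁, hX₁, X₂, hX₂, rfl⟩ := Submodule.mem_sup.1 hX
    obtain ⟨Y₁, hY₁, Y₂, hY₂, rfl⟩ := Submodule.mem_sup.1 hY
    rw [add_add_add_comm, hn _ (add_mem hX₁ hY₁) _ (add_mem hX₂ hY₂), hl _ hX₁ _ hY₁,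
      hn _ hX₁ _ hX₂, hn _ hY₁ _ hY₂]
  let T₁ : c.p →ₗ[ℝ] 𝔸 :=
    { toFun := fun X => derivedRep R (X : LieAlg E G)
      map_add' := fun X Y => hadd X X.2 Y Y.2
      map_smul' := fun r X => hR.derivedRep_smul (c.p_le_lieOf X.2) r }
  obtain ⟨T, hT⟩ := T₁.exists_extend
  have hTp : ∀ X ∈ c.p, T X = derivedRep R X := fun X hX => LinearMap.congr_fun hT ⟨X, hX⟩
  have hexp : ∀ X ∈ c.p, ∀ t : ℝ, R (expG (t • X)) = exp (t • T X) := fun X hX t => by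
    rw [hTp X hX, hR.apply_expG_smul (c.p_le_lieOf hX)]
  have hAd : ∀ g ∈ c.P, ∀ X ∈ c.p, Ad ℝ E g X ∈ c.p → R g * T X = T (Ad ℝ E g X) * R g :=
    fun g hg X hX hgX => by
      rw [hTp X hX, hTp _ hgX, hR.mul_derivedRep hg (c.p_le_lieOf hX)]
  refine ⟨T, hexp, fun X hX Y hY => ?_, hAd⟩
  -- the derivative of this identity at `t = 0` is the bracket relation
  have h : ∀ t : ℝ, exp (t • T X) * T Y = T (exp (t • adL ℝ E G X) Y) * exp (t • T X) := by
    intro t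
    rw [← hexp X hX, ← Ad_expG_smul]
    refine hAd _ (c.expG_mem_P (c.p.smul_mem t hX)) Y hY ?_
    rw [Ad_expG_smul]
    exact exp_apply_mem (fun Z hZ => c.p.smul_mem t (c.lie_mem_p hX hZ)) hY
  let Tc : LieAlg E G →L[ℝ] 𝔸 := LinearMap.toContinuousLinearMap T
  have h1 := (hasDerivAt_exp_smul (𝕜 := ℝ) (T X) 0).mul_const (T Y)
  have h2 : HasDerivAt (fun t : ℝ => exp (t • adL ℝ E G X) Y) ⁅X, Y⁆ 0 := by
    have h3 := (hasDerivAt_exp_smul (𝕜 := ℝ) (adL ℝ E G X) 0).clm_apply (hasDerivAt_const 0 Y)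
    simpa using h3
  have h4 := (Tc.hasFDerivAt.comp_hasDerivAt (0 : ℝ) h2).mul
    (hasDerivAt_exp_smul (𝕜 := ℝ) (T X) 0)
  have h5 := h1.unique (h4.congr_of_eventuallyEq (Eventually.of_forall h))
  simp only [zero_smul, NormedSpace.exp_zero, one_mul, mul_one, Function.comp_apply,
    one_apply_eq_self] at h5
  have h6 : T X * T Y = T ⁅X, Y⁆ + T Y * T X := h5
  rw [h6, add_sub_cancel_right]

end Choices
end ParabolicRepresentation

/-! ### Stable spans -/

section StableSpan

variable {V : Type*} [NormedAddCommGroup V] [NormedSpace ℂ V]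

/-- The smallest subspace that contains `U` and is stable under the operators in `F`. -/
def stableSpan (F : Set (V →L[ℂ] V)) (U : Submodule ℂ V) : Submodule ℂ V :=
  sInf {W | U ≤ W ∧ ∀ f ∈ F, ∀ v ∈ W, f v ∈ W}

lemma le_stableSpan (F : Set (V →L[ℂ] V)) (U : Submodule ℂ V) : U ≤ stableSpan F U :=
  le_sInf fun _ hW => hW.1

lemma stableSpan_le {F : Set (V →L[ℂ] V)} {U W : Submodule ℂ V} (h : U ≤ W)
    (hW : ∀ f ∈ F, ∀ v ∈ W, f v ∈ W) : stableSpan F U ≤ W :=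
  sInf_le ⟨h, hW⟩

lemma apply_mem_stableSpan {F : Set (V →L[ℂ] V)} {U : Submodule ℂ V} {f : V →L[ℂ] V} (hf : f ∈ F)
    {v : V} (hv : v ∈ stableSpan F U) : f v ∈ stableSpan F U := by
  simp only [stableSpan, Submodule.mem_sInf] at hv ⊢
  exact fun W hW => hW.2 f hf v (hv W hW)

end StableSpan

/-! ### Complexified derivatives -/

section ComplexifiedDerivative

variable {E : Type*} [NormedAddCommGroup E] [NormedSpace ℝ E] [FiniteDimensional ℝ E]
  [CompleteSpace E]
  {G : Type*} [Group G] [TopologicalSpace G] [ChartedSpace E G] [LieGroup 𝓘(ℝ, E) ∞ G]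
  {V : Type*} [NormedAddCommGroup V] [NormedSpace ℂ V] [FiniteDimensional ℂ V]

variable (E) in
/-- The complexified adjoint representation. -/
noncomputable def AdC (g : G) : LieAlgC E G →ₗ[ℂ] LieAlgC E G :=
  LinearMap.baseChange ℂ (Ad ℝ E g : LieAlg E G →ₗ[ℝ] LieAlg E G)

lemma AdC_one_tmul (g : G) (X : LieAlg E G) :
    AdC E g ((1 : ℂ) ⊗ₜ[ℝ] X) = (1 : ℂ) ⊗ₜ[ℝ] Ad ℝ E g X := by
  simp [AdC]

lemma AdC_eq (g : G) (Z : LieAlgC E G) : AdC E g Z =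
    (1 : ℂ) ⊗ₜ[ℝ] Ad ℝ E g (reC Z) + Complex.I • ((1 : ℂ) ⊗ₜ[ℝ] Ad ℝ E g (imC Z)) := by
  conv_lhs => rw [eq_re_add_im Z]
  rw [map_add, map_smul, AdC_one_tmul, AdC_one_tmul]

lemma reC_AdC (g : G) (Z : LieAlgC E G) : reC (AdC E g Z) = Ad ℝ E g (reC Z) := by
  rw [AdC_eq]
  simp [reC_smul]

lemma imC_AdC (g : G) (Z : LieAlgC E G) : imC (AdC E g Z) = Ad ℝ E g (imC Z) := by
  rw [AdC_eq]
  simp [imC_smul]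

lemma AdC_inv_apply (g : G) (Z : LieAlgC E G) : AdC E g (AdC E g⁻¹ Z) = Z := by
  apply ext_re_im
  · rw [reC_AdC, reC_AdC, Ad_apply_inv]
  · rw [imC_AdC, imC_AdC, Ad_apply_inv]

namespace Choices

variable (c : Choices E G)

/-- `J` preserves the root spaces, since it fixes `𝔧`. -/
lemma AdC_mem_rootSpaceJ {g : G} (hg : g ∈ c.J) {α : c.j →ₗ[ℝ] ℂ} {Z : LieAlgC E G}
    (hZ : Z ∈ rootSpaceJ c.j α) : AdC E g Z ∈ rootSpaceJ c.j α := by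
  rw [mem_rootSpaceJ]
  intro X
  have hX : Ad ℝ E g X = X := hg X X.2
  apply ext_re_im
  · rw [reC_lie, reC_smul, reC_AdC, imC_AdC]
    nth_rw 1 [← hX]
    rw [← Ad_lie, lie_reC hZ, map_sub, map_smul, map_smul]
  · rw [imC_lie, imC_smul, reC_AdC, imC_AdC]
    nth_rw 1 [← hX]
    rw [← Ad_lie, lie_imC hZ, map_add, map_smul, map_smul]

/-- `R` is a representation of `P` on `V`, and `T` is the complexification of its derivative, with
values outside `𝔭_c` left free. -/
structure IsDerivedPair (R : G → V →L[ℂ] V) (T : LieAlgC E G →ₗ[ℂ] V →L[ℂ] V) : Prop where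
  isRepOn : IsRepOn c.P R
  apply_expG : ∀ X ∈ c.p, ∀ t : ℝ, R (expG (t • X)) = exp (t • T ((1 : ℂ) ⊗ₜ[ℝ] X))
  map_lie : ∀ Z ∈ c.p.baseChange ℂ, ∀ W ∈ c.p.baseChange ℂ, T ⁅Z, W⁆ = T Z * T W - T W * T Z
  mul_apply : ∀ g ∈ c.P, ∀ Z ∈ c.p.baseChange ℂ, AdC E g Z ∈ c.p.baseChange ℂ →
    R g * T Z = T (AdC E g Z) * R g

lemma exists_isDerivedPair [LieAlgebra.IsKilling ℝ (LieAlg E G)] [ConnectedSpace G]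
    [Finite (Subgroup.center G)] {R : G → V →L[ℂ] V} (hR : IsRepOn c.P R)
    (hN : ∀ g ∈ c.N, R g = 1) :
    ∃ T : LieAlgC E G →ₗ[ℂ] V →L[ℂ] V, c.IsDerivedPair R T := by
  have : CompleteSpace V := FiniteDimensional.complete ℂ V
  obtain ⟨T₀, h1, h2, h3⟩ := c.exists_derived hR hN
  let T : LieAlgC E G →ₗ[ℂ] V →L[ℂ] V := LinearMap.liftBaseChange ℂ T₀
  have hT1 : ∀ X, T ((1 : ℂ) ⊗ₜ[ℝ] X) = T₀ X := fun X => by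
    simp [T, LinearMap.liftBaseChange_tmul]
  have hT : ∀ Z, T Z = T₀ (reC Z) + Complex.I • T₀ (imC Z) := fun Z => by
    conv_lhs => rw [eq_re_add_im Z]
    rw [map_add, map_smul, hT1, hT1]
  refine ⟨T, hR, fun X hX t => ?_, fun Z hZ W hW => ?_, fun g hg Z hZ hgZ => ?_⟩
  · rw [hT1, h1 X hX t]
  · rw [mem_baseChange_iff_re_im] at hZ hW
    have hlie : ⁅Z, W⁆ = (1 : ℂ) ⊗ₜ[ℝ] (⁅reC Z, reC W⁆ - ⁅imC Z, imC W⁆) +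
        Complex.I • ((1 : ℂ) ⊗ₜ[ℝ] (⁅reC Z, imC W⁆ + ⁅imC Z, reC W⁆)) := by
      conv_lhs => rw [eq_re_add_im Z, eq_re_add_im W]
      simp only [add_lie, lie_add, smul_lie, lie_smul, LieAlgebra.ExtendScalars.bracket_tmul,
        TensorProduct.tmul_add, TensorProduct.tmul_sub, one_mul, smul_add, smul_smul,
        Complex.I_mul_I, neg_smul, one_smul]
      abel
    rw [hlie, map_add, map_smul, hT1, hT1, map_sub, map_add, h2 _ hZ.1 _ hW.1, h2 _ hZ.2 _ hW.2,
      h2 _ hZ.1 _ hW.2, h2 _ hZ.2 _ hW.1, hT Z, hT W]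
    simp only [add_mul, mul_add, smul_mul_assoc, mul_smul_comm, smul_smul, Complex.I_mul_I,
      neg_smul, one_smul, smul_add, smul_sub]
    abel
  · rw [mem_baseChange_iff_re_im] at hZ hgZ
    rw [reC_AdC, imC_AdC] at hgZ
    rw [hT, hT, reC_AdC, imC_AdC, mul_add, add_mul, mul_smul_comm, smul_mul_assoc,
      h3 g hg _ hZ.1 hgZ.1, h3 g hg _ hZ.2 hgZ.2]

end Choices
end ComplexifiedDerivative

/-! ### Highest weight vectors -/

section HighestWeights

/-- The dimension of a minimal nonzero invariant subspace `U` belongs to `irrepDims`. -/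
lemma finrank_mem_irrepDims {S : Type*} [Group S] [TopologicalSpace S] {V : Type*}
    [AddCommGroup V] [Module ℂ V] [FiniteDimensional ℂ V] {σ : Representation ℂ S V}
    (hσ : IsContinuousRep σ) {U : Submodule ℂ V} (hU : U ≠ ⊥) (hinv : ∀ g, ∀ v ∈ U, σ g v ∈ U)
    (hmin : ∀ U' : Submodule ℂ V, U' ≤ U → U' ≠ ⊥ → (∀ g, ∀ v ∈ U', σ g v ∈ U') → U' = U) :
    Module.finrank ℂ U ∈ irrepDims S := by
  let e : U ≃ₗ[ℂ] (Fin (Module.finrank ℂ U) → ℂ) :=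
    LinearEquiv.ofFinrankEq _ _ (by simp)
  let f : S → U →ₗ[ℂ] U := fun g => (σ g).restrict (hinv g)
  have hf1 : f 1 = 1 := by ext v; simp [f]
  have hfm : ∀ g h, f (g * h) = f g * f h := fun g h => by ext v; simp [f]
  let ρ : Representation ℂ S (Fin (Module.finrank ℂ U) → ℂ) :=
    { toFun := fun g => e.conj (f g)
      map_one' := by rw [hf1]; exact e.conj_id
      map_mul' := fun g h => by
        refine LinearMap.ext fun v => ?_
        simp [hfm, LinearEquiv.conj_apply] }
  have hρ : ∀ g v, ρ g v = e (f g (e.symm v)) := fun g v => rfl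
  have hUn : Nontrivial U := (Submodule.nontrivial_iff_ne_bot).2 hU
  have hn : Nontrivial (Fin (Module.finrank ℂ U) → ℂ) := e.symm.toEquiv.nontrivial
  refine ⟨ρ, ?_, fun v l => ?_⟩
  · have hne : (⊥ : Subrepresentation ρ) ≠ ⊤ := fun h =>
      bot_ne_top (α := Submodule ℂ (Fin (Module.finrank ℂ U) → ℂ))
        (congrArg Subrepresentation.toSubmodule h)
    have : Nontrivial (Subrepresentation ρ) := ⟨_, _, hne⟩
    refine ⟨fun W => ?_⟩
    by_cases hW : W.toSubmodule = ⊥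
    · exact Or.inl (Subrepresentation.toSubmodule_injective hW)
    refine Or.inr (Subrepresentation.toSubmodule_injective ?_)
    let U' : Submodule ℂ V := (W.toSubmodule.comap (e : U →ₗ[ℂ] _)).map U.subtype
    have hU' : U' = U := by
      refine hmin U' (Submodule.map_subtype_le _ _) ?_ fun g => ?_
      · obtain ⟨w, hw, hw0⟩ := (Submodule.ne_bot_iff _).1 hW
        refine (Submodule.ne_bot_iff _).2 ⟨e.symm w, ⟨e.symm w, ?_, rfl⟩, ?_⟩
        · simpa using hw
        · simpa using hw0
      · rintro _ ⟨u, hu, rfl⟩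
        refine ⟨f g u, ?_, rfl⟩
        have h1 := W.apply_mem_toSubmodule g hu
        rw [hρ] at h1
        simpa using h1
    refine eq_top_iff.2 fun w _ => ?_
    have h1 : (e.symm w : V) ∈ U' := by rw [hU']; exact (e.symm w).2
    obtain ⟨u, hu, huw⟩ := h1
    have h2 : u = e.symm w := Subtype.ext huw
    have h3 : e u ∈ W.toSubmodule := hu
    rwa [h2, e.apply_symm_apply] at h3
  · obtain ⟨l', hl'⟩ := (l ∘ₗ (e : U →ₗ[ℂ] _)).exists_extend
    refine (hσ (e.symm v) l').congr fun g => ?_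
    rw [hρ]
    exact LinearMap.congr_fun hl' (f g (e.symm v))

variable {E : Type*} [NormedAddCommGroup E] [NormedSpace ℝ E] [FiniteDimensional ℝ E]
  [CompleteSpace E]
  {G : Type*} [Group G] [TopologicalSpace G] [ChartedSpace E G] [LieGroup 𝓘(ℝ, E) ∞ G]
  [LieAlgebra.IsKilling ℝ (LieAlg E G)]
  {V : Type*} [NormedAddCommGroup V] [NormedSpace ℂ V] [FiniteDimensional ℂ V]

namespace Choices

variable (c : Choices E G)

/-- The vectors killed by the positive root spaces of `𝔧`. -/
def highestWeightSpace (T : LieAlgC E G →ₗ[ℂ] V →L[ℂ] V) : Submodule ℂ V where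
  carrier := {v | ∀ α ∈ c.posJ, ∀ Z ∈ rootSpaceJ c.j α, T Z v = 0}
  zero_mem' := fun _ _ _ _ => map_zero _
  add_mem' := fun hv hw α hα Z hZ => by rw [map_add, hv α hα Z hZ, hw α hα Z hZ, add_zero]
  smul_mem' := fun r v hv α hα Z hZ => by rw [map_smul, hv α hα Z hZ, smul_zero]

lemma rootSpaceJ_le_p {α : c.j →ₗ[ℝ] ℂ} (hα : α ∈ c.posJ) :
    rootSpaceJ c.j α ≤ c.p.baseChange ℂ :=
  (c.rootSpaceJ_le_b (Set.mem_insert_of_mem _ hα)).trans c.b_le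

namespace IsDerivedPair

variable {c} {R : G → V →L[ℂ] V} {T : LieAlgC E G →ₗ[ℂ] V →L[ℂ] V}

/-- An eigenvector of `A₀ - i T₀` whose eigenvalue has maximal real part is killed by the positive
root spaces, because these raise the real part of the eigenvalue. -/
lemma highestWeightSpace_ne_bot [Nontrivial V] (h : c.IsDerivedPair R T) :
    c.highestWeightSpace T ≠ ⊥ := by
  set H₀ : LieAlgC E G := (1 : ℂ) ⊗ₜ[ℝ] (c.A₀ : LieAlg E G) -
    Complex.I • ((1 : ℂ) ⊗ₜ[ℝ] (c.T₀ : LieAlg E G)) with hH₀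
  have hH₀b : H₀ ∈ c.p.baseChange ℂ := c.b_le (sub_mem (c.one_tmul_mem_b c.A₀.2)
    (Submodule.smul_mem _ _ (c.one_tmul_mem_b c.T₀.2)))
  let F : Module.End ℂ V := (T H₀ : V →ₗ[ℂ] V)
  obtain ⟨μ₀, hμ₀⟩ := Module.End.exists_eigenvalue F
  have hfin : {μ : ℂ | F.HasEigenvalue μ}.Finite := Module.End.finite_hasEigenvalue F
  obtain ⟨μ, hμ, hmax⟩ := hfin.exists_maximalFor Complex.re _ ⟨μ₀, hμ₀⟩
  obtain ⟨v, hv, hv0⟩ := hμ.exists_hasEigenvector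
  have hv' : T H₀ v = μ • v := Module.End.mem_eigenspace_iff.1 hv
  refine (Submodule.ne_bot_iff _).2 ⟨v, fun α hα Z hZ => ?_, hv0⟩
  by_contra hne
  have hroot := mem_rootSpaceJ.1 hZ
  have hlie : ⁅H₀, Z⁆ = (α c.A₀ - Complex.I * α c.T₀) • Z := by
    rw [hH₀, sub_lie, smul_lie, hroot, hroot, smul_smul, sub_smul]
  have h1 := congrArg (fun S : V →L[ℂ] V => S v) (h.map_lie H₀ hH₀b Z (c.rootSpaceJ_le_p hα hZ))
  simp only [hlie, map_smul, sub_apply, smul_apply, mul_apply_eq_comp, hv'] at h1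
  have h2 : F.HasEigenvalue (μ + (α c.A₀ - Complex.I * α c.T₀)) := by
    refine Module.End.hasEigenvalue_of_hasEigenvector (x := T Z v)
      ⟨Module.End.mem_eigenspace_iff.2 ?_, hne⟩
    change T H₀ (T Z v) = _
    rw [add_smul, h1]
    abel
  -- the real part of `α A₀ - i α T₀` is `Re (α A₀) + Im (α T₀)`, which is positive
  have h3 := c.reg_pos hα
  have h4 := hmax h2 (by simp; linarith)
  simp at h4
  linarith

lemma J_mem_highestWeightSpace (h : c.IsDerivedPair R T) {g : G} (hgP : g ∈ c.P) (hg : g ∈ c.J)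
    {v : V} (hv : v ∈ c.highestWeightSpace T) : R g v ∈ c.highestWeightSpace T := by
  intro α hα Z hZ
  have hZ' := c.AdC_mem_rootSpaceJ (inv_mem hg) hZ
  have h1 := h.mul_apply g hgP _ (c.rootSpaceJ_le_p hα hZ')
    (by rw [AdC_inv_apply]; exact c.rootSpaceJ_le_p hα hZ)
  have h2 := congrArg (fun S : V →L[ℂ] V => S v) h1
  simp only [AdC_inv_apply, mul_apply_eq_comp] at h2
  rw [← h2, hv α hα _ hZ', map_zero]

/-- Subspaces stable under `exp (t X)` are stable under `X`. -/
lemma apply_mem_of_expG (h : c.IsDerivedPair R T) {X : LieAlg E G} (hX : X ∈ c.p)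
    {U : Submodule ℂ V} (hU : ∀ t : ℝ, ∀ v ∈ U, R (expG (t • X)) v ∈ U) {v : V} (hv : v ∈ U) :
    T ((1 : ℂ) ⊗ₜ[ℝ] X) v ∈ U := by
  have : CompleteSpace V := FiniteDimensional.complete ℂ V
  have h1 : HasDerivAt (fun t : ℝ => R (expG (t • X)) v) (T ((1 : ℂ) ⊗ₜ[ℝ] X) v) 0 := by
    have h2 := hasDerivAt_exp_smul (𝕜 := ℝ) (T ((1 : ℂ) ⊗ₜ[ℝ] X)) 0
    have h3 := ((ContinuousLinearMap.apply ℂ V v).restrictScalars ℝ).hasFDerivAt.comp_hasDerivAt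
      (0 : ℝ) h2
    rw [zero_smul, NormedSpace.exp_zero, one_mul] at h3
    refine h3.congr_of_eventuallyEq (Eventually.of_forall fun t => ?_)
    simp only [Function.comp_apply]
    rw [h.apply_expG X hX t]
    rfl
  have hcl : IsClosed (U : Set V) := U.closed_of_finiteDimensional
  refine hcl.mem_of_tendsto h1.tendsto_slope_zero (Eventually.of_forall fun t => ?_)
  have h0 : R (expG ((0 : ℝ) • X)) v = v := by
    rw [zero_smul, expG_zero, h.isRepOn.map_one, one_apply_eq_self]
  rw [zero_add, h0]
  exact (U.restrictScalars ℝ).smul_mem _ (sub_mem (hU t v hv) hv)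

lemma expG_apply_mem (h : c.IsDerivedPair R T) {X : LieAlg E G} (hX : X ∈ c.p)
    {U : Submodule ℂ V} (hU : ∀ v ∈ U, T ((1 : ℂ) ⊗ₜ[ℝ] X) v ∈ U) {v : V} (hv : v ∈ U) :
    R (expG X) v ∈ U := by
  have := h.apply_expG X hX 1
  rw [one_smul, one_smul] at this
  rw [this]
  exact exp_apply_mem hU hv

end IsDerivedPair
end Choices
end HighestWeights

/-! ### Generation by highest weight vectors -/

section Generation

variable {E : Type*} [NormedAddCommGroup E] [NormedSpace ℝ E] [FiniteDimensional ℝ E]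
  [CompleteSpace E]
  {G : Type*} [Group G] [TopologicalSpace G] [ChartedSpace E G] [LieGroup 𝓘(ℝ, E) ∞ G]
  {V : Type*} [NormedAddCommGroup V] [NormedSpace ℂ V] [FiniteDimensional ℂ V]

/-- The elements of `S` that leave the subspace `U` invariant under the representation `R`. -/
def IsRepOn.stabilizer {S : Subgroup G} {R : G → V →L[ℂ] V} (hR : IsRepOn S R)
    (U : Submodule ℂ V) : Subgroup G where
  carrier := {g | g ∈ S ∧ ∀ v, R g v ∈ U ↔ v ∈ U}
  one_mem' := ⟨S.one_mem, fun v => by rw [hR.map_one, one_apply_eq_self]⟩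
  mul_mem' := fun {g h} hg hh => ⟨S.mul_mem hg.1 hh.1, fun v => by
    rw [hR.map_mul g hg.1 h hh.1, mul_apply_eq_comp, hg.2, hh.2]⟩
  inv_mem' := fun {g} hg => ⟨S.inv_mem hg.1, fun v => by
    rw [← hg.2, ← mul_apply_eq_comp, hR.mul_inv hg.1, one_apply_eq_self]⟩

lemma IsRepOn.mem_stabilizer {S : Subgroup G} {R : G → V →L[ℂ] V} (hR : IsRepOn S R)
    {U : Submodule ℂ V} {g : G} (hg : g ∈ S) (h1 : ∀ v ∈ U, R g v ∈ U)
    (h2 : ∀ v ∈ U, R g⁻¹ v ∈ U) : g ∈ hR.stabilizer U :=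
  ⟨hg, fun v => ⟨fun hv => by
    have := h2 _ hv
    rwa [← mul_apply_eq_comp, hR.inv_mul hg, one_apply_eq_self] at this, h1 v⟩⟩

/-- The space of those `Z` for which the operator `T Z` carries `U` into `U'`. -/
def carrying (T : LieAlgC E G →ₗ[ℂ] V →L[ℂ] V) (U U' : Submodule ℂ V) :
    Submodule ℂ (LieAlgC E G) where
  carrier := {Z | ∀ v ∈ U, T Z v ∈ U'}
  zero_mem' := fun v _ => by rw [map_zero]; exact U'.zero_mem
  add_mem' := fun hZ hW v hv => by
    rw [map_add]
    exact U'.add_mem (hZ v hv) (hW v hv)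
  smul_mem' := fun r Z hZ v hv => by
    rw [map_smul]
    exact U'.smul_mem r (hZ v hv)

namespace Choices

variable {c : Choices E G}

lemma lie_mem_baseChange_p {Z W : LieAlgC E G} (hZ : Z ∈ c.p.baseChange ℂ)
    (hW : W ∈ c.p.baseChange ℂ) [LieAlgebra.IsKilling ℝ (LieAlg E G)] :
    ⁅Z, W⁆ ∈ c.p.baseChange ℂ := by
  rw [mem_baseChange_iff_re_im] at hZ hW
  rw [eq_re_add_im Z, add_lie, smul_lie]
  refine add_mem ?_ (Submodule.smul_mem _ _ ?_)
  · rw [mem_baseChange_iff_re_im, reC_lie, imC_lie]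
    exact ⟨c.lie_mem_p hZ.1 hW.1, c.lie_mem_p hZ.1 hW.2⟩
  · rw [mem_baseChange_iff_re_im, reC_lie, imC_lie]
    exact ⟨c.lie_mem_p hZ.2 hW.1, c.lie_mem_p hZ.2 hW.2⟩

lemma one_tmul_mem_baseChange_p {X : LieAlg E G} (hX : X ∈ c.p)
    [LieAlgebra.IsKilling ℝ (LieAlg E G)] :
    (1 : ℂ) ⊗ₜ[ℝ] X ∈ c.p.baseChange ℂ := Submodule.tmul_mem_baseChange_of_mem (1 : ℂ) hX

namespace IsDerivedPair

variable [LieAlgebra.IsKilling ℝ (LieAlg E G)] [ConnectedSpace G] [Finite (Subgroup.center G)]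
  {R : G → V →L[ℂ] V} {T : LieAlgC E G →ₗ[ℂ] V →L[ℂ] V}

lemma expG_mem_stabilizer (h : c.IsDerivedPair R T) {X : LieAlg E G}
    (hX : X ∈ c.p) {U : Submodule ℂ V} (hU : ∀ v ∈ U, T ((1 : ℂ) ⊗ₜ[ℝ] X) v ∈ U) :
    expG X ∈ h.isRepOn.stabilizer U := by
  refine h.isRepOn.mem_stabilizer (c.expG_mem_P hX) (fun v hv => h.expG_apply_mem hX hU hv)
    fun v hv => ?_
  rw [← expG_neg]
  refine h.expG_apply_mem (neg_mem hX) (fun w hw => ?_) hv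
  rw [TensorProduct.tmul_neg, map_neg, neg_apply]
  exact neg_mem (hU w hw)

/-- An irreducible representation of `L` is generated over `𝔩` by any nonzero `J`-invariant
subspace `U`: the span is invariant under `J` and under the closed subgroup of those elements of `M`
that preserve it, and these two subgroups together exhaust `M`. -/
lemma stableSpan_l_eq_top (h : c.IsDerivedPair R T)
    (hirr : ∀ W : Submodule ℂ V, W ≠ ⊥ → (∀ g ∈ c.L, ∀ v ∈ W, R g v ∈ W) → W = ⊤)
    {U : Submodule ℂ V} (hU : U ≠ ⊥) (hUJ : ∀ g ∈ c.J, ∀ v ∈ U, R g v ∈ U) :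
    stableSpan ((fun X => T ((1 : ℂ) ⊗ₜ[ℝ] X)) '' (c.l : Set (LieAlg E G))) U = ⊤ := by
  have := t2Space_of_chartedSpace E G
  set F : Set (V →L[ℂ] V) := (fun X => T ((1 : ℂ) ⊗ₜ[ℝ] X)) '' (c.l : Set (LieAlg E G)) with hF
  set W := stableSpan F U with hW
  have hlp : ∀ X ∈ c.l, X ∈ c.p := fun X hX => Submodule.mem_sup_left hX
  have hTW : ∀ X ∈ c.l, ∀ v ∈ W, T ((1 : ℂ) ⊗ₜ[ℝ] X) v ∈ W := fun X hX v hv =>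
    apply_mem_stableSpan (F := F) (f := T ((1 : ℂ) ⊗ₜ[ℝ] X)) ⟨X, hX, rfl⟩ hv
  have hexp : ∀ X ∈ c.l, expG X ∈ h.isRepOn.stabilizer W := fun X hX =>
    h.expG_mem_stabilizer (hlp X hX) (hTW X hX)
  have hJL : ∀ g ∈ c.J, g ∈ c.L := fun g hg => c.J_le_L hg
  have hJ : ∀ g ∈ c.J, ∀ v ∈ W, R g v ∈ W := by
    intro g hg
    have h1 : W ≤ W.comap (R g : V →ₗ[ℂ] V) := by
      refine stableSpan_le (fun v hv => le_stableSpan F U (hUJ g hg v hv)) ?_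
      rintro _ ⟨X, hX, rfl⟩ v hv
      have hgX := c.Ad_mem_l (hJL g hg) hX
      have h2 := congrArg (fun S : V →L[ℂ] V => S v) (h.mul_apply g (c.L_le_P (hJL g hg)) _
        (one_tmul_mem_baseChange_p (hlp X hX)) (by
          rw [AdC_one_tmul]
          exact one_tmul_mem_baseChange_p (hlp _ hgX)))
      simp only [mul_apply_eq_comp, AdC_one_tmul] at h2
      change R g (T ((1 : ℂ) ⊗ₜ[ℝ] X) v) ∈ W
      rw [h2]
      exact hTW _ hgX _ hv
    exact h1
  have hJs : c.J ≤ h.isRepOn.stabilizer W := fun g hg =>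
    h.isRepOn.mem_stabilizer (c.L_le_P (hJL g hg)) (hJ g hg) (hJ _ (inv_mem hg))
  have hMP : c.M ≤ c.P := le_sup_left.trans c.L_le_P
  have hMclosed : IsClosed (c.M : Set G) :=
    c.K_maximal.1.isClosed.inter (isClosed_lieCentralizer _)
  have hM : c.M ≤ h.isRepOn.stabilizer W := by
    -- the part of `M` preserving `W` is closed and contains `expG` of the Lie algebra of `M`
    let S : Subgroup G := c.M ⊓ h.isRepOn.stabilizer W
    have hS : IsClosed (S : Set G) := by
      have := isTopologicalGroup_of_chartedSpace E G
      have hWc : IsClosed (W : Set V) := W.closed_of_finiteDimensional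
      have key : ∀ f : G → G, Continuous f → (∀ g ∈ c.M, f g ∈ c.M) → ∀ v,
          IsClosed ((c.M : Set G) ∩ (fun g => R (f g) v) ⁻¹' (W : Set V)) := by
        intro f hf hfM v
        refine ContinuousOn.preimage_isClosed_of_isClosed ?_ hMclosed hWc
        have h1 : ContinuousOn (fun g => R (f g)) (c.M : Set G) :=
          h.isRepOn.continuousOn.comp hf.continuousOn fun g hg => hMP (hfM g hg)
        exact h1.clm_apply continuousOn_const
      have h2 : (S : Set G) = (c.M : Set G) ∩ ⋂ v ∈ W,
          ((c.M : Set G) ∩ (fun g => R (id g) v) ⁻¹' (W : Set V)) ∩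
            ((c.M : Set G) ∩ (fun g => R g⁻¹ v) ⁻¹' (W : Set V)) := by
        ext g
        simp only [Set.mem_inter_iff, Set.mem_iInter]
        constructor
        · intro hg
          have hg' := (h.isRepOn.stabilizer W).inv_mem hg.2
          exact ⟨hg.1, fun v hv => ⟨⟨hg.1, (hg.2.2 v).2 hv⟩, hg.1, (hg'.2 v).2 hv⟩⟩
        · rintro ⟨hg, hgW⟩
          exact ⟨hg, h.isRepOn.mem_stabilizer (hMP hg) (fun v hv => (hgW v hv).1.2)
            fun v hv => (hgW v hv).2.2⟩
      rw [h2]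
      exact hMclosed.inter (isClosed_biInter fun v _ =>
        (key id continuous_id (fun _ hg => hg) v).inter
          (key _ continuous_inv (fun _ hg => inv_mem hg) v))
    intro m hm
    obtain ⟨k, hk, hkm⟩ := c.exists_mul_mem_J hS inf_le_left (fun X hX hθX =>
      ⟨⟨by simpa using mem_lieOf_iff.1 ((c.lie_K X).2 hθX) 1, fun A hA =>
        c.Ad_a_of_mem_L (c.expG_mem_L hX) hA⟩, hexp X hX⟩) hm
    have h1 : m = k⁻¹ * (k * m) := by group
    rw [h1]
    exact mul_mem (inv_mem hk.2) (hJs hkm)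
  have hA : c.A ≤ h.isRepOn.stabilizer W := by
    rw [A, analyticSubgroup_eq, Subgroup.closure_le]
    rintro _ ⟨X, hX, rfl⟩
    exact hexp X (c.j_le_l hX.1)
  have hL : c.L ≤ h.isRepOn.stabilizer W := sup_le hM hA
  refine hirr W (fun hbot => hU ?_) fun g hg v hv => ((hL hg).2 v).2 hv
  exact le_bot_iff.1 (hbot ▸ le_stableSpan F U)

/-- If `U` is a nonzero `J`-invariant space of highest weight vectors and `𝔭_c = 𝔥' + 𝔟`, then `U`
generates the representation over `𝔥'`: the span of `U` over `𝔥'` is invariant under `𝔟`, as `𝔟`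
preserves `U` and `[𝔟, 𝔥'] ⊆ 𝔥' + 𝔟`. -/
lemma eq_top_of_stable (h : c.IsDerivedPair R T)
    (hirr : ∀ W : Submodule ℂ V, W ≠ ⊥ → (∀ g ∈ c.L, ∀ v ∈ W, R g v ∈ W) → W = ⊤)
    {U : Submodule ℂ V} (hU : U ≠ ⊥) (hUJ : ∀ g ∈ c.J, ∀ v ∈ U, R g v ∈ U)
    (hUhw : U ≤ c.highestWeightSpace T) {h' : Submodule ℂ (LieAlgC E G)}
    (hsup : h' ⊔ c.b = c.p.baseChange ℂ) {W : Submodule ℂ V} (hUW : U ≤ W)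
    (hW : ∀ Z ∈ h', ∀ v ∈ W, T Z v ∈ W) : W = ⊤ := by
  have hh'p : h' ≤ c.p.baseChange ℂ := hsup ▸ le_sup_left
  have hbU : c.b ≤ carrying T U U := by
    have hj : ∀ X ∈ c.j, (1 : ℂ) ⊗ₜ[ℝ] X ∈ carrying T U U := fun X hX v hv =>
      h.apply_mem_of_expG (Submodule.mem_sup_left (c.j_le_l hX))
        (fun t w hw => hUJ _ (c.expG_mem_J (c.j.smul_mem t hX)) w hw) hv
    refine sup_le (fun Z hZ => ?_) (iSup₂_le fun α hα Z hZ v hv => ?_)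
    · rw [mem_baseChange_iff_re_im] at hZ
      rw [eq_re_add_im Z]
      exact add_mem (hj _ hZ.1) (Submodule.smul_mem _ _ (hj _ hZ.2))
    · rw [hUhw hv α hα Z hZ]
      exact U.zero_mem
  set W₀ := stableSpan (T '' (h' : Set (LieAlgC E G))) U with hW₀
  have hh' : h' ≤ carrying T W₀ W₀ := fun Z hZ v hv =>
    apply_mem_stableSpan (F := T '' (h' : Set (LieAlgC E G))) (f := T Z) ⟨Z, hZ, rfl⟩ hv
  -- the vectors of `W₀` that `𝔟` maps into `W₀` form a subspace stable under `𝔥'`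
  let W₁ : Submodule ℂ V :=
    { carrier := {w | w ∈ W₀ ∧ ∀ Z ∈ c.b, T Z w ∈ W₀}
      zero_mem' := ⟨W₀.zero_mem, fun Z _ => by rw [map_zero]; exact W₀.zero_mem⟩
      add_mem' := fun hv hw => ⟨W₀.add_mem hv.1 hw.1, fun Z hZ => by
        rw [map_add]
        exact W₀.add_mem (hv.2 Z hZ) (hw.2 Z hZ)⟩
      smul_mem' := fun r v hv => ⟨W₀.smul_mem r hv.1, fun Z hZ => by
        rw [map_smul]
        exact W₀.smul_mem r (hv.2 Z hZ)⟩ }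
  have hW₁ : W₀ ≤ W₁ := by
    refine stableSpan_le (fun u hu => ⟨le_stableSpan _ U hu, fun Z hZ =>
      le_stableSpan _ U (hbU hZ u hu)⟩) ?_
    rintro _ ⟨Y, hY, rfl⟩ w hw
    refine ⟨hh' hY w hw.1, fun Z hZ => ?_⟩
    have h1 := congrArg (fun S : V →L[ℂ] V => S w) (h.map_lie Z (c.b_le hZ) Y (hh'p hY))
    simp only [sub_apply, mul_apply_eq_comp] at h1
    -- `T Z T Y w = T [Z, Y] w + T Y T Z w`
    rw [← sub_add_cancel (T Z (T Y w)) (T Y (T Z w)), ← h1]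
    refine add_mem ?_ (hh' hY _ (hw.2 Z hZ))
    have h2 := lie_mem_baseChange_p (c.b_le hZ) (hh'p hY)
    rw [← hsup] at h2
    obtain ⟨Y', hY', Z', hZ', hsum⟩ := Submodule.mem_sup.1 h2
    rw [← hsum, map_add]
    exact add_mem (hh' hY' w hw.1) (hw.2 Z' hZ')
  have hp : c.p.baseChange ℂ ≤ carrying T W₀ W₀ := by
    rw [← hsup]
    exact sup_le hh' fun Z hZ w hw => (hW₁ hw).2 Z hZ
  have h3 : W₀ ≤ W := stableSpan_le hUW (by
    rintro _ ⟨Z, hZ, rfl⟩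
    exact hW Z hZ)
  refine eq_top_iff.2 (le_trans ?_ h3)
  rw [← h.stableSpan_l_eq_top hirr hU hUJ]
  refine stableSpan_le (le_stableSpan _ U) ?_
  rintro _ ⟨X, hX, rfl⟩
  exact hp (one_tmul_mem_baseChange_p (Submodule.mem_sup_left hX))

end IsDerivedPair
end Choices
end Generation

/-! ### The multiplicity bound -/

section MultiplicityBound

lemma IsContinuousRep.continuous_apply {S : Type*} [Group S] [TopologicalSpace S] {V : Type*}
    [NormedAddCommGroup V] [NormedSpace ℂ V] [FiniteDimensional ℂ V] {σ : Representation ℂ S V}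
    (hσ : IsContinuousRep σ) (v : V) : Continuous fun g => σ g v := by
  let e := (Module.finBasis ℂ V).equivFunL
  have h : Continuous fun g => e (σ g v) :=
    continuous_pi fun i => hσ v ((Module.finBasis ℂ V).coord i)
  exact (e.symm.continuous.comp h).congr fun g => e.symm_apply_apply _

variable {E : Type*} [NormedAddCommGroup E] [NormedSpace ℝ E] [FiniteDimensional ℝ E]
  [CompleteSpace E]
  {G : Type*} [Group G] [TopologicalSpace G] [ChartedSpace E G] [LieGroup 𝓘(ℝ, E) ∞ G]

open Classical in
/-- The extension of a representation of a subgroup by `1`, with values in the Banach algebra of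
bounded operators. -/
noncomputable def extendOne {V : Type*} [NormedAddCommGroup V] [NormedSpace ℂ V]
    [FiniteDimensional ℂ V] {S : Subgroup G} (σ : Representation ℂ S V) (g : G) : V →L[ℂ] V :=
  if h : g ∈ S then LinearMap.toContinuousLinearMap (σ ⟨g, h⟩) else 1

lemma extendOne_apply {V : Type*} [NormedAddCommGroup V] [NormedSpace ℂ V]
    [FiniteDimensional ℂ V] {S : Subgroup G} (σ : Representation ℂ S V) {g : G} (hg : g ∈ S)
    (v : V) : extendOne σ g v = σ ⟨g, hg⟩ v := by
  rw [extendOne, dif_pos hg]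
  rfl

lemma isRepOn_extendOne {V : Type*} [NormedAddCommGroup V] [NormedSpace ℂ V]
    [FiniteDimensional ℂ V] {S : Subgroup G} {σ : Representation ℂ S V}
    (hσ : IsContinuousRep σ) : IsRepOn S (extendOne σ) where
  map_one := by
    ext v
    rw [extendOne_apply σ S.one_mem]
    exact LinearMap.congr_fun σ.map_one v
  map_mul g hg h hh := by
    ext v
    rw [mul_apply_eq_comp, extendOne_apply σ (mul_mem hg hh), extendOne_apply σ hg,
      extendOne_apply σ hh]
    exact LinearMap.congr_fun (σ.map_mul ⟨g, hg⟩ ⟨h, hh⟩) v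
  continuousOn := by
    rw [continuousOn_iff_continuous_domRestrict]
    refine continuous_clm_apply.2 fun v => (hσ.continuous_apply v).congr fun g => ?_
    exact (extendOne_apply σ g.2 v).symm

namespace Choices

variable [LieAlgebra.IsKilling ℝ (LieAlg E G)] [ConnectedSpace G] [Finite (Subgroup.center G)]

/-- The multiplicity bound: a homomorphism is determined by its restriction to an irreducible
`J`-subrepresentation of the highest weight space. -/
lemma finrank_homHP_le (c : Choices E G) {H : Subgroup G} (hH : IsClosed (H : Set G))
    (htop : lieC (E := E) H ⊔ c.b = ⊤)
    {W : Type*} [AddCommGroup W] [Module ℂ W] [FiniteDimensional ℂ W] (τ : Representation ℂ H W)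
    {V : Type*} [NormedAddCommGroup V] [NormedSpace ℂ V] [FiniteDimensional ℂ V]
    {ζ : Representation ℂ c.L V} (hζ : ζ.IsIrreducible) {ζP : Representation ℂ c.P V}
    (hext : c.IsExtension ζ ζP) :
    Module.finrank ℂ (c.homHP H ζP τ) ≤ maxIrrepDim c.J * Module.finrank ℂ W := by
  have := nontrivial_of_irreducible hζ
  have hR := isRepOn_extendOne hext.continuous
  have hN : ∀ g ∈ c.N, extendOne ζP g = 1 := fun g hg => by
    ext v
    rw [extendOne_apply ζP (c.N_le_P hg), hext.on_N ⟨g, hg⟩]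
    rfl
  obtain ⟨T, hT⟩ := c.exists_isDerivedPair hR hN
  have hirr : ∀ U : Submodule ℂ V, U ≠ ⊥ →
      (∀ g ∈ c.L, ∀ v ∈ U, extendOne ζP g v ∈ U) → U = ⊤ := fun U hU hUL =>
    eq_top_of_irreducible hζ hU fun g v hv => by
      have := hUL g g.2 v hv
      rwa [extendOne_apply ζP (c.L_le_P g.2), hext.on_L] at this
  have hJP : c.J ≤ c.P := c.J_le_L.trans c.L_le_P
  -- `U` is a minimal nonzero `J`-invariant space of highest weight vectors
  let Q : Submodule ℂ V → Prop := fun U =>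
    U ≠ ⊥ ∧ U ≤ c.highestWeightSpace T ∧ ∀ g ∈ c.J, ∀ v ∈ U, extendOne ζP g v ∈ U
  obtain ⟨U, -, hUmin⟩ := exists_minimal_le_of_wellFoundedLT Q (c.highestWeightSpace T)
    ⟨hT.highestWeightSpace_ne_bot, le_rfl, fun g hg v hv =>
      hT.J_mem_highestWeightSpace (hJP hg) hg hv⟩
  obtain ⟨hU, hUhw, hUJ⟩ := hUmin.prop
  have hdim : Module.finrank ℂ U ≤ maxIrrepDim c.J := by
    refine c.isGreatest_irrepDims.2 ?_
    let σ : Representation ℂ c.J V := ζP.comp (Subgroup.inclusion hJP)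
    have hσ : ∀ (g : c.J) (v : V), extendOne ζP g v = σ g v := fun g v =>
      extendOne_apply ζP (hJP g.2) v
    refine finrank_mem_irrepDims (σ := σ) (fun v l => ?_) hU (fun g v hv => ?_)
      fun U' hU'U hU' hU'J => ?_
    · exact (hext.continuous v l).comp (continuous_inclusion hJP)
    · rw [← hσ]
      exact hUJ g g.2 v hv
    · refine le_antisymm hU'U (hUmin.2 ⟨hU', hU'U.trans hUhw, fun g hg v hv => ?_⟩ hU'U)
      rw [hσ ⟨g, hg⟩]
      exact hU'J ⟨g, hg⟩ v hv
  -- modular law, as `𝔟 ⊆ 𝔭_c`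
  have hsup : (lieC (E := E) H ⊓ c.p.baseChange ℂ) ⊔ c.b = c.p.baseChange ℂ := by
    rw [sup_comm, ← sup_inf_assoc_of_le _ c.b_le, sup_comm, htop, top_inf_eq]
  let res : c.homHP H ζP τ →ₗ[ℂ] (U →ₗ[ℂ] W) :=
    (LinearMap.lcomp ℂ W U.subtype) ∘ₗ (c.homHP H ζP τ).subtype
  have hinj : Function.Injective res := by
    rw [injective_iff_map_eq_zero]
    rintro ⟨f, hf⟩ hf0
    have hfU : U ≤ LinearMap.ker f := fun u hu => LinearMap.congr_fun hf0 ⟨u, hu⟩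
    -- the scalar by which `f` fails to intertwine `ζ` and `τ` does not affect its kernel
    have hker : ∀ X ∈ lieOf (𝕜 := ℝ) (E := E) H, X ∈ c.p → ∀ v ∈ LinearMap.ker f,
        T ((1 : ℂ) ⊗ₜ[ℝ] X) v ∈ LinearMap.ker f := by
      intro X hX hXp v hv
      refine hT.apply_mem_of_expG hXp (fun t w hw => ?_) hv
      have hP := c.expG_mem_P (c.p.smul_mem t hXp)
      rw [LinearMap.mem_ker] at hw ⊢
      rw [extendOne_apply ζP hP, hf _ (mem_lieOf_iff.1 hX t) hP, hw, map_zero, smul_zero]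
    have htop' : LinearMap.ker f = ⊤ := by
      refine hT.eq_top_of_stable hirr hU hUJ hUhw hsup hfU fun Z hZ v hv => ?_
      have hZ1 := hZ.1
      have hZ2 := hZ.2
      rw [lieC_eq_baseChange hH] at hZ1
      rw [SetLike.mem_coe, mem_baseChange_iff_re_im] at hZ1 hZ2
      rw [eq_re_add_im Z, map_add, map_smul, add_apply, smul_apply]
      exact add_mem (hker _ hZ1.1 hZ2.1 v hv)
        (Submodule.smul_mem _ _ (hker _ hZ1.2 hZ2.2 v hv))
    exact Subtype.ext (LinearMap.ker_eq_top.1 htop')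
  calc Module.finrank ℂ (c.homHP H ζP τ) ≤ Module.finrank ℂ (U →ₗ[ℂ] W) :=
        LinearMap.finrank_le_finrank_of_injective hinj
    _ = Module.finrank ℂ U * Module.finrank ℂ W := Module.finrank_linearMap ℂ ℂ U W
    _ ≤ maxIrrepDim c.J * Module.finrank ℂ W := Nat.mul_le_mul_right _ hdim

end Choices
end MultiplicityBound

end KobayashiOshima

open KobayashiOshima in
theorem proposition4p1
    -- `G`: a connected real semisimple Lie group with finite center
    {E : Type*} [NormedAddCommGroup E] [NormedSpace ℝ E] [FiniteDimensional ℝ E] [CompleteSpace E]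
    {G : Type*} [Group G] [TopologicalSpace G] [ChartedSpace E G] [LieGroup 𝓘(ℝ, E) ∞ G]
    [ConnectedSpace G] [LieAlgebra.IsSemisimple ℝ (LieAlg E G)] [Finite (Subgroup.center G)]
    -- `K`, `𝔧`, positive systems, and with them `P = LN`, `J` and `𝔟`
    (c : Choices E G)
    -- `H`: a closed subgroup with finitely many connected components
    (H : Subgroup G) (hH : IsClosed (H : Set G)) (hHfin : Finite (ConnectedComponents H))
    -- `Gc`: a complex Lie group whose Lie algebra is identified by `φ` with `𝔤_c`
    {Ec : Type*} [NormedAddCommGroup Ec] [NormedSpace ℂ Ec] [FiniteDimensional ℂ Ec]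
    [CompleteSpace Ec]
    {Gc : Type*} [Group Gc] [TopologicalSpace Gc] [ChartedSpace Ec Gc] [LieGroup 𝓘(ℂ, Ec) ∞ Gc]
    (φ : LieAlgC E G ≃ₗ⁅ℂ⁆ GroupLieAlgebra 𝓘(ℂ, Ec) Gc)
    -- `Hc`: a complex Lie subgroup of `Gc` (with inclusion map `ι`) with Lie algebra `𝔥_c`
    {F : Type*} [NormedAddCommGroup F] [NormedSpace ℂ F] [FiniteDimensional ℂ F]
    {Hc : Type*} [Group Hc] [TopologicalSpace Hc] [SecondCountableTopology Hc]
    [ChartedSpace F Hc] [LieGroup 𝓘(ℂ, F) ∞ Hc]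
    (ι : Hc →* Gc) (hι : Function.Injective ι) (hι' : ContMDiff 𝓘(ℂ, F) 𝓘(ℂ, Ec) ∞ ι)
    (hHc : Set.range (mfderiv 𝓘(ℂ, F) 𝓘(ℂ, Ec) ι 1) = φ '' (lieC (E := E) H : Set (LieAlgC E G)))
    -- `Hc B` is open in `Gc`, where `B` is the connected subgroup with Lie algebra `𝔟`
    (hHB : IsOpen (Set.range ι *
      (analyticSubgroup (𝕜 := ℂ) (E := Ec) (φ '' (c.b : Set (LieAlgC E G))) : Set Gc)))
    -- `HP` is open in `G`
    (hHP : IsOpen ((H : Set G) * (c.P : Set G))) :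
    -- `D = maxIrrepDim c.J` is well defined
    IsGreatest (irrepDims c.J) (maxIrrepDim c.J) ∧
    ∀ {W : Type*} [AddCommGroup W] [Module ℂ W] [FiniteDimensional ℂ W]
      (τ : Representation ℂ H W), τ.IsIrreducible → IsContinuousRep τ →
    ∀ {V : Type*} [AddCommGroup V] [Module ℂ V] [FiniteDimensional ℂ V]
      (ζ : Representation ℂ c.L V), ζ.IsIrreducible → IsContinuousRep ζ →
    ∀ ζP : Representation ℂ c.P V, c.IsExtension ζ ζP →
      Module.finrank ℂ (c.homHP H ζP τ) ≤ maxIrrepDim c.J * Module.finrank ℂ W := by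
  have : LieAlgebra.IsKilling ℝ (LieAlg E G) := inferInstance
  have htop := lieC_sup_b_eq_top c H φ ι hι' hHc hHB
  refine ⟨c.isGreatest_irrepDims, ?_⟩
  intro W _ _ _ τ _ _ V _ _ _ ζ hζ _ ζP hext
  -- The bound does not involve a norm on `V`; the one used in its proof comes from coordinates.
  let e : V ≃ₗ[ℂ] (Fin (Module.finrank ℂ V) → ℂ) := (Module.finBasis ℂ V).equivFun
  let _ : NormedAddCommGroup V :=
    NormedAddCommGroup.induced V _ e.toLinearMap e.injective
  let _ : NormedSpace ℂ V := NormedSpace.induced ℂ V _ e.toLinearMap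
  exact c.finrank_homHP_le hH htop τ hζ hext
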